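/- Notation. Let $d\in\mathbb{N}$, $R\ge 1$. For functions $a=a(x,t,\xi)$ on $\mathbb{R}^d\times\mathbb{R}\times\mathbb{R}^d$ write $z=(x,t)$. Fix constants $C=(C_{\alpha,\beta})$, indexed by the multi-indices $\alpha\in\mathbb{N}^{d+1}$, $\beta\in\mathbb{N}^d$, and let $a\in C^\infty(\mathbb{R}^d\times\mathbb{R}\times\mathbb{R}^d;\mathbb{R})$ satisfy, at every point and for all $\alpha,\beta$, $$|\partial_z^\alpha\partial_\xi^\beta a(x,t,\xi)|\le C_{\alpha,\beta}\begin{cases}R^{-|\alpha|},&|\alpha|\le 2,\\ R^{-\frac{|\alpha|-2}{2}-2},&|\alpha|\ge 2.\end{cases}$$ * $(x^t,\xi^t)=(x^t(x,\xi),\xi^t(x,\xi))$ is the Hamiltonian flow $\dot x^t=\partial_\xi a(x^t,t,\xi^t)$, $\dot\xi^t=-\partial_x a(x^t,t,\xi^t)$ with $(x^0,\xi^0)=(x,\xi)$. * $\psi(t,x,\xi)=\int_0^t\big(-a(x^\tau,\tau,\xi^\tau)+\xi^\tau\cdot\partial_\xi a(x^\tau,\tau,\xi^\tau)\big)\,d\tau$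 is the phase shift. * $a^w(t)=a^w(x,t,D)$ is the bounded operator on $L^2(\mathbb{R}^d)$ that is given on Schwartz functions by the Weyl quantization $a^w(t) f(x)=(2\pi)^{-d}\int\big(\int e^{i(x-y)\cdot\xi}a(\tfrac{x+y}{2},t,\xi)f(y)\,dy\big)d\xi$. * $S(t,s)$ is the evolution operator (fundamental solution) on $L^2(\mathbb{R}^d)$ of $i\partial_t u=a^w(t)u$, that is, the family of bounded operators with $S(s,s)=\mathrm{Id}$ and $\partial_t S(t,s)u_0=-i\,a^w(t)S(t,s)u_0$ in $L^2$ for all $u_0\in L^2$, $s,t\in\mathbb{R}$. * $C_R=R^{-d/4}2^{-d/2}\pi^{-d/4}$ and $\phi_{x,\xi}(y)=e^{i\xi\cdot(x-y)}e^{-\frac{1}{2R}|x-y|^2}$. Proposition. There are constants $c=c_{M,\gamma,\sigma,\alpha,\beta,\nu}$, depending only on $d$, the family $C$, the number $M$ and the indices, such that for all $R\ge1$ and all $a$ as above the following holds. The flow $(x^t,\xi^t)$ and the evolution operator $S(t,s)$ exist, are unique, and are defined for all times. There is a function $G(t,s,x,\xi,y)$, for each $s$ smooth in $(t,x,\xi,y)\in\mathbb{R}\times\mathbb{R}^{3d}$,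 such that for all $t,s\in\mathbb{R}$ the distribution kernel of $S(t,s)$ is $$K(t,y,s,\tilde y)=\int_{\mathbb{R}^{2d}}e^{-\frac{1}{2R}|\tilde y-x^s|^2}e^{-i\xi^s\cdot(\tilde y-x^s)}e^{i(\psi(t,x,\xi)-\psi(s,x,\xi))}e^{i\xi^t\cdot(y-x^t)}G(t,s,x,\xi,y)\,dx\,d\xi,$$ meaning that for every Schwartz function $f$, if the integrand is multiplied by $f(\tilde y)$ and integrated first over $\tilde y$, then the integral over $(x,\xi)$ converges absolutely for every $y$ and equals $(S(t,s)f)(y)$ for almost every $y$. Moreover, for all $M$, all multi-indices $\alpha,\beta,\gamma,\nu\in\mathbb{N}^d$, all $\sigma\in\mathbb{N}$, all $x,\xi\in\mathbb{R}^d$, and all $t,s$ with $|t-s|\le MR$ and $|s|\le MR$, $$\big\|(R^{-\frac12}(x^t-y))^\gamma\,\partial_t^\sigma\partial_x^\alpha\partial_\xi^\beta\partial_y^\nu G(t,s,x,\xi,y)\big\|_{L^2_y}\le c_{M,\gamma,\sigma,\alpha,\beta,\nu}\,R^{-\frac{|\alpha|-|\beta|+|\nu|+\sigma}{2}}\,C_R^2\,\|\phi_{x,\xi}\|_{L^2}.$$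 -/

import Mathlib

open MeasureTheory
open scoped ContDiff SchwartzMap

noncomputable section

/-- The Euclidean space `ℝ^d`. -/
abbrev Space (d : ℕ) : Type := EuclideanSpace ℝ (Fin d)

/-- The `i`-th standard basis vector of `ℝ^d`. -/
def stdVec {d : ℕ} (i : Fin d) : Space d := EuclideanSpace.single i (1 : ℝ)

/-- The derivative of `f` in the direction `v`. -/
def dirDeriv {V F : Type*} [NormedAddCommGroup V] [NormedSpace ℝ V]
    [NormedAddCommGroup F] [NormedSpace ℝ F] (v : V) (f : V → F) : V → F :=
  fun p => fderiv ℝ f p v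

/-- The partial derivative `∂_{e_1}^{α_1} ⋯ ∂_{e_d}^{α_d} f` for a family of directions `e` and a
multi-index `α`. -/
def multiDeriv {V F : Type*} [NormedAddCommGroup V] [NormedSpace ℝ V]
    [NormedAddCommGroup F] [NormedSpace ℝ F] {d : ℕ} (e : Fin d → V) (α : Fin d → ℕ)
    (f : V → F) : V → F :=
  (List.finRange d).foldr (fun i g => (dirDeriv (e i))^[α i] g) f

/-- The length `|α| = α_1 + ⋯ + α_d` of a multi-index. -/
def multiLen {d : ℕ} (α : Fin d → ℕ) : ℕ := ∑ i, α i

/-! ### Symbols and the Hamiltonian flow -/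

/-- `∂_x^α ∂_t^k ∂_ξ^β a` for a function `a = a(x, t, ξ)`. -/
def symbolDeriv {d : ℕ} (α : Fin d → ℕ) (k : ℕ) (β : Fin d → ℕ)
    (a : Space d × ℝ × Space d → ℝ) : Space d × ℝ × Space d → ℝ :=
  multiDeriv (fun i => (stdVec i, (0 : ℝ), (0 : Space d))) α
    ((dirDeriv ((0 : Space d), (1 : ℝ), (0 : Space d)))^[k]
      (multiDeriv (fun i => ((0 : Space d), (0 : ℝ), stdVec i)) β a))

/-- The size `R^{-m}` for `m ≤ 2` and `R^{-(m-2)/2-2}` for `m ≥ 2` of a symbol derivative of order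
`m` in the space-time variables. -/
def symbolWeight (R : ℝ) (m : ℕ) : ℝ :=
  if m ≤ 2 then R ^ (-(m : ℝ)) else R ^ (-(((m : ℝ) - 2) / 2) - 2)

/-- Real, smooth Hamiltonians `a(x, t, ξ)` obeying the regularity estimates at scale `R`, with
implicit constants `C`. -/
structure IsRoughHamiltonian {d : ℕ} (R : ℝ) (C : (Fin d → ℕ) → ℕ → (Fin d → ℕ) → ℝ)
    (a : Space d × ℝ × Space d → ℝ) : Prop where
  smooth : ContDiff ℝ ∞ a
  bound : ∀ (α : Fin d → ℕ) (k : ℕ) (β : Fin d → ℕ) (z : Space d × ℝ × Space d),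
    |symbolDeriv α k β a z| ≤ C α k β * symbolWeight R (multiLen α + k)

/-- `∂a/∂x` at `(x, t, ξ)`. -/
def gradX {d : ℕ} (a : Space d × ℝ × Space d → ℝ) (x : Space d) (t : ℝ) (ξ : Space d) : Space d :=
  gradient (fun z => a (z, t, ξ)) x

/-- `∂a/∂ξ` at `(x, t, ξ)`. -/
def gradXi {d : ℕ} (a : Space d × ℝ × Space d → ℝ) (x : Space d) (t : ℝ) (ξ : Space d) : Space d :=
  gradient (fun η => a (x, t, η)) ξ

/-- `Φ t (x, ξ) = (x^t, ξ^t)` is the Hamiltonian flow of `a`, started at time `0`. -/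
structure IsHamiltonianFlow {d : ℕ} (a : Space d × ℝ × Space d → ℝ)
    (Φ : ℝ → Space d × Space d → Space d × Space d) : Prop where
  init : ∀ p, Φ 0 p = p
  position : ∀ p t, HasDerivAt (fun τ => (Φ τ p).1) (gradXi a (Φ t p).1 t (Φ t p).2) t
  momentum : ∀ p t, HasDerivAt (fun τ => (Φ τ p).2) (-gradX a (Φ t p).1 t (Φ t p).2) t

/-- The phase shift `ψ(t, x, ξ)`: it vanishes at `t = 0` and its time derivative is
`-a + ξ^t · ∂a/∂ξ` along the bicharacteristic issued from `p = (x, ξ)` at time `0`. -/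
def phaseShift {d : ℕ} (a : Space d × ℝ × Space d → ℝ)
    (Φ : ℝ → Space d × Space d → Space d × Space d) (t : ℝ) (p : Space d × Space d) : ℝ :=
  ∫ τ in (0 : ℝ)..t,
    (-a ((Φ τ p).1, τ, (Φ τ p).2) + inner ℝ (Φ τ p).2 (gradXi a (Φ τ p).1 τ (Φ τ p).2))

/-! ### Weyl quantization and the evolution -/

/-- The Hilbert space `L²(ℝ^d; ℂ)`. -/
abbrev LTwo (d : ℕ) : Type := Lp ℂ 2 (volume : Measure (Space d))

/-- The Weyl quantization
`b^w f (x) = (2π)^{-d} ∫ (∫ e^{i (x-y)·ξ} b((x+y)/2, ξ) f(y) dy) dξ` of a symbol `b`, acting on a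
Schwartz function `f`. -/
def weylQuantization {d : ℕ} (b : Space d → Space d → ℝ) (f : 𝓢(Space d, ℂ)) (x : Space d) : ℂ :=
  (((2 * Real.pi) ^ d)⁻¹ : ℝ) *
    ∫ ξ : Space d, ∫ y : Space d,
      Complex.exp (Complex.I * (inner ℝ (x - y) ξ : ℝ)) *
        (b ((1 / 2 : ℝ) • (x + y)) ξ : ℂ) * f y

/-- `A` is the bounded operator on `L²` which extends `b^w` from the Schwartz functions. -/
def IsWeylOperator {d : ℕ} (b : Space d → Space d → ℝ) (A : LTwo d →L[ℂ] LTwo d) : Prop :=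
  ∀ f : 𝓢(Space d, ℂ), (A (f.toLp 2) : Space d → ℂ) =ᵐ[volume] weylQuantization b f

/-- `S t s` is the evolution operator on `L²` from time `s` to time `t` of the equation
`i ∂_t u = a^w(x, t, D) u`. -/
def IsFundamentalSolution {d : ℕ} (a : Space d × ℝ × Space d → ℝ)
    (S : ℝ → ℝ → LTwo d →L[ℂ] LTwo d) : Prop :=
  ∃ A : ℝ → LTwo d →L[ℂ] LTwo d,
    (∀ t, IsWeylOperator (fun x ξ => a (x, t, ξ)) (A t)) ∧
    (∀ s, S s s = ContinuousLinearMap.id ℂ (LTwo d)) ∧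
    ∀ (s t : ℝ) (u : LTwo d),
      HasDerivAt (fun τ => S τ s u) (-(Complex.I • A t (S t s u))) t

/-! ### Coherent states and the kernel -/

/-- The constant `C_R = R^{-d/4} 2^{-d/2} π^{-d/4}`. -/
def fbiConst (d : ℕ) (R : ℝ) : ℝ :=
  R ^ (-((d : ℝ) / 4)) * 2 ^ (-((d : ℝ) / 2)) * Real.pi ^ (-((d : ℝ) / 4))

/-- The coherent state `φ_{x,ξ}(y) = e^{i ξ·(x-y)} e^{-(x-y)²/(2R)}`. -/
def coherentState {d : ℕ} (R : ℝ) (x ξ y : Space d) : ℂ :=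
  Complex.exp (Complex.I * (inner ℝ ξ (x - y) : ℝ)) * (Real.exp (-(‖x - y‖ ^ 2 / (2 * R))) : ℂ)

/-- The integrand, at the phase space point `p = (x, ξ)`, of the phase space integral for
`K(t, y, s, y')`, with flow `Φ`, phase shift `ψ` and amplitude `G = G(t, s, x, ξ, y)`. -/
def kernelIntegrand {d : ℕ} (R : ℝ) (Φ : ℝ → Space d × Space d → Space d × Space d)
    (ψ : ℝ → Space d × Space d → ℝ) (G : ℝ → ℝ → Space d → Space d → Space d → ℂ)
    (t : ℝ) (y : Space d) (s : ℝ) (y' : Space d) (p : Space d × Space d) : ℂ :=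
  (Real.exp (-(‖y' - (Φ s p).1‖ ^ 2 / (2 * R))) : ℂ) *
    Complex.exp (-(Complex.I * (inner ℝ (Φ s p).2 (y' - (Φ s p).1) : ℝ))) *
    Complex.exp (Complex.I * ((ψ t p - ψ s p : ℝ) : ℂ)) *
    Complex.exp (Complex.I * (inner ℝ (Φ t p).2 (y - (Φ t p).1) : ℝ)) *
    G t s p.1 p.2 y

/-- `∫_{ℝ^{2d}} (…) dx dξ` is the distribution kernel of the operator `B`: tested against a Schwartz
function in the second variable, the phase space integral converges absolutely and
gives `B f`. -/
def IsPhaseSpaceKernel {d : ℕ} (k : Space d → Space d → Space d × Space d → ℂ)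
    (B : LTwo d →L[ℂ] LTwo d) : Prop :=
  ∀ f : 𝓢(Space d, ℂ),
    (∀ y, Integrable (fun p : Space d × Space d => ∫ y' : Space d, k y y' p * f y')) ∧
    (B (f.toLp 2) : Space d → ℂ) =ᵐ[volume]
      fun y => ∫ p : Space d × Space d, ∫ y' : Space d, k y y' p * f y'

/-- The amplitude at fixed `s`, as a function of `(t, x, ξ, y)`. -/
def amplitudeAt {d : ℕ} (G : ℝ → ℝ → Space d → Space d → Space d → ℂ) (s : ℝ) :
    ℝ × Space d × Space d × Space d → ℂ :=
  fun q => G q.1 s q.2.1 q.2.2.1 q.2.2.2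

/-- `∂_t^σ ∂_x^α ∂_ξ^β ∂_y^ν g` for a function `g = g(t, x, ξ, y)`. -/
def amplitudeDeriv {d : ℕ} (σ : ℕ) (α β ν : Fin d → ℕ)
    (g : ℝ × Space d × Space d × Space d → ℂ) : ℝ × Space d × Space d × Space d → ℂ :=
  (dirDeriv ((1 : ℝ), (0 : Space d), (0 : Space d), (0 : Space d)))^[σ]
    (multiDeriv (fun i => ((0 : ℝ), stdVec i, (0 : Space d), (0 : Space d))) α
      (multiDeriv (fun i => ((0 : ℝ), (0 : Space d), stdVec i, (0 : Space d))) β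
        (multiDeriv (fun i => ((0 : ℝ), (0 : Space d), (0 : Space d), stdVec i)) ν g)))

/-- The monomial `v^γ`. -/
def monomialWeight {d : ℕ} (γ : Fin d → ℕ) (v : Space d) : ℝ := ∏ i, v i ^ γ i

end

/-! Write `R = r ^ 2` and rescale by the canonical dilation `(x, t, ξ) = (r x', r t', ξ' / r)`. The
new Hamiltonian `h = r a(r x', r t', ξ' / r)` (`scaledHam`) has first derivatives O(1) and all
derivatives of order at least two O(ε), with `ε = r⁻¹`; only `h` itself may have size `r`. Coherent
states get width one, and the times `|t| ≤ M R` become `|t'| ≤ M / ε`. The statement is thus one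
about slowly varying Hamiltonians over times of order `1 / ε`, uniformly in the family. The powers
of `R` in the conclusion are the Jacobian factors of the dilation.

At unit scale the representation comes from the resolution of the identity `(2π)^d f = ∫ ⟨coh q, f⟩
coh q dq`. Substituting `q = φ_s(p)`, which preserves volume because the flow is symplectic, and
applying the evolution `U` from time `s` to time `t` gives a superposition of the evolved states `U
coh(φ_s p)`. Each is written as `e^{iθ} shift(φ_t p) V(t, p)`, where `θ` is the symmetrized action.
The packet `V` is brought back to the origin of phase space, and its value at the point `(y - x^t) /
r` is, up to a constant, the amplitude `G` (`evolution_ae_eq_integral`, `integral_kernelIntegrand`).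

The estimates on `G` are Sobolev estimates for `V` in the scale `sob` of the harmonic oscillator,
where position weights and `y`-derivatives both act as generators of phase space shifts. In the
moving frame the packet satisfies `i ∂_t V = B V`. Here `B` (`frameGen`) quantizes `h(z + w)` minus
its first-order Taylor polynomial in `w` at the trajectory point `z` (`dirDeriv_packet_time`): the
flow removes the linear term and the action the constant one. The operator `B` is symmetric, and its
commutator with a generator quantizes `∂_j h(z + w) - ∂_j h(z)` (`gen_frameGen`), a symbol which
grows linearly with slope O(ε) and therefore costs one Sobolev order. Hence `|d/dt sob_k V| ≤ C ε
sob_k V`, and Gronwall's inequality closes over times O(1 / ε) (`exists_re_sobInner_frameGen_le`,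
`exists_sob_packet_le`). Time derivatives are read off the equation. Derivatives in the initial
point produce generators along the differentiated flow and packets with another initial vector
(`dirDeriv_packet_space`), so all derivatives follow by induction (`unifVec_packet`). The
differentiated flow is itself bounded on this time scale, since the variational equation has
coefficients O(ε) (`unifFun_dirDeriv_flow`).

Three foundations are built on the way. Smooth dependence of linear and nonlinear equations on
parameters comes from Volterra operators and the inverse function theorem in spaces of continuous
functions. Weyl operators are defined by their matrix coefficients between coherent states, bounded
by Schur's test (`exists_opForm_bound`), differentiated in their symbol (`hasFDerivAt_opAt`), and
identified with the quantization integral through phase space reflections (`inner_op_eq_integral`,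
`op_toLp_ae_eq`). Symplecticity of the flow follows from the symmetry of the second derivatives of
the action (`IsFlow.symp_fderiv`). -/

noncomputable section

set_option linter.unusedSectionVars false

open scoped Real
open Complex (I norm_real ofReal_mul conj_ofReal real_smul ofReal_inv norm_I ofRealCLM
  ofRealCLM_apply normSq normSq_eq_norm_sq continuous_ofReal ofReal_injective re_sum
  continuous_conj coe_smul add_re)
open Finset (sum_mul sum_nonneg sum_congr mul_sum sum_le_sum sum_add_distrib smul_sum single_le_sum
  sum_insert sum_sub_distrib sum_neg_distrib abs_sum_le_sum_abs univ)
open List (map_append map_replicate map_cons replicate prod_append length_append finite_length_le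
  count_replicate)
open ContinuousLinearMap (fst snd comp_apply restrictScalarsL opNorm_le_bound id_apply
  adjoint_inner_left smulRight_apply smulRightL)
open Real (norm_of_nonneg rpow_natCast rpow_neg norm_eq_abs rpow_mul rpow_add sq_sqrt pi_pos exp
  sqrt)
open ENNReal (ofReal)
open Sum (inl inr)
open EuclideanSpace (norm_sq_eq inner_single_left proj)
open Prod (smul_fst smul_snd fst_add snd_add)
open Function (uncurry)
open Set (Icc)
open MeasureTheory.Measure (volume_eq_prod)
open ContinuousMap (norm_le)
open Fintype (card)
open intervalIntegral (integral_congr integral_hasDerivAt_right)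

/-- Smoothness of functions between real normed spaces. -/
notation "Smooth" => ContDiff ℝ ∞

notation "𝜕" => dirDeriv

notation "½" => (1 / 2 : ℝ)

notation:max "⟪" u "," v "⟫" => inner ℂ u v

notation:max "𝕔" x:max => Complex.ofReal x

/-! ### Directional derivatives -/

variable {d : ℕ} {ι Ω E F G V Q Q' : Type*} [NormedAddCommGroup E] [NormedSpace ℝ E]
  [NormedAddCommGroup F] [NormedSpace ℝ F] [NormedAddCommGroup G] [NormedSpace ℝ G]
  [NormedAddCommGroup V] [NormedSpace ℝ V] [NormedAddCommGroup Q] [NormedSpace ℝ Q]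
  [NormedAddCommGroup Q'] [NormedSpace ℝ Q'] {T : Ω → Set ℝ} {n : ℕ} {M r : ℝ}

lemma ContDiff.dirDeriv {f : V → F} (hf : Smooth f) (v : V) : Smooth (𝜕 v f) :=
  (hf.fderiv_right (m := ∞) (by simp)).clm_apply contDiff_const

lemma two_le_infty : (2 : ℕ∞ω) ≤ ∞ := WithTop.coe_le_coe.2 (le_top : (2 : ℕ∞) ≤ ⊤)

lemma ContDiff.diff_infty {f : V → F} (hf : Smooth f) : Differentiable ℝ f :=
  hf.differentiable (by simp)

lemma dirDeriv_comm {f : V → F} (hf : Smooth f) (v w : V) : 𝜕 v (𝜕 w f) = 𝜕 w (𝜕 v f) := by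
  have key : ∀ v w x, 𝜕 v (𝜕 w f) x = fderiv ℝ (fderiv ℝ f) x v w := fun v w x => by
    have h := ((hf.fderiv_right (m := ∞) (by simp)).diff_infty x).hasFDerivAt
    have h2 : HasFDerivAt (fun y => fderiv ℝ f y w)
        ((ContinuousLinearMap.apply ℝ F w).comp (fderiv ℝ (fderiv ℝ f) x)) x :=
      (ContinuousLinearMap.apply ℝ F w).hasFDerivAt.comp x h
    unfold dirDeriv
    rw [h2.fderiv]
    rfl
  funext x
  rw [key, key]
  exact (hf.contDiffAt.isSymmSndFDerivAt (by simp [two_le_infty])).eq v w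

lemma dirDeriv_comp_clm {f : G → F} (hf : Smooth f) (T : V →L[ℝ] G) (v : V) :
    𝜕 v (fun x => f (T x)) = fun x => 𝜕 (T v) f (T x) := by
  funext x
  have := ((hf.diff_infty (T x)).hasFDerivAt.comp x T.hasFDerivAt).fderiv
  unfold dirDeriv
  change fderiv ℝ (f ∘ T) x v = _
  rw [this]; rfl

lemma dirDeriv_clm_comp {f : V → F} (hf : Smooth f) (T : F →L[ℝ] G) (v : V) :
    𝜕 v (fun x => T (f x)) = fun x => T (𝜕 v f x) := by
  funext x
  have := (T.hasFDerivAt.comp x (hf.diff_infty x).hasFDerivAt).fderiv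
  unfold dirDeriv
  change fderiv ℝ (T ∘ f) x v = _
  rw [this]; rfl

lemma dirDeriv_add {f g : V → F} (hf : Smooth f) (hg : Smooth g) (v : V) :
    𝜕 v (fun x => f x + g x) = fun x => 𝜕 v f x + 𝜕 v g x := by
  funext x
  unfold dirDeriv
  rw [fderiv_fun_add (hf.diff_infty x) (hg.diff_infty x)]; rfl

lemma dirDeriv_sub {f g : V → F} (hf : Smooth f) (hg : Smooth g) (v : V) :
    𝜕 v (fun x => f x - g x) = fun x => 𝜕 v f x - 𝜕 v g x := by
  funext x
  unfold dirDeriv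
  rw [fderiv_fun_sub (hf.diff_infty x) (hg.diff_infty x)]; rfl

lemma dirDeriv_sum {s : Finset ι} {f : ι → V → F} (hf : ∀ i, Smooth (f i))
    (v : V) : 𝜕 v (fun x => ∑ i ∈ s, f i x) = fun x => ∑ i ∈ s, 𝜕 v (f i) x := by
  funext x
  unfold dirDeriv
  rw [fderiv_fun_sum (fun i _ => (hf i).diff_infty x)]
  simp

lemma dirDeriv_const (c : F) (v : V) : 𝜕 v (fun _ : V => c) = fun _ => 0 := by
  funext x
  simp [dirDeriv]

lemma dirDeriv_const_smul {𝕜 : Type*} [NontriviallyNormedField 𝕜] [NormedSpace 𝕜 F]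
    [SMulCommClass ℝ 𝕜 F] {f : V → F} (hf : Smooth f) (c : 𝕜) (v : V) :
    𝜕 v (fun x => c • f x) = fun x => c • 𝜕 v f x := by
  funext x
  unfold dirDeriv
  rw [fderiv_fun_const_smul (hf.diff_infty x)]; rfl

lemma dirDeriv_smul {𝕜 : Type*} [NontriviallyNormedField 𝕜] [NormedAlgebra ℝ 𝕜]
    [NormedSpace 𝕜 F] [IsScalarTower ℝ 𝕜 F] {c : V → 𝕜} {f : V → F} (hc : Smooth c)
    (hf : Smooth f) (v : V) :
    𝜕 v (fun x => c x • f x) = fun x => 𝜕 v c x • f x + c x • 𝜕 v f x := by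
  funext x
  unfold dirDeriv
  rw [fderiv_fun_smul (hc.diff_infty x) (hf.diff_infty x)]
  simp [add_comm]

lemma dirDeriv_add_vec (f : V → F) (v w : V) : 𝜕 (v + w) f = fun x => 𝜕 v f x + 𝜕 w f x := by
  funext x; simp [dirDeriv]

lemma dirDeriv_smul_vec (f : V → F) (c : ℝ) (v : V) : 𝜕 (c • v) f = fun x => c • 𝜕 v f x := by
  funext x; simp [dirDeriv]

lemma HasFDerivAt.dirDeriv_eq {f : V → F} {f' : V →L[ℝ] F} {x : V} (h : HasFDerivAt f f' x)
    (v : V) : 𝜕 v f x = f' v := by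
  unfold _root_.dirDeriv; rw [h.fderiv]

open HasFDerivAt (dirDeriv_eq)

/-- The iterated derivative of `f` along a list of directions. -/
def derivs (l : List V) (f : V → F) : V → F := l.foldr 𝜕 f

@[simp] lemma derivs_nil (f : V → F) : derivs [] f = f := rfl

@[simp] lemma derivs_cons (v : V) (l : List V) (f : V → F) :
    derivs (v :: l) f = 𝜕 v (derivs l f) := rfl

lemma derivs_append (l l' : List V) (f : V → F) : derivs (l ++ l') f = derivs l (derivs l' f) := by
  simp [derivs]

lemma ContDiff.derivs {f : V → F} (hf : Smooth f) (l : List V) : Smooth (derivs l f) := by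
  induction l with
  | nil => exact hf
  | cons v l ih => exact ih.dirDeriv v

lemma derivs_dirDeriv {f : V → F} (hf : Smooth f) (l : List V) (v : V) :
    derivs l (𝜕 v f) = 𝜕 v (derivs l f) := by
  induction l with
  | nil => rfl
  | cons w l ih => rw [derivs_cons, ih, derivs_cons, dirDeriv_comm (hf.derivs l)]

lemma derivs_perm {f : V → F} (hf : Smooth f) {l l' : List V} (h : l.Perm l') :
    derivs l f = derivs l' f := by
  induction h with
  | nil => rfl
  | cons v _ ih => rw [derivs_cons, ih, derivs_cons]
  | swap v w l => simp only [derivs_cons]; exact dirDeriv_comm (hf.derivs l) _ _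
  | trans _ _ h1 h2 => rw [h1, h2]

lemma derivs_add {f g : V → F} (hf : Smooth f) (hg : Smooth g) (l : List V) :
    derivs l (fun x => f x + g x) = fun x => derivs l f x + derivs l g x := by
  induction l with
  | nil => rfl
  | cons v l ih => rw [derivs_cons, ih, dirDeriv_add (hf.derivs l) (hg.derivs l)]; rfl

lemma derivs_sub {f g : V → F} (hf : Smooth f) (hg : Smooth g) (l : List V) :
    derivs l (fun x => f x - g x) = fun x => derivs l f x - derivs l g x := by
  induction l with
  | nil => rfl
  | cons v l ih => rw [derivs_cons, ih, dirDeriv_sub (hf.derivs l) (hg.derivs l)]; rfl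

lemma derivs_const_smul {f : V → F} (hf : Smooth f) (c : ℝ) (l : List V) :
    derivs l (fun x => c • f x) = fun x => c • derivs l f x := by
  induction l with
  | nil => rfl
  | cons v l ih => rw [derivs_cons, ih, dirDeriv_const_smul (hf.derivs l)]; rfl

lemma derivs_clm_comp {f : V → F} (hf : Smooth f) (T : F →L[ℝ] G) (l : List V) :
    derivs l (fun x => T (f x)) = fun x => T (derivs l f x) := by
  induction l with
  | nil => rfl
  | cons v l ih => rw [derivs_cons, ih, dirDeriv_clm_comp (hf.derivs l)]; rfl

lemma derivs_comp_clm {f : G → F} (hf : Smooth f) (T : V →L[ℝ] G) (l : List V) :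
    derivs l (fun x => f (T x)) = fun x => derivs (l.map T) f (T x) := by
  induction l with
  | nil => rfl
  | cons v l ih => rw [derivs_cons, ih, dirDeriv_comp_clm (hf.derivs _)]; rfl

lemma dirDeriv_comp_add (f : V → F) (a v : V) :
    𝜕 v (fun x => f (x + a)) = fun x => 𝜕 v f (x + a) := by
  funext x
  unfold dirDeriv
  rw [fderiv_comp_add_right]

lemma derivs_comp_add (f : V → F) (a : V) (l : List V) :
    derivs l (fun x => f (x + a)) = fun x => derivs l f (x + a) := by
  induction l with
  | nil => rfl
  | cons v l ih => rw [derivs_cons, ih, dirDeriv_comp_add]; rfl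

/-! ### Superposition operators on spaces of continuous functions -/

section Nemytskii

/-- The time interval `[-1, 1]`. -/
abbrev UnitTime : Type := Icc (-1 : ℝ) 1

variable {Y G E : Type} [NormedAddCommGroup Y] [NormedSpace ℝ Y]
  [NormedAddCommGroup G] [NormedSpace ℝ G] [NormedAddCommGroup E] [NormedSpace ℝ E]

/-- The superposition operator `y ↦ F(·, y(·))`. -/
def superposition (F : ℝ × Y → G) (hF : Continuous F) (y : C(UnitTime, Y)) : C(UnitTime, G) :=
  ⟨fun s => F (s, y s), by fun_prop⟩

lemma continuous_superposition (F : ℝ × Y → G) (hF : Continuous F) :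
    Continuous (superposition F hF) := by
  apply ContinuousMap.continuous_of_continuous_uncurry
  change Continuous fun p : C(UnitTime, Y) × UnitTime => F (p.2, p.1 p.2)
  fun_prop

/-- Pointwise application of a continuous family of operators. -/
def pointwiseApply : C(UnitTime, Y →L[ℝ] G) →L[ℝ] C(UnitTime, Y) →L[ℝ] C(UnitTime, G) :=
  LinearMap.mkContinuous₂ (LinearMap.mk₂ ℝ (fun (B : C(UnitTime, Y →L[ℝ] G)) (y : C(UnitTime, Y)) =>
        (⟨fun s => B s (y s), by fun_prop⟩ : C(UnitTime, G)))
      (fun _ _ _ => by ext; simp) (fun _ _ _ => by ext; simp)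
      (fun _ _ _ => by ext; simp) (fun _ _ _ => by ext; simp)) 1
    (fun B y => by
      rw [norm_le _ (by positivity)]
      intro s
      rw [one_mul]
      exact ((B s).le_opNorm_of_le (y.norm_coe_le_norm s)).trans
        (mul_le_mul_of_nonneg_right (B.norm_coe_le_norm s) (norm_nonneg _)))

@[simp] lemma pointwiseApply_apply (B : C(UnitTime, Y →L[ℝ] G)) (y : C(UnitTime, Y))
    (s : UnitTime) : pointwiseApply B y s = B s (y s) := rfl

lemma contDiff_pointwiseApply : Smooth fun B : C(UnitTime, Y →L[ℝ] G) => pointwiseApply B := by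
  have := ContinuousLinearMap.contDiff (𝕜 := ℝ) (n := ∞) (E := C(UnitTime, Y →L[ℝ] G))
    (F := C(UnitTime, Y) →L[ℝ] C(UnitTime, G)) pointwiseApply
  exact this

/-- The mean value inequality is applied at each time on the segment from `y s` to `y s + η s`.
Uniformity in `s` comes from the continuity of `y ↦ F'(·, y(·))` in the supremum norm, which keeps
`F'` within `ε` of its value at `y s` along every such segment. -/
lemma hasFDerivAt_superposition (F : ℝ × Y → G) (hF : Smooth F)
    (F' : ℝ × Y → Y →L[ℝ] G) (hF' : Continuous F')
    (h : ∀ p, F' p = (fderiv ℝ F p).comp (ContinuousLinearMap.inr ℝ ℝ Y)) (y : C(UnitTime, Y)) :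
    HasFDerivAt (superposition F hF.continuous) (pointwiseApply (superposition F' hF' y)) y := by
  rw [hasFDerivAt_iff_isLittleO_nhds_zero, Asymptotics.isLittleO_iff]
  intro ε hε
  have hc := (continuous_superposition F' hF').continuousAt (x := y)
  rw [Metric.continuousAt_iff] at hc
  obtain ⟨δ, hδ, hc⟩ := hc ε hε
  filter_upwards [Metric.ball_mem_nhds (0 : C(UnitTime, Y)) hδ] with η hη
  rw [norm_le _ (by positivity)]
  intro s
  have hpart : ∀ v : Y, HasFDerivAt (fun v => F ((s : ℝ), v)) (F' (s, v)) v := fun v => by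
    rw [h]
    exact ((hF.diff_infty _).hasFDerivAt).comp v (hasFDerivAt_prodMk_right _ _)
  have hseg : ∀ v ∈ segment ℝ (y s) (y s + η s), ‖F' (s, v) - F' (s, y s)‖ ≤ ε := by
    intro v hv
    rw [segment_eq_image'] at hv
    obtain ⟨θ, ⟨h0, h1⟩, rfl⟩ := hv
    have hd : dist (y + θ • η) y < δ := by
      rw [dist_eq_norm, add_sub_cancel_left, norm_smul, norm_of_nonneg h0]
      rw [mem_ball_zero_iff] at hη
      nlinarith [norm_nonneg η]
    have := (ContinuousMap.dist_apply_le_dist (f := superposition F' hF' (y + θ • η))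
      (g := superposition F' hF' y) s).trans (hc hd).le
    rw [dist_eq_norm] at this
    simpa [superposition] using this
  have := Convex.norm_image_sub_le_of_norm_hasFDerivWithin_le'
    (fun v _ => (hpart v).hasFDerivWithinAt) hseg (convex_segment _ _)
    (left_mem_segment ℝ _ _) (right_mem_segment ℝ (y s) (y s + η s))
  refine (le_of_eq ?_).trans (this.trans ?_)
  · simp [superposition]
  · rw [add_sub_cancel_left]
    exact mul_le_mul_of_nonneg_left (η.norm_coe_le_norm s) hε.le

/-- The derivative is a superposition operator with the smooth integrand `F'`, followed by the
bounded linear map `pointwiseApply`, so regularity bootstraps. -/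
lemma contDiff_superposition (F : ℝ × Y → G) (hF : Smooth F) :
    Smooth (superposition F hF.continuous) := by
  -- The target space has to vary in the induction, since `F'` takes values in `Y →L[ℝ] G`.
  suffices H : ∀ n : ℕ, ∀ (G : Type) [NormedAddCommGroup G] [NormedSpace ℝ G] (F : ℝ × Y → G)
      (hF : Smooth F), ContDiff ℝ n (superposition F hF.continuous) from
    contDiff_infty.2 fun n => H n G F hF
  intro n
  induction n with
  | zero =>
    intro G _ _ F hF
    exact contDiff_zero.2 (continuous_superposition F hF.continuous)
  | succ n ih =>
    intro G _ _ F hF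
    have hF' : ContDiff ℝ ∞ (fun p => (fderiv ℝ F p).comp (ContinuousLinearMap.inr ℝ ℝ Y)) :=
      (hF.fderiv_right (m := ∞) (by simp)).clm_comp contDiff_const
    push_cast
    rw [contDiff_succ_iff_hasFDerivAt]
    refine ⟨fun y => pointwiseApply (superposition _ hF'.continuous y), ?_,
      hasFDerivAt_superposition F hF _ hF'.continuous fun _ => rfl⟩
    exact (contDiff_pointwiseApply.of_le (by exact_mod_cast le_top)).comp (ih _ _ hF')

/-- A smooth function of time and a parameter is a smooth function of the parameter with values in
the continuous functions of time. -/
lemma contDiff_curry (F : ℝ × Y → G) (hF : Smooth F) :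
    Smooth (fun q => (⟨fun s => F (s, q), by have := hF.continuous; fun_prop⟩ : C(UnitTime, G))) :=
  (contDiff_superposition F hF).comp (ContinuousLinearMap.const (R := ℝ) (M := Y) UnitTime).contDiff

end Nemytskii

/-! ### Volterra operators and linear differential equations -/

section Volterra

variable {Y G E : Type} [NormedAddCommGroup Y] [NormedSpace ℝ Y]
  [NormedAddCommGroup G] [NormedSpace ℝ G] [NormedAddCommGroup E] [NormedSpace ℝ E]

/-- The extension of a continuous function on `[-1, 1]` by constants. -/
def extendTime (y : C(UnitTime, E)) : ℝ → E := Set.IccExtend (by norm_num) y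

lemma continuous_extendTime (y : C(UnitTime, E)) : Continuous (extendTime y) :=
  y.continuous.Icc_extend'

lemma extendTime_of_mem (y : C(UnitTime, E)) {s : ℝ} (hs : s ∈ Icc (-1 : ℝ) 1) :
    extendTime y s = y ⟨s, hs⟩ := Set.IccExtend_of_mem _ _ hs

lemma norm_extendTime_le (y : C(UnitTime, E)) (s : ℝ) : ‖extendTime y s‖ ≤ ‖y‖ :=
  y.norm_coe_le_norm _

/-- The primitive vanishing at `0`. -/
def primitive : C(UnitTime, E) →L[ℝ] C(UnitTime, E) := LinearMap.mkContinuous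
    { toFun := fun y => ⟨fun s => ∫ τ in (0 : ℝ)..s, extendTime y τ, by
        have : Continuous fun s : ℝ => ∫ τ in (0 : ℝ)..s, extendTime y τ :=
          intervalIntegral.continuous_primitive
            (fun a b => (continuous_extendTime y).intervalIntegrable a b) 0
        fun_prop⟩
      map_add' := fun y z => by
        ext s
        exact intervalIntegral.integral_add ((continuous_extendTime y).intervalIntegrable _ _)
          ((continuous_extendTime z).intervalIntegrable _ _)
      map_smul' := fun c y => by
        ext s
        exact intervalIntegral.integral_smul c _ } 1
    (fun y => by
      rw [norm_le _ (by positivity)]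
      intro s
      refine (intervalIntegral.norm_integral_le_of_norm_le_const
        (fun τ _ => norm_extendTime_le y τ)).trans ?_
      have : |(s : ℝ) - 0| ≤ 1 := by rw [sub_zero, abs_le]; exact s.2
      nlinarith [norm_nonneg y])

lemma primitive_apply (y : C(UnitTime, E)) (s : UnitTime) :
    primitive y s = ∫ τ in (0 : ℝ)..s, extendTime y τ := rfl

/-- The Volterra operator `y ↦ ∫_0^· B y`. -/
def volterra : C(UnitTime, E →L[ℝ] E) →L[ℝ] C(UnitTime, E) →L[ℝ] C(UnitTime, E) :=
  (ContinuousLinearMap.compL ℝ _ _ _ primitive).comp pointwiseApply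

lemma volterra_apply (B : C(UnitTime, E →L[ℝ] E)) (y : C(UnitTime, E)) (s : UnitTime) :
    volterra B y s = ∫ τ in (0 : ℝ)..s, extendTime B τ (extendTime y τ) := rfl

/-- Every application integrates one more power of `|τ|`, which produces the factorial. The bound
must be pointwise in `s` for the induction to run. -/
lemma norm_volterra_pow_apply_le (B : C(UnitTime, E →L[ℝ] E)) (n : ℕ) (y : C(UnitTime, E))
    (s : UnitTime) : ‖(volterra B ^ n) y s‖ ≤ (‖B‖ * |(s : ℝ)|) ^ n / n.factorial * ‖y‖ := by
  induction n generalizing s with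
  | zero => simpa using y.norm_coe_le_norm s
  | succ n ih =>
    rw [pow_succ', mul_apply_eq_comp, volterra_apply]
    set z := (volterra B ^ n) y
    have hb : ∀ τ ∈ Set.uIoc (0 : ℝ) s, ‖extendTime B τ (extendTime z τ)‖ ≤
        ‖B‖ * ((‖B‖ * |τ|) ^ n / n.factorial * ‖y‖) := by
      intro τ hτ
      have hm : τ ∈ Icc (-1 : ℝ) 1 := by
        have := s.2
        rw [Set.mem_uIoc] at hτ
        simp only [Set.mem_Icc] at this ⊢
        rcases hτ with h | h <;> constructor <;> linarith
      refine ((extendTime B τ).le_opNorm _).trans ?_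
      refine mul_le_mul (norm_extendTime_le B τ) ?_ (norm_nonneg _) (norm_nonneg B)
      rw [extendTime_of_mem z hm]
      exact ih ⟨τ, hm⟩
    -- Time runs in both directions on `[-1, 1]`; negative end points are reflected to positive
    -- ones.
    have hint : |∫ τ in (0 : ℝ)..s, |τ| ^ n| = |(s : ℝ)| ^ (n + 1) / (n + 1) := by
      have hpos : ∀ r : ℝ, 0 ≤ r → ∫ τ in (0 : ℝ)..r, |τ| ^ n = r ^ (n + 1) / (n + 1) := by
        intro r hr
        rw [integral_congr (g := fun τ => τ ^ n)]
        · simp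
        · intro τ hτ
          rw [Set.uIcc_of_le hr] at hτ
          simp [abs_of_nonneg hτ.1]
      rcases le_total 0 (s : ℝ) with h | h
      · rw [hpos _ h, abs_of_nonneg (by positivity), abs_of_nonneg h]
      · have : ∫ τ in (0 : ℝ)..s, |τ| ^ n = -∫ τ in (0 : ℝ)..(-s), |τ| ^ n := by
          have := intervalIntegral.integral_comp_neg (a := 0) (b := (s : ℝ)) fun τ : ℝ => |τ| ^ n
          simp only [abs_neg, neg_zero] at this
          rw [this, intervalIntegral.integral_symm]
        rw [this, hpos _ (by linarith), abs_neg, abs_of_nonneg (by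
          have : 0 ≤ -(s : ℝ) := by linarith
          positivity), abs_of_nonpos h]
    calc ‖∫ τ in (0 : ℝ)..s, extendTime B τ (extendTime z τ)‖
        ≤ |∫ τ in (0 : ℝ)..s, ‖B‖ * ((‖B‖ * |τ|) ^ n / n.factorial * ‖y‖)| := by
          apply intervalIntegral.norm_integral_le_abs_of_norm_le
          · exact (ae_restrict_mem measurableSet_uIoc).mono fun τ hτ => hb τ hτ
          · exact (by fun_prop : Continuous fun τ : ℝ =>
              ‖B‖ * ((‖B‖ * |τ|) ^ n / n.factorial * ‖y‖)).intervalIntegrable _ _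
      _ = ‖B‖ ^ (n + 1) / n.factorial * ‖y‖ * |∫ τ in (0 : ℝ)..s, |τ| ^ n| := by
          rw [← abs_of_nonneg (by positivity : 0 ≤ ‖B‖ ^ (n + 1) / n.factorial * ‖y‖), ← abs_mul,
            ← intervalIntegral.integral_const_mul]
          congr 1
          refine integral_congr fun τ _ => ?_
          ring
      _ = (‖B‖ * |(s : ℝ)|) ^ (n + 1) / (n + 1).factorial * ‖y‖ := by
          rw [hint, Nat.factorial_succ, mul_pow]
          push_cast
          field_simp

/-- The factorial bound makes some power of the Volterra operator `V` smaller than one in norm, so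
`1 - V ^ n` is invertible. It is the product of `1 - V` with a polynomial in `V`, and these factors
commute. -/
lemma isUnit_one_sub_volterra [CompleteSpace E] (B : C(UnitTime, E →L[ℝ] E)) :
    IsUnit (1 - volterra B) := by
  have hn : ∀ n, ‖volterra B ^ n‖ ≤ ‖B‖ ^ n / n.factorial := by
    intro n
    refine opNorm_le_bound _ (by positivity) fun y => ?_
    rw [norm_le _ (by positivity)]
    intro s
    refine (norm_volterra_pow_apply_le B n y s).trans ?_
    have : |(s : ℝ)| ≤ 1 := abs_le.2 s.2
    gcongr
    exact mul_le_of_le_one_right (norm_nonneg B) this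
  obtain ⟨n, hlt⟩ := ((FloorSemiring.tendsto_pow_div_factorial_atTop ‖B‖).eventually
    (gt_mem_nhds one_pos)).exists
  have hu : IsUnit (1 - volterra B ^ n) := by
    have := isUnit_one_sub_of_norm_lt_one (R := C(UnitTime, E) →L[ℝ] C(UnitTime, E))
      ((hn n).trans_lt hlt)
    exact this
  rw [← mul_neg_geom_sum] at hu
  refine ((Commute.isUnit_mul_iff ?_).1 hu).1
  refine Commute.sum_right _ _ _ fun i _ => ?_
  exact (Commute.one_left _).sub_left ((Commute.refl (volterra B)).pow_right i)

end Volterra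

/-! ### Linear equations depending smoothly on parameters -/

section ODE

variable {Q E : Type} [NormedAddCommGroup Q] [NormedSpace ℝ Q]
  [NormedAddCommGroup E] [NormedSpace ℝ E] [CompleteSpace E]

/-- The point `1` of `[-1, 1]`. -/
def unitEnd : UnitTime := ⟨1, by norm_num⟩

/-- Evaluation of a continuous function of time. -/
def evalTime (s : UnitTime) : C(UnitTime, E) →L[ℝ] E := LinearMap.mkContinuous
    { toFun := fun y => y s, map_add' := fun _ _ => rfl, map_smul' := fun _ _ => rfl } 1
    (fun y => by simpa using y.norm_coe_le_norm s)

@[simp] lemma evalTime_apply (s : UnitTime) (y : C(UnitTime, E)) : evalTime s y = y s := rfl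

/-- The constant functions of time. -/
def constTime : E →L[ℝ] C(UnitTime, E) := LinearMap.mkContinuous
    { toFun := fun x => ContinuousMap.const _ x, map_add' := fun _ _ => rfl,
      map_smul' := fun _ _ => rfl } 1
    (fun x => by
      rw [norm_le _ (by positivity)]
      intro s; exact (one_mul ‖x‖).symm ▸ le_rfl)

@[simp] lemma constTime_apply (x : E) (s : UnitTime) : constTime x s = x := rfl

lemma ring_inverse_volterra (B : C(UnitTime, E →L[ℝ] E)) (w : C(UnitTime, E)) :
    Ring.inverse (1 - volterra B) w = w + volterra B (Ring.inverse (1 - volterra B) w) := by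
  have h := Ring.mul_inverse_cancel _ (isUnit_one_sub_volterra B)
  have := congrArg (fun T : C(UnitTime, E) →L[ℝ] C(UnitTime, E) => T w) h
  simp only [mul_apply_eq_comp, sub_apply, one_apply_eq_self] at this
  rw [sub_eq_iff_eq_add] at this
  exact this

lemma eq_ring_inverse_volterra {B : C(UnitTime, E →L[ℝ] E)} {y w : C(UnitTime, E)}
    (h : y = w + volterra B y) : y = Ring.inverse (1 - volterra B) w := by
  have h1 := Ring.inverse_mul_cancel _ (isUnit_one_sub_volterra B)
  have := congrArg (fun T : C(UnitTime, E) →L[ℝ] C(UnitTime, E) => T y) h1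
  simp only [mul_apply_eq_comp, sub_apply, one_apply_eq_self] at this
  rw [← this]
  congr 1
  rw [sub_eq_iff_eq_add]
  exact h

/-- The coefficient of a linear equation on the time interval with end points `±t`, rescaled to
`[-1, 1]`. -/
def rescaledCoeff (B : ℝ × Q → E →L[ℝ] E) (hB : Continuous B) (p : ℝ × Q) :
    C(UnitTime, E →L[ℝ] E) :=
  ⟨fun s => p.1 • B (p.1 * s, p.2), by fun_prop⟩

lemma contDiff_rescaledCoeff (B : ℝ × Q → E →L[ℝ] E) (hB : Smooth B) :
    Smooth (rescaledCoeff B hB.continuous) :=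
  contDiff_curry (fun p : ℝ × (ℝ × Q) => p.2.1 • B (p.2.1 * p.1, p.2.2)) (by fun_prop)

lemma extendTime_rescaledCoeff (B : ℝ × Q → E →L[ℝ] E) (hB : Continuous B) (p : ℝ × Q) {s : ℝ}
    (hs : s ∈ Icc (-1 : ℝ) 1) :
    extendTime (rescaledCoeff B hB p) s = p.1 • B (p.1 * s, p.2) := extendTime_of_mem _ hs

/-- The solution at time `p.1 s` of a linear equation. -/
def linearSol (B : ℝ × Q → E →L[ℝ] E) (hB : Continuous B) (p : ℝ × Q) (x : E) : C(UnitTime, E) :=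
  Ring.inverse (1 - volterra (rescaledCoeff B hB p)) (constTime x)

lemma linearSol_apply (B : ℝ × Q → E →L[ℝ] E) (hB : Continuous B) (p : ℝ × Q) (x : E)
    (s : UnitTime) : linearSol B hB p x s =
      x + ∫ τ in (0 : ℝ)..s, (p.1 • B (p.1 * τ, p.2)) (extendTime (linearSol B hB p x) τ) := by
  conv_lhs => rw [linearSol, ring_inverse_volterra]
  simp only [ContinuousMap.add_apply, constTime_apply, volterra_apply]
  congr 1
  refine integral_congr fun τ hτ => ?_
  have hs := s.2
  rw [Set.mem_Icc] at hs
  have : τ ∈ Icc (-1 : ℝ) 1 := by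
    rw [Set.mem_uIcc] at hτ
    rcases hτ with h | h <;> constructor <;> linarith
  simp only [extendTime_rescaledCoeff B hB p this]
  rfl

/-- The length of the time window is treated as a parameter: the solution on `[-t, t]` at the
fraction `s` and the solution on `[-ts, ts]` at its end point satisfy the same Volterra equation.
Smoothness in time thereby becomes smoothness in a parameter. -/
lemma linearSol_rescale (B : ℝ × Q → E →L[ℝ] E) (hB : Continuous B) (t : ℝ) (q : Q) (x : E)
    (s : UnitTime) : linearSol B hB (t, q) x s = linearSol B hB (t * s, q) x unitEnd := by
  have hmem : ∀ σ : UnitTime, (s : ℝ) * σ ∈ Icc (-1 : ℝ) 1 := fun σ => by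
    rw [Set.mem_Icc, ← abs_le, abs_mul]
    exact mul_le_one₀ (abs_le.2 s.2) (abs_nonneg _) (abs_le.2 σ.2)
  set y := linearSol B hB (t, q) x
  let z : C(UnitTime, E) := ⟨fun σ => y ⟨s * σ, hmem σ⟩, by fun_prop⟩
  suffices h : z = linearSol B hB (t * s, q) x by
    rw [← h]
    change y s = y ⟨s * (1 : ℝ), _⟩
    congr 1
    ext; simp
  refine eq_ring_inverse_volterra ?_
  ext σ
  change y ⟨s * σ, hmem σ⟩ = _
  rw [linearSol_apply]
  simp only [ContinuousMap.add_apply, constTime_apply, volterra_apply]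
  congr 1
  have := intervalIntegral.smul_integral_comp_mul_left (a := 0) (b := (σ : ℝ))
    (fun τ => (t • B (t * τ, q)) (extendTime y τ)) (s : ℝ)
  rw [mul_zero] at this
  rw [← this, ← intervalIntegral.integral_smul]
  refine integral_congr fun τ hτ => ?_
  have hσ := σ.2
  rw [Set.mem_Icc] at hσ
  have hτ' : τ ∈ Icc (-1 : ℝ) 1 := by
    rw [Set.mem_uIcc] at hτ
    rcases hτ with h | h <;> constructor <;> linarith
  simp only [extendTime_rescaledCoeff B hB _ hτ', extendTime_of_mem z hτ',
    extendTime_of_mem y (hmem ⟨τ, hτ'⟩)]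
  simp only [smul_apply, smul_smul, mul_assoc]
  rw [mul_comm]
  rfl

/-- The propagator of a smooth linear differential equation depending on a parameter. -/
lemma exists_linear_propagator (B : ℝ × Q → E →L[ℝ] E) (hB : Smooth B) :
    ∃ W : ℝ × Q → E →L[ℝ] E, Smooth W ∧ (∀ q, W (0, q) = 1) ∧
      ∀ t q, HasDerivAt (fun t => W (t, q)) ((B (t, q)).comp (W (t, q))) t := by
  let W : ℝ × Q → E →L[ℝ] E := fun p => (evalTime unitEnd).comp
    ((Ring.inverse (1 - volterra (rescaledCoeff B hB.continuous p))).comp constTime)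
  have hWx : ∀ p x, W p x = linearSol B hB.continuous p x unitEnd := fun p x => rfl
  have hW : Smooth W := by
    have h1 : Smooth fun p => 1 - volterra (rescaledCoeff B hB.continuous p) := by
      have := ContinuousLinearMap.contDiff (𝕜 := ℝ) (n := ∞) (E := C(UnitTime, E →L[ℝ] E))
        (F := C(UnitTime, E) →L[ℝ] C(UnitTime, E)) volterra
      exact contDiff_const.sub (this.comp (contDiff_rescaledCoeff B hB))
    -- Inversion is smooth at every unit of the Banach algebra of operators, and `1 - volterra` is
    -- always a unit.
    have h2 : Smooth fun p => Ring.inverse (1 - volterra (rescaledCoeff B hB.continuous p)) := by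
      rw [contDiff_iff_contDiffAt]
      intro p
      obtain ⟨u, hu⟩ := isUnit_one_sub_volterra (rescaledCoeff B hB.continuous p)
      have h3 := contDiffAt_ringInverse ℝ (n := ∞) (R := C(UnitTime, E) →L[ℝ] C(UnitTime, E)) u
      rw [hu] at h3
      exact h3.comp p h1.contDiffAt
    exact contDiff_const.clm_comp (h2.clm_comp contDiff_const)
  refine ⟨W, hW, fun q => ?_, fun t q => ?_⟩
  · ext x
    rw [hWx, linearSol_apply]
    simp
  · have hd : HasDerivAt (fun t => W (t, q)) (deriv (fun t => W (t, q)) t) t := by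
      have : Smooth fun t => W (t, q) := hW.comp (contDiff_id.prodMk contDiff_const)
      exact (this.diff_infty t).hasDerivAt
    convert hd using 1
    ext x
    have hdx : HasDerivAt (fun t => W (t, q) x) (deriv (fun t => W (t, q)) t x) t :=
      hd.clm_apply (hasDerivAt_const t x) |>.congr_deriv (by simp)
    refine HasDerivAt.unique ?_ hdx
    -- Smoothness already provides a derivative, and only its value is wanted. On the window `[-T,
    -- T]`, which contains `t` in its interior, all nearby values are read off one solution `y`, and
    -- the integral equation for `y` can be differentiated.
    set T := |t| + 1 with hT
    have hTpos : 0 < T := by positivity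
    set y := linearSol B hB.continuous (T, q) x
    have hcont : Continuous fun τ => (T • B (T * τ, q)) (extendTime y τ) := by
      have := continuous_extendTime y
      have := hB.continuous
      fun_prop
    have hF : ∀ s, HasDerivAt (fun s => x + ∫ τ in (0 : ℝ)..s, (T • B (T * τ, q)) (extendTime y τ))
        ((T • B (T * s, q)) (extendTime y s)) s := fun s =>
      (integral_hasDerivAt_right (hcont.intervalIntegrable _ _)
        (hcont.stronglyMeasurableAtFilter _ _) hcont.continuousAt).const_add x
    have hmem : ∀ r : ℝ, |r| < T → r / T ∈ Icc (-1 : ℝ) 1 := fun r hr => by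
      rw [Set.mem_Icc, ← abs_le, abs_div, abs_of_pos hTpos, div_le_one hTpos]; exact hr.le
    have heq : ∀ r : ℝ, ∀ hr : |r| < T, W (r, q) x = y ⟨r / T, hmem r hr⟩ := fun r hr => by
      have h := linearSol_rescale B hB.continuous T q x ⟨r / T, hmem r hr⟩
      rw [hWx, show y _ = _ from h]
      change _ = linearSol B hB.continuous (T * (r / T), q) x unitEnd
      rw [mul_div_cancel₀ r hTpos.ne']
    have hcomp := (hF (t / T)).scomp t ((hasDerivAt_id t).div_const T)
    have ht : |t| < T := by rw [hT]; linarith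
    refine (hcomp.congr_of_eventuallyEq ?_).congr_deriv ?_
    · have : ∀ᶠ r in nhds t, |r| < T := continuous_abs.continuousAt.eventually (gt_mem_nhds ht)
      filter_upwards [this] with r hr
      rw [heq r hr, linearSol_apply]
      rfl
    · have h1 : T * (t / T) = t := by field_simp
      rw [extendTime_of_mem y (hmem t ht), h1, comp_apply, heq t ht]
      simp only [smul_apply, smul_smul]
      rw [one_div, inv_mul_cancel₀ hTpos.ne', one_smul]

end ODE

/-! ### Nonlinear equations: global solutions and smooth flows -/

section NonlinearODE

variable {E : Type} [NormedAddCommGroup E] [NormedSpace ℝ E] [CompleteSpace E]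

lemma eq_of_hasDerivAt_lipschitz {f : ℝ → E → E} {K : NNReal} (hf : ∀ t, LipschitzWith K (f t))
    {y z : ℝ → E} (hy : ∀ t, HasDerivAt y (f t (y t)) t) (hz : ∀ t, HasDerivAt z (f t (z t)) t)
    {t₀ : ℝ} (h : y t₀ = z t₀) : y = z :=
  ODE_solution_unique_univ (s := fun _ => Set.univ) (fun t => (hf t).lipschitzOnWith)
    (fun t => ⟨hy t, trivial⟩) (fun t => ⟨hz t, trivial⟩) h

/-- Global solutions of differential equations with a bounded Lipschitz vector field. -/
lemma exists_global_solution {f : ℝ → E → E} {K L : NNReal} (hf : ∀ t, LipschitzWith K (f t))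
    (hc : ∀ x, Continuous fun t => f t x) (hL : ∀ t x, ‖f t x‖ ≤ L) (t₀ : ℝ) (x : E) :
    ∃ y : ℝ → E, y t₀ = x ∧ ∀ t, HasDerivAt y (f t (y t)) t := by
  have hloc : ∀ n : ℕ, ∃ y : ℝ → E, y t₀ = x ∧
      ∀ t ∈ Set.Ioo (t₀ - (n + 1)) (t₀ + (n + 1)), HasDerivAt y (f t (y t)) t := by
    intro n
    have hmem : t₀ ∈ Icc (t₀ - (n + 1)) (t₀ + (n + 1)) := by
      constructor <;> linarith [n.cast_nonneg (α := ℝ)]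
    -- The field is bounded by `L` and Lipschitz on the whole space, so the ball of radius `L (n +
    -- 1)` admits the full time interval and no shrinking of time is needed.
    have hP : IsPicardLindelof f (⟨t₀, hmem⟩ : Icc (t₀ - (n + 1)) (t₀ + (n + 1))) x
        (L * (n + 1)) 0 L K :=
      { lipschitzOnWith := fun t _ => (hf t).lipschitzOnWith
        continuousOn := fun y _ => (hc y).continuousOn
        norm_le := fun t _ y _ => hL t y
        mul_max_le := by simp }
    obtain ⟨y, hy0, hy⟩ := hP.exists_eq_forall_mem_Icc_hasDerivWithinAt₀
    exact ⟨y, hy0, fun t ht => (hy t (Set.Ioo_subset_Icc_self ht)).hasDerivAt (Icc_mem_nhds ht.1 ht.2)⟩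
  choose y hy0 hy using hloc
  have hagree : ∀ m n : ℕ, m ≤ n → Set.EqOn (y m) (y n) (Set.Ioo (t₀ - (m + 1)) (t₀ + (m + 1))) := by
    intro m n hmn
    have hmn' : (m : ℝ) ≤ n := by exact_mod_cast hmn
    refine ODE_solution_unique_of_mem_Ioo (v := f) (s := fun _ => Set.univ) (K := K) (t₀ := t₀)
      (fun t _ => (hf t).lipschitzOnWith) ?_ (fun t ht => ⟨hy m t ht, trivial⟩)
      (fun t ht => ⟨hy n t ?_, trivial⟩) (by rw [hy0, hy0])
    · constructor <;> linarith [m.cast_nonneg (α := ℝ)]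
    · constructor <;> linarith [ht.1, ht.2]
  have hceil : ∀ t : ℝ, t ∈ Set.Ioo (t₀ - ((⌈|t - t₀|⌉₊ : ℝ) + 1)) (t₀ + ((⌈|t - t₀|⌉₊ : ℝ) + 1)) := by
    intro t
    have h1 := Nat.le_ceil |t - t₀|
    have h2 := abs_le.1 h1
    constructor <;> linarith [h2.1, h2.2]
  -- The local solutions are glued by using, at time `t`, the one numbered `⌈|t - t₀|⌉₊`; it is
  -- defined near `t` because the intervals carry the extra `+ 1`.
  refine ⟨fun t => y ⌈|t - t₀|⌉₊ t, hy0 _, fun t => ?_⟩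
  refine (hy _ t (hceil t)).congr_of_eventuallyEq ?_
  filter_upwards [isOpen_Ioo.mem_nhds (hceil t)] with r hr
  rcases le_total ⌈|r - t₀|⌉₊ ⌈|t - t₀|⌉₊ with h | h
  · exact hagree _ _ h (hceil r)
  · exact (hagree _ _ h hr).symm

/-- The vector field `f`, rescaled to the time interval `[-1, 1]`, with the length of the time
interval as a further variable. -/
def rescaledField (f : ℝ × E → E) (p : ℝ × (E × ℝ)) : E × ℝ := (p.2.2 • f (p.2.2 * p.1, p.2.1), 0)

lemma contDiff_rescaledField {f : ℝ × E → E} (hf : Smooth f) : Smooth (rescaledField f) := by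
  unfold rescaledField
  fun_prop

/-- The map whose zeros, up to the initial value, are the solutions of a differential equation. -/
def integralMap (f : ℝ × E → E) (hf : Smooth f) (y : C(UnitTime, E × ℝ)) : C(UnitTime, E × ℝ) :=
  y - primitive (superposition (rescaledField f) (contDiff_rescaledField hf).continuous y)

lemma contDiff_integralMap (f : ℝ × E → E) (hf : Smooth f) : Smooth (integralMap f hf) := by
  have := ContinuousLinearMap.contDiff (𝕜 := ℝ) (n := ∞) (E := C(UnitTime, E × ℝ))
    (F := C(UnitTime, E × ℝ)) primitive
  exact contDiff_id.sub (this.comp (contDiff_superposition _ (contDiff_rescaledField hf)))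

/-- The derivative is the identity minus a Volterra operator, hence invertible at every `y`. This is
the hypothesis of the inverse function theorem. -/
lemma exists_hasFDerivAt_integralMap (f : ℝ × E → E) (hf : Smooth f)
    (y : C(UnitTime, E × ℝ)) : ∃ T : C(UnitTime, E × ℝ) ≃L[ℝ] C(UnitTime, E × ℝ),
      HasFDerivAt (integralMap f hf) (T : C(UnitTime, E × ℝ) →L[ℝ] C(UnitTime, E × ℝ)) y := by
  have hf' := contDiff_rescaledField hf
  have hF' : Smooth (fun p => (fderiv ℝ (rescaledField f) p).comp
      (ContinuousLinearMap.inr ℝ ℝ (E × ℝ))) :=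
    (hf'.fderiv_right (m := ∞) (by simp)).clm_comp contDiff_const
  have h1 := hasFDerivAt_superposition _ hf' _ hF'.continuous (fun _ => rfl) y
  have h2 := ContinuousLinearMap.hasFDerivAt (𝕜 := ℝ) (E := C(UnitTime, E × ℝ))
    (F := C(UnitTime, E × ℝ)) primitive
    (x := superposition (rescaledField f) hf'.continuous y)
  have h3 := (hasFDerivAt_id y).sub (h2.comp y h1)
  obtain ⟨u, hu⟩ := isUnit_one_sub_volterra (superposition _ hF'.continuous y)
  refine ⟨ContinuousLinearEquiv.ofUnit u, h3.congr_fderiv ?_⟩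
  ext1 w
  exact congrArg (fun T : C(UnitTime, E × ℝ) →L[ℝ] C(UnitTime, E × ℝ) => T w) hu.symm

/-- The second component of a preimage of `(x, t)` is constantly `t`, so its first component solves
the equation run at speed `t`. By uniqueness any preimage ends at `z t`; the local inverse used
later is thus identified with the flow without a closeness argument. -/
lemma integralMap_eq_const {f : ℝ × E → E} (hf : Smooth f) {K : NNReal}
    (hK : ∀ t, LipschitzWith K fun x => f (t, x)) {y : C(UnitTime, E × ℝ)} {x : E} {t : ℝ}
    (h : integralMap f hf y = constTime (x, t)) {z : ℝ → E} (hz0 : z 0 = x)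
    (hz : ∀ t, HasDerivAt z (f (t, z t)) t) : (y unitEnd).1 = z t := by
  have hy : ∀ s : UnitTime, y s = (x, t) + ∫ τ in (0 : ℝ)..s, rescaledField f (τ, extendTime y τ) := by
    intro s
    have := congrArg (fun w : C(UnitTime, E × ℝ) => w s) h
    simp only [integralMap, ContinuousMap.sub_apply, constTime_apply, primitive_apply] at this
    rw [sub_eq_iff_eq_add] at this
    rw [this]
    congr 1
    refine integral_congr fun τ hτ => ?_
    have hs := s.2
    rw [Set.mem_Icc] at hs
    have hτ' : τ ∈ Icc (-1 : ℝ) 1 := by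
      rw [Set.mem_uIcc] at hτ
      rcases hτ with h | h <;> constructor <;> linarith
    simp only [extendTime_of_mem _ hτ']
    rfl
  have hcont : Continuous fun τ => rescaledField f (τ, extendTime y τ) := by
    have := continuous_extendTime y
    have := (contDiff_rescaledField hf).continuous
    fun_prop
  -- The curve `y` lives on `[-1, 1]` only; the integral extends it to a differentiable curve on the
  -- whole line.
  set w : ℝ → E × ℝ := fun s => (x, t) + ∫ τ in (0 : ℝ)..s, rescaledField f (τ, extendTime y τ)
  have hw : ∀ s, HasDerivAt w (rescaledField f (s, extendTime y s)) s := fun s =>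
    (integral_hasDerivAt_right (hcont.intervalIntegrable _ _)
      (hcont.stronglyMeasurableAtFilter _ _) hcont.continuousAt).const_add _
  have hw1 : ∀ s, HasDerivAt (fun s => (w s).1) (rescaledField f (s, extendTime y s)).1 s :=
    fun s => (hw s).fst
  have hw2 : ∀ s, (w s).2 = t := by
    intro s
    have hd : ∀ s, HasDerivAt (fun s => (w s).2) 0 s := fun s => (hw s).snd
    have := is_const_of_deriv_eq_zero (fun s => (hd s).differentiableAt) (fun s => (hd s).deriv) s 0
    rw [this]
    simp [w]
  have hyw : ∀ s ∈ Icc (0 : ℝ) 1, extendTime y s = w s := fun s hs => by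
    have hs' : s ∈ Icc (-1 : ℝ) 1 := ⟨by linarith [hs.1], hs.2⟩
    rw [extendTime_of_mem y hs', hy]
  have key : Set.EqOn (fun s => (w s).1) (fun s => z (t * s)) (Icc 0 1) := by
    refine ODE_solution_unique (v := fun s x => t • f (t * s, x)) (K := ‖t‖₊ * K) (fun s => ?_)
      (fun s _ => (hw1 s).continuousAt.continuousWithinAt) ?_ ?_ ?_ ?_
    · exact (lipschitzWith_smul t).comp (hK _)
    · intro s hs
      have := hyw s (Set.Ico_subset_Icc_self hs)
      refine ((hw1 s).congr_deriv ?_).hasDerivWithinAt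
      rw [this]
      simp only [rescaledField, hw2]
    · exact ((continuous_iff_continuousAt.2 fun s => (hz s).continuousAt).comp
        (continuous_const.mul continuous_id)).continuousOn
    · intro s hs
      have := (hz (t * s)).scomp s ((hasDerivAt_id s).const_mul t)
      exact (this.congr_deriv (by simp)).hasDerivWithinAt
    · simp [w, hz0]
  have := key (Set.right_mem_Icc.2 zero_le_one)
  rw [hy]
  simpa [w, unitEnd] using this

/-- Smooth dependence on the initial values and on time. -/
lemma contDiff_flow {f : ℝ × E → E} (hf : Smooth f) {K : NNReal}
    (hK : ∀ t, LipschitzWith K fun x => f (t, x)) {Φ : ℝ → E → E} (h0 : ∀ x, Φ 0 x = x)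
    (hΦ : ∀ x t, HasDerivAt (fun t => Φ t x) (f (t, Φ t x)) t) :
    Smooth fun p : ℝ × E => Φ p.1 p.2 := by
  rw [contDiff_iff_contDiffAt]
  rintro ⟨t, x⟩
  have hcΦ : Continuous fun r => Φ r x := continuous_iff_continuousAt.2 fun r => (hΦ x r).continuousAt
  let y : C(UnitTime, E × ℝ) := ⟨fun s => (Φ (t * s) x, t), by fun_prop⟩
  have hy : integralMap f hf y = constTime (x, t) := by
    ext1 s
    simp only [integralMap, ContinuousMap.sub_apply, primitive_apply, constTime_apply]
    rw [sub_eq_iff_eq_add]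
    have hs := s.2
    rw [Set.mem_Icc] at hs
    have hd : ∀ τ, HasDerivAt (fun s : ℝ => (Φ (t * s) x, t)) (rescaledField f (τ, (Φ (t * τ) x, t))) τ := by
      intro τ
      refine HasDerivAt.prodMk ?_ (hasDerivAt_const _ _)
      have := (hΦ x (t * τ)).scomp τ ((hasDerivAt_id τ).const_mul t)
      exact this.congr_deriv (by simp)
    have hc : Continuous fun τ => rescaledField f (τ, (Φ (t * τ) x, t)) := by
      have := (contDiff_rescaledField hf).continuous
      fun_prop
    have := intervalIntegral.integral_eq_sub_of_hasDerivAt (a := 0) (b := (s : ℝ)) (fun τ _ => hd τ)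
      (hc.intervalIntegrable _ _)
    rw [integral_congr (g := fun τ => rescaledField f (τ, (Φ (t * τ) x, t))), this]
    · simp [y, h0]
    · intro τ hτ
      have hτ' : τ ∈ Icc (-1 : ℝ) 1 := by
        rw [Set.mem_uIcc] at hτ
        rcases hτ with h | h <;> constructor <;> linarith
      simp only [extendTime_of_mem _ hτ']
      rfl
  -- Near the given trajectory, `integralMap` has a smooth local inverse. Composed with the
  -- constants `(x, t)` and evaluated at the end point, it is the flow.
  obtain ⟨T, hT⟩ := exists_hasFDerivAt_integralMap f hf y
  have hsm : ContDiffAt ℝ ∞ (integralMap f hf) y := (contDiff_integralMap f hf).contDiffAt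
  have hinv := hsm.to_localInverse hT (by simp)
  have hright := (hsm.hasStrictFDerivAt' hT (by simp)).eventually_right_inverse
  rw [hy] at hinv hright
  have hconst : Smooth fun p : ℝ × E => (constTime (p.2, p.1) : C(UnitTime, E × ℝ)) := by
    have := ContinuousLinearMap.contDiff (𝕜 := ℝ) (n := ∞) (E := E × ℝ) (F := C(UnitTime, E × ℝ))
      constTime
    exact this.comp (contDiff_snd.prodMk contDiff_fst)
  have hev : Smooth fun y : C(UnitTime, E × ℝ) => (evalTime unitEnd y).1 := by
    have := ContinuousLinearMap.contDiff (𝕜 := ℝ) (n := ∞) (E := C(UnitTime, E × ℝ)) (F := E × ℝ)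
      (evalTime unitEnd)
    exact this.fst
  have hcomp := hev.contDiffAt.comp (t, x) (ContDiffAt.comp (t, x) hinv hconst.contDiffAt)
  refine hcomp.congr_of_eventuallyEq ?_
  have hcont : Filter.Tendsto (fun p : ℝ × E => (constTime (p.2, p.1) : C(UnitTime, E × ℝ)))
    (nhds (t, x)) (nhds (constTime (x, t))) := hconst.continuous.continuousAt
  filter_upwards [hcont.eventually hright] with p hp
  exact (integralMap_eq_const hf hK hp (h0 p.2) (hΦ p.2)).symm

end NonlinearODE

/-! ### Phase space -/

/-- The phase space `ℝ^d × ℝ^d`. -/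
abbrev Phase (d : ℕ) : Type := Space d × Space d

/-- Time and phase space. -/
notation:max "Ext" d:max => ℝ × Phase d

/-- The class in `L²` of a Schwartz function. -/
notation:max f:max "♭" => SchwartzMap.toLp f 2 volume

/-- The symplectic form `ξ · x' - x · ξ'`. -/
def symp : Phase d →L[ℝ] Phase d →L[ℝ] ℝ := (innerSL ℝ).bilinearComp (snd ℝ _ _) (fst ℝ _ _) -
    (innerSL ℝ).bilinearComp (fst ℝ _ _) (snd ℝ _ _)

lemma symp_apply (z w : Phase d) : symp z w = inner ℝ z.2 w.1 - inner ℝ z.1 w.2 := rfl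

@[simp] lemma symp_self (z : Phase d) : symp z z = 0 := by
  rw [symp_apply, real_inner_comm, sub_self]

lemma symp_swap (z w : Phase d) : symp z w = -symp w z := by
  simp only [symp_apply, real_inner_comm, neg_sub]

/-- The index set of the standard basis of phase space. -/
abbrev PhaseIndex (d : ℕ) : Type := Fin d ⊕ Fin d

/-- The standard basis of phase space. -/
def phaseVec : PhaseIndex d → Phase d
  | inl i => (stdVec i, 0)
  | inr i => (0, stdVec i)

/-- The coordinates on phase space. -/
def phaseCoord : PhaseIndex d → Phase d →L[ℝ] ℝ
  | inl i => (proj i).comp (fst ℝ _ _)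
  | inr i => (proj i).comp (snd ℝ _ _)

lemma sum_stdVec (x : Space d) : ∑ i, x i • (stdVec i : Space d) = x := by
  ext j
  simp [stdVec, Pi.single_apply]

lemma sum_phaseCoord (z : Phase d) : ∑ j, phaseCoord j z • phaseVec j = z := by
  rw [Fintype.sum_sum_type]
  ext1
  · simp [phaseCoord, phaseVec, Prod.fst_sum, sum_stdVec]
  · simp [phaseCoord, phaseVec, Prod.snd_sum, sum_stdVec]

/-- The unit complex number `e^{i r}`. -/
def expI (r : ℝ) : ℂ := Complex.exp (I * r)

lemma expI_add (r s : ℝ) : expI (r + s) = expI r * expI s := by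
  simp [expI, mul_add, Complex.exp_add]

@[simp] lemma expI_zero : expI 0 = 1 := by simp [expI]

@[simp] lemma norm_expI (r : ℝ) : ‖expI r‖ = 1 := by
  rw [expI, mul_comm, Complex.norm_exp_ofReal_mul_I]

lemma conj_expI (r : ℝ) : (starRingEnd ℂ) (expI r) = expI (-r) := by simp [expI, ← Complex.exp_conj]

lemma expI_neg_mul (r : ℝ) : expI (-r) * expI r = 1 := by rw [← expI_add]; simp

lemma contDiff_expI : Smooth expI := by
  unfold expI
  exact (contDiff_const.mul ofRealCLM.contDiff).cexp

lemma dirDeriv_expI {f : V → ℝ} (hf : Smooth f) (v : V) :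
    𝜕 v (fun x => expI (f x)) = fun x => (I * 𝜕 v f x) * expI (f x) := by
  funext x
  have h1 : HasFDerivAt (fun x => (f x : ℂ)) (ofRealCLM.comp (fderiv ℝ f x)) x :=
    ofRealCLM.hasFDerivAt.comp x (hf.diff_infty x).hasFDerivAt
  have h2 := (h1.const_mul I).cexp
  unfold expI
  rw [dirDeriv_eq h2]
  simp only [dirDeriv, smul_apply, comp_apply, ofRealCLM_apply, smul_eq_mul]
  ring

attribute [irreducible] expI symp

section Slices

variable {P : Type*} [NormedAddCommGroup P] [NormedSpace ℝ P]

lemma dirDeriv_slice_right {f : Q × P → F} (hf : Smooth f) (q : Q) (v : P) :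
    𝜕 v (fun z => f (q, z)) = fun z => 𝜕 (0, v) f (q, z) := by
  funext z
  have h := (hf.diff_infty (q, z)).hasFDerivAt.comp z (hasFDerivAt_prodMk_right (𝕜 := ℝ) q z)
  exact (dirDeriv_eq (f := fun z => f (q, z)) h v).trans rfl

lemma dirDeriv_slice_left {f : Q × P → F} (hf : Smooth f) (z : P) (v : Q) :
    𝜕 v (fun q => f (q, z)) = fun q => 𝜕 (v, 0) f (q, z) := by
  funext q
  have h := (hf.diff_infty (q, z)).hasFDerivAt.comp q (hasFDerivAt_prodMk_left (𝕜 := ℝ) q z)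
  exact (dirDeriv_eq (f := fun q => f (q, z)) h v).trans rfl

end Slices

/-! ### Heisenberg systems -/

/-- An irreducible representation of the Heisenberg group by phase space shifts, with the parity
operator, a normalized Gaussian vector and the resulting resolution of the identity. -/
structure HeisenbergSystem (d : ℕ) (H : Type) [NormedAddCommGroup H] [InnerProductSpace ℂ H] where
  shift : Phase d → H →L[ℂ] H
  shift_zero : ∀ u, shift 0 u = u
  shift_shift : ∀ z w u, shift z (shift w u) = expI (symp z w / 2) • shift (z + w) u
  norm_shift : ∀ z u, ‖shift z u‖ = ‖u‖
  parity : H →L[ℂ] H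
  parity_shift : ∀ z u, parity (shift z u) = shift (-z) (parity u)
  vac : H
  parity_vac : parity vac = vac
  inner_vac : ∀ z : Phase d,
    ⟪vac, shift z vac⟫ = (exp (-((‖z.1‖ ^ 2 + ‖z.2‖ ^ 2) / 4)) : ℂ)
  smooth_vac : Smooth fun z => shift z vac
  annihilate_vac : ∀ i, 𝜕 (phaseVec (inr i)) (fun z => shift z vac) 0 =
    I • 𝜕 (phaseVec (inl i)) (fun z => shift z vac) 0
  integrable_sq : ∀ u, Integrable fun q => ‖⟪shift q vac, u⟫‖ ^ 2
  resolution : ∀ u v, ∫ q, ⟪u, shift q vac⟫ * ⟪shift q vac, v⟫ =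
    ((2 * π) ^ d : ℝ) * ⟪u, v⟫

variable {H : Type} [NormedAddCommGroup H] [InnerProductSpace ℂ H] {S : HeisenbergSystem d H}

/-! ### Smooth vectors and generators of phase space shifts -/

namespace HeisenbergSystem

variable (S)

lemma shift_neg_shift (z : Phase d) (u : H) : S.shift (-z) (S.shift z u) = u := by
  simp [S.shift_shift, S.shift_zero]

lemma shift_shift_neg (z : Phase d) (u : H) : S.shift z (S.shift (-z) u) = u := by
  simp [S.shift_shift, S.shift_zero]

lemma shift_add (z w : Phase d) (u : H) :
    S.shift (z + w) u = expI (-(symp z w / 2)) • S.shift z (S.shift w u) := by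
  rw [S.shift_shift, smul_smul, expI_neg_mul, one_smul]

lemma inner_shift_shift (z : Phase d) (u v : H) : ⟪S.shift z u, S.shift z v⟫ = ⟪u, v⟫ :=
  (LinearIsometry.mk (S.shift z).toLinearMap (S.norm_shift z)).inner_map_map u v

lemma inner_shift_left (z : Phase d) (u v : H) : ⟪S.shift z u, v⟫ = ⟪u, S.shift (-z) v⟫ := by
  rw [← S.inner_shift_shift z u, S.shift_shift_neg]

/-- Smooth vectors of the representation. -/
def SmoothVec (u : H) : Prop := Smooth fun z => S.shift z u

/-- Smooth families of smooth vectors. -/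
def SmoothFam (V : Q → H) : Prop := Smooth fun p : Q × Phase d => S.shift p.2 (V p.1)

/-- The generator of the phase space shifts in direction `v`. -/
def gen (v : Phase d) (u : H) : H := -I • 𝜕 v (fun z => S.shift z u) 0

variable {S}

lemma SmoothFam.joint {V : Q → H} (hV : S.SmoothFam V) :
    Smooth fun p : Q × Phase d => S.shift p.2 (V p.1) := hV

lemma SmoothFam.along {V : Q → H} (hV : S.SmoothFam V) {f : Q' → Q} (hf : Smooth f)
    {g : Q' → Phase d} (hg : Smooth g) : Smooth fun q => S.shift (g q) (V (f q)) :=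
  (hV.joint.comp (hf.prodMk hg) :)

lemma SmoothVec.along {u} (hu : S.SmoothVec u) {g : Q' → Phase d} (hg : Smooth g) :
    Smooth fun q => S.shift (g q) u := by
  have h : Smooth fun z => S.shift z u := hu
  exact h.comp hg

lemma SmoothFam.smoothVec {V : Q → H} (hV : S.SmoothFam V) (q : Q) : S.SmoothVec (V q) :=
  hV.along contDiff_const contDiff_id

lemma SmoothFam.contDiff {V : Q → H} (hV : S.SmoothFam V) : Smooth V := by
  have : V = fun q => S.shift 0 (V q) := by funext q; rw [S.shift_zero]
  rw [this]
  exact hV.along contDiff_id contDiff_const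

lemma SmoothVec.const {u} (hu : S.SmoothVec u) : S.SmoothFam fun _ : Q => u := hu.along contDiff_snd

lemma SmoothFam.comp {V : Q → H} (hV : S.SmoothFam V) {f : Q' → Q} (hf : Smooth f) :
    S.SmoothFam fun q => V (f q) :=
  hV.along (hf.comp contDiff_fst) contDiff_snd

lemma SmoothFam.add {V W : Q → H} (hV : S.SmoothFam V) (hW : S.SmoothFam W) :
    S.SmoothFam fun q => V q + W q := by
  unfold SmoothFam
  simp only [map_add]
  exact hV.joint.add hW.joint

lemma SmoothFam.smul {V : Q → H} (hV : S.SmoothFam V) {c : Q → ℂ} (hc : Smooth c) :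
    S.SmoothFam fun q => c q • V q := by
  unfold SmoothFam
  simp only [map_smul]
  exact (hc.comp contDiff_fst).smul hV.joint

lemma contDiff_symp {f g : Q → Phase d} (hf : Smooth f) (hg : Smooth g) :
    Smooth fun q => symp (f q) (g q) :=
  ((symp (d := d)).contDiff.comp hf).clm_apply hg

lemma contDiff_expI_symp {f g : Q → Phase d} (hf : Smooth f) (hg : Smooth g) :
    Smooth fun q => expI (symp (f q) (g q) / 2) := by
  have h : Smooth fun q => symp (f q) (g q) / 2 := (contDiff_symp hf hg).div_const 2
  exact contDiff_expI.comp h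

lemma SmoothFam.shift {V : Q → H} (hV : S.SmoothFam V) {f : Q → Phase d}
    (hf : Smooth f) : S.SmoothFam fun q => S.shift (f q) (V q) := by
  have h0 : (fun p : Q × Phase d => S.shift p.2 (S.shift (f p.1) (V p.1))) =
      fun p => expI (symp p.2 (f p.1) / 2) • S.shift (p.2 + f p.1) (V p.1) :=
    funext fun p => S.shift_shift _ _ _
  unfold SmoothFam
  rw [h0]
  have h1 : Smooth fun p : Q × Phase d => f p.1 := hf.comp contDiff_fst
  have h2 : Smooth fun p : Q × Phase d => expI (symp p.2 (f p.1) / 2) :=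
    contDiff_expI_symp contDiff_snd h1
  have h3 : Smooth fun p : Q × Phase d => S.shift (p.2 + f p.1) (V p.1) :=
    hV.along contDiff_fst (contDiff_snd.add h1)
  exact h2.smul h3

lemma SmoothVec.shift_fam {u} (hu : S.SmoothVec u) : S.SmoothFam fun z => S.shift z u :=
  (hu.const (Q := Phase d)).shift contDiff_id

lemma shift_dirDeriv {V : Q → H} (hV : Smooth V) (z : Phase d) (e : Q) (q : Q) :
    S.shift z (𝜕 e V q) = 𝜕 e (fun q => S.shift z (V q)) q :=
  (congrFun (dirDeriv_clm_comp hV ((S.shift z).restrictScalars ℝ) e) q).symm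

lemma SmoothFam.dirDeriv {V : Q → H} (hV : S.SmoothFam V) (e : Q) : S.SmoothFam (𝜕 e V) := by
  unfold SmoothFam
  simp only [shift_dirDeriv hV.contDiff]
  have : ∀ p : Q × Phase d, 𝜕 e (fun q => S.shift p.2 (V q)) p.1 =
      𝜕 (e, 0) (fun p : Q × Phase d => S.shift p.2 (V p.1)) p := fun p =>
    congrFun (dirDeriv_slice_left (f := fun p : Q × Phase d => S.shift p.2 (V p.1)) hV p.2 e) p.1
  simp only [this]
  exact hV.joint.dirDeriv _

lemma dirDeriv_expI_symp_left (z v : Phase d) : 𝜕 v (fun w => expI (symp w z / 2)) = fun w =>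
      (I * (symp v z / 2 : ℝ)) * expI (symp w z / 2) := by
  have hc : Smooth fun w : Phase d => symp w z / 2 := ((symp.flip z).contDiff (n := ∞)).div_const 2
  rw [dirDeriv_expI hc]
  funext w
  congr 2
  have : HasFDerivAt (fun w : Phase d => symp w z / 2) ((2 : ℝ)⁻¹ • symp.flip z) w := by
    convert ((2 : ℝ)⁻¹ • symp.flip z).hasFDerivAt using 1
    ext w
    simp [div_eq_inv_mul]
  rw [this.dirDeriv_eq]
  simp [div_eq_inv_mul]

/-- The derivative of the phase space shifts, with the generator applied last. -/
lemma dirDeriv_shift_left {u} (hu : S.SmoothVec u) (v z : Phase d) : 𝜕 v (fun z => S.shift z u) z =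
      I • S.gen v (S.shift z u) - (I * (symp v z / 2 : ℝ)) • S.shift z u := by
  have h : (fun w => S.shift w (S.shift z u)) =
      fun w => expI (symp w z / 2) • S.shift (w + z) u := by
    funext w; rw [S.shift_shift]
  have h1 : Smooth fun w : Phase d => expI (symp w z / 2) :=
    contDiff_expI_symp contDiff_id contDiff_const
  have h2 : Smooth fun w => S.shift (w + z) u := hu.along (contDiff_id.add contDiff_const)
  rw [gen, h, dirDeriv_smul h1 h2, dirDeriv_expI_symp_left,
    dirDeriv_comp_add (fun w => S.shift w u) z v]
  simp only [map_zero, zero_apply, zero_div, expI_zero, mul_one, zero_add,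
    one_smul, smul_smul, smul_add, neg_mul, mul_neg]
  rw [show -(I * I) = 1 by simp]
  have h3 (c : ℂ) : I * (I * (I * c)) = -(I * c) := by
    rw [← mul_assoc, Complex.I_mul_I, neg_one_mul]
  simp [h3]

/-- The derivative of the phase space shifts, with the generator applied first. -/
lemma dirDeriv_shift_right {u} (hu : S.SmoothVec u) (v z : Phase d) : 𝜕 v (fun z => S.shift z u) z =
      S.shift z (I • S.gen v u) - (I * (symp z v / 2 : ℝ)) • S.shift z u := by
  have h : (fun w => S.shift z (S.shift w u)) =
      fun w => expI (-symp w z / 2) • S.shift (w + z) u := by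
    funext w; rw [S.shift_shift, symp_swap, add_comm]
  have h1 : Smooth fun w : Phase d => expI (-symp w z / 2) := by
    have : Smooth fun w : Phase d => -symp w z / 2 :=
      ((symp.flip z).contDiff (n := ∞)).neg.div_const 2
    exact contDiff_expI.comp this
  have h2 : Smooth fun w => S.shift (w + z) u := hu.along (contDiff_id.add contDiff_const)
  have h3 := shift_dirDeriv (S := S) hu z v 0
  have h4 : 𝜕 v (fun w => expI (-symp w z / 2)) = fun w =>
      (I * (-symp v z / 2 : ℝ)) * expI (-symp w z / 2) := by
    have := dirDeriv_expI_symp_left (-z) v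
    simpa using this
  rw [gen, smul_smul, show I * -I = 1 by simp, one_smul, h3, h,
    dirDeriv_smul h1 h2, h4, dirDeriv_comp_add (fun w => S.shift w u) z v]
  rw [symp_swap z v]
  simp

/-- The two preceding formulas compute the same derivative of `z ↦ shift z u`. Their comparison says
that conjugation by a shift moves the generator `gen v` by the value at `z` of its classical symbol
`symp v`. -/
lemma gen_shift {u} (hu : S.SmoothVec u) (v z : Phase d) :
    S.gen v (S.shift z u) = S.shift z (S.gen v u) + (symp v z : ℂ) • S.shift z u := by
  have h := (dirDeriv_shift_left hu v z).symm.trans (dirDeriv_shift_right hu v z)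
  have h2 : I • S.gen v (S.shift z u) =
      I • (S.shift z (S.gen v u) + (symp v z : ℂ) • S.shift z u) := by
    rw [sub_eq_iff_eq_add] at h
    rw [h, symp_swap z v, map_smul]
    push_cast
    module
  have := congrArg (fun w => -I • w) h2
  simpa [smul_smul] using this

lemma gen_eq_dirDeriv {V : Q → H} (hV : S.SmoothFam V) (v : Phase d) (q : Q) : S.gen v (V q) = -I •
      𝜕 (0, v) (fun p : Q × Phase d => S.shift p.2 (V p.1)) (q, 0) := by
  rw [gen, dirDeriv_slice_right (f := fun p : Q × Phase d => S.shift p.2 (V p.1)) hV q v]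

/-- The formula `dirDeriv_shift_right`, solved for the shifted generator, expresses it through a
derivative of the jointly smooth map `(q, z) ↦ shift z (V q)`. -/
lemma SmoothFam.gen {V : Q → H} (hV : S.SmoothFam V) (v : Phase d) :
    S.SmoothFam fun q => S.gen v (V q) := by
  have h : ∀ p : Q × Phase d, S.shift p.2 (S.gen v (V p.1)) = -I •
      (𝜕 (0, v) (fun p : Q × Phase d => S.shift p.2 (V p.1)) p +
        (I * (symp p.2 v / 2 : ℝ)) • S.shift p.2 (V p.1)) := fun p => by
    have h1 := dirDeriv_shift_right (hV.smoothVec p.1) v p.2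
    rw [congrFun (dirDeriv_slice_right (f := fun p : Q × Phase d => S.shift p.2 (V p.1)) hV p.1 v)
      p.2, eq_sub_iff_add_eq, map_smul] at h1
    change _ = -I • (𝜕 (0, v) (fun p : Q × Phase d => S.shift p.2 (V p.1)) (p.1, p.2) + _)
    rw [h1, smul_smul]
    simp
  unfold SmoothFam
  simp only [h]
  refine contDiff_const.smul ((hV.joint.dirDeriv _).add (ContDiff.smul ?_ hV.joint))
  have : Smooth fun p : Q × Phase d => symp p.2 v / 2 :=
    (((symp.flip v).contDiff (n := ∞)).comp contDiff_snd).div_const 2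
  exact contDiff_const.mul (ofRealCLM.contDiff.comp this)

/-- A generator is a derivative in the additional phase space variable, so the exchange is the
symmetry of mixed partial derivatives. -/
lemma dirDeriv_gen {V : Q → H} (hV : S.SmoothFam V) (v : Phase d) (e q : Q) :
    𝜕 e (fun q => S.gen v (V q)) q = S.gen v (𝜕 e V q) := by
  have hF : Smooth fun p : Q × Phase d => S.shift p.2 (V p.1) := hV
  have h0 : (fun q => S.gen v (V q)) = fun q => -I •
      𝜕 (0, v) (fun p : Q × Phase d => S.shift p.2 (V p.1)) (q, 0) :=
    funext fun q => gen_eq_dirDeriv hV v q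
  have hs : Smooth fun q => 𝜕 (0, v) (fun p : Q × Phase d => S.shift p.2 (V p.1))
      (q, (0 : Phase d)) := (hF.dirDeriv (0, v)).comp (contDiff_id.prodMk contDiff_const)
  rw [h0, dirDeriv_const_smul hs, gen]
  simp only [shift_dirDeriv hV.contDiff]
  rw [dirDeriv_slice_left (hF.dirDeriv (0, v)), dirDeriv_comm hF]
  have h1 : (fun z => 𝜕 e (fun q => S.shift z (V q)) q) = fun z =>
      𝜕 (e, 0) (fun p : Q × Phase d => S.shift p.2 (V p.1)) (q, z) := funext fun z =>
    congrFun (dirDeriv_slice_left (f := fun p : Q × Phase d => S.shift p.2 (V p.1)) hF z e) q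
  rw [h1, dirDeriv_slice_right (hF.dirDeriv (e, 0))]

lemma SmoothVec.add {u v : H} (hu : S.SmoothVec u) (hv : S.SmoothVec v) :
    S.SmoothVec (u + v) := ((hu.const (Q := ℝ)).add hv.const).smoothVec 0

lemma SmoothVec.smul {u} (hu : S.SmoothVec u) (c : ℂ) : S.SmoothVec (c • u) :=
  ((hu.const (Q := ℝ)).smul (c := fun _ => c) contDiff_const).smoothVec 0

lemma SmoothVec.gen {u} (hu : S.SmoothVec u) (v : Phase d) : S.SmoothVec (S.gen v u) :=
  ((hu.const (Q := ℝ)).gen v).smoothVec 0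

lemma SmoothVec.shift {u} (hu : S.SmoothVec u) (z : Phase d) : S.SmoothVec (S.shift z u) :=
  ((hu.const (Q := ℝ)).shift (f := fun _ => z) contDiff_const).smoothVec 0

lemma SmoothVec.neg {u} (hu : S.SmoothVec u) : S.SmoothVec (-u) := by simpa using hu.smul (-1)

variable (S) in
lemma smoothVec_vac : S.SmoothVec S.vac := S.smooth_vac

lemma gen_add {u w : H} (hu : S.SmoothVec u) (hw : S.SmoothVec w) (v : Phase d) :
    S.gen v (u + w) = S.gen v u + S.gen v w := by
  simp only [gen, map_add]
  rw [dirDeriv_add hu hw, smul_add]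

lemma gen_smul {u} (hu : S.SmoothVec u) (c : ℂ) (v : Phase d) :
    S.gen v (c • u) = c • S.gen v u := by
  simp only [gen, map_smul]
  rw [dirDeriv_const_smul hu, smul_comm]

lemma gen_neg {u} (hu : S.SmoothVec u) (v : Phase d) : S.gen v (-u) = -S.gen v u := by
  simpa using gen_smul hu (-1) v

lemma gen_sub {u w : H} (hu : S.SmoothVec u) (hw : S.SmoothVec w) (v : Phase d) :
    S.gen v (u - w) = S.gen v u - S.gen v w := by
  rw [sub_eq_add_neg, gen_add hu hw.neg, gen_neg hw, sub_eq_add_neg]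

variable (S) in
lemma gen_add_vec (v w : Phase d) (u : H) : S.gen (v + w) u = S.gen v u + S.gen w u := by
  simp only [gen, dirDeriv_add_vec, smul_add]

variable (S) in
lemma gen_smul_vec (c : ℝ) (v : Phase d) (u : H) : S.gen (c • v) u = (c : ℂ) • S.gen v u := by
  simp only [gen, dirDeriv_smul_vec]
  rw [smul_comm, ← coe_smul]

variable (S) in
lemma gen_eq_sum (v : Phase d) (u : H) :
    S.gen v u = ∑ j, (phaseCoord j v : ℂ) • S.gen (phaseVec j) u := by
  have h : ∀ s : Finset (PhaseIndex d), S.gen (∑ j ∈ s, phaseCoord j v • phaseVec j) u =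
      ∑ j ∈ s, (phaseCoord j v : ℂ) • S.gen (phaseVec j) u := by
    intro s
    induction s using Finset.induction_on with
    | empty => simp [gen, dirDeriv]
    | insert j s hj ih => rw [sum_insert hj, sum_insert hj, gen_add_vec, ih, gen_smul_vec]
  rw [← h, sum_phaseCoord]

/-- The canonical commutation relations, obtained by differentiating `gen_shift` in `z` at the
origin. -/
lemma gen_gen_sub {u} (hu : S.SmoothVec u) (v w : Phase d) :
    S.gen v (S.gen w u) - S.gen w (S.gen v u) = -(I * (symp v w : ℂ)) • u := by
  have h1 := dirDeriv_gen hu.shift_fam w v 0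
  simp only [gen_shift hu] at h1
  have h2 : Smooth fun z : Phase d => 𝕔(symp w z) := ofRealCLM.contDiff.comp (symp w).contDiff
  have h3 : 𝜕 v (fun z : Phase d => 𝕔(symp w z)) 0 = (symp w v : ℝ) := by
    have : HasFDerivAt (fun z : Phase d => 𝕔(symp w z))
      (ofRealCLM.comp (symp w)) 0 := (ofRealCLM.comp (symp w)).hasFDerivAt
    rw [this.dirDeriv_eq]; rfl
  have h5 : Smooth fun z : Phase d => 𝕔(symp w z) • S.shift z u := h2.smul hu
  have h6 : Smooth fun z : Phase d => S.shift z (S.gen w u) := hu.gen w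
  have h7 : Smooth fun z : Phase d => S.shift z u := hu
  rw [dirDeriv_add h6 h5, dirDeriv_smul h2 h7] at h1
  simp only [h3, dirDeriv_shift_right hu, dirDeriv_shift_right (hu.gen w), S.shift_zero, map_zero,
    zero_apply, zero_div, Complex.ofReal_zero, mul_zero, zero_smul, sub_zero,
    add_zero, gen_smul (hu.gen v)] at h1
  have h4 := congrArg (fun x => -I • x) h1
  simp only [smul_add, smul_smul, neg_mul, Complex.I_mul_I, neg_neg, one_smul] at h4
  rw [← h4, symp_swap w v]
  push_cast
  module

/-- Unitarity, in the form `⟪shift z u, w⟫ = ⟪u, shift (-z) w⟫`, differentiated at `z = 0`. -/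
lemma inner_gen_left {u w : H} (hu : S.SmoothVec u) (hw : S.SmoothVec w) (v : Phase d) :
    ⟪S.gen v u, w⟫ = ⟪u, S.gen v w⟫ := by
  have h1 : HasFDerivAt (fun z => ⟪S.shift z u, w⟫) _ 0 :=
    ((hu.diff_infty 0).hasFDerivAt.inner ℂ (hasFDerivAt_const w (0 : Phase d)))
  have hw' : Smooth fun z => S.shift (-z) w := ContDiff.comp hw contDiff_neg
  have h2 : HasFDerivAt (fun z => ⟪u, S.shift (-z) w⟫) _ 0 :=
    ((hasFDerivAt_const u (0 : Phase d)).inner ℂ (hw'.diff_infty 0).hasFDerivAt)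
  have h3 : (fun z => ⟪S.shift z u, w⟫) = fun z => ⟪u, S.shift (-z) w⟫ :=
    funext fun z => S.inner_shift_left z u w
  rw [h3] at h1
  have h4 := congrArg (fun T : Phase d →L[ℝ] ℂ => T v) (h1.unique h2)
  have h5 : 𝜕 v (fun z => S.shift (-z) w) 0 = -𝜕 v (fun z => S.shift z w) 0 := by
    have := congrFun (dirDeriv_comp_clm (f := fun z => S.shift z w) hw
      (-ContinuousLinearMap.id ℝ (Phase d)) v) 0
    simp only [neg_apply, id_apply, neg_zero] at this
    rw [this]
    simp [dirDeriv]
  simp [fderivInnerCLM_apply, S.shift_zero] at h4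
  unfold dirDeriv at h5
  rw [h5, inner_neg_right] at h4
  simp only [gen, dirDeriv, inner_smul_left, inner_smul_right, map_neg, Complex.conj_I, neg_neg]
  rw [h4]
  ring

/-! ### The Sobolev scale of a Heisenberg system -/

variable (S)

/-- The squared Sobolev norms of the harmonic oscillator scale. -/
def sob : ℕ → H → ℝ
  | 0, u => ‖u‖ ^ 2
  | k + 1, u => sob k u + ∑ j, sob k (S.gen (phaseVec j) u)

/-- The inner products belonging to `sob`. -/
def sobInner : ℕ → H → H → ℂ
  | 0, u, w => ⟪u, w⟫
  | k + 1, u, w => sobInner k u w + ∑ j, sobInner k (S.gen (phaseVec j) u) (S.gen (phaseVec j) w)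

lemma sob_zero (u : H) : S.sob 0 u = ‖u‖ ^ 2 := rfl

lemma sob_succ (k : ℕ) (u : H) :
    S.sob (k + 1) u = S.sob k u + ∑ j, S.sob k (S.gen (phaseVec j) u) := rfl

lemma sob_nonneg (k : ℕ) (u : H) : 0 ≤ S.sob k u := by
  induction k generalizing u with
  | zero => rw [sob_zero]; positivity
  | succ k ih => exact add_nonneg (ih _) (sum_nonneg fun j _ => ih _)

lemma sob_le_succ (k : ℕ) (u : H) : S.sob k u ≤ S.sob (k + 1) u :=
  le_add_of_nonneg_right (sum_nonneg fun j _ => S.sob_nonneg k _)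

lemma sob_gen_le (k : ℕ) (j : PhaseIndex d) (u : H) :
    S.sob k (S.gen (phaseVec j) u) ≤ S.sob (k + 1) u :=
  (single_le_sum (f := fun j => S.sob k (S.gen (phaseVec j) u))
    (fun j _ => S.sob_nonneg k _) (Finset.mem_univ j)).trans
    (le_add_of_nonneg_left (S.sob_nonneg k u))

variable {S}

lemma sob_smul {u} (hu : S.SmoothVec u) (k : ℕ) (c : ℂ) :
    S.sob k (c • u) = ‖c‖ ^ 2 * S.sob k u := by
  induction k generalizing u with
  | zero => simp only [sob_zero, norm_smul, mul_pow]
  | succ k ih =>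
    simp only [sob_succ, gen_smul hu, ih hu, fun j => ih (hu.gen (phaseVec j)), mul_add, mul_sum]

lemma sob_add_le {u w : H} (hu : S.SmoothVec u) (hw : S.SmoothVec w) (k : ℕ) :
    S.sob k (u + w) ≤ 2 * S.sob k u + 2 * S.sob k w := by
  induction k generalizing u w with
  | zero =>
    simp only [sob_zero]
    nlinarith [norm_add_le u w, norm_nonneg (u + w), sq_nonneg (‖u‖ - ‖w‖), norm_nonneg u,
      norm_nonneg w, pow_le_pow_left₀ (norm_nonneg (u + w)) (norm_add_le u w) 2]
  | succ k ih =>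
    simp only [sob_succ, gen_add hu hw]
    have h := sum_le_sum fun j (_ : j ∈ univ) =>
      ih (hu.gen (phaseVec j)) (hw.gen (phaseVec j))
    rw [sum_add_distrib, ← mul_sum, ← mul_sum] at h
    linarith [ih hu hw]

lemma sobInner_add_right {u v w : H} (hv : S.SmoothVec v) (hw : S.SmoothVec w) (k : ℕ) :
    S.sobInner k u (v + w) = S.sobInner k u v + S.sobInner k u w := by
  induction k generalizing u v w with
  | zero => exact inner_add_right _ _ _
  | succ k ih =>
    simp only [sobInner, gen_add hv hw, ih hv hw,
      fun j => ih (u := S.gen (phaseVec j) u) (hv.gen (phaseVec j)) (hw.gen (phaseVec j)),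
      sum_add_distrib]
    ring

/-- Young's inequality at each level. The weight `δ` stays free because the energy estimate later
chooses it as the size of the second derivatives of the Hamiltonian. -/
lemma abs_re_sobInner_le (u w : H) (k : ℕ) {δ : ℝ} (hδ : 0 < δ) :
    |(S.sobInner k u w).re| ≤ (δ * S.sob k u + δ⁻¹ * S.sob k w) / 2 := by
  induction k generalizing u w with
  | zero =>
    have h1 : |(⟪u, w⟫).re| ≤ ‖u‖ * ‖w‖ := (Complex.abs_re_le_norm _).trans (norm_inner_le_norm u w)
    have h2 : 2 * (‖u‖ * ‖w‖) ≤ δ * ‖u‖ ^ 2 + δ⁻¹ * ‖w‖ ^ 2 := by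
      have h3 : 0 ≤ δ⁻¹ * (δ * ‖u‖ - ‖w‖) ^ 2 := by positivity
      have h4 : δ⁻¹ * (δ * ‖u‖ - ‖w‖) ^ 2 = δ * ‖u‖ ^ 2 + δ⁻¹ * ‖w‖ ^ 2 - 2 * (‖u‖ * ‖w‖) := by
        field_simp; ring
      linarith
    simp only [sobInner, sob_zero]
    linarith
  | succ k ih =>
    simp only [sobInner, sob_succ, add_re, re_sum]
    refine (abs_add_le _ _).trans ((add_le_add (ih _ _) ((abs_sum_le_sum_abs _ _).trans
      (sum_le_sum fun j _ => ih _ _))).trans (le_of_eq ?_))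
    rw [← Finset.sum_div, sum_add_distrib, ← mul_sum, ← mul_sum]
    ring

lemma hasDerivAt_sob {V : ℝ → H} (hV : S.SmoothFam V) (k : ℕ) (t : ℝ) :
    HasDerivAt (fun t => S.sob k (V t)) (2 * (S.sobInner k (V t) (𝜕 1 V t)).re) t := by
  induction k generalizing V with
  | zero =>
    have h1 : HasDerivAt V (𝜕 1 V t) t := (hV.contDiff.diff_infty t).hasFDerivAt.hasDerivAt
    letI : InnerProductSpace ℝ H := InnerProductSpace.rclikeToReal ℂ H
    have h2 := h1.norm_sq
    exact h2
  | succ k ih =>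
    have h := (ih hV).add (HasDerivAt.fun_sum fun j (_ : j ∈ univ) =>
      ih (hV.gen (phaseVec j)))
    refine h.congr_deriv ?_
    simp only [sobInner, add_re, re_sum, mul_add, mul_sum, dirDeriv_gen hV]

end HeisenbergSystem

/-! ### Gaussian Schwartz functions -/

lemma exists_pow_mul_exp_neg_le {c : ℝ} (hc : 0 < c) (m : ℕ) :
    ∃ C, 0 ≤ C ∧ ∀ r : ℝ, 0 ≤ r → (1 + r) ^ m * exp (-(c * r ^ 2)) ≤ C := by
  refine ⟨2 ^ m * (m.factorial * (c⁻¹) ^ m * exp c), by positivity, fun r hr => ?_⟩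
  have h1 : (1 + r) ^ m ≤ (2 * (1 + r ^ 2)) ^ m := by
    refine pow_le_pow_left₀ (by positivity) ?_ m
    nlinarith [sq_nonneg (r - 1), sq_nonneg r]
  have h2 := Real.pow_div_factorial_le_exp (c * (1 + r ^ 2)) (by positivity) m
  rw [div_le_iff₀ (by positivity), mul_add, mul_one, Real.exp_add] at h2
  have h3 : (2 * (1 + r ^ 2)) ^ m = 2 ^ m * ((c⁻¹) ^ m * (c + c * r ^ 2) ^ m) := by
    rw [← mul_pow, ← mul_pow]
    congr 1
    field_simp
  rw [Real.exp_neg, ← div_eq_mul_inv, div_le_iff₀ (Real.exp_pos _)]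
  refine h1.trans ?_
  rw [h3]
  calc 2 ^ m * ((c⁻¹) ^ m * (c + c * r ^ 2) ^ m)
      ≤ 2 ^ m * ((c⁻¹) ^ m * (exp c * exp (c * r ^ 2) * m.factorial)) := by gcongr
    _ = _ := by ring

/-- Only the first two derivatives are nonzero. The bound has the shape `D ^ i` that is required by
the estimate for derivatives of a composition. -/
lemma norm_iteratedFDeriv_quadratic_le (B : E →L[ℝ] E →L[ℝ] ℝ) (x : E) {i : ℕ} (hi : 1 ≤ i) :
    ‖iteratedFDeriv ℝ i (fun x => B x x) x‖ ≤ (1 + ‖B + B.flip‖ * (1 + ‖x‖)) ^ i := by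
  set L := B + B.flip with hL
  have h1 : fderiv ℝ (fun x => B x x) = fun x => L x := by
    funext x
    have h := (B.hasFDerivAt (x := x)).clm_apply (hasFDerivAt_id x)
    refine h.fderiv.trans ?_
    ext v
    simp [hL]
  have hD : 1 ≤ 1 + ‖L‖ * (1 + ‖x‖) := le_add_of_nonneg_right (by positivity)
  obtain ⟨i, rfl⟩ : ∃ k, i = k + 1 := ⟨i - 1, by omega⟩
  refine le_trans ?_ (le_self_pow₀ hD (by omega))
  rw [← norm_iteratedFDeriv_fderiv, h1]
  rcases i with _ | i
  · rw [norm_iteratedFDeriv_zero]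
    refine (L.le_opNorm x).trans ?_
    nlinarith [norm_nonneg L, norm_nonneg x]
  · rw [← norm_iteratedFDeriv_fderiv]
    have h2 : fderiv ℝ (fun x => L x) = fun _ => L := by funext x; exact L.fderiv
    rw [h2]
    rcases i with _ | i
    · rw [norm_iteratedFDeriv_zero]
      nlinarith [norm_nonneg L, norm_nonneg x]
    · rw [iteratedFDeriv_const_of_ne (by omega)]
      simp only [Pi.zero_apply, norm_zero]
      positivity

lemma norm_iteratedFDeriv_exp_neg (i : ℕ) (t : ℝ) :
    ‖iteratedFDeriv ℝ i (fun t : ℝ => exp (-t)) t‖ = exp (-t) := by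
  rw [norm_iteratedFDeriv_eq_norm_iteratedDeriv]
  have h : iteratedDeriv i (fun t : ℝ => exp (-t)) t = (-1) ^ i * exp (-t) := by
    rw [iteratedDeriv_comp_neg, iteratedDeriv_eq_iterate, Real.iter_deriv_exp, smul_eq_mul]
  rw [h]
  simp

/-- The Gaussian `e^{-B(x,x)}` of a positive definite quadratic form. -/
def gaussSchwartz (B : E →L[ℝ] E →L[ℝ] ℝ) {c : ℝ} (hc : 0 < c)
    (hB : ∀ x, c * ‖x‖ ^ 2 ≤ B x x) : 𝓢(E, ℝ) where
  toFun x := exp (-(B x x))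
  smooth' := by
    have h : Smooth fun x => B x x := B.contDiff.clm_apply contDiff_id
    exact h.neg.exp
  decay' k n := by
    obtain ⟨C, hC0, hC⟩ := exists_pow_mul_exp_neg_le hc (k + n)
    refine ⟨n.factorial * (1 + ‖B + B.flip‖) ^ n * C, fun x => ?_⟩
    have hq : Smooth fun x => B x x := B.contDiff.clm_apply contDiff_id
    have hg : Smooth fun t : ℝ => exp (-t) := contDiff_id.neg.exp
    have h := norm_iteratedFDeriv_comp_le hg hq (n := n) (by exact_mod_cast le_top) x
      (C := exp (-(B x x))) (D := 1 + ‖B + B.flip‖ * (1 + ‖x‖))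
      (fun i _ => (norm_iteratedFDeriv_exp_neg i _).le)
      (fun i hi _ => norm_iteratedFDeriv_quadratic_le B x hi)
    have h2 : 1 + ‖B + B.flip‖ * (1 + ‖x‖) ≤ (1 + ‖B + B.flip‖) * (1 + ‖x‖) := by
      nlinarith [norm_nonneg x]
    have h3 := hC ‖x‖ (norm_nonneg x)
    calc ‖x‖ ^ k * ‖iteratedFDeriv ℝ n (fun x => exp (-(B x x))) x‖
        ≤ (1 + ‖x‖) ^ k * (n.factorial * exp (-(c * ‖x‖ ^ 2)) *
          ((1 + ‖B + B.flip‖) * (1 + ‖x‖)) ^ n) := by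
          gcongr
          · linarith
          · refine h.trans ?_
            gcongr
            exact hB x
      _ = n.factorial * (1 + ‖B + B.flip‖) ^ n *
          ((1 + ‖x‖) ^ (k + n) * exp (-(c * ‖x‖ ^ 2))) := by
          rw [mul_pow, pow_add]; ring
      _ ≤ _ := by gcongr

@[simp] lemma gaussSchwartz_apply (B : E →L[ℝ] E →L[ℝ] ℝ) {c : ℝ} (hc : 0 < c)
    (hB : ∀ x, c * ‖x‖ ^ 2 ≤ B x x) (x : E) :
    gaussSchwartz B hc hB x = exp (-(B x x)) := rfl

lemma SchwartzMap.exists_eq_derivs (f : 𝓢(E, F)) (l : List E) : ∃ g : 𝓢(E, F), ⇑g = derivs l f := by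
  induction l with
  | nil => exact ⟨f, rfl⟩
  | cons v l ih =>
    obtain ⟨g, hg⟩ := ih
    refine ⟨LineDeriv.lineDerivOp v g, ?_⟩
    rw [derivs_cons, ← hg]
    funext x
    exact SchwartzMap.lineDerivOp_apply_eq_fderiv v g x

lemma SchwartzMap.exists_one_add_pow_mul_norm_le (f : 𝓢(E, F)) (m : ℕ) :
    ∃ C, 0 ≤ C ∧ ∀ x, (1 + ‖x‖) ^ m * ‖f x‖ ≤ C := by
  refine ⟨2 ^ m * (Finset.Iic (m, 0)).sup (fun m => SchwartzMap.seminorm ℝ m.1 m.2) f,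
    by positivity, fun x => ?_⟩
  have h := SchwartzMap.one_add_le_sup_seminorm_apply (𝕜 := ℝ) (m := (m, 0)) (k := m) (n := 0)
    le_rfl le_rfl f x
  simpa [norm_iteratedFDeriv_zero] using h

/-! ### Derivatives along words in a family of directions -/

section Words

lemma derivs_sum {s : Finset ι} {f : ι → E → F} (hf : ∀ i, Smooth (f i)) (l : List E) :
    derivs l (fun x => ∑ i ∈ s, f i x) = fun x => ∑ i ∈ s, derivs l (f i) x := by
  induction l with
  | nil => rfl
  | cons v l ih =>
    simp only [derivs_cons, ih]
    exact dirDeriv_sum (fun i => (hf i).derivs l) v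

lemma norm_derivs_smul_le {𝕜 : Type*} [NontriviallyNormedField 𝕜] [NormedAlgebra ℝ 𝕜]
    [NormedSpace 𝕜 F] [IsScalarTower ℝ 𝕜 F] (b : ι → E) (x : E) (l : List ι) {f : E → 𝕜}
    {g : E → F} (hf : Smooth f) (hg : Smooth g) {A B : ℝ}
    (hA : ∀ l' : List ι, l'.length ≤ l.length → ‖derivs (l'.map b) f x‖ ≤ A)
    (hB : ∀ l' : List ι, l'.length ≤ l.length → ‖derivs (l'.map b) g x‖ ≤ B) :
    ‖derivs (l.map b) (fun y => f y • g y) x‖ ≤ 2 ^ l.length * (A * B) := by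
  -- The innermost derivative is removed first, so that the product rule yields two products of the
  -- same kind with a shorter word; each derivative costs a factor two.
  induction l using List.reverseRecOn generalizing f g with
  | nil =>
    have h1 := hA [] le_rfl
    have h2 := hB [] le_rfl
    simp only [List.map_nil, derivs_nil] at h1 h2 ⊢
    simp only [List.length_nil, pow_zero, one_mul, norm_smul]
    exact mul_le_mul h1 h2 (norm_nonneg _) ((norm_nonneg _).trans h1)
  | append_singleton l j ih =>
    rw [length_append, List.length_singleton] at hA hB ⊢
    have e (h : E → F) : derivs ((l ++ [j]).map b) h = derivs (l.map b) (𝜕 (b j) h) := by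
      rw [map_append, derivs_append]; rfl
    have h1 := ih (hf.dirDeriv (b j)) hg (fun l' hl' => by
        have := hA (l' ++ [j]) (by simpa using hl')
        rwa [map_append, derivs_append] at this)
      (fun l' hl' => hB l' (by omega))
    have h2 := ih hf (hg.dirDeriv (b j)) (fun l' hl' => hA l' (by omega)) (fun l' hl' => by
        have := hB (l' ++ [j]) (by simpa using hl')
        rwa [map_append, derivs_append] at this)
    have h3 : Smooth fun y => 𝜕 (b j) f y • g y := (hf.dirDeriv _).smul hg
    have h4 : Smooth fun y => f y • 𝜕 (b j) g y := hf.smul (hg.dirDeriv _)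
    rw [e, dirDeriv_smul hf hg, derivs_add h3 h4]
    refine (norm_add_le _ _).trans ?_
    rw [pow_succ]
    linarith

/-- The oscillatory integral `∫ e^{i τ(w)} F(w) dw`. -/
def oscInt [MeasureSpace E] (F : E → ℂ) (τ : E →L[ℝ] ℝ) : ℂ := ∫ w, expI (τ w) * F w

variable [FiniteDimensional ℝ E] [MeasureSpace E] [BorelSpace E]
  [(volume : Measure E).IsAddHaarMeasure]

lemma integrable_expI_mul {F : E → ℂ} (hF : Integrable F) (τ : E →L[ℝ] ℝ) :
    Integrable fun w => expI (τ w) * F w := by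
  refine hF.bdd_mul (c := 1) ?_ (.of_forall fun w => (norm_expI _).le)
  exact (contDiff_expI.continuous.comp τ.continuous).aestronglyMeasurable

lemma norm_oscInt_le (F : E → ℂ) (τ : E →L[ℝ] ℝ) : ‖oscInt F τ‖ ≤ ∫ w, ‖F w‖ := by
  refine (norm_integral_le_integral_norm _).trans_eq ?_
  simp

lemma oscInt_dirDeriv {F : E → ℂ} (hF : Smooth F) (τ : E →L[ℝ] ℝ) (v : E)
    (h0 : Integrable F) (h1 : Integrable (𝜕 v F)) :
    oscInt (𝜕 v F) τ = -(I * τ v) * oscInt F τ := by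
  have he : Smooth fun w => expI (τ w) := contDiff_expI.comp τ.contDiff
  have hd : 𝜕 v (fun w => expI (τ w)) = fun w => I * τ v * expI (τ w) := by
    rw [dirDeriv_expI τ.contDiff]
    funext w
    simp [dirDeriv]
  have h := integral_mul_fderiv_eq_neg_fderiv_mul_of_integrable (𝕜 := ℂ) (μ := (volume : Measure E))
    (f := fun w => expI (τ w)) (g := F) (v := v) ?_ ?_ ?_
    (fun x _ => he.diff_infty x) (fun x _ => hF.diff_infty x)
  · have h2 : (fun w => fderiv ℝ (fun w => expI (τ w)) w v * F w) = fun w =>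
        I * τ v * (expI (τ w) * F w) := by
      funext w
      have := congrFun hd w
      unfold dirDeriv at this
      rw [this]; ring
    rw [h2, integral_const_mul] at h
    unfold oscInt
    rw [neg_mul]
    exact h
  · have h2 : (fun w => fderiv ℝ (fun w => expI (τ w)) w v * F w) = fun w =>
        I * τ v * (expI (τ w) * F w) := by
      funext w
      have := congrFun hd w
      unfold dirDeriv at this
      rw [this]; ring
    rw [h2]
    exact (integrable_expI_mul h0 τ).const_mul _
  · exact integrable_expI_mul h1 τ
  · exact integrable_expI_mul h0 τ

/-- `F - Σ_j ∂_j ∂_j F`. -/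
def oneSubLaplace [Fintype ι] (b : ι → E) (F : E → ℂ) : E → ℂ :=
  fun w => F w - ∑ j, 𝜕 (b j) (𝜕 (b j) F) w

lemma contDiff_oneSubLaplace [Fintype ι] (b : ι → E) {F : E → ℂ} (hF : Smooth F) :
    Smooth (oneSubLaplace b F) :=
  hF.sub (ContDiff.sum fun j _ => (hF.dirDeriv _).dirDeriv _)

lemma oscInt_oneSubLaplace [Fintype ι] (b : ι → E) {F : E → ℂ} (hF : Smooth F)
    (τ : E →L[ℝ] ℝ) (h : ∀ l : List ι, l.length ≤ 2 → Integrable (derivs (l.map b) F)) :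
    oscInt (oneSubLaplace b F) τ = 𝕔(1 + ∑ j, τ (b j) ^ 2) * oscInt F τ := by
  have h0 : Integrable F := h [] (by simp)
  have h1 (j : ι) : Integrable (𝜕 (b j) F) := h [j] (by simp)
  have h2 (j : ι) : Integrable (𝜕 (b j) (𝜕 (b j) F)) := h [j, j] (by simp)
  have h3 (j : ι) : oscInt (𝜕 (b j) (𝜕 (b j) F)) τ = -(τ (b j) : ℂ) ^ 2 * oscInt F τ := by
    rw [oscInt_dirDeriv (hF.dirDeriv _) τ _ (h1 j) (h2 j), oscInt_dirDeriv hF τ _ h0 (h1 j)]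
    linear_combination (τ (b j) : ℂ) ^ 2 * oscInt F τ * Complex.I_mul_I
  have h4 : oscInt (oneSubLaplace b F) τ = oscInt F τ - ∑ j, oscInt (𝜕 (b j) (𝜕 (b j) F)) τ := by
    unfold oscInt oneSubLaplace
    simp only [mul_sub, mul_sum]
    rw [integral_sub (integrable_expI_mul h0 τ)
      (integrable_finsetSum _ fun j _ => integrable_expI_mul (h2 j) τ),
      integral_finsetSum _ fun j _ => integrable_expI_mul (h2 j) τ]
  rw [h4]
  simp only [h3]
  push_cast
  rw [← sum_mul, sum_neg_distrib]
  ring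

/-- Non-stationary phase: `oscInt_oneSubLaplace` turns each application of `1 - Σ ∂_j²` to the
amplitude into a factor `1 + Σ τ(b_j)²`. Each application uses up two derivatives and enlarges the
majorant by the number of terms, `1 + card ι`. -/
lemma norm_oscInt_le_of_derivs [Fintype ι] (b : ι → E) (τ : E →L[ℝ] ℝ) (N : ℕ) {F : E → ℂ}
    (hF : Smooth F) {g : E → ℝ} (hg : Integrable g)
    (h : ∀ l : List ι, l.length ≤ 2 * N → ∀ w, ‖derivs (l.map b) F w‖ ≤ g w) :
    (1 + ∑ j, τ (b j) ^ 2) ^ N * ‖oscInt F τ‖ ≤ (1 + card ι) ^ N * ∫ w, g w := by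
  induction N generalizing F g with
  | zero =>
    simp only [pow_zero, one_mul]
    refine (norm_oscInt_le F τ).trans (integral_mono_of_nonneg (.of_forall fun w => norm_nonneg _)
      hg (.of_forall fun w => h [] (by simp) w))
  | succ N ih =>
    have hi (l : List ι) (hl : l.length ≤ 2 * (N + 1)) : Integrable (derivs (l.map b) F) :=
      hg.mono' (hF.derivs _).continuous.aestronglyMeasurable (.of_forall (h l hl))
    have h1 := ih (contDiff_oneSubLaplace b hF) (g := fun w => (1 + card ι) * g w)
      (hg.const_mul _) (fun l hl w => by
        have e : derivs (l.map b) (oneSubLaplace b F) = fun w => derivs (l.map b) F w -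
            ∑ j, derivs ((l ++ [j, j]).map b) F w := by
          unfold oneSubLaplace
          rw [derivs_sub hF (ContDiff.sum fun j _ => (hF.dirDeriv _).dirDeriv _)]
          funext w
          congr 1
          rw [derivs_sum fun j => (hF.dirDeriv _).dirDeriv _]
          refine sum_congr rfl fun j _ => ?_
          rw [map_append, derivs_append]
          rfl
        rw [e]
        refine (norm_sub_le _ _).trans ?_
        rw [add_mul, one_mul]
        refine add_le_add (h l (by omega) w) ((norm_sum_le _ _).trans ?_)
        refine (sum_le_sum fun j _ => h (l ++ [j, j]) (by simp; omega) w).trans_eq ?_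
        simp)
    rw [oscInt_oneSubLaplace b hF τ fun l hl => hi l (by omega), norm_mul, norm_real,
      norm_of_nonneg (by positivity), integral_const_mul] at h1
    rw [pow_succ, pow_succ, mul_assoc, mul_assoc]
    exact h1

end Words

/-! ### The kernel of a Weyl operator in the coherent state representation -/

instance : (volume : Measure (Phase d)).IsAddHaarMeasure :=
  Measure.prod.instIsAddHaarMeasure (volume : Measure (Space d)) (volume : Measure (Space d))

/-- The standard inner product of phase space, as a bilinear form. -/
def phaseInner : Phase d →L[ℝ] Phase d →L[ℝ] ℝ := (innerSL ℝ).bilinearComp (fst ℝ _ _) (fst ℝ _ _) +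
    (innerSL ℝ).bilinearComp (snd ℝ _ _) (snd ℝ _ _)

lemma phaseInner_self (z : Phase d) : phaseInner z z = ‖z.1‖ ^ 2 + ‖z.2‖ ^ 2 := by
  rw [← real_inner_self_eq_norm_sq, ← real_inner_self_eq_norm_sq]
  rfl

lemma sq_norm_le_phaseInner (z : Phase d) : 1 * ‖z‖ ^ 2 ≤ phaseInner z z := by
  rw [phaseInner_self, one_mul, Prod.norm_def]
  rcases max_cases ‖z.1‖ ‖z.2‖ with h | h <;> rw [h.1] <;> nlinarith [norm_nonneg z.1, norm_nonneg z.2]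

/-- The Gaussian `e^{-|z|²}` on phase space. -/
def phaseGauss : 𝓢(Phase d, ℝ) := gaussSchwartz phaseInner one_pos sq_norm_le_phaseInner

lemma phaseGauss_apply (z : Phase d) : phaseGauss z = exp (-(‖z.1‖ ^ 2 + ‖z.2‖ ^ 2)) := by
  rw [phaseGauss, gaussSchwartz_apply, phaseInner_self]

lemma phaseGauss_nonneg (z : Phase d) : 0 ≤ phaseGauss z := by rw [phaseGauss_apply]; positivity

/-- The number of derivatives of a symbol which control the norm of its quantization. -/
abbrev symbolOrder (d : ℕ) : ℕ := 2 * (2 * d + 2)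

/-- Symbols whose derivatives up to a fixed order are bounded by `M (1 + |z|)^θ`. -/
structure SymbolBound (θ : ℕ) (M : ℝ) (c : Phase d → ℝ) : Prop where
  smooth : Smooth c
  bound : ∀ l : List (PhaseIndex d), l.length ≤ symbolOrder d → ∀ z,
    |derivs (l.map phaseVec) c z| ≤ M * (1 + ‖z‖) ^ θ

lemma SymbolBound.abs_le {θ : ℕ} {c : Phase d → ℝ} (hc : SymbolBound θ M c)
    (z : Phase d) : |c z| ≤ M * (1 + ‖z‖) ^ θ := hc.bound [] (by simp) z

lemma SymbolBound.nonneg {θ : ℕ} {c : Phase d → ℝ} (hc : SymbolBound θ M c) : 0 ≤ M := by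
  have := (abs_nonneg _).trans (hc.abs_le 0)
  simpa using this

lemma SymbolBound.add {θ : ℕ} {M N : ℝ} {c e : Phase d → ℝ} (hc : SymbolBound θ M c)
    (he : SymbolBound θ N e) : SymbolBound θ (M + N) (fun z => c z + e z) where
  smooth := hc.smooth.add he.smooth
  bound l hl z := by
    rw [derivs_add hc.smooth he.smooth, add_mul]
    exact (abs_add_le _ _).trans (add_le_add (hc.bound l hl z) (he.bound l hl z))

lemma SymbolBound.const_mul {θ : ℕ} {c : Phase d → ℝ} (hc : SymbolBound θ M c)
    (r : ℝ) : SymbolBound θ (|r| * M) (fun z => r * c z) where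
  smooth := contDiff_const.mul hc.smooth
  bound l hl z := by
    have := congrFun (derivs_const_smul hc.smooth r (l.map phaseVec)) z
    simp only [smul_eq_mul] at this
    rw [this, abs_mul, mul_assoc]
    exact mul_le_mul_of_nonneg_left (hc.bound l hl z) (abs_nonneg r)

lemma SymbolBound.translate {c : Phase d → ℝ} (hc : SymbolBound 0 M c) (a : Phase d) :
    SymbolBound 0 M (fun z => c (z + a)) where
  smooth := hc.smooth.comp (contDiff_id.add contDiff_const)
  bound l hl z := by
    rw [derivs_comp_add]
    simpa using hc.bound l hl (z + a)

lemma symbolBound_const (r : ℝ) : SymbolBound 0 |r| (fun _ : Phase d => r) where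
  smooth := contDiff_const
  bound l _ z := by
    have h : ∀ l : List (Phase d), l ≠ [] → derivs l (fun _ : Phase d => r) = fun _ => 0 := by
      intro l hl
      induction l with
      | nil => exact absurd rfl hl
      | cons v l ih =>
        rw [derivs_cons]
        by_cases h : l = []
        · subst h; exact dirDeriv_const r v
        · rw [ih h, dirDeriv_const]
    by_cases hl : l = []
    · subst hl; simp
    · rw [h _ (by simpa using hl)]; simp

/-- `∫ c((q' + q)/2 + w) e^{i σ(w, q' - q)} e^{-|w|²} dw`. -/
def opKernelInt (c : Phase d → ℝ) (q' q : Phase d) : ℂ :=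
  ∫ w : Phase d, expI (symp w (q' - q)) * 𝕔(c (½ • (q' + q) + w) * phaseGauss w)

/-- The coherent state matrix coefficients of the Weyl quantization of `c`. -/
def opKernel (c : Phase d → ℝ) (q' q : Phase d) : ℂ :=
  ((π ^ d)⁻¹ : ℝ) * (expI (-(symp q' q / 2)) * opKernelInt c q' q)

lemma integrable_symbol_mul_phaseGauss {c : Phase d → ℝ} (hc : SymbolBound 0 M c)
    (m : Phase d) : Integrable fun w => 𝕔(c (m + w) * phaseGauss w) := by
  refine Integrable.ofReal ?_
  refine (SchwartzMap.integrable phaseGauss).bdd_mul (c := M) ?_ (.of_forall fun w => ?_)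
  · exact (hc.smooth.continuous.comp (continuous_const.add continuous_id)).aestronglyMeasurable
  · simpa using hc.abs_le (m + w)

lemma integrable_opKernelInt {c : Phase d → ℝ} (hc : SymbolBound 0 M c) (m y : Phase d) :
    Integrable fun w => expI (symp w y) * 𝕔(c (m + w) * phaseGauss w) :=
  integrable_expI_mul (integrable_symbol_mul_phaseGauss hc m) (symp.flip y)

lemma continuous_opKernel {c : Phase d → ℝ} (hc : SymbolBound 0 M c) :
    Continuous fun p : Phase d × Phase d => opKernel c p.1 p.2 := by
  have h1 : Continuous fun p : Phase d × Phase d => expI (-(symp p.1 p.2 / 2)) := by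
    have : Continuous fun p : Phase d × Phase d => -(symp p.1 p.2 / 2) :=
      (((symp (d := d)).continuous.comp continuous_fst).clm_apply continuous_snd).div_const 2 |>.neg
    exact contDiff_expI.continuous.comp this
  refine continuous_const.mul (h1.mul ?_)
  refine continuous_of_dominated (bound := fun w => M * phaseGauss w) (fun p => ?_) (fun p => ?_)
    ((SchwartzMap.integrable phaseGauss).const_mul M) (.of_forall fun w => ?_)
  · exact (integrable_opKernelInt hc _ _).aestronglyMeasurable
  · refine .of_forall fun w => ?_
    rw [norm_mul, norm_expI, one_mul, norm_real, norm_mul, norm_of_nonneg (phaseGauss_nonneg w)]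
    refine mul_le_mul_of_nonneg_right ?_ (phaseGauss_nonneg w)
    simpa using hc.abs_le (½ • (p.1 + p.2) + w)
  · have h2 : Continuous fun p : Phase d × Phase d => expI (symp w (p.1 - p.2)) :=
      contDiff_expI.continuous.comp ((symp w).continuous.comp (continuous_fst.sub continuous_snd))
    have h4 : Continuous fun p : Phase d × Phase d => ½ • (p.1 + p.2) + w := by fun_prop
    have h3 : Continuous fun p : Phase d × Phase d => c (½ • (p.1 + p.2) + w) :=
      hc.smooth.continuous.comp h4
    exact h2.mul (continuous_ofReal.comp (h3.mul continuous_const))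

lemma sum_symp_phaseVec_sq (y : Phase d) :
    ∑ j, symp (phaseVec j) y ^ 2 = ‖y.1‖ ^ 2 + ‖y.2‖ ^ 2 := by
  rw [Fintype.sum_sum_type, norm_sq_eq, norm_sq_eq, add_comm]
  congr 1 <;> refine sum_congr rfl fun i _ => ?_ <;>
    simp [symp_apply, phaseVec, stdVec, inner_single_left]

/-- The integral oscillates with frequency `symp · y`, where `y = q' - q`. Integrating by parts `2d
+ 2` times gains `(1 + ‖y‖) ^ (4d + 4)`. One power is spent on comparing the growth of the symbol at
the midpoint with the growth at `q`; the remaining `4d + 3` exceed the dimension `2d`. -/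
lemma exists_norm_opKernel_le (d : ℕ) : ∃ C, 0 ≤ C ∧ ∀ (θ : ℕ) (M : ℝ) (c : Phase d → ℝ),
    θ ≤ 1 → SymbolBound θ M c → ∀ q' q,
      ‖opKernel c q' q‖ ≤ C * M * (1 + ‖q‖) ^ θ * ((1 + ‖q' - q‖) ^ (4 * d + 3))⁻¹ := by
  -- Of these `2d + 2` powers, one absorbs the growth `(1 + ‖w‖) ^ θ` with `θ ≤ 1`, and `2d + 1`
  -- remain for integrability in `w`.
  have hG : ∃ G, 0 ≤ G ∧ ∀ l : List (PhaseIndex d), l.length ≤ symbolOrder d → ∀ w,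
      (1 + ‖w‖) ^ (2 * d + 2) * |derivs (l.map phaseVec) phaseGauss w| ≤ G := by
    have h1 : ∀ l : List (PhaseIndex d), ∃ G, 0 ≤ G ∧ ∀ w,
        (1 + ‖w‖) ^ (2 * d + 2) * |derivs (l.map phaseVec) phaseGauss w| ≤ G := fun l => by
      obtain ⟨g, hg⟩ := SchwartzMap.exists_eq_derivs (phaseGauss (d := d)) (l.map phaseVec)
      obtain ⟨G, hG0, hG⟩ := SchwartzMap.exists_one_add_pow_mul_norm_le g (2 * d + 2)
      exact ⟨G, hG0, fun w => by rw [← hg]; exact hG w⟩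
    choose G hG0 hG using h1
    -- There are finitely many words of bounded length over a finite alphabet, so the separate
    -- bounds can be summed into a single one.
    have hfin : {l : List (PhaseIndex d) | l.length ≤ symbolOrder d}.Finite := finite_length_le _ _
    refine ⟨∑ l ∈ hfin.toFinset, G l, sum_nonneg fun l _ => hG0 l, fun l hl w => ?_⟩
    exact (hG l w).trans (single_le_sum (fun l _ => hG0 l) (by simpa using hl))
  obtain ⟨G, hG0, hG⟩ := hG
  have hr : Integrable fun w : Phase d => ((1 + ‖w‖) ^ (2 * d + 1))⁻¹ := by
    have := integrable_one_add_norm (E := Phase d) (μ := volume) (r := ((2 * d + 1 : ℕ) : ℝ))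
      (by simp; linarith)
    refine this.congr (.of_forall fun w => ?_)
    simp only [rpow_neg (by positivity : (0 : ℝ) ≤ 1 + ‖w‖), rpow_natCast]
  set J := ∫ w : Phase d, ((1 + ‖w‖) ^ (2 * d + 1))⁻¹
  have hJ : 0 ≤ J := integral_nonneg fun w => by positivity
  refine ⟨(π ^ d)⁻¹ * (2 ^ (2 * d + 2) * ((1 + card (PhaseIndex d)) ^ (2 * d + 2) *
    (2 ^ symbolOrder d * G * J))), by positivity, fun θ M c hθ hc q' q => ?_⟩
  have hM := hc.nonneg
  set m : Phase d := ½ • (q' + q) with hm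
  set y := q' - q with hy
  have hmq : 1 + ‖m‖ ≤ (1 + ‖q‖) * (1 + ‖y‖) := by
    have : m = q + ½ • y := by rw [hm, hy]; module
    have h2 : ‖m‖ ≤ ‖q‖ + ‖y‖ := by
      rw [this]
      refine (norm_add_le _ _).trans (add_le_add le_rfl ?_)
      rw [norm_smul]
      norm_num
      linarith [norm_nonneg y]
    nlinarith [norm_nonneg q, norm_nonneg y]
  have hcm : Smooth fun w => c (m + w) := hc.smooth.comp (contDiff_const.add contDiff_id)
  have hg : Smooth (phaseGauss (d := d)) := phaseGauss.smooth ⊤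
  have hF0 : Smooth fun w => c (m + w) • phaseGauss w := hcm.smul hg
  have hF : Smooth fun w => 𝕔(c (m + w) * phaseGauss w) := ofRealCLM.contDiff.comp hF0
  have hb : ∀ l : List (PhaseIndex d), l.length ≤ symbolOrder d → ∀ w,
      ‖derivs (l.map phaseVec) (fun w => 𝕔(c (m + w) * phaseGauss w)) w‖ ≤
        (2 ^ symbolOrder d * G * M * (1 + ‖m‖) ^ θ) * ((1 + ‖w‖) ^ (2 * d + 1))⁻¹ := by
    intro l hl w
    have h1 : derivs (l.map phaseVec) (fun w => 𝕔(c (m + w) * phaseGauss w)) w =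
        𝕔(derivs (l.map phaseVec) (fun w => c (m + w) • phaseGauss w) w) :=
      congrFun (derivs_clm_comp hF0 ofRealCLM (l.map phaseVec)) w
    rw [h1, norm_real]
    have h2 := norm_derivs_smul_le phaseVec w l hcm hg
      (A := M * ((1 + ‖m‖) ^ θ * (1 + ‖w‖) ^ θ)) (B := G * ((1 + ‖w‖) ^ (2 * d + 2))⁻¹)
      (fun l' hl' => by
        have e : (fun w => c (m + w)) = fun w => c (w + m) := by simp only [add_comm]
        rw [e, derivs_comp_add]
        refine (hc.bound l' (hl'.trans hl) (w + m)).trans ?_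
        rw [← mul_pow]
        refine mul_le_mul_of_nonneg_left (pow_le_pow_left₀ (by positivity) ?_ θ) hM
        nlinarith [norm_add_le w m, norm_nonneg w, norm_nonneg m])
      (fun l' hl' => by
        rw [← div_eq_mul_inv, le_div_iff₀ (by positivity), mul_comm]
        exact hG l' (hl'.trans hl) w)
    refine h2.trans ?_
    have h3 : (1 + ‖w‖) ^ θ ≤ (1 + ‖w‖) ^ 1 :=
      pow_le_pow_right₀ (le_add_of_nonneg_right (norm_nonneg w)) hθ
    have h4 : (2 : ℝ) ^ l.length ≤ 2 ^ symbolOrder d := pow_le_pow_right₀ one_le_two hl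
    calc 2 ^ l.length * (M * ((1 + ‖m‖) ^ θ * (1 + ‖w‖) ^ θ) * (G * ((1 + ‖w‖) ^ (2 * d + 2))⁻¹))
        ≤ 2 ^ symbolOrder d * (M * ((1 + ‖m‖) ^ θ * (1 + ‖w‖) ^ 1) *
          (G * ((1 + ‖w‖) ^ (2 * d + 2))⁻¹)) := by gcongr
      _ = _ := by
        have : (1 + ‖w‖) ≠ 0 := by positivity
        field_simp
        ring
  have h5 := norm_oscInt_le_of_derivs phaseVec (symp.flip y) (2 * d + 2) hF (hr.const_mul _) hb
  rw [integral_const_mul] at h5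
  have h6 : (1 + ‖y‖) ^ symbolOrder d ≤ 2 ^ (2 * d + 2) *
      (1 + ∑ j, symp.flip y (phaseVec j) ^ 2) ^ (2 * d + 2) := by
    rw [symbolOrder, pow_mul, ← mul_pow]
    refine pow_le_pow_left₀ (by positivity) ?_ _
    simp only [ContinuousLinearMap.flip_apply]
    have := sq_norm_le_phaseInner y
    rw [phaseInner_self] at this
    rw [sum_symp_phaseVec_sq]
    nlinarith [sq_nonneg (‖y‖ - 1)]
  have h7 : opKernelInt c q' q = oscInt (fun w => 𝕔(c (m + w) * phaseGauss w)) (symp.flip y) := rfl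
  have h8 : ‖opKernel c q' q‖ = (π ^ d)⁻¹ * ‖opKernelInt c q' q‖ := by
    rw [opKernel, norm_mul, norm_mul, norm_expI, one_mul, norm_real, norm_of_nonneg (by positivity)]
  rw [h8, h7]
  set X := ‖oscInt (fun w => 𝕔(c (m + w) * phaseGauss w)) (symp.flip y)‖ with hX
  have hX0 : 0 ≤ X := norm_nonneg _
  have h9 : (1 + ‖y‖) ^ symbolOrder d * X ≤ 2 ^ (2 * d + 2) *
      ((1 + card (PhaseIndex d)) ^ (2 * d + 2) *
        (2 ^ symbolOrder d * G * M * (1 + ‖m‖) ^ θ * J)) := by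
    refine (mul_le_mul_of_nonneg_right h6 hX0).trans ?_
    rw [mul_assoc]
    exact mul_le_mul_of_nonneg_left h5 (by positivity)
  have h10 : (1 + ‖m‖) ^ θ ≤ (1 + ‖q‖) ^ θ * (1 + ‖y‖) := by
    refine (pow_le_pow_left₀ (by positivity) hmq θ).trans ?_
    rw [mul_pow]
    refine mul_le_mul_of_nonneg_left ?_ (by positivity)
    simpa using pow_le_pow_right₀ (le_add_of_nonneg_right (norm_nonneg y)) hθ
  have h11 : (1 + ‖y‖) ^ (4 * d + 3) * X ≤ 2 ^ (2 * d + 2) *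
      ((1 + card (PhaseIndex d)) ^ (2 * d + 2) *
        (2 ^ symbolOrder d * G * M * (1 + ‖q‖) ^ θ * J)) := by
    have hy0 : 0 < 1 + ‖y‖ := by positivity
    refine le_of_mul_le_mul_left ?_ hy0
    have e1 : (1 + ‖y‖) * ((1 + ‖y‖) ^ (4 * d + 3) * X) = (1 + ‖y‖) ^ symbolOrder d * X := by
      rw [symbolOrder]; ring
    rw [e1]
    refine h9.trans ?_
    calc _ ≤ 2 ^ (2 * d + 2) * ((1 + card (PhaseIndex d) : ℝ) ^ (2 * d + 2) *
          (2 ^ symbolOrder d * G * M * ((1 + ‖q‖) ^ θ * (1 + ‖y‖)) * J)) := by gcongr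
      _ = _ := by ring
  rw [← div_eq_mul_inv, le_div_iff₀ (by positivity), mul_assoc, mul_comm X]
  calc (π ^ d)⁻¹ * ((1 + ‖y‖) ^ (4 * d + 3) * X) ≤ (π ^ d)⁻¹ * _ :=
        mul_le_mul_of_nonneg_left h11 (by positivity)
    _ = _ := by ring

lemma integrable_inv_one_add_norm_pow :
    Integrable fun w : Phase d => ((1 + ‖w‖) ^ (4 * d + 3))⁻¹ := by
  have := integrable_one_add_norm (E := Phase d) (μ := volume) (r := ((4 * d + 3 : ℕ) : ℝ))
    (by simp; linarith [(Nat.cast_nonneg d : (0 : ℝ) ≤ d)])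
  refine this.congr (.of_forall fun w => ?_)
  simp only [rpow_neg (by positivity : (0 : ℝ) ≤ 1 + ‖w‖), rpow_natCast]

/-- The optimal choice is `δ = b / a`. Both numbers are first increased by a small `η`, since either
may vanish. -/
lemma le_mul_of_forall_le_div_two {x a b : ℝ} (ha : 0 ≤ a) (hb : 0 ≤ b)
    (h : ∀ δ > 0, x ≤ (δ * a ^ 2 + δ⁻¹ * b ^ 2) / 2) : x ≤ a * b := by
  refine le_of_forall_pos_le_add fun ε hε => ?_
  have key : ∀ η > 0, x ≤ (a + η) * (b + η) := fun η hη => by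
    have h1 := h ((b + η) / (a + η)) (by positivity)
    have h2 : (b + η) / (a + η) * a ^ 2 ≤ (b + η) * (a + η) := by
      rw [div_mul_eq_mul_div, div_le_iff₀ (by positivity)]
      have : a ^ 2 ≤ (a + η) ^ 2 := by gcongr; linarith
      nlinarith
    have h3 : ((b + η) / (a + η))⁻¹ * b ^ 2 ≤ (b + η) * (a + η) := by
      rw [inv_div, div_mul_eq_mul_div, div_le_iff₀ (by positivity)]
      have : b ^ 2 ≤ (b + η) ^ 2 := by gcongr; linarith
      nlinarith
    linarith
  have hη : ∃ η > 0, (a + η) * (b + η) ≤ a * b + ε := by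
    refine ⟨min 1 (ε / (a + b + 1)), by positivity, ?_⟩
    have h1 : min 1 (ε / (a + b + 1)) ≤ 1 := min_le_left _ _
    have h2 : min 1 (ε / (a + b + 1)) * (a + b + 1) ≤ ε := by
      rw [← le_div_iff₀ (by positivity)]; exact min_le_right _ _
    have h0 : 0 < min 1 (ε / (a + b + 1)) := by positivity
    nlinarith
  obtain ⟨η, hη0, hη⟩ := hη
  exact (key η hη0).trans hη

/-! ### Schur's test -/

section Schur

variable {E : Type*} [NormedAddCommGroup E] [MeasurableSpace E] [BorelSpace E]
  [SecondCountableTopology E] {μ : Measure E} [SFinite μ] [μ.IsAddHaarMeasure] [μ.IsNegInvariant]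

/-- Young's inequality with a free `δ` splits the integrand into `‖a‖² k` and `‖b‖² k`. Both are
convolution integrands, so each integral factors through `∫ k`; optimizing over `δ` yields the
product of the `L²` norms. -/
lemma schur_bound {k : E → ℝ} (hk : Integrable k μ) (hk0 : ∀ y, 0 ≤ k y) {a b : E → ℂ}
    (ha : Continuous a) (hb : Continuous b) (ha2 : Integrable (fun q => ‖a q‖ ^ 2) μ)
    (hb2 : Integrable (fun q => ‖b q‖ ^ 2) μ) {K : E × E → ℂ} (hK : Continuous K)
    (h : ∀ p : E × E, ‖a p.1 * K p * b p.2‖ ≤ ‖a p.1‖ * ‖b p.2‖ * k (p.1 - p.2)) :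
    Integrable (fun p : E × E => a p.1 * K p * b p.2) (μ.prod μ) ∧
      ‖∫ p : E × E, a p.1 * K p * b p.2 ∂(μ.prod μ)‖ ≤
        (∫ y, k y ∂μ) * (sqrt (∫ q, ‖a q‖ ^ 2 ∂μ) * sqrt (∫ q, ‖b q‖ ^ 2 ∂μ)) := by
  have hB := hb2.convolution_integrand (ContinuousLinearMap.mul ℝ ℝ) hk
  have hk' : Integrable (fun y => k (-y)) μ := hk.comp_neg
  have hA := (ha2.convolution_integrand (ContinuousLinearMap.mul ℝ ℝ) hk').swap
  simp only [ContinuousLinearMap.mul_apply'] at hA hB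
  have hA' : Integrable (fun p : E × E => ‖a p.1‖ ^ 2 * k (p.1 - p.2)) (μ.prod μ) := by
    refine hA.congr (.of_forall fun p => ?_)
    simp
  have hIA : ∫ p : E × E, ‖a p.1‖ ^ 2 * k (p.1 - p.2) ∂(μ.prod μ) =
      (∫ y, k y ∂μ) * ∫ q, ‖a q‖ ^ 2 ∂μ := by
    rw [integral_prod _ hA']
    simp only [integral_const_mul]
    rw [mul_comm, ← integral_mul_const]
    refine integral_congr_ae (.of_forall fun q => ?_)
    simp only
    rw [integral_sub_left_eq_self k μ q]
  have hIB : ∫ p : E × E, ‖b p.2‖ ^ 2 * k (p.1 - p.2) ∂(μ.prod μ) =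
      (∫ y, k y ∂μ) * ∫ q, ‖b q‖ ^ 2 ∂μ := by
    rw [integral_prod_symm _ hB]
    simp only [integral_const_mul]
    rw [mul_comm, ← integral_mul_const]
    refine integral_congr_ae (.of_forall fun q => ?_)
    simp only
    rw [integral_sub_right_eq_self k q]
  have hδ : ∀ δ > 0, ∀ p : E × E, ‖a p.1 * K p * b p.2‖ ≤
      (δ / 2) * (‖a p.1‖ ^ 2 * k (p.1 - p.2)) + (δ⁻¹ / 2) * (‖b p.2‖ ^ 2 * k (p.1 - p.2)) := by
    intro δ hδ p
    refine (h p).trans ?_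
    have h3 : 0 ≤ δ⁻¹ * (δ * ‖a p.1‖ - ‖b p.2‖) ^ 2 * k (p.1 - p.2) :=
      mul_nonneg (by positivity) (hk0 _)
    have h4 : δ⁻¹ * (δ * ‖a p.1‖ - ‖b p.2‖) ^ 2 * k (p.1 - p.2) =
        2 * ((δ / 2) * (‖a p.1‖ ^ 2 * k (p.1 - p.2)) + (δ⁻¹ / 2) * (‖b p.2‖ ^ 2 * k (p.1 - p.2)) -
          ‖a p.1‖ * ‖b p.2‖ * k (p.1 - p.2)) := by
      field_simp; ring
    linarith
  have hmeas : AEStronglyMeasurable (fun p : E × E => a p.1 * K p * b p.2) (μ.prod μ) :=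
    (((ha.comp continuous_fst).mul hK).mul (hb.comp continuous_snd)).aestronglyMeasurable
  refine ⟨((hA'.const_mul (1 / 2)).add (hB.const_mul (1⁻¹ / 2))).mono' hmeas
    (.of_forall (hδ 1 one_pos)), ?_⟩
  have hk1 : 0 ≤ ∫ y, k y ∂μ := integral_nonneg hk0
  -- The optimization divides by `∫ k`; if this vanishes, the bound with `δ = 1` is already zero.
  rcases eq_or_lt_of_le hk1 with h0 | h0
  · rw [← h0, zero_mul]
    refine (norm_integral_le_of_norm_le ((hA'.const_mul (1 / 2)).add (hB.const_mul (1⁻¹ / 2)))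
      (.of_forall (hδ 1 one_pos))).trans_eq ?_
    rw [integral_add' (hA'.const_mul (1 / 2)) (hB.const_mul (1⁻¹ / 2)), integral_const_mul,
      integral_const_mul, hIA, hIB, ← h0]
    simp
  · rw [mul_comm, ← div_le_iff₀ h0]
    refine le_mul_of_forall_le_div_two (Real.sqrt_nonneg _) (Real.sqrt_nonneg _) fun δ hd => ?_
    rw [div_le_iff₀ h0, sq_sqrt (integral_nonneg fun q => by positivity),
      sq_sqrt (integral_nonneg fun q => by positivity)]
    refine (norm_integral_le_of_norm_le ((hA'.const_mul (δ / 2)).add (hB.const_mul (δ⁻¹ / 2)))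
      (.of_forall (hδ δ hd))).trans_eq ?_
    rw [integral_add' (hA'.const_mul _) (hB.const_mul _), integral_const_mul, integral_const_mul,
      hIA, hIB]
    ring

end Schur

/-! ### Weyl operators of a Heisenberg system -/

instance : (volume : Measure (Phase d)).IsNegInvariant :=
  ⟨((LinearIsometryEquiv.neg ℝ (E := Space d)).measurePreserving.prod
    (LinearIsometryEquiv.neg ℝ (E := Space d)).measurePreserving).map_eq⟩

lemma integral_expI_symp_mul_phaseGauss (y : Phase d) :
    ∫ w : Phase d, expI (symp w y) * (phaseGauss w : ℂ) =
      𝕔(π ^ d * exp (-((‖y.1‖ ^ 2 + ‖y.2‖ ^ 2) / 4))) := by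
  have h1 : ∀ w : Phase d, expI (symp w y) * (phaseGauss w : ℂ) =
      Complex.exp (-1 * (‖w.1‖ : ℂ) ^ 2 + -I * (inner ℝ y.2 w.1 : ℝ)) *
        Complex.exp (-1 * (‖w.2‖ : ℂ) ^ 2 + I * (inner ℝ y.1 w.2 : ℝ)) := fun w => by
    rw [expI, phaseGauss_apply, symp_apply, ← Complex.exp_add, Complex.ofReal_exp, ← Complex.exp_add,
      real_inner_comm w.2 y.1, real_inner_comm w.1 y.2]
    congr 1
    push_cast
    ring
  simp only [h1]
  rw [volume_eq_prod, integral_prod_mul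
    (fun x : Space d => Complex.exp (-1 * (‖x‖ : ℂ) ^ 2 + -I * (inner ℝ y.2 x : ℝ)))
    (fun x : Space d => Complex.exp (-1 * (‖x‖ : ℂ) ^ 2 + I * (inner ℝ y.1 x : ℝ))),
    GaussianFourier.integral_cexp_neg_mul_sq_norm_add (by simp),
    GaussianFourier.integral_cexp_neg_mul_sq_norm_add (by simp)]
  have hpi : (π : ℂ) ≠ 0 := by exact_mod_cast Real.pi_ne_zero
  have h2 : ((π : ℂ) / 1) ^ ((Module.finrank ℝ (Space d) : ℂ) / 2) *
      ((π : ℂ) / 1) ^ ((Module.finrank ℝ (Space d) : ℂ) / 2) = (π : ℂ) ^ d := by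
    rw [div_one, ← Complex.cpow_add _ _ hpi, add_halves]
    simp
  rw [mul_mul_mul_comm, h2, ← Complex.exp_add]
  push_cast
  congr 2
  simp only [neg_sq, Complex.I_sq]
  ring

namespace HeisenbergSystem

variable (S)

/-- The coherent states. -/
def coh (q : Phase d) : H := S.shift q S.vac

lemma continuous_coh : Continuous S.coh := S.smooth_vac.continuous

lemma continuous_inner_coh (u : H) : Continuous fun q => ⟪S.coh q, u⟫ :=
  S.continuous_coh.inner continuous_const

lemma continuous_inner_coh_right (u : H) : Continuous fun q => ⟪u, S.coh q⟫ :=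
  continuous_const.inner S.continuous_coh

lemma norm_vac : ‖S.vac‖ = 1 := by
  have h := S.inner_vac 0
  rw [S.shift_zero, inner_self_eq_norm_sq_to_K] at h
  have h2 : ‖S.vac‖ ^ 2 = 1 := by
    have : ((‖S.vac‖ : ℂ)) ^ 2 = 1 := by simpa using h
    exact_mod_cast this
  nlinarith [norm_nonneg S.vac]

lemma norm_coh (q : Phase d) : ‖S.coh q‖ = 1 := by rw [coh, S.norm_shift, S.norm_vac]

lemma norm_inner_coh_le (q : Phase d) (u : H) : ‖⟪S.coh q, u⟫‖ ≤ ‖u‖ := by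
  simpa [S.norm_coh] using norm_inner_le_norm (𝕜 := ℂ) (S.coh q) u

lemma integral_sq_inner_coh (u : H) : ∫ q, ‖⟪S.coh q, u⟫‖ ^ 2 = (2 * π) ^ d * ‖u‖ ^ 2 := by
  have h := S.resolution u u
  have h1 : ∀ q, ⟪u, S.shift q S.vac⟫ * ⟪S.shift q S.vac, u⟫ = 𝕔(‖⟪S.coh q, u⟫‖ ^ 2) := fun q => by
    rw [← inner_conj_symm, mul_comm, Complex.mul_conj, normSq_eq_norm_sq]
    rfl
  have h2 : ∫ q, 𝕔(‖⟪S.coh q, u⟫‖ ^ 2) = 𝕔(∫ q, ‖⟪S.coh q, u⟫‖ ^ 2) := integral_ofReal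
  simp only [h1] at h
  rw [h2, inner_self_eq_norm_sq_to_K] at h
  refine ofReal_injective (h.trans ?_)
  simp

lemma inner_coh_coh (q' q : Phase d) : ⟪S.coh q', S.coh q⟫ = expI (-(symp q' q / 2)) *
      (exp (-((‖(q' - q).1‖ ^ 2 + ‖(q' - q).2‖ ^ 2) / 4)) : ℂ) := by
  rw [coh, coh, S.inner_shift_left, S.shift_shift, inner_smul_right, S.inner_vac]
  congr 2
  · simp [neg_div]
  · rw [neg_add_eq_sub, ← neg_sub q' q, Prod.fst_neg, Prod.snd_neg, norm_neg, norm_neg]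

/-- The quadratic form of the Weyl quantization of `c`. -/
def opForm (c : Phase d → ℝ) (v u : H) : ℂ := 𝕔(((2 * π) ^ d)⁻¹ ^ 2) *
    ∫ p : Phase d × Phase d, ⟪v, S.coh p.1⟫ * opKernel c p.1 p.2 * ⟪S.coh p.2, u⟫

/-- Schur's test, after the factor `(1 + ‖q‖) ^ θ` has been moved from the kernel to the coherent
state transform of `u`. The bound `M'` only serves the continuity of the kernel and does not enter
the constant; this matters because symbols of linear growth with small slope may be bounded only by
a very large constant. -/
lemma exists_opForm_bound : ∃ C, 0 ≤ C ∧ ∀ (θ : ℕ) (M M' : ℝ) (c : Phase d → ℝ), θ ≤ 1 →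
    SymbolBound 0 M' c → SymbolBound θ M c → ∀ v u : H,
    Integrable (fun q => ((1 + ‖q‖) ^ θ * ‖⟪S.coh q, u⟫‖) ^ 2) →
    Integrable (fun p : Phase d × Phase d => ⟪v, S.coh p.1⟫ * opKernel c p.1 p.2 * ⟪S.coh p.2, u⟫) ∧
    ‖S.opForm c v u‖ ≤ C * M * (‖v‖ * sqrt (∫ q, ((1 + ‖q‖) ^ θ * ‖⟪S.coh q, u⟫‖) ^ 2)) := by
  obtain ⟨C, hC0, hC⟩ := exists_norm_opKernel_le d
  set J := ∫ y : Phase d, ((1 + ‖y‖) ^ (4 * d + 3))⁻¹ with hJ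
  have hJ0 : 0 ≤ J := integral_nonneg fun w => by positivity
  refine ⟨(((2 * π) ^ d)⁻¹ ^ 2) * (C * J * sqrt ((2 * π) ^ d)), by positivity,
    fun θ M M' c hθ hc0 hc v u hu => ?_⟩
  have hM := hc.nonneg
  have hpow (q : Phase d) : 𝕔((1 + ‖q‖) ^ θ) ≠ 0 := by
    have : (0 : ℝ) < (1 + ‖q‖) ^ θ := by positivity
    exact_mod_cast this.ne'
  have hcp : Continuous fun q : Phase d => 𝕔((1 + ‖q‖) ^ θ) := by fun_prop
  have hnp (q : Phase d) : ‖𝕔((1 + ‖q‖) ^ θ)‖ = (1 + ‖q‖) ^ θ := by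
    rw [norm_real, norm_of_nonneg (by positivity)]
  have ha : ∀ q, ‖⟪v, S.coh q⟫‖ ^ 2 = ‖⟪S.coh q, v⟫‖ ^ 2 := fun q => by rw [norm_inner_symm]
  have hb : ∀ q, ‖𝕔((1 + ‖q‖) ^ θ) * ⟪S.coh q, u⟫‖ ^ 2 =
      ((1 + ‖q‖) ^ θ * ‖⟪S.coh q, u⟫‖) ^ 2 := fun q => by rw [norm_mul, hnp]
  have h := schur_bound (μ := (volume : Measure (Phase d)))
    (k := fun y => C * M * ((1 + ‖y‖) ^ (4 * d + 3))⁻¹)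
    (integrable_inv_one_add_norm_pow.const_mul _) (fun y => by positivity)
    (a := fun q => ⟪v, S.coh q⟫)
    (b := fun q => 𝕔((1 + ‖q‖) ^ θ) * ⟪S.coh q, u⟫)
    (K := fun p => opKernel c p.1 p.2 * (𝕔((1 + ‖p.2‖) ^ θ))⁻¹)
    (S.continuous_inner_coh_right v) (hcp.mul (S.continuous_inner_coh u))
    (by simp only [ha]; exact S.integrable_sq v) (by simp only [hb]; exact hu)
    ((continuous_opKernel hc0).mul ((hcp.comp continuous_snd).inv₀ fun p => hpow p.2))
    (fun p => by
      simp only [norm_mul, norm_inv, hnp]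
      have h1 := hC θ M c hθ hc p.1 p.2
      have h2 : ‖opKernel c p.1 p.2‖ * ((1 + ‖p.2‖) ^ θ)⁻¹ ≤
          C * M * ((1 + ‖p.1 - p.2‖) ^ (4 * d + 3))⁻¹ := by
        rw [← div_eq_mul_inv, div_le_iff₀ (by positivity)]
        refine h1.trans_eq (by ring)
      calc ‖⟪v, S.coh p.1⟫‖ * (‖opKernel c p.1 p.2‖ * ((1 + ‖p.2‖) ^ θ)⁻¹) *
            ((1 + ‖p.2‖) ^ θ * ‖⟪S.coh p.2, u⟫‖)
          = ‖⟪v, S.coh p.1⟫‖ * ((1 + ‖p.2‖) ^ θ * ‖⟪S.coh p.2, u⟫‖) *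
            (‖opKernel c p.1 p.2‖ * ((1 + ‖p.2‖) ^ θ)⁻¹) := by ring
        _ ≤ _ := by gcongr)
  have he : ∀ p : Phase d × Phase d, ⟪v, S.coh p.1⟫ * (opKernel c p.1 p.2 * (𝕔((1 + ‖p.2‖) ^ θ))⁻¹) *
        (𝕔((1 + ‖p.2‖) ^ θ) * ⟪S.coh p.2, u⟫) =
      ⟪v, S.coh p.1⟫ * opKernel c p.1 p.2 * ⟪S.coh p.2, u⟫ := fun p => by
    have := hpow p.2
    field_simp
  simp only [he, ha, hb, integral_const_mul, S.integral_sq_inner_coh] at h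
  refine ⟨h.1, ?_⟩
  rw [opForm, norm_mul, norm_real, norm_of_nonneg (by positivity)]
  refine (mul_le_mul_of_nonneg_left h.2 (by positivity)).trans_eq ?_
  rw [Real.sqrt_mul (by positivity), Real.sqrt_sq (norm_nonneg v)]
  ring

lemma exists_norm_opForm_le : ∃ C, 0 ≤ C ∧ ∀ (M : ℝ) (c : Phase d → ℝ),
    SymbolBound 0 M c → ∀ v u : H,
    Integrable (fun p : Phase d × Phase d => ⟪v, S.coh p.1⟫ * opKernel c p.1 p.2 * ⟪S.coh p.2, u⟫) ∧
    ‖S.opForm c v u‖ ≤ C * M * ‖v‖ * ‖u‖ := by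
  obtain ⟨C, hC0, hC⟩ := S.exists_opForm_bound
  refine ⟨C * sqrt ((2 * π) ^ d), by positivity, fun M c hc v u => ?_⟩
  have := hC 0 M M c zero_le_one hc hc v u (by simpa using! S.integrable_sq u)
  refine ⟨this.1, this.2.trans_eq ?_⟩
  simp only [pow_zero, one_mul]
  rw [S.integral_sq_inner_coh, Real.sqrt_mul (by positivity), Real.sqrt_sq (norm_nonneg u)]
  ring

variable {S}

lemma integrable_opForm {c} (hc : SymbolBound 0 M c) (v u : H) :
    Integrable (fun p : Phase d × Phase d =>
      ⟪v, S.coh p.1⟫ * opKernel c p.1 p.2 * ⟪S.coh p.2, u⟫) := by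
  obtain ⟨C, -, hC⟩ := S.exists_norm_opForm_le
  exact (hC M c hc v u).1

variable (S) in
/-- The bounded sesquilinear form of the Weyl quantization of `c`. -/
def opBilin (c : Phase d → ℝ) (hc : ∃ M, SymbolBound 0 M c) : H →L⋆[ℂ] H →L[ℂ] ℂ :=
  LinearMap.mkContinuous₂
    (LinearMap.mk₂'ₛₗ (starRingEnd ℂ) (RingHom.id ℂ) (fun v u => S.opForm c v u) (fun v v' u => by
        obtain ⟨M, hM⟩ := hc
        simp only [opForm]
        rw [← mul_add, ← integral_add (integrable_opForm hM v u) (integrable_opForm hM v' u)]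
        simp only [inner_add_left, add_mul])
      (fun a v u => by
        simp only [opForm, inner_smul_left, mul_assoc, integral_const_mul, smul_eq_mul]
        ring)
      (fun v u u' => by
        obtain ⟨M, hM⟩ := hc
        simp only [opForm]
        rw [← mul_add, ← integral_add (integrable_opForm hM v u) (integrable_opForm hM v u')]
        simp only [inner_add_right, mul_add])
      (fun a v u => by
        simp only [opForm, inner_smul_right, mul_left_comm _ a, integral_const_mul, smul_eq_mul,
          RingHom.id_apply]))
    (S.exists_norm_opForm_le.choose * hc.choose)
    (fun v u => (S.exists_norm_opForm_le.choose_spec.2 _ c hc.choose_spec v u).2)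

variable [CompleteSpace H]

variable (S) in
open scoped Classical in
/-- The Weyl quantization of the symbol `c`. -/
def op (c : Phase d → ℝ) : H →L[ℂ] H := if hc : ∃ M, SymbolBound 0 M c then
    InnerProductSpace.continuousLinearMapOfBilin (S.opBilin c hc) else 0

lemma inner_op_left {c} (hc : SymbolBound 0 M c) (v u : H) : ⟪S.op c v, u⟫ = S.opForm c v u := by
  rw [op, dif_pos ⟨M, hc⟩, InnerProductSpace.continuousLinearMapOfBilin_apply]
  rfl

/-- Reality of the symbol makes the kernel hermitian, which is the source of the symmetry of Weyl
operators. -/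
lemma opKernel_swap (c : Phase d → ℝ) (q' q : Phase d) :
    opKernel c q q' = (starRingEnd ℂ) (opKernel c q' q) := by
  unfold opKernel opKernelInt
  rw [map_mul, map_mul, conj_ofReal, conj_expI, ← integral_conj, symp_swap q q']
  congr 2
  · congr 1; ring
  · refine integral_congr_ae (.of_forall fun w => ?_)
    simp only
    rw [map_mul, conj_ofReal, conj_expI, add_comm q q', ← map_neg, neg_sub]

lemma opForm_swap (c : Phase d → ℝ) (v u : H) :
    S.opForm c u v = (starRingEnd ℂ) (S.opForm c v u) := by
  unfold opForm
  rw [map_mul, conj_ofReal, ← integral_conj, volume_eq_prod, ← integral_prod_swap]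
  congr 1
  refine integral_congr_ae (.of_forall fun p => ?_)
  simp only [Prod.fst_swap, Prod.snd_swap]
  rw [map_mul, map_mul, inner_conj_symm, inner_conj_symm, opKernel_swap]
  ring

lemma inner_op_right {c} (hc : SymbolBound 0 M c) (v u : H) : ⟪v, S.op c u⟫ = S.opForm c v u := by
  rw [← inner_conj_symm, inner_op_left hc, opForm_swap, Complex.conj_conj]

lemma inner_op_swap {c} (hc : SymbolBound 0 M c) (v u : H) : ⟪S.op c v, u⟫ = ⟪v, S.op c u⟫ := by
  rw [inner_op_left hc, inner_op_right hc]

variable (S) in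
-- The form bound is tested against `op c u` itself and one factor of its norm is cancelled.
lemma exists_norm_op_le : ∃ C, 0 ≤ C ∧ ∀ (M : ℝ) (c : Phase d → ℝ),
    SymbolBound 0 M c → ∀ u : H, ‖S.op c u‖ ≤ C * M * ‖u‖ := by
  obtain ⟨C, hC0, hC⟩ := S.exists_norm_opForm_le
  refine ⟨C, hC0, fun M c hc u => ?_⟩
  have h := (hC M c hc (S.op c u) u).2
  rw [← inner_op_right hc, inner_self_eq_norm_sq_to_K, norm_pow] at h
  simp only [Complex.coe_algebraMap, norm_real, norm_norm] at h
  rcases eq_or_lt_of_le (norm_nonneg (S.op c u)) with h0 | h0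
  · rw [← h0]; have := hc.nonneg; positivity
  · refine le_of_mul_le_mul_left ?_ h0
    linarith

lemma op_add {M N : ℝ} {c e : Phase d → ℝ} (hc : SymbolBound 0 M c) (he : SymbolBound 0 N e)
    (u : H) : S.op (fun z => c z + e z) u = S.op c u + S.op e u := by
  refine ext_inner_right ℂ fun v => ?_
  rw [inner_add_left, inner_op_left (hc.add he), inner_op_left hc, inner_op_left he]
  unfold opForm
  rw [← mul_add, ← integral_add (integrable_opForm hc u v) (integrable_opForm he u v)]
  congr 2
  funext p
  rw [← add_mul, ← mul_add]
  congr 2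
  unfold opKernel opKernelInt
  rw [← mul_add, ← mul_add,
    ← integral_add (integrable_opKernelInt hc _ _) (integrable_opKernelInt he _ _)]
  congr 3
  funext w
  push_cast
  ring

lemma op_const_mul {c} (hc : SymbolBound 0 M c) (r : ℝ) (u : H) :
    S.op (fun z => r * c z) u = (r : ℂ) • S.op c u := by
  refine ext_inner_right ℂ fun v => ?_
  rw [inner_smul_left, inner_op_left (hc.const_mul r), inner_op_left hc, conj_ofReal]
  have h : ∀ q' q, opKernel (fun z => r * c z) q' q = r * opKernel c q' q := fun q' q => by
    have : opKernelInt (fun z => r * c z) q' q = r * opKernelInt c q' q := by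
      unfold opKernelInt
      rw [← integral_const_mul]
      congr 1
      funext w
      push_cast
      ring
    rw [opKernel, opKernel, this]
    ring
  unfold opForm
  simp only [h, mul_left_comm _ (r : ℂ), mul_assoc, integral_const_mul]

lemma opKernel_one (q' q : Phase d) : opKernel (fun _ => 1) q' q = ⟪S.coh q', S.coh q⟫ := by
  rw [opKernel, opKernelInt, S.inner_coh_coh]
  simp only [one_mul]
  rw [integral_expI_symp_mul_phaseGauss]
  have : (π : ℂ) ≠ 0 := by exact_mod_cast Real.pi_ne_zero
  push_cast
  field_simp

/-- For the symbol one the kernel is the reproducing kernel of the coherent states, so the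
resolution of the identity, applied once in each variable, leaves the inner product. -/
lemma op_one (u : H) : S.op (fun _ => 1) u = u := by
  have h1 := symbolBound_const (d := d) 1
  refine ext_inner_right ℂ fun v => ?_
  have hi := integrable_opForm (S := S) h1 u v
  rw [inner_op_left h1, opForm, volume_eq_prod, integral_prod _ hi]
  have h2 : ∀ q', ∫ q, ⟪u, S.coh q'⟫ * opKernel (fun _ => 1) q' q * ⟪S.coh q, v⟫ =
      ((2 * π) ^ d : ℝ) * (⟪u, S.coh q'⟫ * ⟪S.coh q', v⟫) := fun q' => by
    simp only [opKernel_one (S := S), mul_assoc]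
    have h3 : ∫ q, ⟪S.coh q', S.coh q⟫ * ⟪S.coh q, v⟫ =
      ((2 * π) ^ d : ℝ) * ⟪S.coh q', v⟫ := S.resolution (S.coh q') v
    rw [integral_const_mul, h3]
    ring
  simp only [h2]
  rw [integral_const_mul]
  have h3 : ∫ q', ⟪u, S.coh q'⟫ * ⟪S.coh q', v⟫ = ((2 * π) ^ d : ℝ) * ⟪u, v⟫ := S.resolution u v
  rw [h3]
  have : (π : ℂ) ≠ 0 := by exact_mod_cast Real.pi_ne_zero
  push_cast
  field_simp

lemma op_sub_const {c} (hc : SymbolBound 0 M c) (r : ℝ) (u : H) :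
    S.op (fun z => c z - r) u = S.op c u - (r : ℂ) • u := by
  have h1 := (symbolBound_const (d := d) 1).const_mul (-r)
  have h2 := op_add (S := S) hc h1 u
  rw [op_const_mul (symbolBound_const (d := d) 1), op_one] at h2
  simp only [mul_one, Complex.ofReal_neg, neg_smul, ← sub_eq_add_neg] at h2
  exact h2

/-- Covariance of the Weyl calculus. Both coherent state variables are translated by `w`; the three
phases, one from the kernel and one from each transform, cancel by antisymmetry of `symp`. -/
lemma op_translate {c} (hc : SymbolBound 0 M c) (w : Phase d) (u : H) :
    S.op (fun z => c (z - w)) (S.shift w u) = S.shift w (S.op c u) := by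
  have hc' : SymbolBound 0 M (fun z => c (z - w)) := by
    simpa [sub_eq_add_neg] using hc.translate (-w)
  refine ext_inner_left ℂ fun v => ?_
  have h1 : ⟪v, S.shift w (S.op c u)⟫ = ⟪S.shift (-w) v, S.op c u⟫ := by
    rw [S.inner_shift_left, neg_neg]
  rw [h1, inner_op_right hc', inner_op_right hc, opForm, opForm]
  congr 1
  have : (volume : Measure (Phase d × Phase d)).IsAddRightInvariant :=
    Measure.prod.instIsAddRightInvariant
  rw [← integral_add_right_eq_self _ (w, w)]
  refine integral_congr_ae (.of_forall fun p => ?_)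
  obtain ⟨q', q⟩ := p
  have hk : opKernel (fun z => c (z - w)) (q' + w) (q + w) =
      expI (-(symp q' w / 2) - symp w q / 2) * opKernel c q' q := by
    unfold opKernel opKernelInt
    have e1 : expI (-(symp (q' + w) (q + w) / 2)) =
        expI (-(symp q' w / 2) - symp w q / 2) * expI (-(symp q' q / 2)) := by
      rw [← expI_add]
      congr 1
      simp only [map_add, add_apply, symp_self]
      ring
    have e2 : ∀ x : Phase d, ½ • (q' + w + (q + w)) + x - w = ½ • (q' + q) + x := fun x => by module
    simp only [e1, e2, add_sub_add_right_eq_sub]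
    ring
  have hv : ⟪v, S.coh (q' + w)⟫ = expI (-(symp w q' / 2)) * ⟪S.shift (-w) v, S.coh q'⟫ := by
    rw [S.inner_shift_left, neg_neg, coh, add_comm q' w, S.shift_add, inner_smul_right]
    rfl
  have hu : ⟪S.coh (q + w), S.shift w u⟫ = expI (symp w q / 2) * ⟪S.coh q, u⟫ := by
    rw [coh, add_comm q w, S.shift_add, inner_smul_left, conj_expI, neg_neg, S.inner_shift_shift]
    rfl
  simp only [Prod.mk_add_mk, hk, hv, hu]
  have hp : expI (-(symp w q' / 2)) * expI (-(symp q' w / 2) - symp w q / 2) *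
      expI (symp w q / 2) = 1 := by
    rw [← expI_add, ← expI_add, symp_swap w q']
    convert expI_zero using 2
    ring
  linear_combination (⟪S.shift (-w) v, S.coh q'⟫ * opKernel c q' q * ⟪S.coh q, u⟫) * hp

end HeisenbergSystem

variable [CompleteSpace H]

/-! ### Symbols on space-time -/

/-- The index set of the standard basis of time and phase space. -/
abbrev ExtIndex (d : ℕ) : Type := Option (PhaseIndex d)

/-- The standard basis of time and phase space. -/
def extVec : ExtIndex d → Ext d
  | none => (1, 0)
  | some j => (0, phaseVec j)

/-- The coordinates on time and phase space. -/
def extCoord : ExtIndex d → Ext d →L[ℝ] ℝ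
  | none => fst ℝ _ _
  | some j => (phaseCoord j).comp (snd ℝ _ _)

lemma sum_extCoord (z : Ext d) : ∑ j, extCoord j z • extVec j = z := by
  rw [Fintype.sum_option]
  ext1
  · simp [extCoord, extVec, Prod.fst_sum]
  · have := sum_phaseCoord z.2
    simp only [extCoord, extVec, snd_add, smul_snd, smul_zero, zero_add, Prod.snd_sum]
    exact this

lemma fderiv_eq_sum_extCoord (f : Ext d → F) (x δ : Ext d) :
    fderiv ℝ f x δ = ∑ j, extCoord j δ • 𝜕 (extVec j) f x := by
  conv_lhs => rw [← sum_extCoord δ]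
  simp only [map_sum, map_smul]
  rfl

lemma abs_phaseCoord_le (j : PhaseIndex d) (z : Phase d) : |phaseCoord j z| ≤ ‖z‖ := by
  rcases j with i | i
  · exact (PiLp.norm_apply_le z.1 i).trans (norm_fst_le z)
  · exact (PiLp.norm_apply_le z.2 i).trans (norm_snd_le z)

lemma abs_extCoord_le (j : ExtIndex d) (z : Ext d) : |extCoord j z| ≤ ‖z‖ := by
  rcases j with _ | j
  · exact norm_fst_le z
  · exact (abs_phaseCoord_le j z.2).trans (norm_snd_le z)

/-- Taylor's formula by two applications of the mean value inequality; the lost factor one half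
plays no role. -/
lemma abs_sub_sub_fderiv_le {f : E → ℝ} (hf : Smooth f) (x δ : E) {K : ℝ}
    (hK : ∀ y, |𝜕 δ (𝜕 δ f) y| ≤ K) : |f (x + δ) - f x - fderiv ℝ f x δ| ≤ K := by
  have h1 (g : E → ℝ) (hg : Smooth g) (s : ℝ) :
      HasDerivAt (fun s : ℝ => g (x + s • δ)) (𝜕 δ g (x + s • δ)) s := by
    have h := (hg.diff_infty (x + s • δ)).hasFDerivAt.comp_hasDerivAt s
      (((hasDerivAt_id s).smul_const δ).const_add x)
    exact h.congr_deriv (by simp [dirDeriv])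
  have h2 : ∀ s ∈ Icc (0 : ℝ) 1, |𝜕 δ f (x + s • δ) - 𝜕 δ f x| ≤ K := by
    intro s hs
    have h := norm_image_sub_le_of_norm_deriv_le_segment' (a := 0) (b := s)
      (f := fun s : ℝ => 𝜕 δ f (x + s • δ)) (C := K)
      (fun t _ => (h1 _ (hf.dirDeriv δ) t).hasDerivWithinAt) (fun t _ => hK _) s ⟨hs.1, le_rfl⟩
    simp only [zero_smul, add_zero, sub_zero, norm_eq_abs] at h
    have hK0 := (abs_nonneg _).trans (hK x)
    refine h.trans ?_
    nlinarith [hs.2]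
  have h3 := norm_image_sub_le_of_norm_deriv_le_segment_01' (C := K)
    (f := fun s : ℝ => f (x + s • δ) - s * 𝜕 δ f x)
    (f' := fun s => 𝜕 δ f (x + s • δ) - 𝜕 δ f x)
    (fun t _ => ((h1 f hf t).sub
      ((hasDerivAt_id t).mul_const _ |>.congr_deriv (one_mul _))).hasDerivWithinAt)
    (fun t ht => h2 t ⟨ht.1, ht.2.le⟩)
  simp only [one_smul, one_mul, zero_smul, add_zero, zero_mul, sub_zero, norm_eq_abs] at h3
  have e : f (x + δ) - f x - fderiv ℝ f x δ = f (x + δ) - 𝜕 δ f x - f x := by unfold dirDeriv; ring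
  rw [e]
  exact h3

/-- Smooth functions on time and phase space all of whose derivatives are bounded. -/
structure BddSymbol (h : Ext d → ℝ) : Prop where
  smooth : Smooth h
  bound : ∀ l : List (ExtIndex d), ∃ C, ∀ z, |derivs (l.map extVec) h z| ≤ C

lemma BddSymbol.dirDeriv {h : Ext d → ℝ} (hh : BddSymbol h) (j : ExtIndex d) :
    BddSymbol (𝜕 (extVec j) h) where
  smooth := hh.smooth.dirDeriv _
  bound l := by
    obtain ⟨C, hC⟩ := hh.bound (l ++ [j])
    refine ⟨C, fun z => ?_⟩
    have := hC z
    rwa [map_append, derivs_append] at this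

/-- The function `w ↦ h (e + (0, w))` on phase space. -/
def slice (h : Ext d → ℝ) (e : Ext d) : Phase d → ℝ := fun w => h (e + (0, w))

lemma derivs_slice {h : Ext d → ℝ} (hh : Smooth h) (e : Ext d)
    (l : List (PhaseIndex d)) (w : Phase d) :
    derivs (l.map phaseVec) (slice h e) w = derivs ((l.map some).map extVec) h (e + (0, w)) := by
  have h1 : slice h e = fun w => (fun z => h (z + e)) (ContinuousLinearMap.inr ℝ ℝ (Phase d) w) := by
    funext w
    simp [slice, add_comm]
  have h2 : Smooth fun z => h (z + e) := hh.comp (contDiff_id.add contDiff_const)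
  rw [h1, derivs_comp_clm h2, derivs_comp_add]
  simp only [List.map_map, add_comm e]
  rfl

lemma BddSymbol.exists_symbolBound {h : Ext d → ℝ} (hh : BddSymbol h) :
    ∃ M, ∀ e, SymbolBound 0 M (slice h e) := by
  choose C hC using hh.bound
  have hC0 l : 0 ≤ C l := (abs_nonneg _).trans (hC l 0)
  have hfin : {l : List (PhaseIndex d) | l.length ≤ symbolOrder d}.Finite := finite_length_le _ _
  refine ⟨∑ l ∈ hfin.toFinset, C (l.map some), fun e => ⟨?_, fun l hl w => ?_⟩⟩
  · exact hh.smooth.comp (contDiff_const.add (contDiff_const.prodMk contDiff_id))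
  · rw [derivs_slice hh.smooth, pow_zero, mul_one]
    exact (hC _ _).trans (single_le_sum (f := fun l : List (PhaseIndex d) => C (l.map some))
      (fun l _ => hC0 _) (by simpa using hl))

/-! ### Differentiation of Weyl operators in their symbol -/

namespace HeisenbergSystem

lemma op_sum (s : Finset ι) {c : ι → Phase d → ℝ}
    (hc : ∀ i, ∃ M, SymbolBound 0 M (c i)) (r : ι → ℝ) (u : H) :
    (∃ M, SymbolBound 0 M (fun z => ∑ i ∈ s, r i * c i z)) ∧
      S.op (fun z => ∑ i ∈ s, r i * c i z) u = ∑ i ∈ s, (r i : ℂ) • S.op (c i) u := by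
  classical
  induction s using Finset.induction_on with
  | empty =>
    simp only [Finset.sum_empty]
    have h := op_const_mul (S := S) (symbolBound_const (d := d) 1) 0 u
    simp only [zero_mul, Complex.ofReal_zero, zero_smul] at h
    exact ⟨⟨_, symbolBound_const 0⟩, h⟩
  | insert i s hi ih =>
    obtain ⟨⟨M, hM⟩, ih⟩ := ih
    obtain ⟨N, hN⟩ := hc i
    simp only [sum_insert hi]
    exact ⟨⟨_, (hN.const_mul (r i)).add hM⟩, by
      rw [op_add (hN.const_mul (r i)) hM, op_const_mul hN, ih]⟩

variable (S) in
/-- The Weyl quantization of `w ↦ h (e + (0, w))`. -/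
def opAt (h : Ext d → ℝ) (e : Ext d) : H →L[ℂ] H := S.op (slice h e)

variable (S) in
/-- The derivative of `opAt`. -/
def opAtDeriv (h : Ext d → ℝ) (e : Ext d) : Ext d →L[ℝ] (H →L[ℂ] H) :=
  ∑ j, (extCoord j).smulRight (S.opAt (𝜕 (extVec j) h) e)

lemma opAtDeriv_apply (h : Ext d → ℝ) (e δ : Ext d) :
    S.opAtDeriv h e δ = ∑ j, extCoord j δ • S.opAt (𝜕 (extVec j) h) e := by
  simp [opAtDeriv]

lemma extCoord_extVec (i j : ExtIndex d) : extCoord i (extVec j) = if i = j then 1 else 0 := by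
  rcases i with _ | i | i <;> rcases j with _ | j | j <;>
    simp [extCoord, extVec, phaseCoord, phaseVec, stdVec]

lemma opAtDeriv_extVec (h : Ext d → ℝ) (e : Ext d) (j : ExtIndex d) :
    S.opAtDeriv h e (extVec j) = S.opAt (𝜕 (extVec j) h) e := by
  simp [opAtDeriv_apply, extCoord_extVec]

/-- Quantization is linear, so the remainder of first order is the quantization of the Taylor
remainder of the symbol. The latter, together with its derivatives, is O(‖δ‖²), and the operator
norm bound transfers this. -/
lemma hasFDerivAt_opAt {h} (hh : BddSymbol h) (e : Ext d) :
    HasFDerivAt (S.opAt h) (S.opAtDeriv h e) e := by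
  obtain ⟨C, hC0, hC⟩ := S.exists_norm_op_le
  obtain ⟨M0, hM0⟩ := hh.exists_symbolBound
  choose M1 hM1 using fun j => (hh.dirDeriv j).exists_symbolBound
  choose M2 hM2 using fun i j => ((hh.dirDeriv j).dirDeriv i).exists_symbolBound
  set K := ∑ i, ∑ j, M2 i j with hK
  -- The remainder is arranged as a sum of scalar multiples, the shape on which `op_add`,
  -- `op_const_mul` and `op_sum` act.
  have hrem : ∀ δ, SymbolBound 0 (K * ‖δ‖ ^ 2) (fun w => (slice h (e + δ) w +
      (-1) * slice h e w) + ∑ j, (-extCoord j δ) * slice (𝜕 (extVec j) h) e w) := by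
    intro δ
    refine ⟨((hM0 _).smooth.add (contDiff_const.mul (hM0 _).smooth)).add
      (ContDiff.sum fun j _ => contDiff_const.mul (hM1 j e).smooth), fun l hl w => ?_⟩
    have e1 : derivs (l.map phaseVec) (fun w => (slice h (e + δ) w +
        (-1) * slice h e w) + ∑ j, (-extCoord j δ) * slice (𝜕 (extVec j) h) e w) w =
        derivs ((l.map some).map extVec) h (e + (0, w) + δ) -
        derivs ((l.map some).map extVec) h (e + (0, w)) -
        fderiv ℝ (derivs ((l.map some).map extVec) h) (e + (0, w)) δ := by
      have s1 : Smooth fun w => (-1) * slice h e w := contDiff_const.mul (hM0 e).smooth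
      have s2 : ∀ j, Smooth fun w => (-extCoord j δ) * slice (𝜕 (extVec j) h) e w :=
        fun j => contDiff_const.mul (hM1 j e).smooth
      rw [derivs_add ((hM0 (e + δ)).smooth.add s1) (ContDiff.sum fun j _ => s2 j),
        derivs_add (hM0 (e + δ)).smooth s1, derivs_sum s2]
      have s3 := derivs_const_smul (hM0 e).smooth (-1) (l.map phaseVec)
      have s4 := fun j => derivs_const_smul (hM1 j e).smooth (-extCoord j δ) (l.map phaseVec)
      simp only [smul_eq_mul] at s3 s4
      simp only [s3, s4, derivs_slice hh.smooth, derivs_slice (hh.dirDeriv _).smooth]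
      rw [fderiv_eq_sum_extCoord, show e + δ + (0, w) = e + (0, w) + δ by abel]
      simp only [derivs_dirDeriv hh.smooth, neg_mul, sum_neg_distrib, smul_eq_mul]
      ring
    rw [e1, pow_zero, mul_one]
    refine abs_sub_sub_fderiv_le (hh.smooth.derivs _) _ δ fun y => ?_
    have hf := hh.smooth.derivs ((l.map some).map extVec)
    set f := derivs ((l.map some).map extVec) h with hfdef
    have e2 : ∀ g : Ext d → ℝ, 𝜕 δ g = fun y => ∑ j, extCoord j δ • 𝜕 (extVec j) g y := fun g => by
      funext y; exact fderiv_eq_sum_extCoord g y δ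
    have e3 : 𝜕 δ (𝜕 δ f) y = ∑ i, extCoord i δ * ∑ j, extCoord j δ *
        𝜕 (extVec i) (𝜕 (extVec j) f) y := by
      rw [e2 (𝜕 δ f), e2 f]
      simp only [smul_eq_mul]
      refine sum_congr rfl fun i _ => ?_
      congr 1
      have s5 : ∀ j, Smooth fun y => extCoord j δ * 𝜕 (extVec j) f y := fun j =>
        contDiff_const.mul (hf.dirDeriv _)
      rw [dirDeriv_sum s5]
      refine sum_congr rfl fun j _ => ?_
      exact congrFun (dirDeriv_const_smul (hf.dirDeriv (extVec j)) (extCoord j δ) (extVec i)) y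
    rw [e3, hK, sum_mul]
    refine (abs_sum_le_sum_abs _ _).trans (sum_le_sum fun i _ => ?_)
    rw [abs_mul, sum_mul]
    have e4 : |∑ j, extCoord j δ * 𝜕 (extVec i) (𝜕 (extVec j) f) y| ≤ ∑ j, ‖δ‖ * M2 i j := by
      refine (abs_sum_le_sum_abs _ _).trans (sum_le_sum fun j _ => ?_)
      rw [abs_mul]
      refine mul_le_mul (abs_extCoord_le j δ) ?_ (abs_nonneg _) (norm_nonneg δ)
      rw [hfdef, ← derivs_dirDeriv hh.smooth, ← derivs_dirDeriv (hh.dirDeriv j).smooth]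
      have := (hM2 i j y).bound l hl 0
      rw [derivs_slice ((hh.dirDeriv j).dirDeriv i).smooth, pow_zero, mul_one] at this
      rwa [show y + ((0 : ℝ), (0 : Phase d)) = y from add_zero y] at this
    calc _ ≤ ‖δ‖ * ∑ j, ‖δ‖ * M2 i j :=
          mul_le_mul (abs_extCoord_le i δ) e4 (abs_nonneg _) (norm_nonneg δ)
      _ = _ := by
          rw [mul_sum]
          exact sum_congr rfl fun j _ => by ring
  have hop : ∀ δ, ‖S.opAt h (e + δ) - S.opAt h e - S.opAtDeriv h e δ‖ ≤ C * (K * ‖δ‖ ^ 2) := by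
    intro δ
    have hK0 := (hrem δ).nonneg
    refine opNorm_le_bound _ (by positivity) fun u => ?_
    have h1 := hC _ _ (hrem δ) u
    obtain ⟨⟨M, hM⟩, h2⟩ := op_sum (S := S) univ (fun j => ⟨_, hM1 j e⟩)
      (fun j => -extCoord j δ) u
    rw [op_add ((hM0 (e + δ)).add ((hM0 e).const_mul (-1))) hM,
      op_add (hM0 (e + δ)) ((hM0 e).const_mul (-1)), op_const_mul (hM0 e), h2] at h1
    refine (congrArg norm ?_).trans_le h1
    simp only [sub_apply, opAtDeriv_apply, sum_apply, smul_apply, opAt,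
      Complex.ofReal_neg, Complex.ofReal_one, neg_smul, one_smul, sum_neg_distrib,
      coe_smul]
    abel
  refine HasFDerivAt.of_isLittleO ?_
  have h3 : (fun x => S.opAt h x - S.opAt h e - S.opAtDeriv h e (x - e)) =O[nhds e]
      fun x => ‖x - e‖ ^ 2 := by
    refine Asymptotics.IsBigO.of_bound (C * K) (.of_forall fun x => ?_)
    have := hop (x - e)
    rw [add_sub_cancel] at this
    rw [norm_pow, norm_norm, mul_assoc]
    exact this
  refine h3.trans_isLittleO ?_
  have h4 : (fun x => ‖x - e‖ ^ 2) =o[nhds e] fun x => ‖x - e‖ := by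
    have := Asymptotics.isLittleO_norm_pow_id (E' := Ext d) one_lt_two
    refine (this.norm_right.comp_tendsto (k := fun x => x - e) (l' := nhds e) ?_)
    exact (continuous_id.sub continuous_const).tendsto' e 0 (sub_self e)
  exact h4.trans_isBigO (Asymptotics.isBigO_refl (fun x => x - e) (nhds e)).norm_left

/-- The derivative is a finite combination of operators of the same kind, with symbols `∂_j h` that
are again bounded with all derivatives. -/
lemma contDiff_opAt {h} (hh : BddSymbol h) : Smooth (S.opAt h) := by
  rw [contDiff_infty]
  intro n
  induction n generalizing h with
  | zero =>
    exact contDiff_zero.2 (continuous_iff_continuousAt.2 fun e => (hasFDerivAt_opAt hh e).continuousAt)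
  | succ n ih =>
    refine contDiff_succ_iff_hasFDerivAt.2 ⟨S.opAtDeriv h, ?_, fun e => hasFDerivAt_opAt hh e⟩
    unfold opAtDeriv
    refine ContDiff.sum fun j _ => ?_
    exact (smulRightL ℝ Ext d (H →L[ℂ] H) (extCoord j)).contDiff.comp
      (ih (hh.dirDeriv j))

lemma contDiff_opAt_apply {h} (hh : BddSymbol h) {f : Q → Ext d} (hf : Smooth f)
    {V : Q → H} (hV : Smooth V) : Smooth fun q => S.opAt h (f q) (V q) := by
  have h1 : Smooth fun q => restrictScalarsL ℂ H H ℝ ℝ (S.opAt h (f q)) :=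
    (ContinuousLinearMap.contDiff _).comp ((contDiff_opAt hh).comp hf)
  exact h1.clm_apply hV

lemma dirDeriv_opAt_apply {h} (hh : BddSymbol h) {f : Q → Ext d} (hf : Smooth f)
    {V : Q → H} (hV : Smooth V) (v q : Q) :
    𝜕 v (fun q => S.opAt h (f q) (V q)) q =
      S.opAtDeriv h (f q) (𝜕 v f q) (V q) + S.opAt h (f q) (𝜕 v V q) := by
  have h1 : HasFDerivAt (fun q => S.opAt h (f q)) ((S.opAtDeriv h (f q)).comp (fderiv ℝ f q)) q :=
    (hasFDerivAt_opAt (S := S) hh (f q)).comp (g := S.opAt h) q (hf.diff_infty q).hasFDerivAt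
  have h2 : HasFDerivAt (fun q => restrictScalarsL ℂ H H ℝ ℝ (S.opAt h (f q)))
    _ q := (restrictScalarsL ℂ H H ℝ ℝ).hasFDerivAt.comp q h1
  have h3 := h2.clm_apply (hV.diff_infty q).hasFDerivAt
  rw [dirDeriv_eq (f := fun q => S.opAt h (f q) (V q)) h3, add_comm]
  rfl

/-! ### Weyl operators on the Sobolev scale -/

/-- Coherent states are eigenvectors of the annihilation operators: the relation for the vacuum is
transported to `q` by `gen_shift`, which adds the scalar `q.1 i + i q.2 i`. -/
lemma gen_inr_coh (i : Fin d) (q : Phase d) : S.gen (phaseVec (inr i)) (S.coh q) =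
      I • S.gen (phaseVec (inl i)) (S.coh q) + ((q.1 i : ℂ) + I * (q.2 i : ℂ)) • S.coh q := by
  have h0 : S.gen (phaseVec (inr i)) S.vac = I • S.gen (phaseVec (inl i)) S.vac := by
    rw [gen, gen, S.annihilate_vac, smul_comm]
  have h1 : symp (phaseVec (inr i)) q = q.1 i := by
    simp [symp_apply, phaseVec, stdVec, inner_single_left]
  have h2 : symp (phaseVec (inl i)) q = -q.2 i := by
    simp [symp_apply, phaseVec, stdVec, inner_single_left]
  rw [coh, gen_shift S.smoothVec_vac, gen_shift S.smoothVec_vac, h0, h1, h2, map_smul]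
  push_cast
  module

/-- The coherent state transform turns the creation operators into multiplications. -/
lemma mul_inner_coh {u} (hu : S.SmoothVec u) (i : Fin d) (q : Phase d) :
    ((q.1 i : ℂ) - I * (q.2 i : ℂ)) * ⟪S.coh q, u⟫ = ⟪S.coh q, S.gen (phaseVec (inr i)) u +
        I • S.gen (phaseVec (inl i)) u⟫ := by
  have hc : S.SmoothVec (S.coh q) := S.smoothVec_vac.shift q
  have h := congrArg (fun w => ⟪w, u⟫) (gen_inr_coh (S := S) i q)
  simp only [inner_add_left, inner_smul_left, map_add, map_mul, Complex.conj_I, conj_ofReal] at h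
  rw [inner_gen_left hc hu, inner_gen_left hc hu] at h
  rw [inner_add_right, inner_smul_right, h]
  ring

lemma sq_one_add_norm_mul_le {u} (hu : S.SmoothVec u) (q : Phase d) :
    ((1 + ‖q‖) ^ 1 * ‖⟪S.coh q, u⟫‖) ^ 2 ≤ 2 * ‖⟪S.coh q, u⟫‖ ^ 2 +
      2 * ∑ i, ‖⟪S.coh q, S.gen (phaseVec (inr i)) u + I • S.gen (phaseVec (inl i)) u⟫‖ ^ 2 := by
  have h1 : ∀ i, ‖⟪S.coh q, S.gen (phaseVec (inr i)) u + I • S.gen (phaseVec (inl i)) u⟫‖ ^ 2 =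
      (q.1 i ^ 2 + q.2 i ^ 2) * ‖⟪S.coh q, u⟫‖ ^ 2 := fun i => by
    rw [← mul_inner_coh hu, norm_mul, mul_pow]
    congr 1
    rw [← normSq_eq_norm_sq, Complex.normSq_apply]
    simp
    ring
  simp only [h1]
  rw [← sum_mul, sum_add_distrib]
  have h2 := sq_norm_le_phaseInner q
  rw [phaseInner_self, norm_sq_eq, norm_sq_eq] at h2
  simp only [norm_eq_abs, sq_abs, one_mul] at h2
  rw [mul_pow, pow_one]
  have h3 : (1 + ‖q‖) ^ 2 ≤ 2 + 2 * ‖q‖ ^ 2 := by nlinarith [sq_nonneg (‖q‖ - 1)]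
  nlinarith [sq_nonneg ‖⟪S.coh q, u⟫‖]

/-- Multiplication of the transform by `q.1 i - i q.2 i` is the transform of a creation operator
applied to `u`. The weight `1 + ‖q‖` therefore costs one generator, that is, one Sobolev order. -/
lemma integrable_one_add_norm_mul {u} (hu : S.SmoothVec u) :
    Integrable (fun q => ((1 + ‖q‖) ^ 1 * ‖⟪S.coh q, u⟫‖) ^ 2) ∧
      ∫ q, ((1 + ‖q‖) ^ 1 * ‖⟪S.coh q, u⟫‖) ^ 2 ≤ (2 * π) ^ d * (4 * S.sob 1 u) := by
  have hi (w : H) : Integrable fun q => ‖⟪S.coh q, w⟫‖ ^ 2 := S.integrable_sq w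
  have hI := ((hi u).const_mul 2).add ((integrable_finsetSum univ fun i _ =>
    hi (S.gen (phaseVec (inr i)) u + I • S.gen (phaseVec (inl i)) u)).const_mul 2)
  have hm : AEStronglyMeasurable (fun q => ((1 + ‖q‖) ^ 1 * ‖⟪S.coh q, u⟫‖) ^ 2) :=
    (((continuous_const.add continuous_norm).pow 1).mul
      (S.continuous_inner_coh u).norm).pow 2 |>.aestronglyMeasurable
  refine ⟨hI.mono' hm (.of_forall fun q => ?_), ?_⟩
  · rw [norm_of_nonneg (by positivity)]
    exact sq_one_add_norm_mul_le hu q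
  refine (integral_mono_of_nonneg (.of_forall fun q => by positivity) hI
    (.of_forall fun q => sq_one_add_norm_mul_le hu q)).trans ?_
  rw [integral_add' ((hi u).const_mul 2) ((integrable_finsetSum univ fun i _ =>
    hi (S.gen (phaseVec (inr i)) u + I • S.gen (phaseVec (inl i)) u)).const_mul 2),
    integral_const_mul, integral_const_mul, integral_finsetSum _ fun i _ => hi _]
  simp only [S.integral_sq_inner_coh]
  rw [← mul_sum, sob_succ, sob_zero, Fintype.sum_sum_type]
  simp only [sob_zero]
  have h1 : ∑ i, ‖S.gen (phaseVec (inr i)) u + I • S.gen (phaseVec (inl i)) u‖ ^ 2 ≤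
      ∑ i, (2 * ‖S.gen (phaseVec (inr i)) u‖ ^ 2 + 2 * ‖S.gen (phaseVec (inl i)) u‖ ^ 2) := by
    refine sum_le_sum fun i _ => ?_
    have h2 := norm_add_le (S.gen (phaseVec (inr i)) u) (I • S.gen (phaseVec (inl i)) u)
    rw [norm_smul, norm_I, one_mul] at h2
    have h3 := pow_le_pow_left₀ (norm_nonneg _) h2 2
    nlinarith [sq_nonneg (‖S.gen (phaseVec (inr i)) u‖ - ‖S.gen (phaseVec (inl i)) u‖)]
  rw [sum_add_distrib, ← mul_sum, ← mul_sum] at h1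
  have hp : 0 ≤ (2 * π) ^ d := by positivity
  nlinarith [sq_nonneg ‖u‖]

variable (S) in
-- A symbol of linear growth maps one Sobolev order down. Boundedness of the symbol is required only
-- for the operator to be defined, and the constant depends solely on the slope `M`.
lemma exists_sq_norm_op_le : ∃ C, 0 ≤ C ∧ ∀ (M : ℝ) (c : Phase d → ℝ),
    (∃ M', SymbolBound 0 M' c) → SymbolBound 1 M c → ∀ u : H, S.SmoothVec u →
      ‖S.op c u‖ ^ 2 ≤ C * M ^ 2 * S.sob 1 u := by
  obtain ⟨C, hC0, hC⟩ := S.exists_opForm_bound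
  refine ⟨C ^ 2 * ((2 * π) ^ d * 4), by positivity, fun M c ⟨M', hM'⟩ hc u hu => ?_⟩
  have hM := hc.nonneg
  obtain ⟨h1, h2⟩ := integrable_one_add_norm_mul hu
  have h := (hC 1 M M' c le_rfl hM' hc (S.op c u) u h1).2
  rw [← inner_op_right hM', inner_self_eq_norm_sq_to_K, norm_pow] at h
  simp only [Complex.coe_algebraMap, norm_real, norm_norm] at h
  set X := ∫ q, ((1 + ‖q‖) ^ 1 * ‖⟪S.coh q, u⟫‖) ^ 2 with hX
  have hX0 : 0 ≤ X := integral_nonneg fun q => by positivity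
  have h3 : ‖S.op c u‖ ≤ C * M * sqrt X := by
    rcases eq_or_lt_of_le (norm_nonneg (S.op c u)) with h0 | h0
    · rw [← h0]; positivity
    · refine le_of_mul_le_mul_left ?_ h0
      linarith
  have h4 := pow_le_pow_left₀ (norm_nonneg _) h3 2
  rw [mul_pow, sq_sqrt hX0, mul_pow] at h4
  refine h4.trans ?_
  calc C ^ 2 * M ^ 2 * X ≤ C ^ 2 * M ^ 2 * ((2 * π) ^ d * (4 * S.sob 1 u)) := by gcongr
    _ = _ := by ring

/-- By covariance a shift merely moves the base point of the symbol. Joint smoothness of shifted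
Weyl operators thereby reduces to smoothness of `opAt` in its base point. -/
lemma shift_opAt {h} (hh : BddSymbol h) (e : Ext d) (z : Phase d)
    (u : H) : S.shift z (S.opAt h e u) = S.opAt h (e - (0, z)) (S.shift z u) := by
  obtain ⟨M, hM⟩ := hh.exists_symbolBound
  rw [opAt, ← op_translate (hM e), opAt]
  congr 2
  funext w
  simp only [slice]
  congr 1
  ext1
  · simp
  · simp only [snd_add, Prod.snd_sub]; abel

lemma SmoothFam.opAt {V : Q → H} (hV : S.SmoothFam V) {h} (hh : BddSymbol h)
    {f : Q → Ext d} (hf : Smooth f) : S.SmoothFam fun q => S.opAt h (f q) (V q) := by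
  unfold SmoothFam
  simp only [shift_opAt hh]
  have h1 : Smooth fun p : Q × Phase d => f p.1 - (0, p.2) :=
    (hf.comp contDiff_fst).sub (contDiff_const.prodMk contDiff_snd)
  exact contDiff_opAt_apply hh h1 hV.joint

lemma SmoothVec.opAt {u} (hu : S.SmoothVec u) {h} (hh : BddSymbol h)
    (e : Ext d) : S.SmoothVec (S.opAt h e u) :=
  ((hu.const (Q := ℝ)).opAt hh (f := fun _ => e) contDiff_const).smoothVec 0

/-- Differentiating `shift_opAt` at the origin shows that the commutator with a generator is the
quantization of a derivative of the symbol, exactly and without remainder. -/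
lemma gen_opAt {u} (hu : S.SmoothVec u) {h} (hh : BddSymbol h)
    (e : Ext d) (j : PhaseIndex d) : S.gen (phaseVec j) (S.opAt h e u) =
      S.opAt h e (S.gen (phaseVec j) u) + I • S.opAt (𝜕 (extVec (some j)) h) e u := by
  have hf : Smooth fun z : Phase d => e - ((0 : ℝ), z) :=
    contDiff_const.sub (contDiff_const.prodMk contDiff_id)
  have h1 : 𝜕 (phaseVec j) (fun z : Phase d => e - ((0 : ℝ), z)) 0 = -extVec (some j) := by
    have : HasFDerivAt (fun z : Phase d => e - ((0 : ℝ), z))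
        (-ContinuousLinearMap.inr ℝ ℝ (Phase d)) 0 :=
      (ContinuousLinearMap.inr ℝ ℝ (Phase d)).hasFDerivAt.const_sub e
    rw [this.dirDeriv_eq]
    rfl
  have hsu : Smooth fun z => S.shift z u := hu
  have h2 := dirDeriv_opAt_apply (S := S) hh hf hsu (phaseVec j) 0
  rw [h1, map_neg, opAtDeriv_extVec] at h2
  unfold gen
  simp only [shift_opAt hh]
  rw [h2]
  simp only [S.shift_zero, show e - ((0 : ℝ), (0 : Phase d)) = e from sub_zero e, neg_apply,
    map_smul, smul_add]
  rw [add_comm]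
  simp

variable (S) in
/-- The Weyl quantization of `w ↦ h (e + (0, w)) - h e`. -/
def centered (h : Ext d → ℝ) (e : Ext d) (u : H) : H := S.opAt h e u - (h e : ℂ) • u

lemma SmoothFam.centered {V : Q → H} (hV : S.SmoothFam V) {h}
    (hh : BddSymbol h) {f : Q → Ext d} (hf : Smooth f) :
    S.SmoothFam fun q => S.centered h (f q) (V q) := by
  have h1 : Smooth fun q => 𝕔(-h (f q)) := ofRealCLM.contDiff.comp (hh.smooth.comp hf).neg
  have := (hV.opAt hh hf).add (hV.smul h1)
  refine (congrArg S.SmoothFam (funext fun q => ?_)).mp this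
  simp [HeisenbergSystem.centered, sub_eq_add_neg]

lemma SmoothVec.centered {u} (hu : S.SmoothVec u) {h} (hh : BddSymbol h)
    (e : Ext d) : S.SmoothVec (S.centered h e u) :=
  ((hu.const (Q := ℝ)).centered hh (f := fun _ => e) contDiff_const).smoothVec 0

lemma dirDeriv_centered {V : Q → H} (hV : Smooth V) {h}
    (hh : BddSymbol h) {f : Q → Ext d} (hf : Smooth f) (v q : Q) :
    𝜕 v (fun q => S.centered h (f q) (V q)) q = ∑ j, (extCoord j (𝜕 v f q) : ℂ) •
        S.centered (𝜕 (extVec j) h) (f q) (V q) + S.centered h (f q) (𝜕 v V q) := by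
  have hc : Smooth fun q => 𝕔(h (f q)) := ofRealCLM.contDiff.comp (hh.smooth.comp hf)
  have hd : 𝜕 v (fun q => 𝕔(h (f q))) q =
      ∑ j, (extCoord j (𝜕 v f q) : ℂ) * 𝕔(𝜕 (extVec j) h (f q)) := by
    have h1 : HasFDerivAt (fun q => 𝕔(h (f q)))
        (ofRealCLM.comp ((fderiv ℝ h (f q)).comp (fderiv ℝ f q))) q :=
      ofRealCLM.hasFDerivAt.comp q ((hh.smooth.diff_infty _).hasFDerivAt.comp q
          (hf.diff_infty q).hasFDerivAt)
    rw [h1.dirDeriv_eq]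
    simp only [comp_apply, fderiv_eq_sum_extCoord h, ofRealCLM_apply]
    push_cast
    simp only [smul_eq_mul, ofReal_mul]
    rfl
  unfold centered
  have hcV : Smooth fun q => 𝕔(h (f q)) • V q := hc.smul hV
  rw [dirDeriv_sub (contDiff_opAt_apply hh hf hV) hcV]
  simp only
  rw [dirDeriv_opAt_apply hh hf hV, dirDeriv_smul hc hV, opAtDeriv_apply]
  simp only [hd, ← ofReal_mul, sum_apply, smul_apply, smul_sub, sum_sub_distrib, smul_smul, coe_smul]
  rw [Finset.sum_smul]
  simp only [coe_smul]
  abel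

lemma gen_centered {u} (hu : S.SmoothVec u) {h} (hh : BddSymbol h)
    (e : Ext d) (j : PhaseIndex d) : S.gen (phaseVec j) (S.centered h e u) =
      S.centered h e (S.gen (phaseVec j) u) + I • (S.centered (𝜕 (extVec (some j)) h) e u +
          𝕔(𝜕 (extVec (some j)) h e) • u) := by
  unfold centered
  rw [gen_sub (hu.opAt hh e) (hu.smul _), gen_opAt hu hh, gen_smul hu]
  simp only [sub_add_cancel]
  abel

/-- All derivatives of `h` of positive order at most `n` are bounded by `M`. -/
def DerivBound (n : ℕ) (M : ℝ) (h : Ext d → ℝ) : Prop :=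
  ∀ l : List (ExtIndex d), l ≠ [] → l.length ≤ n → ∀ e, |derivs (l.map extVec) h e| ≤ M

lemma DerivBound.mono {n m : ℕ} {h : Ext d → ℝ} (hh : DerivBound n M h)
    (hm : m ≤ n) : DerivBound m M h := fun l h0 hl => hh l h0 (hl.trans hm)

lemma DerivBound.dirDeriv {h : Ext d → ℝ} (hh : DerivBound (n + 1) M h)
    (j : ExtIndex d) : DerivBound n M (𝜕 (extVec j) h) := fun l _ hl e => by
  have := hh (l ++ [j]) (by simp) (by simpa using hl) e
  rwa [map_append, derivs_append] at this

/-- Subtracting the value at `e` leaves a function controlled by its gradient alone, so the growth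
is linear whatever the size of `h`. Only the empty word needs the mean value theorem; derivatives do
not see the constant. -/
lemma DerivBound.symbolBound {h : Ext d → ℝ} (hs : Smooth h)
    (hh : DerivBound (symbolOrder d) M h) (hM : 0 ≤ M) (e : Ext d) :
    SymbolBound 1 ((1 + card (ExtIndex d)) * M) (fun w => slice h e w - h e) where
  smooth := (hs.comp (contDiff_const.add (contDiff_const.prodMk contDiff_id))).sub contDiff_const
  bound l hl w := by
    have hb : M ≤ (1 + card (ExtIndex d)) * M * (1 + ‖w‖) ^ 1 := by
      have h1 : (1 : ℝ) ≤ 1 + card (ExtIndex d) := le_add_of_nonneg_right (Nat.cast_nonneg _)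
      have h2 : (1 : ℝ) ≤ (1 + ‖w‖) ^ 1 := by simp
      nlinarith [mul_le_mul h1 h2 zero_le_one (by positivity)]
    rcases List.eq_nil_or_concat l with rfl | ⟨l', j, rfl⟩
    · have h1 : ∀ x, ‖fderiv ℝ h x‖ ≤ card (ExtIndex d) * M := fun x => by
        refine opNorm_le_bound _ (by positivity) fun δ => ?_
        rw [fderiv_eq_sum_extCoord]
        refine (norm_sum_le _ _).trans ((sum_le_sum fun j _ => ?_).trans_eq
          (by rw [Finset.sum_const, Finset.card_univ, nsmul_eq_mul, mul_assoc]))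
        rw [norm_smul, mul_comm]
        exact mul_le_mul (hh [j] (by simp) (by simp [symbolOrder]; omega) x) (abs_extCoord_le j δ)
          (norm_nonneg _) hM
      have h2 := (convex_univ (𝕜 := ℝ) (E := Ext d)).norm_image_sub_le_of_norm_fderiv_le
        (fun x _ => hs.diff_infty x) (fun x _ => h1 x) (Set.mem_univ e)
        (Set.mem_univ (e + (0, w)))
      simp only [add_sub_cancel_left, Prod.norm_mk, norm_zero] at h2
      rw [max_eq_right (norm_nonneg w)] at h2
      refine h2.trans ?_
      have : (0 : ℝ) ≤ card (ExtIndex d) := by positivity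
      nlinarith [norm_nonneg w, mul_nonneg this hM, mul_nonneg hM (norm_nonneg w)]
    · have hsl : Smooth (slice h e) :=
        hs.comp (contDiff_const.add (contDiff_const.prodMk contDiff_id))
      have h3 : derivs ((l' ++ [j]).map phaseVec) (fun w => slice h e w - h e) =
          derivs ((l' ++ [j]).map phaseVec) (slice h e) := by
        rw [map_append, derivs_append, derivs_append]
        congr 1
        funext w
        simp only [map_cons, List.map_nil, derivs_cons, derivs_nil]
        rw [dirDeriv_sub hsl contDiff_const, dirDeriv_const]
        simp
      rw [List.concat_eq_append] at hl ⊢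
      rw [h3, derivs_slice hs]
      exact (hh _ (by simp) (by simpa using hl) _).trans hb

/-- Commuting a generator past the operator produces the centred operator of `∂_j h` and the scalar
`∂_j h(e)`, both controlled by `M`. Each Sobolev order consumes one more derivative, and the size of
`h` itself never enters. -/
lemma exists_sob_centered_le (S : HeisenbergSystem d H) (k : ℕ) : ∃ C, 0 ≤ C ∧
    ∀ (M : ℝ) (h : Ext d → ℝ), BddSymbol h → 0 ≤ M → DerivBound (symbolOrder d + k) M h →
      ∀ (e : Ext d) (u : H), S.SmoothVec u →
        S.sob k (S.centered h e u) ≤ C * M ^ 2 * S.sob (k + 1) u := by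
  induction k with
  | zero =>
    obtain ⟨C, hC0, hC⟩ := S.exists_sq_norm_op_le
    refine ⟨C * (1 + card (ExtIndex d)) ^ 2, by positivity, fun M h hh hM hd e u hu => ?_⟩
    obtain ⟨M', hM'⟩ := hh.exists_symbolBound
    have h1 := hC _ _ ⟨_, by
      simpa [sub_eq_add_neg] using (hM' e).add ((symbolBound_const (d := d) (-h e)))⟩
      (hd.symbolBound hh.smooth hM e) u hu
    rw [op_sub_const (hM' e)] at h1
    rw [sob_zero]
    refine h1.trans_eq ?_
    ring
  | succ k ih =>
    obtain ⟨C, hC0, hC⟩ := ih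
    refine ⟨C + ∑ _j : PhaseIndex d, (2 * C + (4 * C + 4)), by positivity,
      fun M h hh hM hd e u hu => ?_⟩
    have hd' : DerivBound (symbolOrder d + k) M h := hd.mono (by omega)
    rw [S.sob_succ k, add_mul, add_mul, sum_mul, sum_mul]
    have hs1 := S.sob_le_succ (k + 1) u
    have hs0 := (S.sob_le_succ k u).trans hs1
    refine add_le_add ((hC M h hh hM hd' e u hu).trans ?_) (sum_le_sum fun j _ => ?_)
    · gcongr
    · rw [gen_centered hu hh]
      have hdj : DerivBound (symbolOrder d + k) M (𝜕 (extVec (some j)) h) := hd.dirDeriv (some j)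
      have a1 := hC M h hh hM hd' e _ (hu.gen (phaseVec j))
      have a2 := hC M _ (hh.dirDeriv (some j)) hM hdj e u hu
      have hcu := hu.centered (hh.dirDeriv (some j)) e
      have a3 := sob_add_le ((hu.gen (phaseVec j)).centered hh e)
        ((hcu.add (hu.smul 𝕔(𝜕 (extVec (some j)) h e))).smul I) k
      have a4 := sob_add_le hcu (hu.smul 𝕔(𝜕 (extVec (some j)) h e)) k
      rw [sob_smul (hcu.add (hu.smul _))] at a3
      rw [sob_smul hu] at a4
      have a5 : ‖𝕔(𝜕 (extVec (some j)) h e)‖ ^ 2 ≤ M ^ 2 := by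
        rw [norm_real]
        exact pow_le_pow_left₀ (norm_nonneg _) (hd [some j] (by simp) (by simp [symbolOrder]; omega) e) 2
      have a6 := mul_le_mul a5 hs0 (S.sob_nonneg k u) (by positivity)
      have a7 := mul_le_mul_of_nonneg_left (S.sob_gen_le (k + 1) j u) (by positivity : 0 ≤ C * M ^ 2)
      have a8 := mul_le_mul_of_nonneg_left hs1 (by positivity : 0 ≤ C * M ^ 2)
      simp only [norm_I, one_pow, one_mul] at a3
      refine a3.trans ?_
      linarith

end HeisenbergSystem

/-! ### Uniform bounds over families -/

/-- Gronwall's inequality in both time directions. The assumption `1 ≤ K` lets the inhomogeneity be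
absorbed as `ε L / (ε K) ≤ L`, so the bound depends on `ε` and time only through `ε |t - a|`. -/
lemma norm_le_of_norm_deriv_le {y y' : ℝ → E} {K L ε a t : ℝ} (hε : 0 < ε) (hK : 1 ≤ K) (hL : 0 ≤ L)
    (hy : ∀ τ ∈ Set.uIcc a t, HasDerivAt y (y' τ) τ)
    (hb : ∀ τ ∈ Set.uIcc a t, ‖y' τ‖ ≤ ε * (K * ‖y τ‖ + L)) :
    ‖y t‖ ≤ (‖y a‖ + L) * exp (K * (ε * |t - a|)) := by
  have key : ∀ (z z' : ℝ → E) (b : ℝ), 0 ≤ b → (∀ τ ∈ Icc 0 b, HasDerivAt z (z' τ) τ) →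
      (∀ τ ∈ Icc 0 b, ‖z' τ‖ ≤ ε * (K * ‖z τ‖ + L)) →
      ‖z b‖ ≤ (‖z 0‖ + L) * exp (K * (ε * b)) := by
    intro z z' b hb0 hz hzb
    have h := norm_le_gronwallBound_of_norm_deriv_right_le (f := z) (f' := z') (δ := ‖z 0‖)
      (K := ε * K) (ε := ε * L) (a := 0) (b := b)
      (fun τ hτ => (hz τ hτ).continuousAt.continuousWithinAt)
      (fun τ hτ => (hz τ ⟨hτ.1, hτ.2.le⟩).hasDerivWithinAt) le_rfl
      (fun τ hτ => (hzb τ ⟨hτ.1, hτ.2.le⟩).trans_eq (by ring)) b ⟨hb0, le_rfl⟩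
    refine h.trans ?_
    have hK0 : ε * K ≠ 0 := by positivity
    rw [gronwallBound_of_K_ne_0 hK0, sub_zero]
    have e1 : ε * L / (ε * K) ≤ L := by
      rw [div_le_iff₀ (by positivity)]
      nlinarith [mul_nonneg hε.le hL]
    have e2 : 0 ≤ ε * L / (ε * K) := by positivity
    rw [show K * (ε * b) = ε * K * b by ring]
    have e3 : 1 ≤ exp (ε * K * b) := Real.one_le_exp (by positivity)
    nlinarith
  rcases le_total a t with h | h
  · rw [Set.uIcc_of_le h] at hy hb
    have := key (fun τ => y (a + τ)) (fun τ => y' (a + τ)) (t - a) (sub_nonneg.2 h)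
      (fun τ hτ => (hy (a + τ) ⟨by linarith [hτ.1], by linarith [hτ.2]⟩).comp_const_add a τ)
      (fun τ hτ => hb (a + τ) ⟨by linarith [hτ.1], by linarith [hτ.2]⟩)
    simpa [abs_of_nonneg (sub_nonneg.2 h)] using this
  · rw [Set.uIcc_of_ge h] at hy hb
    have := key (fun τ => y (a - τ)) (fun τ => -y' (a - τ)) (a - t) (sub_nonneg.2 h)
      (fun τ hτ => (hy (a - τ) ⟨by linarith [hτ.2], by linarith [hτ.1]⟩).comp_const_sub a τ)
      (fun τ hτ => by
        rw [norm_neg]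
        exact hb (a - τ) ⟨by linarith [hτ.2], by linarith [hτ.1]⟩)
    simpa [abs_of_nonpos (sub_nonpos.2 h)] using this

/-- Families of smooth functions on `ℝ × P`, whose derivatives up to order `n` are bounded uniformly
in the family and at all times in `T`. -/
def UnifFun (T : Ω → Set ℝ) : ℕ → (Ω → Ext d → F) → Prop
  | 0, f => (∀ κ, Smooth (f κ)) ∧ ∃ C, ∀ κ x, x.1 ∈ T κ → ‖f κ x‖ ≤ C
  | n + 1, f => ((∀ κ, Smooth (f κ)) ∧ ∃ C, ∀ κ x, x.1 ∈ T κ → ‖f κ x‖ ≤ C) ∧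
      ∀ i, UnifFun T n (fun κ => 𝜕 (extVec i) (f κ))

lemma UnifFun.zero {f : Ω → Ext d → F} (hf : UnifFun T n f) : UnifFun T 0 f := by
  cases n with
  | zero => exact hf
  | succ n => exact hf.1

lemma UnifFun.smooth {f : Ω → Ext d → F} (hf : UnifFun T n f) (κ : Ω) : Smooth (f κ) := hf.zero.1 κ

lemma UnifFun.pred {f : Ω → Ext d → F} (hf : UnifFun T (n + 1) f) : UnifFun T n f := by
  induction n generalizing f with
  | zero => exact hf.zero
  | succ n ih => exact ⟨hf.zero, fun i => ih (hf.2 i)⟩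

lemma UnifFun.add {f g : Ω → Ext d → F} (hf : UnifFun T n f)
    (hg : UnifFun T n g) : UnifFun T n (fun κ x => f κ x + g κ x) := by
  have h0 : ∀ {f g : Ω → Ext d → F}, UnifFun T 0 f → UnifFun T 0 g →
      UnifFun T 0 (fun κ x => f κ x + g κ x) := fun ⟨hf, C, hC⟩ ⟨hg, D, hD⟩ =>
    ⟨fun κ => (hf κ).add (hg κ), C + D, fun κ x hx =>
      (norm_add_le _ _).trans (add_le_add (hC κ x hx) (hD κ x hx))⟩
  induction n generalizing f g with
  | zero => exact h0 hf hg
  | succ n ih =>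
    refine ⟨h0 hf.zero hg.zero, fun i => ?_⟩
    simp only [fun κ => dirDeriv_add (hf.smooth κ) (hg.smooth κ) (extVec i)]
    exact ih (hf.2 i) (hg.2 i)

lemma unifFun_const (n : ℕ) {c : Ω → F} (hc : ∃ C, ∀ κ, ‖c κ‖ ≤ C) :
    UnifFun T n (fun κ (_ : Ext d) => c κ) := by
  have h0 : ∀ {c : Ω → F}, (∃ C, ∀ κ, ‖c κ‖ ≤ C) →
      UnifFun T 0 (fun κ (_ : Ext d) => c κ) := fun ⟨C, hC⟩ =>
    ⟨fun κ => contDiff_const, C, fun κ _ _ => hC κ⟩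
  induction n generalizing c with
  | zero => exact h0 hc
  | succ n ih =>
    refine ⟨h0 hc, fun i => ?_⟩
    simp only [dirDeriv_const]
    exact ih ⟨0, fun _ => by simp⟩

lemma UnifFun.sum (s : Finset ι) {f : ι → Ω → Ext d → F}
    (hf : ∀ i, UnifFun T n (f i)) : UnifFun T n (fun κ x => ∑ i ∈ s, f i κ x) := by
  classical
  induction s using Finset.induction_on with
  | empty => simpa using unifFun_const n (c := fun _ : Ω => (0 : F)) ⟨0, fun _ => by simp⟩
  | insert i s hi ih => simpa only [sum_insert hi] using (hf i).add ih

lemma UnifFun.smul {c : Ω → Ext d → ℝ} {f : Ω → Ext d → F}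
    (hc : UnifFun T n c) (hf : UnifFun T n f) : UnifFun T n (fun κ x => c κ x • f κ x) := by
  have h0 : ∀ {c : Ω → Ext d → ℝ} {f : Ω → Ext d → F}, UnifFun T 0 c → UnifFun T 0 f →
      UnifFun T 0 (fun κ x => c κ x • f κ x) := fun ⟨hc, C, hC⟩ ⟨hf, D, hD⟩ =>
    ⟨fun κ => (hc κ).smul (hf κ), C * D, fun κ x hx => by
      rw [norm_smul]
      exact mul_le_mul (hC κ x hx) (hD κ x hx) (norm_nonneg _) ((norm_nonneg _).trans (hC κ x hx))⟩
  induction n generalizing c f with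
  | zero => exact h0 hc hf
  | succ n ih =>
    refine ⟨h0 hc.zero hf.zero, fun i => ?_⟩
    simp only [fun κ => dirDeriv_smul (hc.smooth κ) (hf.smooth κ) (extVec i)]
    exact (ih (hc.2 i) hf.pred).add (ih hc.pred (hf.2 i))

lemma UnifFun.clm {f : Ω → Ext d → F} (hf : UnifFun T n f) (L : F →L[ℝ] G) :
    UnifFun T n (fun κ x => L (f κ x)) := by
  have h0 : ∀ {f : Ω → Ext d → F}, UnifFun T 0 f → UnifFun T 0 (fun κ x => L (f κ x)) :=
    fun ⟨hf, C, hC⟩ => ⟨fun κ => L.contDiff.comp (hf κ), ‖L‖ * C, fun κ x hx =>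
      (L.le_opNorm _).trans (mul_le_mul_of_nonneg_left (hC κ x hx) (norm_nonneg L))⟩
  induction n generalizing f with
  | zero => exact h0 hf
  | succ n ih =>
    refine ⟨h0 hf.zero, fun i => ?_⟩
    simp only [fun κ => dirDeriv_clm_comp (hf.smooth κ) L (extVec i)]
    exact ih (hf.2 i)

lemma UnifFun.freeze {f : Ω → Ext d → F} (hf : UnifFun T n f) {s : Ω → ℝ}
    (hs : ∀ κ, s κ ∈ T κ) : UnifFun T n (fun κ x => f κ (s κ, x.2)) := by
  have h0 : ∀ {f : Ω → Ext d → F}, UnifFun T 0 f →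
      UnifFun T 0 (fun κ x => f κ (s κ, x.2)) := fun ⟨hf, C, hC⟩ =>
    ⟨fun κ => (hf κ).comp (contDiff_const.prodMk contDiff_snd), C, fun κ x _ => hC κ _ (hs κ)⟩
  induction n generalizing f with
  | zero => exact h0 hf
  | succ n ih =>
    refine ⟨h0 hf.zero, fun i => ?_⟩
    have h1 (κ : Ω) (v : Ext d) : 𝜕 v (fun x => f κ (s κ, x.2)) =
        fun x => 𝜕 (0, v.2) (f κ) (s κ, x.2) := by
      funext x
      have h2 : HasFDerivAt (fun x : Ext d => (s κ, x.2))
          ((0 : Ext d →L[ℝ] ℝ).prod (snd ℝ ℝ (Phase d))) x :=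
        (hasFDerivAt_const (s κ) x).prodMk hasFDerivAt_snd
      have h3 := ((hf.smooth κ).diff_infty (s κ, x.2)).hasFDerivAt.comp x h2
      exact (dirDeriv_eq (f := fun x => f κ (s κ, x.2)) h3 v).trans rfl
    simp only [h1]
    rcases i with _ | i
    · have h4 : ∀ κ (x : Ext d), 𝜕 ((0 : ℝ), (extVec (none : ExtIndex d)).2) (f κ)
          (s κ, x.2) = 0 := fun κ x => map_zero (fderiv ℝ (f κ) (s κ, x.2))
      simp only [h4]
      exact unifFun_const n ⟨0, fun _ => by simp⟩
    · exact ih (hf.2 (some i))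

/-- Families of smooth functions on `ℝ × P`, all of whose derivatives are bounded uniformly. -/
structure UnifSym (g : Ω → Ext d → F) : Prop where
  smooth : ∀ κ, Smooth (g κ)
  bound : ∀ l : List (ExtIndex d), ∃ C, ∀ κ z, ‖derivs (l.map extVec) (g κ) z‖ ≤ C

lemma UnifSym.dirDeriv {g : Ω → Ext d → F} (hg : UnifSym g) (j : ExtIndex d) :
    UnifSym (fun κ => 𝜕 (extVec j) (g κ)) where
  smooth κ := (hg.smooth κ).dirDeriv _
  bound l := by
    obtain ⟨C, hC⟩ := hg.bound (l ++ [j])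
    refine ⟨C, fun κ z => ?_⟩
    have := hC κ z
    rwa [map_append, derivs_append] at this

/-- By the chain rule only derivatives of the inner map enter, never its values, which are unbounded
for a flow. Derivatives of `𝕜 (extVec i) (f κ)` are needed to orders below `n` only; this makes the
strong induction for flows possible. -/
lemma UnifSym.comp {g : Ω → Ext d → F} (hg : UnifSym g)
    {f : Ω → Ext d → Ext d} (hfs : ∀ κ, Smooth (f κ))
    (hf : ∀ m < n, ∀ i, UnifFun T m (fun κ => 𝜕 (extVec i) (f κ))) :
    UnifFun T n (fun κ x => g κ (f κ x)) := by
  have h0 : ∀ {g : Ω → Ext d → F}, UnifSym g → UnifFun T 0 (fun κ x => g κ (f κ x)) := fun hg => by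
      obtain ⟨C, hC⟩ := hg.bound []
      exact ⟨fun κ => (hg.smooth κ).comp (hfs κ), C, fun κ x _ => hC κ (f κ x)⟩
  induction n generalizing g with
  | zero => exact h0 hg
  | succ n ih =>
    refine ⟨h0 hg, fun i => ?_⟩
    have h1 (κ : Ω) : 𝜕 (extVec i) (fun x => g κ (f κ x)) = fun x =>
        ∑ j, extCoord j (𝜕 (extVec i) (f κ) x) • 𝜕 (extVec j) (g κ) (f κ x) := by
      funext x
      have h2 := ((hg.smooth κ).diff_infty (f κ x)).hasFDerivAt.comp x
        ((hfs κ).diff_infty x).hasFDerivAt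
      rw [dirDeriv_eq (f := fun x => g κ (f κ x)) h2]
      exact fderiv_eq_sum_extCoord (g κ) (f κ x) _
    simp only [h1]
    refine UnifFun.sum _ fun j => UnifFun.smul ((hf n (Nat.lt_succ_self n) i).clm (extCoord j)) ?_
    exact ih (hg.dirDeriv j) fun m hm => hf m (hm.trans (Nat.lt_succ_self n))

/-- The slowly varying time interval `|t| ≤ M / ε`. -/
def timeRange (M : ℝ) (ε : Ω → ℝ) (κ : Ω) : Set ℝ := {t | ε κ * |t| ≤ M}

/-- Solutions of slowly varying linear equations obey uniform bounds. -/
lemma unifFun_of_linear {ε : Ω → ℝ} (hε : ∀ κ, 0 < ε κ) (hε1 : ∀ κ, ε κ ≤ 1) {A : PhaseIndex d → Ω → Ext d → Phase d}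
    (hA : ∀ j, UnifFun (timeRange M ε) n (A j))
    {Y f : Ω → Ext d → Phase d} (hf : UnifFun (timeRange M ε) n f)
    (hY : ∀ κ, Smooth (Y κ)) {c : Ω → Phase d} (hc : ∃ C, ∀ κ, ‖c κ‖ ≤ C)
    (hY0 : ∀ κ p, Y κ (0, p) = c κ)
    (hYt : ∀ κ x, 𝜕 (extVec none) (Y κ) x = ε κ • (∑ j, phaseCoord j (Y κ x) • A j κ x + f κ x)) :
    UnifFun (timeRange M ε) n Y := by
  have hεu : ∀ n, UnifFun (timeRange M ε) n (fun κ (_ : Ext d) => ε κ) := fun n =>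
    unifFun_const n ⟨1, fun κ => by rw [norm_of_nonneg (hε κ).le]; exact hε1 κ⟩
  -- Order zero is Gronwall's inequality; the growth rate O(ε) over a time O(1 / ε) leaves a
  -- constant.
  have h0 : ∀ {A : PhaseIndex d → Ω → Ext d → Phase d} (_ : ∀ j, UnifFun (timeRange M ε) 0 (A j))
      {Y f : Ω → Ext d → Phase d} (_ : UnifFun (timeRange M ε) 0 f)
      (_ : ∀ κ, Smooth (Y κ)) {c : Ω → Phase d} (_ : ∃ C, ∀ κ, ‖c κ‖ ≤ C)
      (_ : ∀ κ p, Y κ (0, p) = c κ)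
      (_ : ∀ κ x, 𝜕 (extVec none) (Y κ) x = ε κ • (∑ j, phaseCoord j (Y κ x) • A j κ x + f κ x)),
      UnifFun (timeRange M ε) 0 Y := by
    intro A hA Y f hf hY c ⟨C, hC⟩ hY0 hYt
    choose hAs K hK using hA
    obtain ⟨hfs, L, hL⟩ := hf
    refine ⟨hY, (C + |L|) * exp ((1 + ∑ j, |K j|) * M), fun κ x hx => ?_⟩
    obtain ⟨t, p⟩ := x
    have hmem : ∀ τ ∈ Set.uIcc 0 t, τ ∈ timeRange M ε κ := fun τ hτ => by
      have h1 : |τ| ≤ |t| := by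
        have := Set.abs_sub_left_of_mem_uIcc hτ
        simpa using this
      exact (mul_le_mul_of_nonneg_left h1 (hε κ).le).trans hx
    have h1 := norm_le_of_norm_deriv_le (y := fun τ => Y κ (τ, p))
      (y' := fun τ => 𝜕 (extVec none) (Y κ) (τ, p)) (K := 1 + ∑ j, |K j|) (L := |L|)
      (a := 0) (t := t) (hε κ) (le_add_of_nonneg_right (sum_nonneg fun j _ => abs_nonneg _))
      (abs_nonneg L)
      (fun τ _ => by
        have h2 := ((hY κ).diff_infty (τ, p)).hasFDerivAt.comp_hasDerivAt τ
          ((hasDerivAt_id τ).prodMk (hasDerivAt_const τ p))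
        exact h2)
      (fun τ hτ => by
        rw [hYt, norm_smul, norm_of_nonneg (hε κ).le]
        refine mul_le_mul_of_nonneg_left ((norm_add_le _ _).trans (add_le_add ?_
          ((hL κ (τ, p) (hmem τ hτ)).trans (le_abs_self L)))) (hε κ).le
        refine (norm_sum_le _ _).trans ?_
        have h3 : ∑ j, ‖phaseCoord j (Y κ (τ, p)) • A j κ (τ, p)‖ ≤ ∑ j, |K j| * ‖Y κ (τ, p)‖ := by
          refine sum_le_sum fun j _ => ?_
          rw [norm_smul, mul_comm]
          exact mul_le_mul ((hK j κ (τ, p) (hmem τ hτ)).trans (le_abs_self _))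
            (abs_phaseCoord_le j _) (norm_nonneg _) (abs_nonneg _)
        rw [← sum_mul] at h3
        nlinarith [norm_nonneg (Y κ (τ, p))])
    refine h1.trans ?_
    rw [hY0, sub_zero]
    have h5 : ε κ * |t| ≤ M := hx
    have h6 : 0 ≤ ∑ j, |K j| := sum_nonneg fun j _ => abs_nonneg _
    have h7 : 0 ≤ C := (norm_nonneg _).trans (hC κ)
    gcongr
    exact hC κ
  induction n generalizing Y f c with
  | zero => exact h0 hA hf hY hc hY0 hYt
  | succ n ih =>
    have hYn : UnifFun (timeRange M ε) n Y := ih (fun j => (hA j).pred) hf.pred hY hc hY0 hYt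
    refine ⟨h0 (fun j => (hA j).zero) hf.zero hY hc hY0 hYt, fun i => ?_⟩
    rcases i with _ | i
    · simp only [fun κ => show 𝜕 (extVec none) (Y κ) = _ from funext fun x => hYt κ x]
      exact (hεu n).smul ((UnifFun.sum _ fun j => (hYn.clm (phaseCoord j)).smul (hA j).pred).add
        hf.pred)
    · have hcs (j : PhaseIndex d) (κ : Ω) : Smooth fun x => phaseCoord j (Y κ x) :=
        (phaseCoord j).contDiff.comp (hY κ)
      have hcA (j : PhaseIndex d) (κ : Ω) : Smooth fun x => phaseCoord j (Y κ x) • A j κ x :=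
        (hcs j κ).smul ((hA j).smooth κ)
      refine ih (fun j => (hA j).pred)
        (f := fun κ x => ∑ j, phaseCoord j (Y κ x) • 𝜕 (extVec (some i)) (A j κ) x +
          𝜕 (extVec (some i)) (f κ) x)
        ((UnifFun.sum _ fun j => (hYn.clm (phaseCoord j)).smul ((hA j).2 (some i))).add
          (hf.2 (some i)))
        (fun κ => (hY κ).dirDeriv _) (c := fun _ => 0) ⟨0, fun _ => by simp⟩ ?_ ?_
      · intro κ p
        have h1 := congrFun (dirDeriv_slice_right (hY κ) 0 (phaseVec i)) p
        simp only [hY0, dirDeriv_const] at h1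
        exact h1.symm
      · intro κ x
        rw [dirDeriv_comm (hY κ), show 𝜕 (extVec none) (Y κ) = _ from funext fun x => hYt κ x,
          dirDeriv_const_smul ((ContDiff.sum fun j _ => hcA j κ).add (hf.smooth κ)),
          dirDeriv_add (ContDiff.sum fun j _ => hcA j κ) (hf.smooth κ),
          dirDeriv_sum fun j => hcA j κ]
        simp only [fun j => dirDeriv_smul (hcs j κ) ((hA j).smooth κ) (extVec (some i)),
          fun j => dirDeriv_clm_comp (hY κ) (phaseCoord j) (extVec (some i)),
          sum_add_distrib]
        congr 1
        abel

/-! ### Hamiltonian flows at unit scale -/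

/-- The basis of phase space which is symplectically dual to the standard basis. -/
def dualVec : PhaseIndex d → Phase d
  | inl i => -phaseVec (inr i)
  | inr i => phaseVec (inl i)

lemma symp_dualVec (v : Phase d) (j : PhaseIndex d) : symp v (dualVec j) = phaseCoord j v := by
  rcases j with i | i <;>
    simp [dualVec, phaseVec, symp_apply, phaseCoord, stdVec, EuclideanSpace.inner_single_right]

/-- The Hamiltonian vector field of `h`. -/
def hamVec (h : Ext d → ℝ) (x : Ext d) : Phase d := ∑ j, 𝜕 (extVec (some j)) h x • dualVec j

lemma symp_hamVec (h : Ext d → ℝ) (v : Phase d) (x : Ext d) :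
    symp v (hamVec h x) = fderiv ℝ h x (0, v) := by
  rw [fderiv_eq_sum_extCoord, Fintype.sum_option]
  simp [hamVec, symp_dualVec, extCoord, mul_comm]

lemma contDiff_hamVec {h : Ext d → ℝ} (hh : Smooth h) : Smooth (hamVec h) :=
  ContDiff.sum fun _ _ => (hh.dirDeriv _).smul contDiff_const

/-- Families of slowly varying Hamiltonians, together with their flows. -/
structure HamFamily (ε : Ω → ℝ) (h : Ω → Ext d → ℝ) (φ : Ω → Ext d → Phase d) :
    Prop where
  pos : ∀ κ, 0 < ε κ
  le_one : ∀ κ, ε κ ≤ 1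
  bdd : ∀ κ, BddSymbol (h κ)
  first : ∀ j, UnifSym fun κ => 𝜕 (extVec j) (h κ)
  second : ∀ i j, UnifSym fun κ x => (ε κ)⁻¹ * 𝜕 (extVec i) (𝜕 (extVec j) (h κ)) x
  flow_smooth : ∀ κ, Smooth (φ κ)
  flow_zero : ∀ κ p, φ κ (0, p) = p
  flow_deriv : ∀ κ x, 𝜕 (extVec none) (φ κ) x = hamVec (h κ) (x.1, φ κ x)

/-- The space-time trajectory of the flow `φ`. -/
def traj (φ : Ext d → Phase d) (x : Ext d) : Ext d := (x.1, φ x)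

lemma contDiff_traj {φ : Ext d → Phase d} (hφ : Smooth φ) : Smooth (traj φ) :=
  contDiff_fst.prodMk hφ

lemma dirDeriv_traj {φ : Ext d → Phase d} (hφ : Smooth φ) (v x : Ext d) :
    𝜕 v (traj φ) x = (v.1, 𝜕 v φ x) := by
  have h1 : HasFDerivAt (traj φ) ((fst ℝ ℝ (Phase d)).prod (fderiv ℝ φ x)) x :=
    hasFDerivAt_fst.prodMk (hφ.diff_infty x).hasFDerivAt
  rw [h1.dirDeriv_eq]
  rfl

namespace HamFamily

variable {ε : Ω → ℝ} {h : Ω → Ext d → ℝ} {φ : Ω → Ext d → Phase d} {M : ℝ}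

lemma unifFun_dirDeriv_traj (hF : HamFamily ε h φ) {i : ExtIndex d}
    (hi : UnifFun (timeRange M ε) n fun κ => 𝜕 (extVec i) (φ κ)) :
    UnifFun (timeRange M ε) n fun κ => 𝜕 (extVec i) (traj (φ κ)) := by
  have h1 : (fun κ => 𝜕 (extVec i) (traj (φ κ))) = fun κ x => ((extVec i).1, (0 : Phase d)) +
        ContinuousLinearMap.inr ℝ ℝ (Phase d) (𝜕 (extVec i) (φ κ) x) := by
    funext κ x
    simp [dirDeriv_traj (hF.flow_smooth κ)]
  rw [h1]
  exact (unifFun_const n (c := fun _ => ((extVec i).1, (0 : Phase d))) ⟨_, fun _ => le_rfl⟩).add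
    (hi.clm _)

/-- Time derivatives are read off Hamilton's equation, whose right side has uniformly bounded first
derivatives of `h`. Phase space derivatives solve the variational equation, whose coefficients are
`ε` times bounded functions along the trajectory; their derivatives up to order `n` involve the flow
derivatives only to orders covered by the strong induction. -/
lemma unifFun_dirDeriv_flow (hF : HamFamily ε h φ) (n : ℕ) (i : ExtIndex d) :
    UnifFun (timeRange M ε) n fun κ => 𝜕 (extVec i) (φ κ) := by
  induction n using Nat.strong_induction_on generalizing i with
  | _ n ih =>
  have htraj : ∀ m < n, ∀ i, UnifFun (timeRange M ε) m
      (fun κ => 𝜕 (extVec i) (traj (φ κ))) := fun m hm i =>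
    hF.unifFun_dirDeriv_traj (ih m hm i)
  have hts := fun κ => contDiff_traj (hF.flow_smooth κ)
  rcases i with _ | i
  · simp only [fun κ => show 𝜕 (extVec none) (φ κ) = _ from funext (hF.flow_deriv κ), hamVec]
    refine UnifFun.sum _ fun j => ?_
    exact UnifFun.smul ((hF.first (some j)).comp hts htraj)
      (unifFun_const n (c := fun _ => dualVec j) ⟨_, fun _ => le_rfl⟩)
  · refine unifFun_of_linear hF.pos hF.le_one (f := fun _ _ => 0)
      (A := fun j κ x => ∑ k, ((ε κ)⁻¹ * 𝜕 (extVec (some j)) (𝜕 (extVec (some k))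
        (h κ)) (traj (φ κ) x)) • dualVec k) (c := fun _ => phaseVec i) (fun j => ?_)
        (unifFun_const n ⟨0, fun _ => by simp⟩) (fun κ => (hF.flow_smooth κ).dirDeriv _)
        ⟨_, fun _ => le_rfl⟩ (fun κ p => ?_) (fun κ x => ?_)
    · refine UnifFun.sum _ fun k => ?_
      exact UnifFun.smul ((hF.second (some j) (some k)).comp hts htraj)
        (unifFun_const n (c := fun _ => dualVec k) ⟨_, fun _ => le_rfl⟩)
    · have h1 := congrFun (dirDeriv_slice_right (hF.flow_smooth κ) 0 (phaseVec i)) p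
      simp only [hF.flow_zero] at h1
      exact h1.symm.trans (by simp [dirDeriv])
    · have hX := contDiff_hamVec (hF.bdd κ).smooth
      have h1 : 𝜕 (extVec (some i)) (fun x => hamVec (h κ) (traj (φ κ) x)) x =
          fderiv ℝ (hamVec (h κ)) (traj (φ κ) x) (𝜕 (extVec (some i)) (traj (φ κ)) x) :=
        dirDeriv_eq (f := fun x => hamVec (h κ) (traj (φ κ) x))
          ((hX.diff_infty _).hasFDerivAt.comp x ((hts κ).diff_infty x).hasFDerivAt) _
      rw [dirDeriv_comm (hF.flow_smooth κ),
        show 𝜕 (extVec none) (φ κ) = fun x => hamVec (h κ) (traj (φ κ) x) from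
          funext (hF.flow_deriv κ), h1, dirDeriv_traj (hF.flow_smooth κ), fderiv_eq_sum_extCoord,
          Fintype.sum_option, add_zero]
      have h2 : ∀ j y, 𝜕 (extVec j) (hamVec (h κ)) y =
          ∑ k, 𝜕 (extVec j) (𝜕 (extVec (some k)) (h κ)) y • dualVec k := by
        intro j y
        unfold hamVec
        have hs : ∀ k, Smooth (𝜕 (extVec (some k)) (h κ)) := fun k => (hF.bdd κ).smooth.dirDeriv _
        have hs' : ∀ k, Smooth fun y => 𝜕 (extVec (some k)) (h κ) y • dualVec k :=
          fun k => (hs k).smul contDiff_const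
        rw [dirDeriv_sum hs']
        refine sum_congr rfl fun k _ => ?_
        rw [dirDeriv_smul (hs k) contDiff_const, dirDeriv_const]
        simp
      simp only [h2]
      rw [smul_sum (r := ε κ)]
      have h3 : extCoord (none : ExtIndex d) ((extVec (some i)).1,
          𝜕 (extVec (some i)) (φ κ) x) = 0 := rfl
      simp only [h3, zero_smul, Finset.sum_const_zero, zero_add]
      refine sum_congr rfl fun j _ => ?_
      change phaseCoord j _ • _ = _
      rw [smul_comm (ε κ), smul_sum (r := ε κ)]
      congr 1
      refine sum_congr rfl fun k _ => ?_
      rw [smul_smul, mul_inv_cancel_left₀ (hF.pos κ).ne']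

lemma unifFun_comp_traj (hF : HamFamily ε h φ) {g : Ω → Ext d → F} (hg : UnifSym g) (n : ℕ) :
    UnifFun (timeRange M ε) n fun κ x => g κ (traj (φ κ) x) :=
  hg.comp (fun κ => contDiff_traj (hF.flow_smooth κ)) fun m _ i =>
    hF.unifFun_dirDeriv_traj (hF.unifFun_dirDeriv_flow m i)

lemma unifFun_hamVec (hF : HamFamily ε h φ) (n : ℕ) :
    UnifFun (timeRange M ε) n fun κ x => hamVec (h κ) (traj (φ κ) x) :=
  UnifFun.sum _ fun j => UnifFun.smul (hF.unifFun_comp_traj (hF.first (some j)) n)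
    (unifFun_const n (c := fun _ => dualVec j) ⟨_, fun _ => le_rfl⟩)

end HamFamily
/-! ### Uniform families of smooth vectors -/

namespace HeisenbergSystem

variable (S)

/-- Families of smooth families of smooth vectors, whose derivatives up to order `n` obey uniform
Sobolev bounds at all times in `T`. -/
def UnifVec (T : Ω → Set ℝ) : ℕ → (Ω → Ext d → H) → Prop
  | 0, V => (∀ κ, S.SmoothFam (V κ)) ∧ ∀ k, ∃ C, ∀ κ x, x.1 ∈ T κ → S.sob k (V κ x) ≤ C
  | n + 1, V => ((∀ κ, S.SmoothFam (V κ)) ∧ ∀ k, ∃ C, ∀ κ x, x.1 ∈ T κ → S.sob k (V κ x) ≤ C) ∧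
      ∀ i, UnifVec T n (fun κ => 𝜕 (extVec i) (V κ))

variable {S}

lemma UnifVec.zero {V : Ω → Ext d → H} (hV : S.UnifVec T n V) : S.UnifVec T 0 V := by
  cases n with
  | zero => exact hV
  | succ n => exact hV.1

lemma UnifVec.smoothFam {V : Ω → Ext d → H} (hV : S.UnifVec T n V) (κ : Ω) :
    S.SmoothFam (V κ) := hV.zero.1 κ

lemma UnifVec.pred {V : Ω → Ext d → H} (hV : S.UnifVec T (n + 1) V) : S.UnifVec T n V := by
  induction n generalizing V with
  | zero => exact hV.zero
  | succ n ih => exact ⟨hV.zero, fun i => ih (hV.2 i)⟩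

lemma UnifVec.add {V W : Ω → Ext d → H} (hV : S.UnifVec T n V)
    (hW : S.UnifVec T n W) : S.UnifVec T n (fun κ x => V κ x + W κ x) := by
  have h0 : ∀ {V W : Ω → Ext d → H}, S.UnifVec T 0 V → S.UnifVec T 0 W →
      S.UnifVec T 0 (fun κ x => V κ x + W κ x) := fun {V W} ⟨hV, hC⟩ ⟨hW, hD⟩ =>
    ⟨fun κ => (hV κ).add (hW κ), fun k => by
      obtain ⟨C, hC⟩ := hC k
      obtain ⟨D, hD⟩ := hD k
      refine ⟨2 * C + 2 * D, fun κ x hx =>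
        (sob_add_le ((hV κ).smoothVec x) ((hW κ).smoothVec x) k).trans ?_⟩
      linarith [hC κ x hx, hD κ x hx]⟩
  induction n generalizing V W with
  | zero => exact h0 hV hW
  | succ n ih =>
    refine ⟨h0 hV.zero hW.zero, fun i => ?_⟩
    simp only [fun κ => dirDeriv_add (hV.smoothFam κ).contDiff (hW.smoothFam κ).contDiff (extVec i)]
    exact ih (hV.2 i) (hW.2 i)

lemma unifVec_zero (n : ℕ) : S.UnifVec T n fun (_ : Ω) (_ : Ext d) => (0 : H) := by
  have h0 : S.UnifVec T 0 fun (_ : Ω) (_ : Ext d) => (0 : H) := by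
    have hz : S.SmoothVec (0 : H) := by
      unfold SmoothVec
      simp only [map_zero]
      exact contDiff_const
    refine ⟨fun κ => hz.const, fun k => ⟨0, fun κ x _ => ?_⟩⟩
    have := sob_smul hz k 0
    rw [zero_smul] at this
    rw [this]
    simp
  induction n with
  | zero => exact h0
  | succ n ih => exact ⟨h0, fun i => by simpa only [dirDeriv_const] using ih⟩

lemma UnifVec.sum (s : Finset ι) {V : ι → Ω → Ext d → H}
    (hV : ∀ i, S.UnifVec T n (V i)) : S.UnifVec T n (fun κ x => ∑ i ∈ s, V i κ x) := by
  classical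
  induction s using Finset.induction_on with
  | empty => simpa using unifVec_zero n
  | insert i s hi ih => simpa only [sum_insert hi] using (hV i).add ih

lemma UnifVec.const_smul {V : Ω → Ext d → H} (hV : S.UnifVec T n V) (c : ℂ) :
    S.UnifVec T n (fun κ x => c • V κ x) := by
  have h0 : ∀ {V : Ω → Ext d → H}, S.UnifVec T 0 V →
      S.UnifVec T 0 (fun κ x => c • V κ x) := fun {V} ⟨hV, hD⟩ =>
    ⟨fun κ => (hV κ).smul contDiff_const, fun k => by
      obtain ⟨D, hD⟩ := hD k
      refine ⟨‖c‖ ^ 2 * D, fun κ x hx => ?_⟩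
      rw [sob_smul ((hV κ).smoothVec x)]
      exact mul_le_mul_of_nonneg_left (hD κ x hx) (by positivity)⟩
  induction n generalizing V with
  | zero => exact h0 hV
  | succ n ih =>
    refine ⟨h0 hV.zero, fun i => ?_⟩
    simp only [fun κ => dirDeriv_const_smul (hV.smoothFam κ).contDiff c (extVec i)]
    exact ih (hV.2 i)

lemma dirDeriv_ofReal {c : Q → ℝ} (hc : Smooth c) (v : Q) :
    𝜕 v (fun q => 𝕔(c q)) = fun q => 𝕔(𝜕 v c q) :=
  dirDeriv_clm_comp hc ofRealCLM v

lemma UnifVec.smul {c : Ω → Ext d → ℝ} {V : Ω → Ext d → H}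
    (hc : UnifFun T n c) (hV : S.UnifVec T n V) :
    S.UnifVec T n (fun κ x => 𝕔(c κ x) • V κ x) := by
  have h0 : ∀ {c : Ω → Ext d → ℝ} {V : Ω → Ext d → H}, UnifFun T 0 c → S.UnifVec T 0 V →
      S.UnifVec T 0 (fun κ x => 𝕔(c κ x) • V κ x) := fun {c V} ⟨hc, C, hC⟩ ⟨hV, hD⟩ =>
    ⟨fun κ => (hV κ).smul (ofRealCLM.contDiff.comp (hc κ)), fun k => by
      obtain ⟨D, hD⟩ := hD k
      refine ⟨C ^ 2 * D, fun κ x hx => ?_⟩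
      rw [sob_smul ((hV κ).smoothVec x), norm_real]
      exact mul_le_mul (pow_le_pow_left₀ (norm_nonneg _) (hC κ x hx) 2) (hD κ x hx)
        (S.sob_nonneg _ _) (by positivity)⟩
  induction n generalizing c V with
  | zero => exact h0 hc hV
  | succ n ih =>
    refine ⟨h0 hc.zero hV.zero, fun i => ?_⟩
    have h1 : ∀ κ, Smooth fun x => 𝕔(c κ x) := fun κ => ofRealCLM.contDiff.comp (hc.smooth κ)
    simp only [fun κ => dirDeriv_smul (h1 κ) (hV.smoothFam κ).contDiff (extVec i),
      fun κ => dirDeriv_ofReal (hc.smooth κ)]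
    exact (ih (hc.2 i) hV.pred).add (ih hc.pred (hV.2 i))

lemma UnifVec.gen {V : Ω → Ext d → H} (hV : S.UnifVec T n V) (j : PhaseIndex d) :
    S.UnifVec T n (fun κ x => S.gen (phaseVec j) (V κ x)) := by
  have h0 : ∀ {V : Ω → Ext d → H}, S.UnifVec T 0 V →
      S.UnifVec T 0 (fun κ x => S.gen (phaseVec j) (V κ x)) := fun {V} ⟨hV, hD⟩ =>
    ⟨fun κ => (hV κ).gen _, fun k => by
      obtain ⟨D, hD⟩ := hD (k + 1)
      exact ⟨D, fun κ x hx => (S.sob_gen_le k j _).trans (hD κ x hx)⟩⟩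
  induction n generalizing V with
  | zero => exact h0 hV
  | succ n ih =>
    refine ⟨h0 hV.zero, fun i => ?_⟩
    simp only [fun κ => show 𝜕 (extVec i) (fun x => S.gen (phaseVec j) (V κ x)) = _ from
      funext fun x => dirDeriv_gen (hV.smoothFam κ) (phaseVec j) (extVec i) x]
    exact ih (hV.2 i)

lemma UnifVec.gen_along {V : Ω → Ext d → H} (hV : S.UnifVec T n V)
    {v : Ω → Ext d → Phase d} (hv : UnifFun T n v) :
    S.UnifVec T n (fun κ x => S.gen (v κ x) (V κ x)) := by
  simp only [fun κ x => S.gen_eq_sum (v κ x) (V κ x)]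
  exact UnifVec.sum _ fun j => UnifVec.smul (hv.clm (phaseCoord j)) (hV.gen j)

lemma UnifSym.exists_derivBound {h : Ω → Ext d → ℝ}
    (hh : ∀ j, UnifSym fun κ => 𝜕 (extVec j) (h κ)) (n : ℕ) :
    ∃ M, 0 ≤ M ∧ ∀ κ, DerivBound n M (h κ) := by
  choose C hC using fun (j : ExtIndex d) => (hh j).bound
  have hfin : {l : List (ExtIndex d) | l.length ≤ n}.Finite := finite_length_le _ _
  refine ⟨∑ j, ∑ l ∈ hfin.toFinset, |C j l|,
    sum_nonneg fun j _ => sum_nonneg fun l _ => abs_nonneg _, fun κ l h0 hl e => ?_⟩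
  rcases List.eq_nil_or_concat l with rfl | ⟨l', j, rfl⟩
  · exact absurd rfl h0
  · rw [List.concat_eq_append] at hl ⊢
    rw [map_append, derivs_append]
    have h1 := hC j l' κ e
    have h2 := single_le_sum (f := fun l => |C j l|) (fun l _ => abs_nonneg _)
      (show l' ∈ hfin.toFinset by simp at hl ⊢; omega)
    have h3 := single_le_sum (f := fun j => ∑ l ∈ hfin.toFinset, |C j l|)
      (fun j _ => sum_nonneg fun l _ => abs_nonneg _) (Finset.mem_univ j)
    exact h1.trans ((le_abs_self _).trans (h2.trans h3))

/-- Differentiation replaces `h` by `∂_j h` times a derivative of the base point, or acts on `V`.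
All hypotheses concern derivatives of `h` and `f`, since neither is itself uniformly bounded. -/
lemma UnifVec.centered {V : Ω → Ext d → H} (hV : S.UnifVec T n V)
    {h : Ω → Ext d → ℝ} (hb : ∀ κ, BddSymbol (h κ))
    (hh : ∀ j, UnifSym fun κ => 𝜕 (extVec j) (h κ))
    {f : Ω → Ext d → Ext d} (hfs : ∀ κ, Smooth (f κ))
    (hf : ∀ m < n, ∀ i, UnifFun T m (fun κ => 𝜕 (extVec i) (f κ))) :
    S.UnifVec T n (fun κ x => S.centered (h κ) (f κ x) (V κ x)) := by
  have h0 : ∀ {V : Ω → Ext d → H} (_ : S.UnifVec T 0 V) {h : Ω → Ext d → ℝ}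
      (_ : ∀ κ, BddSymbol (h κ)) (_ : ∀ j, UnifSym fun κ => 𝜕 (extVec j) (h κ)),
      S.UnifVec T 0 (fun κ x => S.centered (h κ) (f κ x) (V κ x)) := by
    intro V ⟨hV, hD⟩ h hb hh
    refine ⟨fun κ => (hV κ).centered (hb κ) (hfs κ), fun k => ?_⟩
    obtain ⟨C, hC0, hC⟩ := exists_sob_centered_le S k
    obtain ⟨M, hM0, hM⟩ := UnifSym.exists_derivBound hh (symbolOrder d + k)
    obtain ⟨D, hD⟩ := hD (k + 1)
    exact ⟨C * M ^ 2 * D, fun κ x hx => (hC M (h κ) (hb κ) hM0 (hM κ) (f κ x) (V κ x)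
      ((hV κ).smoothVec x)).trans (mul_le_mul_of_nonneg_left (hD κ x hx) (by positivity))⟩
  induction n generalizing V h with
  | zero => exact h0 hV hb hh
  | succ n ih =>
    refine ⟨h0 hV.zero hb hh, fun i => ?_⟩
    simp only [fun κ => show 𝜕 (extVec i)
      (fun x => S.centered (h κ) (f κ x) (V κ x)) = _ from funext fun x =>
        dirDeriv_centered (hV.smoothFam κ).contDiff (hb κ) (hfs κ) (extVec i) x]
    have hf' : ∀ m < n, ∀ i, UnifFun T m (fun κ => 𝜕 (extVec i) (f κ)) :=
      fun m hm => hf m (hm.trans (Nat.lt_succ_self n))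
    refine UnifVec.add (UnifVec.sum _ fun j => ?_) (ih (hV.2 i) hb hh hf')
    exact UnifVec.smul ((hf n (Nat.lt_succ_self n) i).clm (extCoord j))
      (ih hV.pred (fun κ => (hb κ).dirDeriv j) (fun k => by
        have := (hh k).dirDeriv j
        simpa only [fun κ => dirDeriv_comm (hb κ).smooth (extVec j) (extVec k)] using this) hf')

/-! ### The evolution and its wave packets -/

lemma SmoothVec.dirDeriv_along {u} (hu : S.SmoothVec u) {f : Q → Phase d}
    (hf : Smooth f) (e q : Q) : 𝜕 e (fun q => S.shift (f q) u) q =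
      𝜕 (𝜕 e f q) (fun z => S.shift z u) (f q) := by
  have hu' : Smooth fun z => S.shift z u := hu
  exact dirDeriv_eq (f := fun q => S.shift (f q) u)
    ((hu'.diff_infty (f q)).hasFDerivAt.comp q (hf.diff_infty q).hasFDerivAt) e

lemma dirDeriv_half_symp {f g : Q → Phase d} (hf : Smooth f) (hg : Smooth g)
    (e q : Q) : 𝜕 e (fun q => symp (f q) (g q) / 2) q =
      symp (𝜕 e f q) (g q) / 2 + symp (f q) (𝜕 e g q) / 2 := by
  have h1 : HasFDerivAt (fun q => symp (f q)) (symp.comp (fderiv ℝ f q)) q :=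
    symp.hasFDerivAt.comp q (hf.diff_infty q).hasFDerivAt
  have h2 := (h1.clm_apply (hg.diff_infty q).hasFDerivAt).mul_const (2⁻¹ : ℝ)
  simp only [div_eq_mul_inv]
  rw [dirDeriv_eq (f := fun q => symp (f q) (g q) * 2⁻¹) h2]
  simp [dirDeriv]
  ring

lemma dirDeriv_shift_family {V : Q → H} (hV : S.SmoothFam V) {f : Q → Phase d}
    (hf : Smooth f) (e q : Q) : 𝜕 e (fun q => S.shift (f q) (V q)) q =
      I • S.gen (𝜕 e f q) (S.shift (f q) (V q)) -
        (I * (symp (𝜕 e f q) (f q) / 2 : ℝ)) • S.shift (f q) (V q) +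
        S.shift (f q) (𝜕 e V q) := by
  set F := fun p : Q × Phase d => S.shift p.2 (V p.1) with hFdef
  have hF : Smooth F := hV
  have h1 : 𝜕 e (fun q => F (q, f q)) q = fderiv ℝ F (q, f q) (e, 𝜕 e f q) :=
    dirDeriv_eq (f := fun q => F (q, f q))
      (HasFDerivAt.comp (f := fun q => (q, f q)) q (hF.diff_infty (q, f q)).hasFDerivAt
        ((hasFDerivAt_id q).prodMk (hf.diff_infty q).hasFDerivAt)) e
  have h2 : (e, 𝜕 e f q) = (0, 𝜕 e f q) + (e, 0) := by simp
  rw [h1, h2, map_add]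
  congr 1
  · rw [← dirDeriv_shift_left (hV.smoothVec q)]
    exact (congrFun (dirDeriv_slice_right hF q (𝜕 e f q)) (f q)).symm
  · rw [shift_dirDeriv hV.contDiff]
    exact (congrFun (dirDeriv_slice_left hF (f q) e) q).symm

lemma exists_lipschitz_opAt {h} (hh : BddSymbol h) :
    ∃ K : NNReal, ∀ e, LipschitzWith K fun u : H => -(I • S.opAt h e u) := by
  obtain ⟨C, hC0, hC⟩ := S.exists_norm_op_le
  obtain ⟨M, hM⟩ := hh.exists_symbolBound
  have hM0 := (hM 0).nonneg
  refine ⟨⟨C * M, by positivity⟩, fun e => LipschitzWith.of_dist_le_mul fun u v => ?_⟩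
  rw [dist_eq_norm, dist_eq_norm, ← neg_sub_neg, neg_neg, neg_neg, ← smul_sub, ← map_sub, norm_smul,
    norm_I, one_mul, norm_sub_rev u v]
  exact hC M _ (hM e) (v - u)

variable (S) in
/-- `U t` solves the evolution equation with Hamiltonian `h`, with initial time `s`. -/
structure IsEvolution (h : Ext d → ℝ) (s : ℝ) (U : ℝ → H →L[ℂ] H) : Prop where
  init : ∀ u, U s u = u
  deriv : ∀ t u, HasDerivAt (fun τ => U τ u) (-(I • S.opAt h (t, 0) (U t u))) t

/-- The parameter `q` moves the Hamiltonian to the base point `-q`, as conjugation by a shift does.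
Smoothness of `W` in `q` will express that the evolution preserves smooth vectors. -/
lemma exists_shifted_propagator {h} (hh : BddSymbol h) (s : ℝ) :
    ∃ W : Ext d → H →L[ℝ] H, Smooth W ∧ (∀ q, W (0, q) = 1) ∧ ∀ t q u,
      HasDerivAt (fun t => W (t - s, q) u) (-(I • S.opAt h (t, -q) (W (t - s, q) u))) t := by
  have hB : Smooth fun p : Ext d => -(I •
      restrictScalarsL ℂ H H ℝ ℝ (S.opAt h (s + p.1, -p.2))) := by
    have h1 : Smooth fun p : Ext d => S.opAt h (s + p.1, -p.2) :=
      (contDiff_opAt hh).comp ((contDiff_const.add contDiff_fst).prodMk contDiff_snd.neg)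
    exact (((ContinuousLinearMap.contDiff _).comp h1).const_smul I).neg
  obtain ⟨W, hW, hW0, hWt⟩ := exists_linear_propagator _ hB
  refine ⟨W, hW, hW0, fun t q u => ?_⟩
  have h1 := ((hWt (t - s) q).comp_sub_const t s).clm_apply (hasDerivAt_const t u)
  refine h1.congr_deriv ?_
  simp

lemma exists_isEvolution {h} (hh : BddSymbol h) (s : ℝ) : ∃ U, S.IsEvolution h s U := by
  obtain ⟨W, -, hW0, hWt⟩ := exists_shifted_propagator (S := S) hh s
  obtain ⟨K, hK⟩ := exists_lipschitz_opAt (S := S) hh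
  -- The theory of linear equations delivers real linear operators; complex linearity follows from
  -- uniqueness.
  have hlin (t : ℝ) (c : ℂ) (u : H) : W (t - s, 0) (c • u) = c • W (t - s, 0) u := by
    have := eq_of_hasDerivAt_lipschitz (f := fun t u => -(I • S.opAt h (t, -0) u))
      (fun t => hK (t, -0)) (y := fun t => W (t - s, 0) (c • u)) (z := fun t => c • W (t - s, 0) u)
      (t₀ := s) (fun t => hWt t 0 (c • u)) (fun t => ?_) (by simp [hW0])
    · exact congrFun this t
    · refine ((hWt t 0 u).const_smul c).congr_deriv ?_
      simp only [map_smul, smul_neg, smul_comm c]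
  refine ⟨fun t => ⟨⟨⟨W (t - s, 0), map_add _⟩, hlin t⟩, (W (t - s, 0)).continuous⟩, fun u => ?_, fun t u => ?_⟩
  · change W (s - s, 0) u = u
    rw [sub_self, hW0]; rfl
  · have := hWt t 0 u
    rw [neg_zero] at this
    exact this

namespace IsEvolution

variable {h : Ext d → ℝ} {s : ℝ} {U : ℝ → H →L[ℂ] H}

lemma eq_of_hasDerivAt (hU : S.IsEvolution h s U) (hh : BddSymbol h) {y : ℝ → H}
    (hy : ∀ t, HasDerivAt y (-(I • S.opAt h (t, 0) (y t))) t) (t : ℝ) :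
    y t = U t (y s) := by
  obtain ⟨K, hK⟩ := exists_lipschitz_opAt (S := S) hh
  exact congrFun (eq_of_hasDerivAt_lipschitz (f := fun t u => -(I • S.opAt h (t, 0) u))
    (fun t => hK (t, 0)) hy (hU.deriv · (y s)) (hU.init (y s)).symm) t

/-- By covariance and uniqueness, `shift z (U t u)` is the propagator at base point `-z` applied to
`shift z u`; the right side is jointly smooth. -/
lemma smoothFam (hU : S.IsEvolution h s U) (hh : BddSymbol h) {V : Q → H} (hV : S.SmoothFam V)
    {f : Q → ℝ} (hf : Smooth f) : S.SmoothFam fun q => U (f q) (V q) := by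
  obtain ⟨W, hW, hW0, hWt⟩ := exists_shifted_propagator (S := S) hh s
  obtain ⟨K, hK⟩ := exists_lipschitz_opAt (S := S) hh
  have key (z : Phase d) (t : ℝ) (u : H) : S.shift z (U t u) = W (t - s, z) (S.shift z u) := by
    refine congrFun (eq_of_hasDerivAt_lipschitz (f := fun t u => -(I • S.opAt h (t, -z) u))
      (fun t => hK (t, -z)) (y := fun t => S.shift z (U t u)) (t₀ := s) (fun t => ?_)
      (fun t => hWt t z (S.shift z u)) (by simp [hW0, hU.init])) t
    have h1 := ((S.shift z).restrictScalars ℝ).hasFDerivAt.comp_hasDerivAt t (hU.deriv t u)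
    refine h1.congr_deriv ?_
    simp only [ContinuousLinearMap.coe_restrictScalars', map_neg, map_smul, shift_opAt hh]
    simp
  unfold SmoothFam
  simp only [key]
  have h1 : Smooth fun p : Q × Phase d => W (f p.1 - s, p.2) :=
    hW.comp (((hf.comp contDiff_fst).sub contDiff_const).prodMk contDiff_snd)
  exact h1.clm_apply hV.joint

end IsEvolution

/-- A Hamiltonian with its flow, its action and its evolution with initial time `s`. -/
structure IsPropagation (S : HeisenbergSystem d H) (h : Ext d → ℝ)
    (φ : Ext d → Phase d) (θ : Ext d → ℝ) (s : ℝ) (U : ℝ → H →L[ℂ] H) : Prop where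
  bdd : BddSymbol h
  evol : S.IsEvolution h s U
  flow_smooth : Smooth φ
  flow_deriv : ∀ x, 𝜕 (extVec none) φ x = hamVec h (traj φ x)
  action_smooth : Smooth θ
  action_init : ∀ p, θ (s, p) = 0
  action_deriv : ∀ x, 𝜕 (extVec none) θ x =
    -h (traj φ x) + symp (φ x) (hamVec h (traj φ x)) / 2

variable (S) in
/-- The evolved coherent family, brought back to the origin of phase space. -/
def packet (φ : Ext d → Phase d) (θ : Ext d → ℝ) (s : ℝ) (U : ℝ → H →L[ℂ] H) (u : H)
    (x : Ext d) : H :=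
  expI (-θ x) • S.shift (-φ x) (U x.1 (S.shift (φ (s, x.2)) u))

namespace IsPropagation

variable {h : Ext d → ℝ} {φ : Ext d → Phase d} {θ : Ext d → ℝ} {s : ℝ}
  {U : ℝ → H →L[ℂ] H}

lemma smoothFam_inner (hP : S.IsPropagation h φ θ s U) {u} (hu : S.SmoothVec u) :
    S.SmoothFam fun x : Ext d => U x.1 (S.shift (φ (s, x.2)) u) :=
  hP.evol.smoothFam hP.bdd ((hu.const (Q := Ext d)).shift
    (f := fun x => φ (s, x.2)) (hP.flow_smooth.comp (contDiff_const.prodMk contDiff_snd)))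
    contDiff_fst

lemma smoothFam_packet (hP : S.IsPropagation h φ θ s U) {u} (hu : S.SmoothVec u) :
    S.SmoothFam (S.packet φ θ s U u) :=
  ((hP.smoothFam_inner hu).shift hP.flow_smooth.neg).smul (c := fun x => expI (-θ x))
    (contDiff_expI.comp hP.action_smooth.neg)

lemma packet_init (hP : S.IsPropagation h φ θ s U) (u : H) (p : Phase d) :
    S.packet φ θ s U u (s, p) = u := by
  simp [packet, hP.action_init, hP.evol.init, S.shift_neg_shift]

/-- The quantity `dθ - symp φ dφ / 2` is constant in time by Hamilton's equations, in which the two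
halves of `symp` combine to cancel `dh(dφ)`. Its value at time `s`, where `θ` vanishes, gives the
second term. -/
lemma dirDeriv_action (hP : S.IsPropagation h φ θ s U) (v : Phase d) (x : Ext d) :
    𝜕 (0, v) θ x = symp (φ x) (𝜕 (0, v) φ x) / 2 - symp (φ (s, x.2)) (𝜕 (0, v) φ (s, x.2)) / 2 := by
  obtain ⟨t, p⟩ := x
  have hφ := hP.flow_smooth
  have hX : Smooth fun x => hamVec h (traj φ x) :=
    (contDiff_hamVec hP.bdd.smooth).comp (contDiff_traj hφ)
  have hht : Smooth fun x => h (traj φ x) := hP.bdd.smooth.comp (contDiff_traj hφ)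
  have hd : ∀ t, HasDerivAt (fun t => 𝜕 (0, v) θ (t, p) -
      symp (φ (t, p)) (𝜕 (0, v) φ (t, p)) / 2) 0 t := by
    intro t
    have hF : Smooth fun x => 𝜕 (0, v) θ x - symp (φ x) (𝜕 (0, v) φ x) / 2 :=
      (hP.action_smooth.dirDeriv _).sub ((contDiff_symp hφ (hφ.dirDeriv _)).div_const 2)
    have h1 := (hF.diff_infty (t, p)).hasFDerivAt.comp_hasDerivAt t
      ((hasDerivAt_id t).prodMk (hasDerivAt_const t p))
    refine h1.congr_deriv ?_
    change 𝜕 (extVec none) (fun x => 𝜕 (0, v) θ x - symp (φ x) (𝜕 (0, v) φ x) / 2) (t, p) = 0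
    have hsφ : Smooth fun x => symp (φ x) (𝜕 (0, v) φ x) / 2 :=
      (contDiff_symp hφ (hφ.dirDeriv _)).div_const 2
    have hsX : Smooth fun x => symp (φ x) (hamVec h (traj φ x)) / 2 :=
      (contDiff_symp hφ hX).div_const 2
    rw [dirDeriv_sub (hP.action_smooth.dirDeriv _) hsφ]
    simp only
    rw [dirDeriv_half_symp hφ (hφ.dirDeriv _), dirDeriv_comm hP.action_smooth,
      show 𝜕 (extVec none) θ = fun x => -h (traj φ x) + symp (φ x) (hamVec h (traj φ x)) / 2
        from funext hP.action_deriv, dirDeriv_comm hφ (extVec none),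
      show 𝜕 (extVec none) φ = fun x => hamVec h (traj φ x) from funext hP.flow_deriv,
      dirDeriv_add hht.neg hsX]
    simp only
    rw [dirDeriv_half_symp hφ hX]
    have h2 : 𝜕 (0, v) (fun x => -h (traj φ x)) (t, p) =
        -symp (𝜕 (0, v) φ (t, p)) (hamVec h (traj φ (t, p))) := by
      rw [symp_hamVec]
      have h3 := ((hP.bdd.smooth.diff_infty (traj φ (t, p))).hasFDerivAt.comp (t, p)
        ((contDiff_traj hφ).diff_infty (t, p)).hasFDerivAt).neg
      rw [dirDeriv_eq (f := fun x => -h (traj φ x)) h3]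
      change -fderiv ℝ h _ (𝜕 (0, v) (traj φ) (t, p)) = _
      rw [dirDeriv_traj hφ]
    rw [h2, symp_swap (hamVec h (traj φ (t, p)))]
    ring
  have h0 := is_const_of_deriv_eq_zero (fun t => (hd t).differentiableAt) (fun t => (hd t).deriv) t s
  have hi : 𝜕 (0, v) θ (s, p) = 0 := by
    have h1 := congrFun (dirDeriv_slice_right hP.action_smooth s v) p
    simp only [hP.action_init, dirDeriv_const] at h1
    exact h1.symm
  rw [hi] at h0
  simp only
  linarith

/-- The derivative of the action cancels `h` at the trajectory and the cocycle term of the shift.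
The generator of the Hamiltonian vector field has symbol minus the linear part of `h`, so what acts
on the packet is the quantized Taylor remainder of second order. -/
lemma dirDeriv_packet_time (hP : S.IsPropagation h φ θ s U) {u} (hu : S.SmoothVec u)
    (x : Ext d) : 𝜕 (extVec none) (S.packet φ θ s U u) x =
      -I • (S.gen (hamVec h (traj φ x)) (S.packet φ θ s U u x) +
        S.centered h (traj φ x) (S.packet φ θ s U u x)) := by
  have hw := hP.smoothFam_inner hu
  set w := fun x : Ext d => U x.1 (S.shift (φ (s, x.2)) u) with hwdef
  have hφ := hP.flow_smooth
  have hwt : 𝜕 (extVec none) w x = -(I • S.opAt h (x.1, 0) (w x)) := by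
    have h1 := (hw.contDiff.diff_infty x).hasFDerivAt.comp_hasDerivAt x.1
      ((hasDerivAt_id x.1).prodMk (hasDerivAt_const x.1 x.2))
    exact h1.unique (hP.evol.deriv x.1 (S.shift (φ (s, x.2)) u))
  have hsw : Smooth fun x => S.shift (-φ x) (w x) := (hw.shift hφ.neg).contDiff
  have hv : S.SmoothVec (S.shift (-φ x) (w x)) := (hw.smoothVec x).shift _
  have hc : Smooth fun x => -θ x := hP.action_smooth.neg
  have hdn {F : Type} [NormedAddCommGroup F] [NormedSpace ℝ F] (f : Ext d → F) (v) :
      dirDeriv v (fun x => -f x) x = -dirDeriv v f x := by simp [dirDeriv, fderiv_fun_neg]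
  have hsh := dirDeriv_shift_family hw hφ.neg (extVec none) x
  simp only [hdn φ, hP.flow_deriv] at hsh
  have hce : Smooth fun x => expI (-θ x) := contDiff_expI.comp hc
  unfold packet
  rw [dirDeriv_smul hce hsw, dirDeriv_expI hc]
  beta_reduce
  rw [hsh, hdn θ, hP.action_deriv, hwt]
  have h2 : S.shift (-φ x) (S.opAt h (x.1, 0) (w x)) =
      S.opAt h (traj φ x) (S.shift (-φ x) (w x)) := by
    rw [shift_opAt hP.bdd]
    simp [traj]
  have h3 := S.gen_smul_vec (-1) (hamVec h (traj φ x)) (S.shift (-φ x) (w x))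
  rw [neg_one_smul] at h3
  rw [gen_smul hv, h3]
  simp only [map_neg, map_smul, h2, centered, neg_apply, neg_neg,
    symp_swap (hamVec h (traj φ x)) (φ x)]
  simp only [hwdef]
  push_cast
  module

/-- The formula for `dθ` cancels the scalar terms produced by the shifts at both times. What remains
is a generator acting on the packet, and the packet issued from a generator applied to the initial
vector. -/
lemma dirDeriv_packet_space (hP : S.IsPropagation h φ θ s U) {u} (hu : S.SmoothVec u)
    (v : Phase d) (x : Ext d) : 𝜕 (0, v) (S.packet φ θ s U u) x =
      -I • S.gen (𝜕 (0, v) φ x) (S.packet φ θ s U u x) +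
        S.packet φ θ s U (I • S.gen (𝜕 (0, v) φ (s, x.2)) u) x := by
  have hw := hP.smoothFam_inner hu
  set w := fun x : Ext d => U x.1 (S.shift (φ (s, x.2)) u) with hwdef
  have hφ := hP.flow_smooth
  have hφs : Smooth fun p => φ (s, p) := hφ.comp (contDiff_const.prodMk contDiff_id)
  set z := 𝜕 (0, v) φ (s, x.2) with hz
  have hwt : 𝜕 (0, v) w x = U x.1 (S.shift (φ (s, x.2)) (I • S.gen z u)) -
      (I * (symp (φ (s, x.2)) z / 2 : ℝ)) • w x := by
    have h1 := congrFun (dirDeriv_slice_right hw.contDiff x.1 v) x.2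
    have h2 : Smooth fun p => S.shift (φ (s, p)) u := hu.along hφs
    have h3 := congrFun (dirDeriv_clm_comp h2 ((U x.1).restrictScalars ℝ) v) x.2
    have h4 := hu.dirDeriv_along hφs v x.2
    rw [congrFun (dirDeriv_slice_right hφ s v) x.2, dirDeriv_shift_right hu] at h4
    rw [h4] at h3
    refine h1.symm.trans (h3.trans ?_)
    simp [hwdef, hz]
  have hsw : Smooth fun x => S.shift (-φ x) (w x) := (hw.shift hφ.neg).contDiff
  have hv : S.SmoothVec (S.shift (-φ x) (w x)) := (hw.smoothVec x).shift _
  have hc : Smooth fun x => -θ x := hP.action_smooth.neg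
  have hdn {F : Type} [NormedAddCommGroup F] [NormedSpace ℝ F] (f : Ext d → F) (v) :
      dirDeriv v (fun x => -f x) x = -dirDeriv v f x := by simp [dirDeriv, fderiv_fun_neg]
  have hsh := dirDeriv_shift_family hw hφ.neg (0, v) x
  simp only [hdn φ] at hsh
  have hce : Smooth fun x => expI (-θ x) := contDiff_expI.comp hc
  unfold packet
  rw [dirDeriv_smul hce hsw, dirDeriv_expI hc]
  beta_reduce
  rw [hsh, hdn θ, hP.dirDeriv_action, hwt]
  have h3 := S.gen_smul_vec (-1) (𝜕 (0, v) φ x) (S.shift (-φ x) (w x))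
  rw [neg_one_smul] at h3
  rw [gen_smul hv, h3]
  simp only [map_sub, map_smul, map_neg, neg_apply, neg_neg,
    symp_swap (𝜕 (0, v) φ x) (φ x), hwdef, hz]
  push_cast
  module

end IsPropagation
/-! ### Energy estimates for wave packets -/

lemma inner_centered_left {h} (hh : BddSymbol h) (e : Ext d) (u w : H) :
    ⟪S.centered h e u, w⟫ = ⟪u, S.centered h e w⟫ := by
  obtain ⟨M, hM⟩ := hh.exists_symbolBound
  simp only [centered, inner_sub_left, inner_sub_right, inner_smul_left, inner_smul_right,
    conj_ofReal, opAt, inner_op_swap (hM e)]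

variable (S) in
/-- The generator of the evolution in the moving frame. -/
def frameGen (h : Ext d → ℝ) (e : Ext d) (u : H) : H := S.gen (hamVec h e) u + S.centered h e u

lemma SmoothVec.frameGen {u} (hu : S.SmoothVec u) {h} (hh : BddSymbol h)
    (e : Ext d) : S.SmoothVec (S.frameGen h e u) := (hu.gen _).add (hu.centered hh e)

/-- The canonical commutator contributes the scalar `-I ∂_j h(e)`, which removes the value of `∂_j
h` at the base point from `gen_centered`. The commutator is thus centred, and is controlled by
second derivatives of `h`. -/
lemma gen_frameGen {u} (hu : S.SmoothVec u) {h} (hh : BddSymbol h)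
    (e : Ext d) (j : PhaseIndex d) : S.gen (phaseVec j) (S.frameGen h e u) =
      S.frameGen h e (S.gen (phaseVec j) u) + I • S.centered (𝜕 (extVec (some j)) h) e u := by
  have h1 := gen_gen_sub hu (phaseVec j) (hamVec h e)
  rw [symp_hamVec, sub_eq_iff_eq_add] at h1
  have h2 : fderiv ℝ h e (0, phaseVec j) = 𝜕 (extVec (some j)) h e := rfl
  rw [frameGen, gen_add (hu.gen _) (hu.centered hh e), gen_centered hu hh, h1, h2, frameGen]
  module

/-- In order zero the contribution vanishes because the generator is symmetric. In higher orders
only the commutators contribute, and these are of size `M`, the bound on the second derivatives. -/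
lemma exists_re_sobInner_frameGen_le (S : HeisenbergSystem d H) (k : ℕ) : ∃ C, 0 ≤ C ∧
    ∀ (M : ℝ) (h : Ext d → ℝ), BddSymbol h → 0 < M →
      (∀ j : PhaseIndex d, DerivBound (symbolOrder d + k) M (𝜕 (extVec (some j)) h)) →
      ∀ (e : Ext d) (u : H), S.SmoothVec u →
        |(S.sobInner k u (-I • S.frameGen h e u)).re| ≤ C * M * S.sob k u := by
  induction k with
  | zero =>
    refine ⟨0, le_rfl, fun M h hh _ _ e u hu => ?_⟩
    have h1 : (starRingEnd ℂ) ⟪u, S.frameGen h e u⟫ = ⟪u, S.frameGen h e u⟫ := by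
      rw [inner_conj_symm, frameGen, inner_add_left, inner_add_right, inner_gen_left hu hu,
        inner_centered_left hh]
    have h2 := Complex.conj_eq_iff_im.1 h1
    simp [sobInner, inner_smul_right, h2]
  | succ k ih =>
    obtain ⟨C, hC0, hC⟩ := ih
    obtain ⟨C', hC0', hC'⟩ := exists_sob_centered_le S k
    refine ⟨C + ∑ _j : PhaseIndex d, (C + (1 + C') / 2), by positivity,
      fun M h hh hM hd e u hu => ?_⟩
    have hd' : ∀ j : PhaseIndex d, DerivBound (symbolOrder d + k) M (𝜕 (extVec (some j)) h) :=
      fun j => (hd j).mono (by omega)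
    have hB := hu.frameGen hh e
    have hs := S.sob_le_succ k u
    have hs0 := S.sob_nonneg k u
    simp only [sobInner, add_re, re_sum]
    rw [add_mul, add_mul, sum_mul, sum_mul]
    refine (abs_add_le _ _).trans (add_le_add ((hC M h hh hM hd' e u hu).trans (by gcongr))
      ((abs_sum_le_sum_abs _ _).trans (sum_le_sum fun j _ => ?_)))
    have hj := hu.gen (phaseVec j)
    have hc := hu.centered (hh.dirDeriv (some j)) e
    have e1 : S.gen (phaseVec j) (-I • S.frameGen h e u) =
        -I • S.frameGen h e (S.gen (phaseVec j) u) + S.centered (𝜕 (extVec (some j)) h) e u := by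
      rw [gen_smul hB, gen_frameGen hu hh, smul_add, smul_smul]
      simp
    rw [e1, sobInner_add_right ((hj.frameGen hh e).smul _) hc, add_re]
    have a1 := hC M h hh hM hd' e _ hj
    -- The weight is `δ = M`: the squared norm of the commutator term is O(M²), so both parts of
    -- Young's inequality become O(M).
    have a2 := abs_re_sobInner_le (S := S) (S.gen (phaseVec j) u)
      (S.centered (𝜕 (extVec (some j)) h) e u) k hM
    have a3 := hC' M _ (hh.dirDeriv (some j)) hM.le (hd' j) e u hu
    have a4 := S.sob_gen_le k j u
    have a5 : M⁻¹ * S.sob k (S.centered (𝜕 (extVec (some j)) h) e u) ≤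
        C' * M * S.sob (k + 1) u := by
      rw [inv_mul_le_iff₀ hM]
      exact a3.trans_eq (by ring)
    have a6 := mul_le_mul_of_nonneg_left a4 hM.le
    have a7 := mul_le_mul_of_nonneg_left a4 (by positivity : 0 ≤ C * M)
    refine (abs_add_le _ _).trans ?_
    linarith

variable {ε : Ω → ℝ} {h : Ω → Ext d → ℝ} {φ : Ω → Ext d → Phase d}
  {θ : Ω → Ext d → ℝ} {s : Ω → ℝ} {U : Ω → ℝ → H →L[ℂ] H} {M : ℝ}

/-- The family `ε⁻¹ ∂_j h` has uniformly bounded first derivatives; multiplying back by `ε` shows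
that `∂_j h` varies slowly. -/
lemma _root_.HamFamily.exists_derivBound (hF : HamFamily ε h φ) (n : ℕ) : ∃ A, 0 < A ∧
    ∀ κ (j : PhaseIndex d), DerivBound n (A * ε κ) (𝜕 (extVec (some j)) (h κ)) := by
  have h1 : ∀ j i : ExtIndex d, UnifSym fun κ => 𝜕 (extVec i)
      (fun x => (ε κ)⁻¹ • 𝜕 (extVec j) (h κ) x) := fun j i => by
    have h2 (κ : Ω) : 𝜕 (extVec i) (fun x => (ε κ)⁻¹ • 𝜕 (extVec j) (h κ) x) =
        fun x => (ε κ)⁻¹ * 𝜕 (extVec i) (𝜕 (extVec j) (h κ)) x :=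
      dirDeriv_const_smul ((hF.bdd κ).smooth.dirDeriv _) _ _
    simp only [h2]
    exact hF.second i j
  choose A hA0 hA using fun j => UnifSym.exists_derivBound (h1 j) n
  refine ⟨1 + ∑ j, A j, add_pos_of_pos_of_nonneg one_pos (sum_nonneg fun j _ => hA0 j),
    fun κ j l h0 hl e => ?_⟩
  have h3 := hA (some j) κ l h0 hl e
  rw [derivs_const_smul ((hF.bdd κ).smooth.dirDeriv _)] at h3
  beta_reduce at h3
  rw [smul_eq_mul, abs_mul, abs_inv,
    abs_of_pos (hF.pos κ), inv_mul_le_iff₀ (hF.pos κ), mul_comm] at h3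
  refine h3.trans (mul_le_mul_of_nonneg_right ?_ (hF.pos κ).le)
  have := single_le_sum (f := A) (fun j _ => hA0 j) (Finset.mem_univ (some j))
  linarith

/-- The energy grows at a rate O(ε), and two times of the range differ by at most `2 M / ε`.
Initially the packet is the vector `u` itself, whatever the point. -/
lemma exists_sob_packet_le (hF : HamFamily ε h φ)
    (hP : ∀ κ, S.IsPropagation (h κ) (φ κ) (θ κ) (s κ) (U κ))
    (hs : ∀ κ, s κ ∈ timeRange M ε κ) (k : ℕ) {u} (hu : S.SmoothVec u) :
    ∃ C, ∀ κ x, x.1 ∈ timeRange M ε κ → S.sob k (S.packet (φ κ) (θ κ) (s κ) (U κ) u x) ≤ C := by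
  obtain ⟨C, hC0, hC⟩ := exists_re_sobInner_frameGen_le S k
  obtain ⟨A, hA0, hA⟩ := hF.exists_derivBound (symbolOrder d + k)
  refine ⟨S.sob k u * exp ((1 + 2 * (C * A)) * (M + M)), fun κ x hx => ?_⟩
  obtain ⟨t, p⟩ := x
  have hε := hF.pos κ
  set V := S.packet (φ κ) (θ κ) (s κ) (U κ) u with hV
  have hVs : S.SmoothFam V := (hP κ).smoothFam_packet hu
  have hVp : S.SmoothFam fun τ : ℝ => V (τ, p) :=
    hVs.comp (f := fun τ : ℝ => (τ, p)) (contDiff_id.prodMk contDiff_const)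
  have hd (τ : ℝ) : 𝜕 (1 : ℝ) (fun τ : ℝ => V (τ, p)) τ =
      -I • S.frameGen (h κ) (traj (φ κ) (τ, p)) (V (τ, p)) := by
    rw [congrFun (dirDeriv_slice_left hVs.contDiff p 1) τ]
    exact (hP κ).dirDeriv_packet_time hu (τ, p)
  have h1 := norm_le_of_norm_deriv_le (y := fun τ => S.sob k (V (τ, p))) (y' := fun τ =>
      2 * (S.sobInner k (V (τ, p)) (𝜕 (1 : ℝ) (fun τ : ℝ => V (τ, p)) τ)).re)
      (K := 1 + 2 * (C * A)) (L := 0) (a := s κ) (t := t) hε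
      (le_add_of_nonneg_right (by positivity)) le_rfl
      (fun τ _ => hasDerivAt_sob hVp k τ) (fun τ _ => by
        have h2 := hC (A * ε κ) (h κ) (hF.bdd κ) (by positivity) (hA κ) (traj (φ κ) (τ, p))
          (V (τ, p)) (hVs.smoothVec _)
        have h3 := S.sob_nonneg k (V (τ, p))
        rw [hd, norm_mul, norm_eq_abs, norm_eq_abs, abs_two, norm_of_nonneg h3]
        nlinarith [mul_nonneg hε.le h3])
  rw [norm_of_nonneg (S.sob_nonneg _ _), norm_of_nonneg (S.sob_nonneg _ _), add_zero,
    hV, (hP κ).packet_init] at h1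
  refine h1.trans ?_
  have h5 : ε κ * |t| ≤ M := hx
  have h6 : ε κ * |s κ| ≤ M := hs κ
  have h7 : ε κ * |t - s κ| ≤ M + M := by
    have := mul_le_mul_of_nonneg_left (abs_sub t (s κ)) hε.le
    linarith
  have := S.sob_nonneg k u
  gcongr

/-- The wave packets obey uniform bounds on the slowly varying time scale. -/
lemma unifVec_packet (hF : HamFamily ε h φ)
    (hP : ∀ κ, S.IsPropagation (h κ) (φ κ) (θ κ) (s κ) (U κ))
    (hs : ∀ κ, s κ ∈ timeRange M ε κ) (n : ℕ) {u} (hu : S.SmoothVec u) :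
    S.UnifVec (timeRange M ε) n fun κ => S.packet (φ κ) (θ κ) (s κ) (U κ) u := by
  have h0 : ∀ {u : H}, S.SmoothVec u →
      S.UnifVec (timeRange M ε) 0 fun κ => S.packet (φ κ) (θ κ) (s κ) (U κ) u := fun hu =>
    ⟨fun κ => (hP κ).smoothFam_packet hu, fun k => exists_sob_packet_le hF hP hs k hu⟩
  -- The initial vector varies in the induction because derivatives in the initial point replace `u`
  -- by its generators.
  induction n generalizing u with
  | zero => exact h0 hu
  | succ n ih =>
    refine ⟨h0 hu, fun i => ?_⟩
    rcases i with _ | i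
    · simp only [fun κ => show 𝜕 (extVec none) (S.packet (φ κ) (θ κ) (s κ) (U κ) u) = _ from
        funext ((hP κ).dirDeriv_packet_time hu)]
      exact (((ih hu).gen_along (hF.unifFun_hamVec n)).add ((ih hu).centered hF.bdd hF.first
        (fun κ => contDiff_traj (hF.flow_smooth κ)) fun m _ i =>
          hF.unifFun_dirDeriv_traj (hF.unifFun_dirDeriv_flow m i))).const_smul _
    · have h1 (κ : Ω) : 𝜕 (extVec (some i)) (S.packet (φ κ) (θ κ) (s κ) (U κ) u) = fun x =>
          -I • S.gen (𝜕 (extVec (some i)) (φ κ) x) (S.packet (φ κ) (θ κ) (s κ) (U κ) u x) + ∑ j,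
            𝕔(phaseCoord j (𝜕 (extVec (some i)) (φ κ) (s κ, x.2))) •
              S.packet (φ κ) (θ κ) (s κ) (U κ) (I • S.gen (phaseVec j) u) x := by
        funext x
        refine ((hP κ).dirDeriv_packet_space hu (phaseVec i) x).trans (congrArg _ ?_)
        rw [S.gen_eq_sum, smul_sum]
        simp only [packet, map_sum, map_smul, smul_sum, extVec]
        refine sum_congr rfl fun j _ => ?_
        simp only [smul_smul]
        congr 1
        ring
      simp only [h1]
      refine (((ih hu).gen_along (hF.unifFun_dirDeriv_flow n (some i))).const_smul _).add
        (UnifVec.sum _ fun j => UnifVec.smul ?_ (ih ((hu.gen (phaseVec j)).smul _)))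
      exact ((hF.unifFun_dirDeriv_flow n (some i)).freeze hs).clm (phaseCoord j)

/-! ### Smooth functionals on smooth vectors -/

variable (S)

/-- Functionals which are smooth along smooth families of smooth vectors. -/
structure IsSmoothFunctional (E : H → ℂ) : Prop where
  contDiff : ∀ (Q : Type) [NormedAddCommGroup Q] [NormedSpace ℝ Q] (V : Q → H), S.SmoothFam V →
    Smooth fun q => E (V q)
  deriv : ∀ (Q : Type) [NormedAddCommGroup Q] [NormedSpace ℝ Q] (V : Q → H), S.SmoothFam V →
    ∀ e, 𝜕 e (fun q => E (V q)) = fun q => E (𝜕 e V q)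
  bound : ∃ (k : ℕ) (C : ℝ), 0 ≤ C ∧ ∀ u, S.SmoothVec u → ‖E u‖ ^ 2 ≤ C * S.sob k u

variable {S}

lemma sob_mono {k l : ℕ} (h : k ≤ l) (u : H) : S.sob k u ≤ S.sob l u := by
  induction l, h using Nat.le_induction with
  | base => exact le_rfl
  | succ l _ ih => exact ih.trans (S.sob_le_succ l u)

lemma isSmoothFunctional_clm (L : H →L[ℂ] ℂ) : S.IsSmoothFunctional L where
  contDiff Q _ _ V hV := (L.restrictScalars ℝ).contDiff.comp hV.contDiff
  deriv Q _ _ V hV e := dirDeriv_clm_comp hV.contDiff (L.restrictScalars ℝ) e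
  bound := ⟨0, ‖L‖ ^ 2, by positivity, fun u _ => by
    rw [sob_zero, ← mul_pow]
    exact pow_le_pow_left₀ (norm_nonneg _) (L.le_opNorm u) 2⟩

namespace IsSmoothFunctional

variable {E E' : H → ℂ}

lemma congr (hE : S.IsSmoothFunctional E) (h : ∀ u, S.SmoothVec u → E' u = E u) :
    S.IsSmoothFunctional E' where
  contDiff Q _ _ V hV := by
    simp only [fun q => h _ (hV.smoothVec q)]
    exact hE.contDiff Q V hV
  deriv Q _ _ V hV e := by
    simp only [fun q => h _ (hV.smoothVec q), fun q => h _ ((hV.dirDeriv e).smoothVec q)]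
    exact hE.deriv Q V hV e
  bound := by
    obtain ⟨k, C, hC0, hC⟩ := hE.bound
    exact ⟨k, C, hC0, fun u hu => by rw [h u hu]; exact hC u hu⟩

lemma add (hE : S.IsSmoothFunctional E) (hE' : S.IsSmoothFunctional E') :
    S.IsSmoothFunctional fun u => E u + E' u where
  contDiff Q _ _ V hV := (hE.contDiff Q V hV).add (hE'.contDiff Q V hV)
  deriv Q _ _ V hV e := by
    rw [dirDeriv_add (hE.contDiff Q V hV) (hE'.contDiff Q V hV), hE.deriv Q V hV, hE'.deriv Q V hV]
  bound := by
    obtain ⟨k, C, hC0, hC⟩ := hE.bound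
    obtain ⟨l, D, hD0, hD⟩ := hE'.bound
    refine ⟨k + l, 2 * C + 2 * D, by positivity, fun u hu => ?_⟩
    have h1 := (hC u hu).trans
      (mul_le_mul_of_nonneg_left (sob_mono (S := S) (Nat.le_add_right k l) u) hC0)
    have h2 := (hD u hu).trans
      (mul_le_mul_of_nonneg_left (sob_mono (S := S) (Nat.le_add_left l k) u) hD0)
    have h3 := pow_le_pow_left₀ (norm_nonneg _) (norm_add_le (E u) (E' u)) 2
    nlinarith [sq_nonneg (‖E u‖ - ‖E' u‖)]

lemma sum (s : Finset ι) {E : ι → H → ℂ} (hE : ∀ i, S.IsSmoothFunctional (E i)) :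
    S.IsSmoothFunctional fun u => ∑ i ∈ s, E i u := by
  classical
  induction s using Finset.induction_on with
  | empty => simpa using! isSmoothFunctional_clm (S := S) (0 : H →L[ℂ] ℂ)
  | insert i s hi ih => simpa only [sum_insert hi] using (hE i).add ih

end IsSmoothFunctional

variable (S) in
/-- The creation operators of the harmonic oscillator. -/
def creation (i : Fin d) (u : H) : H := S.gen (phaseVec (inr i)) u + I • S.gen (phaseVec (inl i)) u

lemma SmoothVec.creation {u} (hu : S.SmoothVec u) (i : Fin d) :
    S.SmoothVec (S.creation i u) := (hu.gen _).add ((hu.gen _).smul _)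

lemma IsSmoothFunctional.comp_creation {E : H → ℂ} (hE : S.IsSmoothFunctional E) (i : Fin d) :
    S.IsSmoothFunctional fun u => E (S.creation i u) := by
  have h1 : ∀ {Q : Type} [NormedAddCommGroup Q] [NormedSpace ℝ Q] {V : Q → H}, S.SmoothFam V →
      S.SmoothFam fun q => S.creation i (V q) := fun hV =>
    (hV.gen _).add ((hV.gen _).smul contDiff_const)
  refine ⟨fun Q _ _ V hV => hE.contDiff Q _ (h1 hV), fun Q _ _ V hV e => ?_, ?_⟩
  · rw [hE.deriv Q _ (h1 hV) e]
    funext q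
    congr 1
    unfold creation
    have h2 : Smooth fun q => I • S.gen (phaseVec (inl i)) (V q) :=
      ((hV.gen _).contDiff).const_smul I
    rw [dirDeriv_add (hV.gen _).contDiff h2, dirDeriv_const_smul (hV.gen _).contDiff]
    beta_reduce
    rw [dirDeriv_gen hV, dirDeriv_gen hV]
  · obtain ⟨k, C, hC0, hC⟩ := hE.bound
    refine ⟨k + 1, C * 4, by positivity, fun u hu => (hC _ (hu.creation i)).trans ?_⟩
    rw [mul_assoc]
    refine mul_le_mul_of_nonneg_left ?_ hC0
    have h2 := sob_add_le (hu.gen (phaseVec (inr i))) ((hu.gen (phaseVec (inl i))).smul I) k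
    rw [sob_smul (hu.gen _), norm_I] at h2
    have h3 := S.sob_gen_le k (inr i) u
    have h4 := S.sob_gen_le k (inl i) u
    unfold creation
    linarith

variable (S) in
/-- The integral of the coherent state transform against `m`. -/
def cohInt (m : Phase d → ℂ) (u : H) : ℂ := ∫ q, m q * ⟪S.coh q, u⟫

lemma integrable_cohInt_of_integrable {m : Phase d → ℂ} (hm : Continuous m) (hi : Integrable m)
    (u : H) : Integrable fun q => m q * ⟪S.coh q, u⟫ := by
  refine (hi.norm.mul_const ‖u‖).mono' (hm.mul (S.continuous_inner_coh u)).aestronglyMeasurable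
    (.of_forall fun q => ?_)
  rw [norm_mul]
  exact mul_le_mul_of_nonneg_left (S.norm_inner_coh_le q u) (norm_nonneg _)

lemma isSmoothFunctional_cohInt_of_integrable {m : Phase d → ℂ} (hm : Continuous m)
    (hi : Integrable m) : S.IsSmoothFunctional (S.cohInt m) := by
  have hint := integrable_cohInt_of_integrable (S := S) hm hi
  let L : H →ₗ[ℂ] ℂ :=
    { toFun := S.cohInt m
      map_add' := fun u v => by
        simp only [cohInt, inner_add_right, mul_add]
        exact integral_add (hint u) (hint v)
      map_smul' := fun c u => by
        simp only [cohInt, inner_smul_right, RingHom.id_apply, smul_eq_mul]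
        rw [← integral_const_mul]
        congr 1
        funext q
        ring }
  refine isSmoothFunctional_clm (L.mkContinuous (∫ q, ‖m q‖) fun u => ?_)
  change ‖S.cohInt m u‖ ≤ _
  rw [← integral_mul_const]
  refine (norm_integral_le_integral_norm _).trans
    (integral_mono (hint u).norm (hi.norm.mul_const _) fun q => ?_)
  simp only [norm_mul]
  exact mul_le_mul_of_nonneg_left (S.norm_inner_coh_le q u) (norm_nonneg _)

/-- The symbol of the creation operators. -/
def cohCoord (i : Fin d) (q : Phase d) : ℂ := (q.1 i : ℂ) - I * (q.2 i : ℂ)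

lemma continuous_cohCoord (i : Fin d) : Continuous (cohCoord (d := d) i) := by
  unfold cohCoord
  fun_prop

lemma normSq_cohCoord (i : Fin d) (q : Phase d) :
    normSq (cohCoord i q) = q.1 i ^ 2 + q.2 i ^ 2 := by
  rw [cohCoord, Complex.normSq_apply]
  simp
  ring

/-- The weight `1 + |q|²`, through the creation operators. -/
def cohWeight (q : Phase d) : ℝ := 1 + ∑ i, normSq (cohCoord i q)

lemma sq_one_add_norm_le_cohWeight (q : Phase d) : (1 + ‖q‖) ^ 2 ≤ 2 * cohWeight q := by
  have h1 := sq_norm_le_phaseInner q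
  rw [phaseInner_self, norm_sq_eq, norm_sq_eq] at h1
  simp only [norm_eq_abs, sq_abs, one_mul] at h1
  simp only [cohWeight, normSq_cohCoord, sum_add_distrib]
  nlinarith [sq_nonneg (‖q‖ - 1)]

/-- Decay of the multiplier is traded for regularity of the vector. With `w = 1 + Σ |c_j|²`, the
identity `m = m / w + Σ (m conj(c_j) / w) c_j` splits the integral; each new multiplier decays one
power faster and each `c_j` becomes a creation operator on `u`. The induction starts at an
integrable multiplier and ends, at `r = 4d + 3`, with a merely bounded one. -/
lemma cohInt_of_norm_le (r : ℕ) (hr : r ≤ 4 * d + 3) {m : Phase d → ℂ} (hm : Continuous m)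
    {C : ℝ} (hC : ∀ q, ‖m q‖ ≤ C * ((1 + ‖q‖) ^ (4 * d + 3 - r))⁻¹) :
    S.IsSmoothFunctional (S.cohInt m) ∧
      ∀ u, S.SmoothVec u → Integrable fun q => m q * ⟪S.coh q, u⟫ := by
  induction r generalizing m C with
  | zero =>
    have hi : Integrable m := (integrable_inv_one_add_norm_pow.const_mul C).mono'
      hm.aestronglyMeasurable (.of_forall hC)
    exact ⟨isSmoothFunctional_cohInt_of_integrable hm hi,
      fun u _ => integrable_cohInt_of_integrable hm hi u⟩
  | succ r ih =>
    set w : Phase d → ℝ := cohWeight with hw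
    have hw1 : ∀ q : Phase d, (1 + ‖q‖) ^ 2 ≤ 2 * w q := sq_one_add_norm_le_cohWeight
    have hw0 (q : Phase d) : 0 < w q := by
      have : 0 < (1 + ‖q‖) ^ 2 := by positivity
      linarith [hw1 q]
    have hwc : Continuous w := continuous_const.add (continuous_finsetSum _ fun i _ =>
      Complex.continuous_normSq.comp (continuous_cohCoord i))
    have hgain {ρ : Phase d → ℂ} (hρ : ∀ q, ‖ρ q‖ ≤ 4 * (1 + ‖q‖)⁻¹) (q : Phase d) :
        ‖m q * ρ q‖ ≤ C * 4 * ((1 + ‖q‖) ^ (4 * d + 3 - r))⁻¹ := by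
      rw [norm_mul, show 4 * d + 3 - r = 4 * d + 3 - (r + 1) + 1 by omega, pow_succ, mul_inv]
      refine (mul_le_mul (hC q) (hρ q) (norm_nonneg _) ((norm_nonneg _).trans (hC q))).trans_eq ?_
      ring
    have hinv (q : Phase d) : (w q)⁻¹ ≤ 2 * ((1 + ‖q‖)⁻¹) ^ 2 := by
      have h1 : 0 < (1 + ‖q‖) ^ 2 := by positivity
      rw [inv_pow, ← div_eq_mul_inv, le_div_iff₀ h1, inv_mul_le_iff₀ (hw0 q)]
      linarith [hw1 q]
    have hinv1 (q : Phase d) : (1 + ‖q‖)⁻¹ ≤ 1 := inv_le_one_of_one_le₀ (by linarith [norm_nonneg q])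
    have hinv0 (q : Phase d) : 0 < (1 + ‖q‖)⁻¹ := by positivity
    have hwC : Continuous fun q => 𝕔((w q)⁻¹) :=
      continuous_ofReal.comp (hwc.inv₀ fun q => (hw0 q).ne')
    have h0 := ih (by omega) (m := fun q => m q * 𝕔((w q)⁻¹)) (hm.mul hwC) (hgain fun q => by
        rw [norm_real, norm_of_nonneg (inv_nonneg.2 (hw0 q).le)]
        nlinarith [hinv q, hinv1 q, hinv0 q])
    have hj (j : Fin d) := ih (by omega)
      (m := fun q => m q * (𝕔((w q)⁻¹) * (starRingEnd ℂ) (cohCoord j q)))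
      (hm.mul (hwC.mul (continuous_conj.comp (continuous_cohCoord j))))
      (hgain fun q => by
        rw [norm_mul, norm_real, norm_of_nonneg (inv_nonneg.2 (hw0 q).le), RCLike.norm_conj]
        have h1 : ‖cohCoord j q‖ ≤ ‖q‖ + ‖q‖ := by
          refine (norm_sub_le _ _).trans ?_
          rw [norm_mul, norm_I, one_mul, norm_real, norm_real]
          exact add_le_add ((PiLp.norm_apply_le q.1 j).trans (norm_fst_le q))
            ((PiLp.norm_apply_le q.2 j).trans (norm_snd_le q))
        have h2 : (1 + ‖q‖)⁻¹ * (1 + ‖q‖) = 1 := inv_mul_cancel₀ (by linarith [norm_nonneg q])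
        have h3 := mul_le_mul (hinv q) (show ‖cohCoord j q‖ ≤ 2 * (1 + ‖q‖) by linarith)
          (norm_nonneg _) (by positivity)
        refine h3.trans_eq ?_
        linear_combination 4 * (1 + ‖q‖)⁻¹ * h2)
    have hpt (u : H) (hu : S.SmoothVec u) (q : Phase d) : m q * ⟪S.coh q, u⟫ =
        m q * 𝕔((w q)⁻¹) * ⟪S.coh q, u⟫ + ∑ j, m q * (𝕔((w q)⁻¹) * (starRingEnd ℂ) (cohCoord j q)) *
            ⟪S.coh q, S.creation j u⟫ := by
      simp only [creation, ← mul_inner_coh hu]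
      have h1 : ∀ j : Fin d, (starRingEnd ℂ) (cohCoord j q) *
          ((q.1 j : ℂ) - I * (q.2 j : ℂ)) = (normSq (cohCoord j q) : ℂ) := fun j => by
        rw [Complex.normSq_eq_conj_mul_self]; rfl
      have h2 : 𝕔(w q) = 1 + ∑ j, (normSq (cohCoord j q) : ℂ) := by
        simp [hw, cohWeight]
      have h3 : 𝕔(w q) ≠ 0 := Complex.ofReal_ne_zero.2 (hw0 q).ne'
      have h4 : ∀ j : Fin d, m q * (𝕔((w q)⁻¹) * (starRingEnd ℂ) (cohCoord j q)) *
          (((q.1 j : ℂ) - I * (q.2 j : ℂ)) * ⟪S.coh q, u⟫) =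
          (normSq (cohCoord j q) : ℂ) * (m q * 𝕔((w q)⁻¹) * ⟪S.coh q, u⟫) := fun j => by
        rw [← h1]; ring
      simp only [h4]
      rw [← sum_mul, ← one_add_mul, ← h2, ofReal_inv]
      field_simp
    have hint (u : H) (hu : S.SmoothVec u) : Integrable fun q => m q * ⟪S.coh q, u⟫ := by
      simp only [hpt u hu]
      exact (h0.2 u hu).add (integrable_finsetSum _ fun j _ => (hj j).2 _ (hu.creation j))
    refine ⟨(h0.1.add (IsSmoothFunctional.sum univ fun j =>
      (hj j).1.comp_creation j)).congr fun u hu => ?_, hint⟩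
    simp only [cohInt, hpt u hu]
    rw [integral_add (h0.2 u hu) (integrable_finsetSum _ fun j _ => (hj j).2 _ (hu.creation j)),
      integral_finsetSum _ fun j _ => (hj j).2 _ (hu.creation j)]

lemma isSmoothFunctional_cohInt {m : Phase d → ℂ} (hm : Continuous m) {C : ℝ}
    (hC : ∀ q, ‖m q‖ ≤ C) : S.IsSmoothFunctional (S.cohInt m) :=
  (cohInt_of_norm_le (4 * d + 3) le_rfl hm (C := C) fun q => by simpa using hC q).1

lemma integrable_inner_coh {u} (hu : S.SmoothVec u) : Integrable fun q => ⟪S.coh q, u⟫ := by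
  simpa using (cohInt_of_norm_le (S := S) (4 * d + 3) le_rfl (m := fun _ => 1) continuous_const
    (C := 1) fun q => by simp).2 u hu

end HeisenbergSystem

/-! ### Phase space shifts on `L²` -/

lemma memLp_weightedComp {c : Space d → ℂ} (hc : Continuous c) {τ : Space d → Space d}
    (hτ : Measure.QuasiMeasurePreserving τ) (hn : ∀ f : Space d → ℂ, AEStronglyMeasurable f →
      eLpNorm (fun y => c y * f (τ y)) 2 volume = eLpNorm f 2 volume) (f : LTwo d) :
    MemLp (fun y => c y * f (τ y)) 2 :=
  ⟨hc.aestronglyMeasurable.mul ((Lp.aestronglyMeasurable f).comp_quasiMeasurePreserving hτ), by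
    rw [hn f (Lp.aestronglyMeasurable f)]; exact (Lp.memLp f).2⟩

/-- The isometry `f ↦ c · (f ∘ τ)` of `L²`. -/
def weightedComp {c : Space d → ℂ} (hc : Continuous c) {τ : Space d → Space d}
    (hτ : Measure.QuasiMeasurePreserving τ) (hn : ∀ f : Space d → ℂ, AEStronglyMeasurable f →
      eLpNorm (fun y => c y * f (τ y)) 2 volume = eLpNorm f 2 volume) : LTwo d →ₗᵢ[ℂ] LTwo d :=
  have hm := memLp_weightedComp hc hτ hn
  { toFun := fun f => (hm f).toLp
    map_add' := fun f g => by
      rw [← MemLp.toLp_add]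
      refine MemLp.toLp_congr _ _ ?_
      filter_upwards [hτ.ae (Lp.coeFn_add f g)] with y hy
      rw [hy]
      exact mul_add _ _ _
    map_smul' := fun r f => by
      rw [RingHom.id_apply, ← MemLp.toLp_const_smul]
      refine MemLp.toLp_congr _ _ ?_
      filter_upwards [hτ.ae (Lp.coeFn_smul r f)] with y hy
      rw [hy]
      simp only [Pi.smul_apply, smul_eq_mul]
      ring
    norm_map' := fun f => by
      change ‖(hm f).toLp‖ = _
      rw [Lp.norm_toLp, Lp.norm_def, hn f (Lp.aestronglyMeasurable f)] }

lemma coeFn_weightedComp {c : Space d → ℂ} (hc : Continuous c) {τ : Space d → Space d}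
    (hτ : Measure.QuasiMeasurePreserving τ) (hn : ∀ f : Space d → ℂ, AEStronglyMeasurable f →
      eLpNorm (fun y => c y * f (τ y)) 2 volume = eLpNorm f 2 volume) (f : LTwo d) :
    weightedComp hc hτ hn f =ᵐ[volume] fun y => c y * f (τ y) :=
  MemLp.coeFn_toLp (memLp_weightedComp hc hτ hn f)

lemma eLpNorm_weighted {c : Space d → ℂ} (hc1 : ∀ y, ‖c y‖ = 1) {τ : Space d → Space d}
    (hτ : MeasurePreserving τ) (f : Space d → ℂ) (hf : AEStronglyMeasurable f) :
    eLpNorm (fun y => c y * f (τ y)) 2 volume = eLpNorm f 2 volume := by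
  rw [← eLpNorm_comp_measurePreserving hf hτ]
  refine eLpNorm_congr_norm_ae (.of_forall fun y => ?_)
  rw [norm_mul, hc1, one_mul]
  rfl

/-- The phase of the phase space shift. -/
def shiftPhase (z : Phase d) (y : Space d) : ℝ := inner ℝ z.2 y - inner ℝ z.2 z.1 / 2

lemma continuous_shiftPhase (z : Phase d) : Continuous (shiftPhase z) := by
  unfold shiftPhase; fun_prop

lemma shiftPhase_add (z w : Phase d) (y : Space d) :
    shiftPhase z y + shiftPhase w (y - z.1) = symp z w / 2 + shiftPhase (z + w) y := by
  simp only [shiftPhase, symp_apply, fst_add, snd_add, inner_add_left, inner_add_right,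
    inner_sub_right]
  rw [real_inner_comm w.2 z.1]
  ring

/-- The phase space shift of a function. -/
def shiftFun (z : Phase d) (f : Space d → ℂ) (y : Space d) : ℂ :=
  expI (shiftPhase z y) * f (y - z.1)

lemma norm_shiftFun (z : Phase d) (f : Space d → ℂ) (y : Space d) :
    ‖shiftFun z f y‖ = ‖f (y - z.1)‖ := by
  rw [shiftFun, norm_mul, norm_expI, one_mul]

/-- The phase space shift on `L²`. -/
def lShift (z : Phase d) : LTwo d →L[ℂ] LTwo d :=
  (weightedComp (contDiff_expI.continuous.comp (continuous_shiftPhase z))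
    (measurePreserving_sub_right volume z.1).quasiMeasurePreserving (eLpNorm_weighted
      (fun _ => norm_expI _) (measurePreserving_sub_right volume z.1))).toContinuousLinearMap

lemma coeFn_lShift (z : Phase d) (f : LTwo d) : lShift z f =ᵐ[volume] shiftFun z f :=
  coeFn_weightedComp (contDiff_expI.continuous.comp (continuous_shiftPhase z))
    (measurePreserving_sub_right volume z.1).quasiMeasurePreserving (eLpNorm_weighted
      (fun _ => norm_expI _) (measurePreserving_sub_right volume z.1)) f

lemma coeFn_lShift_of_ae {z : Phase d} {f : LTwo d} {g : Space d → ℂ} (h : f =ᵐ[volume] g) :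
    lShift z f =ᵐ[volume] shiftFun z g := by
  filter_upwards [coeFn_lShift z f,
    (measurePreserving_sub_right volume z.1).quasiMeasurePreserving.ae h] with y h1 h2
  rw [h1, shiftFun, h2, shiftFun]

lemma norm_lShift (z : Phase d) (f : LTwo d) : ‖lShift z f‖ = ‖f‖ := LinearIsometry.norm_map _ f

lemma lShift_lShift (z w : Phase d) (f : LTwo d) :
    lShift z (lShift w f) = expI (symp z w / 2) • lShift (z + w) f := by
  refine Lp.ext ?_
  filter_upwards [coeFn_lShift_of_ae (z := z) (coeFn_lShift w f),
    Lp.coeFn_smul (expI (symp z w / 2)) (lShift (z + w) f), coeFn_lShift (z + w) f] with y h1 h2 h3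
  rw [h1, h2, Pi.smul_apply, h3, shiftFun, shiftFun, shiftFun, smul_eq_mul, ← mul_assoc,
    ← mul_assoc, ← expI_add, ← expI_add, shiftPhase_add, fst_add, sub_sub]

lemma lShift_zero (f : LTwo d) : lShift 0 f = f := by
  refine Lp.ext ?_
  filter_upwards [coeFn_lShift 0 f] with y h1
  rw [h1]
  simp [shiftFun, shiftPhase]

/-- The parity operator on `L²`. -/
def lParity : LTwo d →L[ℂ] LTwo d := (weightedComp (c := fun _ => (1 : ℂ)) continuous_const
    (Measure.measurePreserving_neg volume).quasiMeasurePreserving (eLpNorm_weighted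
      (fun _ => norm_one) (Measure.measurePreserving_neg volume))).toContinuousLinearMap

lemma coeFn_lParity (f : LTwo d) : lParity f =ᵐ[volume] fun y => f (-y) := by
  filter_upwards [coeFn_weightedComp (c := fun _ => (1 : ℂ)) continuous_const
    (Measure.measurePreserving_neg volume).quasiMeasurePreserving (eLpNorm_weighted
      (fun _ => norm_one) (Measure.measurePreserving_neg volume)) f] with y hy
  exact hy.trans (one_mul _)

lemma coeFn_lParity_of_ae {f : LTwo d} {g : Space d → ℂ} (h : f =ᵐ[volume] g) :
    lParity f =ᵐ[volume] fun y => g (-y) := by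
  filter_upwards [coeFn_lParity f,
    (Measure.measurePreserving_neg volume).quasiMeasurePreserving.ae h] with y h1 h2
  rw [h1, h2]

lemma lParity_lShift (z : Phase d) (f : LTwo d) :
    lParity (lShift z f) = lShift (-z) (lParity f) := by
  refine Lp.ext ?_
  filter_upwards [coeFn_lParity_of_ae (coeFn_lShift z f),
    coeFn_lShift_of_ae (z := -z) (coeFn_lParity f)] with y h1 h2
  rw [h1, h2]
  simp only [shiftFun, shiftPhase, Prod.fst_neg, Prod.snd_neg, inner_neg_left, inner_neg_right,
    neg_neg, sub_neg_eq_add, neg_add]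
  congr 2

/-! ### Differentiation of the shifts of Schwartz functions -/

/-- The derivative of the phase space shifts at the origin, in direction `v`. -/
def shiftDeriv (v : Phase d) (f : 𝓢(Space d, ℂ)) : 𝓢(Space d, ℂ) :=
  SchwartzMap.smulLeftCLM ℂ (fun y => I * (inner ℝ v.2 y : ℝ)) f - LineDeriv.lineDerivOp v.1 f

lemma shiftDeriv_apply (v : Phase d) (f : 𝓢(Space d, ℂ)) (y : Space d) :
    shiftDeriv v f y = I * (inner ℝ v.2 y : ℝ) * f y - fderiv ℝ f y v.1 := by
  have h : Function.HasTemperateGrowth fun y : Space d => I * (inner ℝ v.2 y : ℝ) := by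
    have h1 : Function.HasTemperateGrowth fun y : Space d => (inner ℝ v.2 y : ℝ) :=
      (innerSL ℝ v.2).hasTemperateGrowth
    have h2 : Function.HasTemperateGrowth fun y : Space d => 𝕔(inner ℝ v.2 y) :=
      (ofRealCLM.hasTemperateGrowth).comp h1
    exact (Function.HasTemperateGrowth.const I).mul h2
  rw [shiftDeriv, sub_apply, SchwartzMap.smulLeftCLM_apply_apply h,
    SchwartzMap.lineDerivOp_apply_eq_fderiv]
  rfl

lemma shiftDeriv_eq_sum (v : Phase d) (f : 𝓢(Space d, ℂ)) :
    shiftDeriv v f = ∑ j, (phaseCoord j v : ℂ) • shiftDeriv (phaseVec j) f := by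
  ext y
  have hL : IsLinearMap ℝ fun v : Phase d => I * (inner ℝ v.2 y : ℝ) * f y - fderiv ℝ f y v.1 := by
    constructor
    · intro v w
      simp only [snd_add, fst_add, inner_add_left, map_add]
      push_cast
      ring
    · intro c v
      simp only [smul_snd, smul_fst, real_inner_smul_left, map_smul, real_smul]
      push_cast
      ring
  have h2 := congrArg hL.mk' (sum_phaseCoord v)
  rw [map_sum] at h2
  simp only [map_smul, IsLinearMap.mk'_apply] at h2
  rw [shiftDeriv_apply, ← h2]
  have h3 : (∑ j, (phaseCoord j v : ℂ) • shiftDeriv (phaseVec j) f) y =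
      ∑ j, (phaseCoord j v : ℂ) • shiftDeriv (phaseVec j) f y := by
    simp
  rw [h3]
  simp only [shiftDeriv_apply, coe_smul]

lemma shiftDeriv_sum_smul (v : Phase d) (s : Finset ι) (c : ι → ℂ) (f : ι → 𝓢(Space d, ℂ)) :
    shiftDeriv v (∑ j ∈ s, c j • f j) = ∑ j ∈ s, c j • shiftDeriv v (f j) := by
  simp only [shiftDeriv, map_sum, map_smul, LineDeriv.lineDerivOp_sum,
    LineDeriv.lineDerivOp_smul, smul_sub, sum_sub_distrib]

lemma hasDerivAt_shiftFun (w : Phase d) (f : 𝓢(Space d, ℂ)) (y : Space d) (s : ℝ) :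
    HasDerivAt (fun s : ℝ => shiftFun (s • w) f y) (shiftFun (s • w) (shiftDeriv w f) y) s := by
  have h1 : HasDerivAt (fun s : ℝ => shiftPhase (s • w) y)
      (inner ℝ w.2 y - s * inner ℝ w.2 w.1) s := by
    have e : (fun s : ℝ => shiftPhase (s • w) y) = fun s =>
        s * inner ℝ w.2 y - s ^ 2 * (inner ℝ w.2 w.1 / 2) := by
      funext s
      simp only [shiftPhase, smul_snd, smul_fst, real_inner_smul_left, real_inner_smul_right]
      ring
    rw [e]
    refine (((hasDerivAt_id s).mul_const _).sub
      (((hasDerivAt_id s).pow 2).mul_const _)).congr_deriv ?_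
    simp
    ring
  have h2 : HasDerivAt (fun s : ℝ => expI (shiftPhase (s • w) y))
      (I * (inner ℝ w.2 y - s * inner ℝ w.2 w.1 : ℝ) * expI (shiftPhase (s • w) y)) s := by
    have h3 := ((h1.ofReal_comp).const_mul I).cexp
    unfold expI
    exact h3.congr_deriv (by ring)
  have h4 : HasDerivAt (fun s : ℝ => f (y - (s • w).1)) (-(fderiv ℝ f (y - (s • w).1) w.1)) s := by
    have h5 : HasDerivAt (fun s : ℝ => y - (s • w).1) (-w.1) s := by
      have := ((hasDerivAt_id s).smul_const w.1).const_sub y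
      simpa using! this
    have := (SchwartzMap.hasFDerivAt f (y - (s • w).1)).comp_hasDerivAt s h5
    exact this.congr_deriv (map_neg _ _)
  refine (h2.mul h4).congr_deriv ?_
  rw [shiftFun, shiftDeriv_apply]
  simp only [smul_fst, inner_sub_right, real_inner_smul_right]
  ring

lemma norm_sub_sub_deriv_le {g g' g'' : ℝ → E} {K : ℝ} (h1 : ∀ s, HasDerivAt g (g' s) s)
    (h2 : ∀ s, HasDerivAt g' (g'' s) s) (hK : ∀ s ∈ Icc (0 : ℝ) 1, ‖g'' s‖ ≤ K) :
    ‖g 1 - g 0 - g' 0‖ ≤ K := by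
  have hK0 : 0 ≤ K := (norm_nonneg _).trans (hK 0 (by simp))
  have h3 : ∀ s ∈ Icc (0 : ℝ) 1, ‖g' s - g' 0‖ ≤ K := by
    intro s hs
    have h := norm_image_sub_le_of_norm_deriv_le_segment' (a := 0) (b := s) (f := g') (C := K)
      (fun t _ => (h2 t).hasDerivWithinAt) (fun t ht => hK t ⟨ht.1, ht.2.le.trans hs.2⟩) s
      ⟨hs.1, le_rfl⟩
    rw [sub_zero] at h
    refine h.trans ?_
    nlinarith [hs.2]
  have h4 := norm_image_sub_le_of_norm_deriv_le_segment_01' (C := K)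
    (f := fun s : ℝ => g s - s • g' 0) (f' := fun s => g' s - g' 0)
    (fun t _ => ((h1 t).sub ((hasDerivAt_id t).smul_const (g' 0)
      |>.congr_deriv (one_smul _ _))).hasDerivWithinAt)
    (fun t ht => h3 t ⟨ht.1, ht.2.le⟩)
  simp only [one_smul, zero_smul, sub_zero] at h4
  rwa [sub_right_comm] at h4

lemma memLp_inv_one_add_norm_pow (d : ℕ) :
    MemLp (fun y : Space d => (((1 + ‖y‖) ^ (d + 1))⁻¹ : ℝ)) 2 := by
  have hc : Continuous fun y : Space d => (((1 + ‖y‖) ^ (d + 1))⁻¹ : ℝ) :=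
    ((continuous_const.add continuous_norm).pow _).inv₀ fun y =>
      pow_ne_zero _ (by linarith [norm_nonneg y] : (0 : ℝ) < 1 + ‖y‖).ne'
  rw [memLp_two_iff_integrable_sq hc.aestronglyMeasurable]
  have h := integrable_one_add_norm (E := Space d) (μ := volume) (r := ((d + 1 : ℕ) : ℝ)) (by simp)
  refine h.mono' (hc.pow 2).aestronglyMeasurable (.of_forall fun y => ?_)
  have h1 : ((1 + ‖y‖) ^ (d + 1))⁻¹ ≤ (1 : ℝ) :=
    inv_le_one_of_one_le₀ (one_le_pow₀ (by linarith [norm_nonneg y]))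
  have h0 : 0 < ((1 + ‖y‖) ^ (d + 1))⁻¹ := by positivity
  rw [norm_of_nonneg (by positivity), rpow_neg (by positivity), rpow_natCast]
  nlinarith

/-- Taylor's formula along `s ↦ shift (s w) f` at every point `y`. The second derivative is a shift
of a Schwartz function; as `‖w‖ ≤ 1`, its decay is comparable to `(1 + ‖y‖) ^ (-(d + 1))`, which is
square integrable. -/
lemma exists_norm_lShift_sub_le (f : 𝓢(Space d, ℂ)) : ∃ K, ∀ w : Phase d, ‖w‖ ≤ 1 →
    ‖lShift w f♭ - f♭ - (shiftDeriv w f)♭‖ ≤ K * ‖w‖ ^ 2 := by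
  set f2 : PhaseIndex d → PhaseIndex d → 𝓢(Space d, ℂ) := fun i j =>
    shiftDeriv (phaseVec i) (shiftDeriv (phaseVec j) f) with hf2
  choose C hC0 hC using fun i j => SchwartzMap.exists_one_add_pow_mul_norm_le (f2 i j) (d + 1)
  set B : Lp ℝ 2 (volume : Measure (Space d)) := (memLp_inv_one_add_norm_pow d).toLp with hB
  set K := ∑ i, ∑ j, C i j with hK
  have hK0 : 0 ≤ K := sum_nonneg fun i _ => sum_nonneg fun j _ => hC0 i j
  refine ⟨2 ^ (d + 1) * K * ‖B‖, fun w hw => ?_⟩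
  have hD (y : Space d) : (shiftDeriv w (shiftDeriv w f)) y =
      ∑ i, ∑ j, ((phaseCoord i w : ℂ) * (phaseCoord j w : ℂ)) * f2 i j y := by
    have e1 : ∀ i, shiftDeriv (phaseVec i) (shiftDeriv w f) =
        ∑ j, (phaseCoord j w : ℂ) • f2 i j := by
      intro i
      ext y
      rw [shiftDeriv_eq_sum w f]
      rw [shiftDeriv_sum_smul]
    rw [shiftDeriv_eq_sum]
    simp only [e1, smul_sum, smul_smul]
    simp
  have hpt (y : Space d) : ‖shiftFun w f y - f y - shiftDeriv w f y‖ ≤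
      2 ^ (d + 1) * K * ‖w‖ ^ 2 * ((1 + ‖y‖) ^ (d + 1))⁻¹ := by
    have h := norm_sub_sub_deriv_le (g := fun s : ℝ => shiftFun (s • w) f y)
      (K := 2 ^ (d + 1) * K * ‖w‖ ^ 2 * ((1 + ‖y‖) ^ (d + 1))⁻¹)
      (hasDerivAt_shiftFun w f y) (hasDerivAt_shiftFun w (shiftDeriv w f) y) (fun s hs => ?_)
    · simp only [one_smul, zero_smul] at h
      have e0 : ∀ g : Space d → ℂ, shiftFun 0 g y = g y := fun g => by simp [shiftFun, shiftPhase]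
      rwa [e0, e0] at h
    · rw [norm_shiftFun, hD]
      set x := y - (s • w).1 with hx
      have hyx : 1 + ‖y‖ ≤ 2 * (1 + ‖x‖) := by
        have h1 : ‖y‖ ≤ ‖x‖ + ‖(s • w).1‖ := by
          have := norm_add_le x (s • w).1
          rwa [hx, sub_add_cancel] at this
        have h2 : ‖(s • w).1‖ ≤ 1 := by
          refine (norm_fst_le _).trans ?_
          rw [norm_smul, norm_of_nonneg hs.1]
          nlinarith [hs.2, norm_nonneg w]
        linarith [norm_nonneg x]
      have h3 : ((1 + ‖x‖) ^ (d + 1))⁻¹ ≤ 2 ^ (d + 1) * ((1 + ‖y‖) ^ (d + 1))⁻¹ := by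
        rw [← div_eq_mul_inv, le_div_iff₀ (by positivity), inv_mul_le_iff₀ (by positivity),
          mul_comm, ← mul_pow]
        gcongr
      calc _ ≤ ∑ i, ∑ j, ‖w‖ * ‖w‖ * (C i j * ((1 + ‖x‖) ^ (d + 1))⁻¹) := by
            refine (norm_sum_le _ _).trans (sum_le_sum fun i _ => (norm_sum_le _ _).trans
              (sum_le_sum fun j _ => ?_))
            rw [norm_mul, norm_mul, norm_real, norm_real]
            refine mul_le_mul (mul_le_mul (abs_phaseCoord_le i w) (abs_phaseCoord_le j w)
              (norm_nonneg _) (norm_nonneg _)) ?_ (norm_nonneg _) (by positivity)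
            rw [← div_eq_mul_inv, le_div_iff₀ (by positivity), mul_comm]
            exact hC i j x
        _ = K * ‖w‖ ^ 2 * ((1 + ‖x‖) ^ (d + 1))⁻¹ := by
            rw [hK, sum_mul, sum_mul]
            refine sum_congr rfl fun i _ => ?_
            rw [sum_mul, sum_mul]
            exact sum_congr rfl fun j _ => by ring
        _ ≤ K * ‖w‖ ^ 2 * (2 ^ (d + 1) * ((1 + ‖y‖) ^ (d + 1))⁻¹) := by gcongr
        _ = _ := by ring
  have h := Lp.norm_le_mul_norm_of_ae_le_mul (c := 2 ^ (d + 1) * K * ‖w‖ ^ 2)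
    (f := lShift w f♭ - f♭ - (shiftDeriv w f)♭) (g := B) ?_
  · exact h.trans_eq (by ring)
  · filter_upwards [Lp.coeFn_sub (lShift w f♭ - f♭) (shiftDeriv w f)♭,
      Lp.coeFn_sub (lShift w f♭) f♭, coeFn_lShift_of_ae (z := w) (f.coeFn_toLp 2 volume),
      f.coeFn_toLp 2 volume, (shiftDeriv w f).coeFn_toLp 2 volume,
      MemLp.coeFn_toLp (memLp_inv_one_add_norm_pow d)] with y h1 h2 h3 h4 h5 h6
    rw [h1, Pi.sub_apply, h2, Pi.sub_apply, h3, h4, h5, h6,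
      norm_of_nonneg (by positivity : (0 : ℝ) ≤ ((1 + ‖y‖) ^ (d + 1))⁻¹)]
    exact hpt y

section SmoothShift

variable {H : Type*} [NormedAddCommGroup H] [InnerProductSpace ℂ H]

/-- Shift operators `T` on a Hilbert space, and a linear map `J` from the Schwartz space along
which `T` is differentiable at the origin. -/
structure IsShiftModel (T : Phase d → H →L[ℂ] H) (J : 𝓢(Space d, ℂ) →ₗ[ℂ] H) : Prop where
  shift_zero : ∀ u, T 0 u = u
  shift_shift : ∀ z w u, T z (T w u) = expI (symp z w / 2) • T (z + w) u
  bound : ∀ f, ∃ K, ∀ w : Phase d, ‖w‖ ≤ 1 →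
    ‖T w (J f) - J f - J (shiftDeriv w f)‖ ≤ K * ‖w‖ ^ 2

namespace IsShiftModel

variable {T : Phase d → H →L[ℂ] H} {J : 𝓢(Space d, ℂ) →ₗ[ℂ] H}

lemma map_shiftDeriv_eq_sum (J : 𝓢(Space d, ℂ) →ₗ[ℂ] H) (v : Phase d) (f : 𝓢(Space d, ℂ)) :
    J (shiftDeriv v f) = ∑ j, phaseCoord j v • J (shiftDeriv (phaseVec j) f) := by
  conv_lhs => rw [shiftDeriv_eq_sum v f]
  rw [map_sum]
  refine sum_congr rfl fun j _ => ?_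
  rw [map_smul, coe_smul]

lemma hasFDerivAt_zero (hT : IsShiftModel T J) (f : 𝓢(Space d, ℂ)) :
    HasFDerivAt (fun w => T w (J f)) (∑ j, (phaseCoord j).smulRight
      (J (shiftDeriv (phaseVec j) f))) (0 : Phase d) := by
  obtain ⟨K, hK⟩ := hT.bound f
  rw [hasFDerivAt_iff_isLittleO_nhds_zero]
  refine (Asymptotics.IsBigO.of_bound K ?_ : _ =O[nhds 0] fun w : Phase d => ‖w‖ ^ 2).trans_isLittleO
    (Asymptotics.isLittleO_norm_pow_id one_lt_two)
  filter_upwards [Metric.closedBall_mem_nhds (0 : Phase d) one_pos] with w hw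
  rw [norm_pow, norm_norm, zero_add, hT.shift_zero, sum_apply]
  simp only [smulRight_apply]
  rw [← map_shiftDeriv_eq_sum]
  exact hK w (by simpa using hw)

/-- The derivative at the origin is carried to `z` by the group law, whose cocycle accounts for the
scalar term. -/
lemma hasFDerivAt (hT : IsShiftModel T J) (f : 𝓢(Space d, ℂ)) (z : Phase d) :
    HasFDerivAt (fun z => T z (J f)) (∑ j, (phaseCoord j).smulRight
      (T z (J (shiftDeriv (phaseVec j) f)) -
        (I * (symp z (phaseVec j) / 2 : ℝ)) • T z (J f))) z := by
  have h1 : HasFDerivAt (fun w : Phase d => expI (-(symp z w / 2)))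
      ((-(I * (1 / 2))) • (ofRealCLM.comp (symp z))) 0 := by
    have h2 : HasFDerivAt (fun w : Phase d => 𝕔(symp z w))
        (ofRealCLM.comp (symp z)) 0 := (ofRealCLM.comp (symp z)).hasFDerivAt
    have h3 := (h2.const_mul (-(I * (1 / 2)))).cexp
    have h4 : (fun w : Phase d => expI (-(symp z w / 2))) =
        fun w => Complex.exp (-(I * (1 / 2)) * 𝕔(symp z w)) := by
      funext w
      unfold expI
      congr 1
      push_cast
      ring
    rw [h4]
    refine h3.congr_fderiv ?_
    simp
  have h2 : HasFDerivAt (fun w => T z (T w (J f))) _ (0 : Phase d) :=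
    ((T z).restrictScalars ℝ).hasFDerivAt.comp (0 : Phase d) (hT.hasFDerivAt_zero f)
  have h3 := h1.smul h2
  have h4 : (fun w => T w (J f)) = fun w => expI (-(symp z (w - z) / 2)) •
      T z (T (w - z) (J f)) := by
    funext w
    rw [hT.shift_shift, smul_smul, expI_neg_mul, one_smul, add_sub_cancel]
  rw [h4]
  have h5 : HasFDerivAt (fun w : Phase d => w - z) (ContinuousLinearMap.id ℝ (Phase d)) z :=
    (hasFDerivAt_id z).sub_const z
  rw [← sub_self z] at h3
  refine (HasFDerivAt.comp (f := fun w => w - z) z h3 h5).congr_fderiv ?_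
  refine ContinuousLinearMap.ext fun v => ?_
  have h6 : 𝕔(symp z v) = ∑ j, (phaseCoord j v : ℂ) * (symp z (phaseVec j) : ℂ) := by
    conv_lhs => rw [← sum_phaseCoord v, map_sum]
    simp
  simp only [sub_self, map_zero, zero_div, neg_zero, expI_zero, one_smul, hT.shift_zero, add_apply,
    comp_apply, id_apply, smul_apply,
    smulRight_apply, ContinuousLinearMap.coe_restrictScalars', sum_apply,
    map_sum, ofRealCLM_apply, h6, smul_sum, smul_sub, sum_sub_distrib,
    smul_eq_mul, mul_sum, Finset.sum_smul]
  rw [sub_eq_add_neg, ← sum_neg_distrib]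
  congr 1
  · refine sum_congr rfl fun j _ => ?_
    exact ((T z).restrictScalars ℝ).map_smul _ _
  · refine sum_congr rfl fun j _ => ?_
    rw [← coe_smul, smul_smul, ← neg_smul]
    congr 1
    push_cast
    ring

/-- The derivative involves the same shifts applied to `shiftDeriv f`, again a Schwartz function, so
regularity bootstraps. -/
lemma contDiff (hT : IsShiftModel T J) (f : 𝓢(Space d, ℂ)) : Smooth fun z => T z (J f) := by
  rw [contDiff_infty]
  intro n
  induction n generalizing f with
  | zero =>
    exact contDiff_zero.2 (continuous_iff_continuousAt.2 fun z => (hT.hasFDerivAt f z).continuousAt)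
  | succ n ih =>
    refine contDiff_succ_iff_hasFDerivAt.2 ⟨_, ?_, fun z => hT.hasFDerivAt f z⟩
    refine ContDiff.sum fun j _ => ?_
    refine (smulRightL ℝ (Phase d) H (phaseCoord j)).contDiff.comp
      ((ih _).sub ?_)
    have h1 : ContDiff ℝ n fun z : Phase d => symp z (phaseVec j) / 2 :=
      (symp.flip (phaseVec j)).contDiff.div_const 2
    have h2 : ContDiff ℝ n fun z : Phase d => I * (symp z (phaseVec j) / 2 : ℝ) :=
      contDiff_const.mul (ofRealCLM.contDiff.comp h1)
    exact h2.smul (ih f)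

lemma dirDeriv_zero (hT : IsShiftModel T J) (f : 𝓢(Space d, ℂ)) (v : Phase d) :
    𝜕 v (fun z => T z (J f)) 0 = J (shiftDeriv v f) := by
  rw [(hT.hasFDerivAt_zero f).dirDeriv_eq, map_shiftDeriv_eq_sum, sum_apply]
  rfl

end IsShiftModel

end SmoothShift

/-! ### Resolutions of the identity from a dense set -/

section Frame

variable {H α : Type*} [NormedAddCommGroup H] [InnerProductSpace ℂ H] [TopologicalSpace α]
  [MeasurableSpace α] [BorelSpace α] {μ : Measure α}

/-- Fatou's lemma extends the identity to all vectors as an inequality, which suffices for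
integrability. -/
lemma lintegral_sq_inner_le_of_dense {c : α → H} (hc : Continuous c) {K : ℝ} {D : Set H}
    (hD : Dense D) (h : ∀ u ∈ D, ∫⁻ q, ofReal (‖⟪c q, u⟫‖ ^ 2) ∂μ = ofReal (K * ‖u‖ ^ 2)) (u : H) :
    ∫⁻ q, ofReal (‖⟪c q, u⟫‖ ^ 2) ∂μ ≤ ofReal (K * ‖u‖ ^ 2) := by
  obtain ⟨v, hv, hvu⟩ := mem_closure_iff_seq_limit.1 (hD u)
  have h1 : ∀ q, ofReal (‖⟪c q, u⟫‖ ^ 2) =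
      Filter.liminf (fun n => ofReal (‖⟪c q, v n⟫‖ ^ 2)) Filter.atTop := by
    intro q
    have : Filter.Tendsto (fun n => ofReal (‖⟪c q, v n⟫‖ ^ 2)) Filter.atTop
        (nhds (ofReal (‖⟪c q, u⟫‖ ^ 2))) :=
      ENNReal.tendsto_ofReal ((tendsto_const_nhds.inner hvu).norm.pow 2)
    exact this.liminf_eq.symm
  have h2 : Filter.Tendsto (fun n => ofReal (K * ‖v n‖ ^ 2)) Filter.atTop
      (nhds (ofReal (K * ‖u‖ ^ 2))) :=
    ENNReal.tendsto_ofReal ((hvu.norm.pow 2).const_mul K)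
  simp only [h1]
  refine (lintegral_liminf_le fun n => ?_).trans_eq ?_
  · have : Continuous fun q => ‖⟪c q, v n⟫‖ ^ 2 := (hc.inner continuous_const).norm.pow 2
    exact (ENNReal.continuous_ofReal.comp this).measurable
  · simp only [h _ (hv _)]
    exact h2.liminf_eq

lemma integrable_sq_inner_of_dense {c : α → H} (hc : Continuous c) {K : ℝ} {D : Set H}
    (hD : Dense D) (h : ∀ u ∈ D, ∫⁻ q, ofReal (‖⟪c q, u⟫‖ ^ 2) ∂μ = ofReal (K * ‖u‖ ^ 2)) (u : H) :
    Integrable (fun q => ‖⟪c q, u⟫‖ ^ 2) μ := by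
  have h1 : Continuous fun q => ‖⟪c q, u⟫‖ ^ 2 := (hc.inner continuous_const).norm.pow 2
  refine ⟨h1.measurable.aestronglyMeasurable, ?_⟩
  rw [hasFiniteIntegral_iff_ofReal (.of_forall fun q => sq_nonneg _)]
  exact (lintegral_sq_inner_le_of_dense hc hD h u).trans_lt ENNReal.ofReal_lt_top

lemma memLp_inner_of_dense {c : α → H} (hc : Continuous c) {K : ℝ} {D : Set H}
    (hD : Dense D) (h : ∀ u ∈ D, ∫⁻ q, ofReal (‖⟪c q, u⟫‖ ^ 2) ∂μ =
      ofReal (K * ‖u‖ ^ 2)) (u : H) : MemLp (fun q => ⟪c q, u⟫) 2 μ := by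
  rw [memLp_two_iff_integrable_sq_norm (hc.inner continuous_const).measurable.aestronglyMeasurable]
  exact integrable_sq_inner_of_dense hc hD h u

/-- The transform `u ↦ ⟪c ·, u⟫` is bounded into `L²` and is `√K` times an isometry on a dense set,
hence everywhere by continuity. An isometry preserves inner products, which is the polarized
identity. -/
lemma integral_inner_mul_inner_of_dense {c : α → H} (hc : Continuous c) {K : ℝ} (hK : 0 < K)
    {D : Set H} (hD : Dense D)
    (h : ∀ u ∈ D, ∫⁻ q, ofReal (‖⟪c q, u⟫‖ ^ 2) ∂μ = ofReal (K * ‖u‖ ^ 2)) (u v : H) :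
    ∫ q, ⟪u, c q⟫ * ⟪c q, v⟫ ∂μ = (K : ℂ) * ⟪u, v⟫ := by
  have hm := memLp_inner_of_dense hc hD h
  let T0 : H →ₗ[ℂ] Lp ℂ 2 μ :=
    { toFun := fun u => (hm u).toLp
      map_add' := fun u v => by
        rw [← MemLp.toLp_add]
        exact MemLp.toLp_congr (hm _) ((hm u).add (hm v)) (.of_forall fun q => inner_add_right _ _ _)
      map_smul' := fun r u => by
        rw [RingHom.id_apply, ← MemLp.toLp_const_smul]
        exact MemLp.toLp_congr (hm _) ((hm u).const_smul r) (.of_forall fun q => inner_smul_right _ _ _) }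
  have hin : ∀ u v, ⟪T0 u, T0 v⟫ = ∫ q, ⟪u, c q⟫ * ⟪c q, v⟫ ∂μ := by
    intro u v
    rw [L2.inner_def]
    refine integral_congr_ae ?_
    filter_upwards [(hm u).coeFn_toLp, (hm v).coeFn_toLp] with q h1 h2
    change ⟪((hm u).toLp _ : α → ℂ) q, ((hm v).toLp _ : α → ℂ) q⟫ = _
    rw [h1, h2, RCLike.inner_apply, inner_conj_symm, mul_comm]
  have hn : ∀ u, ‖T0 u‖ ^ 2 = ∫ q, ‖⟪c q, u⟫‖ ^ 2 ∂μ := by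
    intro u
    have h1 := hin u u
    rw [inner_self_eq_norm_sq_to_K] at h1
    have h2 : ∀ q, ⟪u, c q⟫ * ⟪c q, u⟫ = 𝕔(‖⟪c q, u⟫‖ ^ 2) := by
      intro q
      rw [← inner_conj_symm, mul_comm, Complex.mul_conj, normSq_eq_norm_sq]
    simp only [h2] at h1
    rw [integral_complex_ofReal] at h1
    exact ofReal_injective (by simpa using! h1)
  have hle : ∀ u, ‖T0 u‖ ≤ √K * ‖u‖ := by
    intro u
    refine abs_le_of_sq_le_sq' ?_ (by positivity) |>.2
    rw [hn, mul_pow, sq_sqrt hK.le]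
    have h1 := lintegral_sq_inner_le_of_dense hc hD h u
    rw [← ofReal_integral_eq_lintegral_ofReal (integrable_sq_inner_of_dense hc hD h u)
      (.of_forall fun q => sq_nonneg _)] at h1
    exact (ENNReal.ofReal_le_ofReal_iff (by positivity)).1 h1
  let T : H →L[ℂ] Lp ℂ 2 μ := T0.mkContinuous _ hle
  have hT : ∀ u, ‖T u‖ = √K * ‖u‖ := by
    have : (fun u => ‖T u‖) = fun u => √K * ‖u‖ := by
      refine Continuous.ext_on hD T.continuous.norm (continuous_const.mul continuous_norm) ?_
      intro u hu
      change ‖T0 u‖ = √K * ‖u‖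
      rw [← sq_eq_sq₀ (norm_nonneg _) (by positivity), hn, mul_pow, sq_sqrt hK.le]
      have h1 := h u hu
      rw [← ofReal_integral_eq_lintegral_ofReal (integrable_sq_inner_of_dense hc hD h u)
        (.of_forall fun q => sq_nonneg _)] at h1
      exact (ENNReal.ofReal_eq_ofReal_iff (integral_nonneg fun q => sq_nonneg _)
        (by positivity)).1 h1
    exact fun u => congrFun this u
  have hs : 0 < √K := Real.sqrt_pos.2 hK
  let J : H →ₗᵢ[ℂ] Lp ℂ 2 μ :=
    { toLinearMap := ((√K)⁻¹ : ℂ) • T.toLinearMap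
      norm_map' := fun u => by
        change ‖((√K)⁻¹ : ℂ) • T u‖ = ‖u‖
        rw [norm_smul, hT, ← ofReal_inv, norm_real, norm_of_nonneg (by positivity),
          inv_mul_cancel_left₀ hs.ne'] }
  have hJ := J.inner_map_map u v
  change ⟪((√K)⁻¹ : ℂ) • T0 u, ((√K)⁻¹ : ℂ) • T0 v⟫ = _ at hJ
  rw [inner_smul_left, inner_smul_right, hin] at hJ
  rw [← hJ, ← mul_assoc, ← mul_assoc, map_inv₀, conj_ofReal]
  have h3 : (K : ℂ) = (√K : ℂ) * √K := by rw [← ofReal_mul, Real.mul_self_sqrt hK.le]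
  have h4 : (√K : ℂ) ≠ 0 := by exact_mod_cast hs.ne'
  rw [h3]
  field_simp

end Frame

/-! ### The standard Heisenberg system -/

section Vacuum

variable (d : ℕ)

lemma sq_norm_le_half_innerSL (y : Space d) : ½ * ‖y‖ ^ 2 ≤ (½ • innerSL ℝ) y y := by simp

/-- The normalized Gaussian `π^{-d/4} e^{-|y|²/2}`. -/
def vacSchwartz {d : ℕ} : 𝓢(Space d, ℂ) :=
  𝕔(π ^ (-((d : ℝ) / 4))) • SchwartzMap.postcompCLM ofRealCLM
    (gaussSchwartz (½ • innerSL ℝ) (c := 1 / 2) (by norm_num) (sq_norm_le_half_innerSL d))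

variable {d}

lemma vacSchwartz_apply (y : Space d) :
    vacSchwartz y = 𝕔(π ^ (-((d : ℝ) / 4)) * exp (-(‖y‖ ^ 2 / 2))) := by
  have h : (½ • innerSL ℝ) y y = ‖y‖ ^ 2 / 2 := by simp; ring
  rw [vacSchwartz, smul_apply, SchwartzMap.postcompCLM_apply, ofRealCLM_apply,
    gaussSchwartz_apply, h, smul_eq_mul, ← ofReal_mul]

lemma rpow_neg_mul_rpow_neg (d : ℕ) :
    π ^ (-((d : ℝ) / 4)) * π ^ (-((d : ℝ) / 4)) * π ^ ((d : ℝ) / 2) = 1 := by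
  rw [← rpow_add pi_pos, ← rpow_add pi_pos]
  have : -((d : ℝ) / 4) + -((d : ℝ) / 4) + (d : ℝ) / 2 = 0 := by ring
  rw [this, Real.rpow_zero]

lemma inner_vac_lShift (z : Phase d) : ⟪vacSchwartz♭, lShift z vacSchwartz♭⟫ =
      (exp (-((‖z.1‖ ^ 2 + ‖z.2‖ ^ 2) / 4)) : ℂ) := by
  set k : ℝ := π ^ (-((d : ℝ) / 4)) with hk
  have h1 : ⟪vacSchwartz♭, lShift z vacSchwartz♭⟫ =
      ∫ y : Space d, vacSchwartz y * shiftFun z vacSchwartz y := by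
    rw [L2.inner_def]
    refine integral_congr_ae ?_
    filter_upwards [vacSchwartz.coeFn_toLp 2 volume,
      coeFn_lShift_of_ae (z := z) (vacSchwartz.coeFn_toLp 2 volume)] with y h1 h2
    rw [h1, h2, RCLike.inner_apply, vacSchwartz_apply, conj_ofReal, mul_comm]
  have h2 : ∀ y : Space d, vacSchwartz (y + ½ • z.1) * shiftFun z vacSchwartz (y + ½ • z.1) =
      𝕔(k * k * exp (-(‖z.1‖ ^ 2 / 4))) *
        Complex.exp (-1 * (‖y‖ : ℂ) ^ 2 + I * (inner ℝ z.2 y : ℝ)) := by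
    intro y
    have e1 : ‖y + ½ • z.1‖ ^ 2 / 2 + ‖y + ½ • z.1 - z.1‖ ^ 2 / 2 = ‖y‖ ^ 2 + ‖z.1‖ ^ 2 / 4 := by
      have : y + ½ • z.1 - z.1 = y - ½ • z.1 := by module
      rw [this, norm_add_sq_real, norm_sub_sq_real, norm_smul, mul_pow]
      norm_num
      ring
    have e2 : shiftPhase z (y + ½ • z.1) = inner ℝ z.2 y := by
      simp only [shiftPhase, inner_add_right, real_inner_smul_right]
      ring
    rw [shiftFun, e2, vacSchwartz_apply, vacSchwartz_apply, ← hk, expI]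
    have e3 : k * exp (-(‖y + ½ • z.1‖ ^ 2 / 2)) *
        (k * exp (-(‖y + ½ • z.1 - z.1‖ ^ 2 / 2))) =
        k * k * exp (-(‖z.1‖ ^ 2 / 4)) * exp (-‖y‖ ^ 2) := by
      rw [mul_mul_mul_comm, ← Real.exp_add, mul_assoc (k * k), ← Real.exp_add]
      congr 2
      linarith
    rw [mul_left_comm, ← ofReal_mul, e3, Complex.exp_add]
    push_cast
    ring_nf
  -- Recentring at the midpoint of the two Gaussians makes their product a centred Gaussian and
  -- removes the quadratic phase of the shift.
  rw [h1, ← integral_add_right_eq_self _ (½ • z.1)]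
  simp only [h2]
  rw [integral_const_mul, GaussianFourier.integral_cexp_neg_mul_sq_norm_add (by simp)]
  have h3 : ((π : ℂ) / 1) ^ ((Module.finrank ℝ (Space d) : ℂ) / 2) = 𝕔(π ^ ((d : ℝ) / 2)) := by
    rw [div_one, Complex.ofReal_cpow pi_pos.le]
    simp
  have h4 : Complex.exp (I ^ 2 * (‖z.2‖ : ℂ) ^ 2 / (4 * 1)) =
      (exp (-(‖z.2‖ ^ 2 / 4)) : ℂ) := by
    rw [Complex.ofReal_exp]
    congr 1
    rw [Complex.I_sq]
    push_cast
    ring_nf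
  rw [h3, h4, ← ofReal_mul, ← ofReal_mul]
  congr 1
  calc _ = k * k * π ^ ((d : ℝ) / 2) *
      (exp (-(‖z.1‖ ^ 2 / 4)) * exp (-(‖z.2‖ ^ 2 / 4))) := by ring
    _ = _ := by
      rw [rpow_neg_mul_rpow_neg, one_mul, ← Real.exp_add]
      congr 1
      ring

lemma norm_toLp_vacSchwartz : ‖(vacSchwartz (d := d))♭‖ = 1 := by
  have h := inner_vac_lShift (d := d) 0
  rw [lShift_zero, inner_self_eq_norm_sq_to_K] at h
  refine (pow_eq_one_iff_of_nonneg (norm_nonneg _) two_ne_zero).1 (Complex.ofReal_injective ?_)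
  simpa using h

lemma norm_sq_toLp (f : 𝓢(Space d, ℂ)) : ‖f♭‖ ^ 2 = ∫ y, ‖f y‖ ^ 2 := by
  have h : ⟪f♭, f♭⟫ = ∫ y, 𝕔(‖f y‖ ^ 2) := by
    rw [L2.inner_def]
    refine integral_congr_ae ?_
    filter_upwards [f.coeFn_toLp 2 volume] with y h1
    rw [h1, inner_self_eq_norm_sq_to_K]
    simp
  rw [inner_self_eq_norm_sq_to_K, integral_complex_ofReal] at h
  exact ofReal_injective (by simpa using! h)

lemma integral_norm_sq_vacSchwartz : ∫ y, ‖vacSchwartz (d := d) y‖ ^ 2 = 1 := by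
  rw [← norm_sq_toLp, norm_toLp_vacSchwartz, one_pow]

lemma fderiv_vacSchwartz (y v : Space d) :
    fderiv ℝ vacSchwartz y v = -𝕔(inner ℝ v y) * vacSchwartz y := by
  have h1 : HasFDerivAt (fun y : Space d => -(‖y‖ ^ 2 / 2)) (-(innerSL ℝ y)) y := by
    have h2 := ((hasStrictFDerivAt_norm_sq y).hasFDerivAt.mul_const ½).neg
    have e : (fun y : Space d => -(‖y‖ ^ 2 / 2)) = -fun y => ‖y‖ ^ 2 * (1 / 2) := by
      funext y
      simp only [Pi.neg_apply]
      ring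
    rw [e]
    refine h2.congr_fderiv ?_
    ext v
    simp
  have h3 := ofRealCLM.hasFDerivAt.comp y (h1.exp.const_mul (π ^ (-((d : ℝ) / 4))))
  have e : (vacSchwartz : Space d → ℂ) = ofRealCLM ∘
      fun y => π ^ (-((d : ℝ) / 4)) * exp (-(‖y‖ ^ 2 / 2)) :=
    funext vacSchwartz_apply
  rw [vacSchwartz_apply, e, h3.fderiv]
  simp only [comp_apply, smul_apply, neg_apply, innerSL_apply_apply,
    ofRealCLM_apply, smul_eq_mul, real_inner_comm]
  push_cast
  ring

end Vacuum

/-- The inclusion of the Schwartz space into `L²`. -/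
def toLTwo (d : ℕ) : 𝓢(Space d, ℂ) →ₗ[ℂ] LTwo d :=
  (SchwartzMap.toLpCLM ℂ ℂ 2 (volume : Measure (Space d))).toLinearMap

lemma toLTwo_apply (f : 𝓢(Space d, ℂ)) : toLTwo d f = f♭ := rfl

lemma dense_range_toLTwo : Dense (Set.range (toLTwo d)) := SchwartzMap.denseRange_toLpCLM (by simp)

lemma isShiftModel_lShift : IsShiftModel (lShift (d := d)) (toLTwo d) where
  shift_zero := lShift_zero
  shift_shift := lShift_lShift
  bound := exists_norm_lShift_sub_le

lemma integral_sq_fourier_scaled (w : 𝓢(Space d, ℂ)) :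
    Integrable (fun ξ : Space d => ‖∫ y, expI (-(inner ℝ ξ y)) * w y‖ ^ 2) ∧
    ∫ ξ : Space d, ‖∫ y, expI (-(inner ℝ ξ y)) * w y‖ ^ 2 = (2 * π) ^ d * ∫ y, ‖w y‖ ^ 2 := by
  have hπ : (2 * π) ≠ 0 := by positivity
  have h1 : ∀ ξ : Space d, ∫ y, expI (-(inner ℝ ξ y)) * w y =
      FourierTransform.fourier w ((2 * π)⁻¹ • ξ) := by
    intro ξ
    rw [SchwartzMap.fourier_coe, Real.fourier_eq']
    refine integral_congr_ae (.of_forall fun y => ?_)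
    simp only [real_inner_smul_right, smul_eq_mul]
    rw [expI, real_inner_comm]
    congr 2
    push_cast
    field_simp
  simp only [h1]
  have h2 : Integrable fun ξ : Space d => ‖FourierTransform.fourier w ξ‖ ^ 2 :=
    (memLp_two_iff_integrable_sq_norm (FourierTransform.fourier w).continuous.aestronglyMeasurable).1
      ((FourierTransform.fourier w).memLp 2 volume)
  refine ⟨h2.comp_smul (inv_ne_zero hπ), ?_⟩
  rw [Measure.integral_comp_smul volume (fun ξ => ‖FourierTransform.fourier w ξ‖ ^ 2),
    SchwartzMap.integral_norm_sq_fourier]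
  simp only [finrank_euclideanSpace, Fintype.card_fin, inv_pow, inv_inv, smul_eq_mul]
  rw [abs_of_pos (by positivity)]

lemma inner_lShift_vac (z : Phase d) (f : 𝓢(Space d, ℂ)) : ⟪lShift z vacSchwartz♭, f♭⟫ =
      expI (inner ℝ z.2 z.1 / 2) *
        ∫ y, expI (-(inner ℝ z.2 y)) * (vacSchwartz (y - z.1) * f y) := by
  rw [L2.inner_def, ← integral_const_mul]
  refine integral_congr_ae ?_
  filter_upwards [f.coeFn_toLp 2 volume,
    coeFn_lShift_of_ae (z := z) (vacSchwartz.coeFn_toLp 2 volume)] with y h1 h2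
  rw [h1, h2, RCLike.inner_apply, shiftFun, map_mul, vacSchwartz_apply, conj_ofReal,
    conj_expI, shiftPhase, ← mul_assoc (expI _), ← expI_add]
  have : inner ℝ z.2 z.1 / 2 + -inner ℝ z.2 y = -(inner ℝ z.2 y - inner ℝ z.2 z.1 / 2) := by ring
  rw [this]
  ring

/-- For fixed position the coefficient is a Fourier transform of a windowed function, so
Plancherel's theorem evaluates the momentum integral. Tonelli's theorem and translation invariance
then give the normalized mass of the window. -/
lemma lintegral_sq_inner_lShift_vac (f : 𝓢(Space d, ℂ)) : ∫⁻ q : Phase d, ofReal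
      (‖⟪lShift q vacSchwartz♭, f♭⟫‖ ^ 2) =
      ofReal ((2 * π) ^ d * ‖f♭‖ ^ 2) := by
  have hc : Continuous fun q : Phase d => ofReal (‖⟪lShift q vacSchwartz♭, f♭⟫‖ ^ 2) :=
    ENNReal.continuous_ofReal.comp
      (((isShiftModel_lShift.contDiff vacSchwartz).continuous.inner continuous_const).norm.pow 2)
  rw [volume_eq_prod, lintegral_prod _ hc.aemeasurable]
  have h1 : ∀ x : Space d, ∫⁻ ξ : Space d, ofReal (‖⟪lShift (x, ξ) vacSchwartz♭, f♭⟫‖ ^ 2) =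
      ofReal ((2 * π) ^ d) * ∫⁻ y, ofReal (‖vacSchwartz (y - x)‖ ^ 2) * ofReal (‖f y‖ ^ 2) := by
    intro x
    have hg : Function.HasTemperateGrowth fun y => vacSchwartz (y - x) :=
      (SchwartzMap.compSubConstCLM ℂ x vacSchwartz).hasTemperateGrowth
    set w := SchwartzMap.smulLeftCLM ℂ (fun y => vacSchwartz (y - x)) f with hw
    have hwy : ∀ y, w y = vacSchwartz (y - x) * f y := fun y => by
      rw [hw, SchwartzMap.smulLeftCLM_apply_apply hg, smul_eq_mul]
    obtain ⟨i1, i2⟩ := integral_sq_fourier_scaled w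
    have h2 : ∀ ξ : Space d, ‖⟪lShift (x, ξ) vacSchwartz♭, f♭⟫‖ =
        ‖∫ y, expI (-(inner ℝ ξ y)) * w y‖ := by
      intro ξ
      rw [inner_lShift_vac, norm_mul, norm_expI, one_mul]
      simp only [hwy]
    simp only [h2]
    rw [← ofReal_integral_eq_lintegral_ofReal i1 (.of_forall fun _ => sq_nonneg _), i2,
      ENNReal.ofReal_mul (by positivity), ofReal_integral_eq_lintegral_ofReal
      ((memLp_two_iff_integrable_sq_norm w.continuous.aestronglyMeasurable).1 (w.memLp 2 volume))
      (.of_forall fun _ => sq_nonneg _)]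
    congr 1
    refine lintegral_congr fun y => ?_
    rw [hwy, norm_mul, mul_pow, ENNReal.ofReal_mul (sq_nonneg _)]
  simp only [h1]
  rw [lintegral_const_mul _ (by
    refine Measurable.lintegral_prod_right ?_
    fun_prop), lintegral_lintegral_swap (by fun_prop)]
  have h3 : ∀ y : Space d, ∫⁻ x : Space d,
      ofReal (‖vacSchwartz (y - x)‖ ^ 2) * ofReal (‖f y‖ ^ 2) =
      ofReal (‖f y‖ ^ 2) := by
    intro y
    rw [lintegral_mul_const _ (by fun_prop),
      lintegral_sub_left_eq_self (fun x => ofReal (‖vacSchwartz x‖ ^ 2)) y,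
      ← ofReal_integral_eq_lintegral_ofReal
      ((memLp_two_iff_integrable_sq_norm vacSchwartz.continuous.aestronglyMeasurable).1
        (vacSchwartz.memLp 2 volume)) (.of_forall fun _ => sq_nonneg _),
      integral_norm_sq_vacSchwartz, ENNReal.ofReal_one, one_mul]
  simp only [h3]
  rw [ENNReal.ofReal_mul (by positivity), norm_sq_toLp, ofReal_integral_eq_lintegral_ofReal
      ((memLp_two_iff_integrable_sq_norm f.continuous.aestronglyMeasurable).1 (f.memLp 2 volume))
      (.of_forall fun _ => sq_nonneg _)]

/-- The Heisenberg system on `L²(ℝ^d)`. -/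
def stdSys : HeisenbergSystem d (LTwo d) where
  shift := lShift
  shift_zero := lShift_zero
  shift_shift := lShift_lShift
  norm_shift := norm_lShift
  parity := lParity
  parity_shift := lParity_lShift
  vac := vacSchwartz♭
  parity_vac := by
    refine Lp.ext ?_
    filter_upwards [coeFn_lParity_of_ae (vacSchwartz.coeFn_toLp 2 volume),
      vacSchwartz.coeFn_toLp 2 volume] with y h1 h2
    rw [h1, h2, vacSchwartz_apply, vacSchwartz_apply, norm_neg]
  inner_vac := inner_vac_lShift
  smooth_vac := isShiftModel_lShift.contDiff vacSchwartz
  annihilate_vac i := by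
    have h1 := isShiftModel_lShift.dirDeriv_zero vacSchwartz (phaseVec (inr i))
    have h2 := isShiftModel_lShift.dirDeriv_zero vacSchwartz (phaseVec (inl i))
    refine h1.trans (Eq.trans ?_ (congrArg (I • ·) h2).symm)
    beta_reduce
    rw [← map_smul]
    congr 1
    ext y
    rw [smul_apply, shiftDeriv_apply, shiftDeriv_apply, fderiv_vacSchwartz, fderiv_vacSchwartz]
    simp [phaseVec]
    ring
  integrable_sq u := integrable_sq_inner_of_dense
    (isShiftModel_lShift.contDiff vacSchwartz).continuous dense_range_toLTwo
    (by rintro _ ⟨f, rfl⟩; exact lintegral_sq_inner_lShift_vac f) u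
  resolution u v := integral_inner_mul_inner_of_dense
    (isShiftModel_lShift.contDiff vacSchwartz).continuous (by positivity) dense_range_toLTwo
    (by rintro _ ⟨f, rfl⟩; exact lintegral_sq_inner_lShift_vac f) u v

lemma smoothVec_toLTwo (f : 𝓢(Space d, ℂ)) : stdSys.SmoothVec (toLTwo d f) :=
  isShiftModel_lShift.contDiff f

/-! ### Weyl operators as superpositions of reflections -/

namespace HeisenbergSystem

/-- The reflection at the phase space point `z`. -/
def reflect (S : HeisenbergSystem d H) (z : Phase d) : H →L[ℂ] H :=
  (S.shift ((2 : ℝ) • z)).comp S.parity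

lemma reflect_coh (z q : Phase d) :
    S.reflect z (S.coh q) = expI (-(symp z q)) • S.coh ((2 : ℝ) • z - q) := by
  rw [reflect, comp_apply, coh, S.parity_shift, S.parity_vac, S.shift_shift, coh, ← sub_eq_add_neg]
  congr 2
  simp
  ring

lemma inner_coh_reflect_coh (z q' q : Phase d) : ⟪S.coh q', S.reflect z (S.coh q)⟫ =
      expI (-(symp q' q / 2)) * (expI (symp (z - ½ • (q' + q)) (q' - q)) *
        (phaseGauss (z - ½ • (q' + q)) : ℂ)) := by
  rw [reflect_coh, inner_smul_right, inner_coh_coh, phaseGauss_apply, ← mul_assoc, ← mul_assoc,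
    ← expI_add, ← expI_add]
  have e1 : q' - ((2 : ℝ) • z - q) = (-2 : ℝ) • (z - ½ • (q' + q)) := by module
  congr 2
  · have h1 := symp_self q'
    have h2 := symp_self q
    have h3 := symp_swap q q'
    have h4 := symp_swap z q'
    simp only [map_sub, map_add, map_smul, sub_apply, add_apply, smul_apply, smul_eq_mul]
    rw [h1, h2]
    linarith
  · rw [e1]
    simp only [smul_fst, smul_snd, norm_smul, mul_pow]
    norm_num
    ring

/-- Two resolutions of the identity are inserted into `π^{-d} ∫ c(z) ⟪v, reflect z u⟫ dz`. The
coherent state transforms of smooth vectors are integrable, so the triple integral converges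
absolutely: in one order it produces `opKernel`, in the other the reflections. -/
lemma inner_op_eq_integral {c} (hc : SymbolBound 0 M c) {v u : H}
    (hv : S.SmoothVec v) (hu : S.SmoothVec u) :
    Integrable (fun z => (c z : ℂ) * ⟪v, S.reflect z u⟫) ∧
    ⟪v, S.op c u⟫ = 𝕔((π ^ d)⁻¹) * ∫ z, (c z : ℂ) * ⟪v, S.reflect z u⟫ := by
  set F : (Phase d × Phase d) × Phase d → ℂ := fun p => ⟪v, S.coh p.1.1⟫ * ⟪S.coh p.1.2, u⟫ *
      ((c p.2 : ℂ) * ⟪S.coh p.1.1, S.reflect p.2 (S.coh p.1.2)⟫) with hF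
  have hFc : Continuous F := by
    have h1 : Continuous fun p : (Phase d × Phase d) × Phase d =>
        ⟪S.coh p.1.1, S.reflect p.2 (S.coh p.1.2)⟫ := by
      simp only [inner_coh_reflect_coh]
      have h2 : Continuous fun p : (Phase d × Phase d) × Phase d => -(symp p.1.1 p.1.2 / 2) := by
        fun_prop
      have h3 : Continuous fun p : (Phase d × Phase d) × Phase d =>
          symp (p.2 - ½ • (p.1.1 + p.1.2)) (p.1.1 - p.1.2) := by fun_prop
      have h4 : Continuous fun p : (Phase d × Phase d) × Phase d =>
          phaseGauss (p.2 - ½ • (p.1.1 + p.1.2)) :=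
        phaseGauss.continuous.comp (by fun_prop)
      exact (contDiff_expI.continuous.comp h2).mul
        ((contDiff_expI.continuous.comp h3).mul (continuous_ofReal.comp h4))
    have h5 := (S.continuous_inner_coh_right v).comp
      (continuous_fst.comp (continuous_fst (X := Phase d × Phase d) (Y := Phase d)))
    have h6 := (S.continuous_inner_coh u).comp
      (continuous_snd.comp (continuous_fst (X := Phase d × Phase d) (Y := Phase d)))
    exact (h5.mul h6).mul ((continuous_ofReal.comp
      (hc.smooth.continuous.comp continuous_snd)).mul h1)
  have ha : Integrable fun q => ⟪v, S.coh q⟫ := by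
    refine (integrable_inner_coh hv).norm.mono'
      (S.continuous_inner_coh_right v).aestronglyMeasurable (.of_forall fun q => ?_)
    rw [norm_inner_symm]
  have hab : Integrable fun p : Phase d × Phase d => ⟪v, S.coh p.1⟫ * ⟪S.coh p.2, u⟫ := by
    rw [volume_eq_prod]
    exact ha.mul_prod (integrable_inner_coh hu)
  have hin : ∀ p : Phase d × Phase d, ∀ w, F (p, ½ • (p.1 + p.2) + w) =
      ⟪v, S.coh p.1⟫ * ⟪S.coh p.2, u⟫ * (expI (-(symp p.1 p.2 / 2)) * (expI (symp w (p.1 - p.2)) *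
          𝕔(c (½ • (p.1 + p.2) + w) * phaseGauss w))) := by
    intro p w
    simp only [hF, inner_coh_reflect_coh, add_sub_cancel_left]
    push_cast
    ring
  have hinner : ∀ p : Phase d × Phase d, Integrable (fun z => F (p, z)) ∧
      ∫ z, ‖F (p, z)‖ ≤ ‖⟪v, S.coh p.1⟫ * ⟪S.coh p.2, u⟫‖ * (M * ∫ w, phaseGauss (d := d) w) ∧
      ∫ z, F (p, z) = 𝕔(π ^ d) * (⟪v, S.coh p.1⟫ * opKernel c p.1 p.2 * ⟪S.coh p.2, u⟫) := by
    intro p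
    set m := ½ • (p.1 + p.2) with hm
    have h1 : Integrable fun w => F (p, m + w) := by
      simp only [hin, hm]
      exact ((integrable_opKernelInt hc _ _).const_mul _).const_mul _
    refine ⟨?_, ?_, ?_⟩
    · have := h1.comp_add_left (-m)
      simpa using this
    · rw [← integral_add_left_eq_self _ m, ← integral_const_mul, ← integral_const_mul]
      refine integral_mono_of_nonneg (.of_forall fun w => norm_nonneg _)
        (((SchwartzMap.integrable phaseGauss).const_mul M).const_mul _) (.of_forall fun w => ?_)
      simp only [hin, hm]
      rw [norm_mul, norm_mul (expI _), norm_mul (expI _), norm_expI, norm_expI, one_mul, one_mul,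
        norm_real, norm_mul (c _), norm_of_nonneg (phaseGauss_nonneg w)]
      refine mul_le_mul_of_nonneg_left (mul_le_mul_of_nonneg_right ?_ (phaseGauss_nonneg w))
        (norm_nonneg _)
      simpa using! hc.abs_le _
    · rw [← integral_add_left_eq_self _ m]
      simp only [hin, hm]
      rw [integral_const_mul, integral_const_mul, opKernel, opKernelInt]
      have : (π : ℂ) ≠ 0 := by exact_mod_cast Real.pi_ne_zero
      push_cast
      field_simp
  have hFi' : Integrable F ((volume : Measure (Phase d × Phase d)).prod volume) := by
    rw [integrable_prod_iff hFc.aestronglyMeasurable]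
    refine ⟨.of_forall fun p => (hinner p).1, ?_⟩
    refine (hab.norm.mul_const (M * ∫ w, phaseGauss (d := d) w)).mono'
      hFc.norm.stronglyMeasurable.integral_prod_right'.aestronglyMeasurable
      (.of_forall fun p => ?_)
    rw [norm_of_nonneg (integral_nonneg fun z => norm_nonneg _)]
    exact (hinner p).2.1
  have hz : ∀ z, Integrable (fun p => F (p, z)) → ∫ p, F (p, z) =
      𝕔((2 * π) ^ d) ^ 2 * ((c z : ℂ) * ⟪v, S.reflect z u⟫) := by
    intro z hi
    have h1 : ∀ q, ∫ q', F ((q', q), z) = 𝕔((2 * π) ^ d) * (c z : ℂ) *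
        (⟪(S.reflect z).adjoint v, S.coh q⟫ * ⟪S.coh q, u⟫) := by
      intro q
      rw [adjoint_inner_left]
      have h2 := S.resolution v (S.reflect z (S.coh q))
      have h3 : ∀ q', F ((q', q), z) = ⟪S.coh q, u⟫ * (c z : ℂ) *
          (⟪v, S.coh q'⟫ * ⟪S.coh q', S.reflect z (S.coh q)⟫) := fun q' => by
        simp only [hF]; ring
      simp only [h3]
      rw [integral_const_mul]
      change _ * (∫ q', ⟪v, S.shift q' S.vac⟫ * ⟪S.shift q' S.vac, _⟫) = _
      rw [h2]
      ring
    rw [volume_eq_prod, integral_prod_symm _ hi]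
    simp only [h1]
    rw [integral_const_mul]
    have h2 := S.resolution ((S.reflect z).adjoint v) u
    change _ * (∫ q, ⟪_, S.shift q S.vac⟫ * ⟪S.shift q S.vac, u⟫) = _
    rw [h2, adjoint_inner_left]
    ring
  have hK : 𝕔((2 * π) ^ d) ≠ 0 := by exact_mod_cast (by positivity : ((2 * π) ^ d : ℝ) ≠ 0)
  -- Fubini's theorem gives integrable slices for almost every `z` only.
  have hae : ∀ᵐ z, ∫ p, F (p, z) = 𝕔((2 * π) ^ d) ^ 2 * ((c z : ℂ) * ⟪v, S.reflect z u⟫) := by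
    filter_upwards [hFi'.prod_left_ae] with z h
    exact hz z h
  refine ⟨?_, ?_⟩
  · have h1 := (hFi'.integral_prod_right.congr hae).const_mul (𝕔((2 * π) ^ d) ^ 2)⁻¹
    simpa [inv_mul_cancel_left₀ (pow_ne_zero 2 hK)] using! h1
  · have h1 : ∫ z, ∫ p, F (p, z) = ∫ p, ∫ z, F (p, z) := by
      rw [← integral_prod _ hFi', ← integral_prod_symm _ hFi']
    rw [integral_congr_ae hae] at h1
    simp only [(hinner _).2.2] at h1
    rw [integral_const_mul, integral_const_mul] at h1
    rw [S.inner_op_right hc, opForm]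
    have hpi : 𝕔(π ^ d) ≠ 0 := by exact_mod_cast (by positivity : (π ^ d : ℝ) ≠ 0)
    have h2 : ∫ p : Phase d × Phase d, ⟪v, S.coh p.1⟫ * opKernel c p.1 p.2 * ⟪S.coh p.2, u⟫ =
        𝕔((π ^ d)⁻¹) * (𝕔((2 * π) ^ d) ^ 2 * ∫ z, (c z : ℂ) * ⟪v, S.reflect z u⟫) := by
      rw [h1, ofReal_inv, inv_mul_cancel_left₀ hpi]
    rw [h2, Complex.ofReal_pow, ofReal_inv]
    field_simp

end HeisenbergSystem

/-! ### Weyl operators of the standard system are Weyl quantizations -/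

lemma inner_toLp_left (v : 𝓢(Space d, ℂ)) {w : LTwo d} {h : Space d → ℂ} (hw : w =ᵐ[volume] h) :
    ⟪v♭, w⟫ = ∫ y, (starRingEnd ℂ) (v y) * h y := by
  rw [L2.inner_def]
  refine integral_congr_ae ?_
  filter_upwards [v.coeFn_toLp 2 volume, hw] with y h1 h2
  rw [h1, h2, RCLike.inner_apply, mul_comm]

lemma ae_eq_of_inner_toLp {w : LTwo d} {h : Space d → ℂ} (hh : LocallyIntegrable h)
    (H : ∀ v : 𝓢(Space d, ℂ), ⟪v♭, w⟫ = ∫ y, (starRingEnd ℂ) (v y) * h y) :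
    w =ᵐ[volume] h := by
  refine ae_eq_of_integral_contDiff_smul_eq ((Lp.memLp w).locallyIntegrable (by simp)) hh
    fun g hg hgc => ?_
  have hg' : Smooth fun y => 𝕔(g y) := ofRealCLM.contDiff.comp hg
  have hgc' : HasCompactSupport fun y => 𝕔(g y) :=
    hgc.comp_left (g := fun r : ℝ => (r : ℂ)) Complex.ofReal_zero
  have h1 := H (hgc'.toSchwartzMap hg')
  rw [inner_toLp_left _ (ae_eq_refl _)] at h1
  have h2 : ∀ y, (hgc'.toSchwartzMap hg') y = 𝕔(g y) := fun y => rfl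
  simp only [h2, conj_ofReal] at h1
  simp only [real_smul]
  exact h1

/-- The inner integral of the Weyl quantization. -/
@[irreducible] def weylInner (c : Phase d → ℝ) (f : 𝓢(Space d, ℂ)) (ξ y : Space d) : ℂ :=
  ∫ y', expI (inner ℝ (y - y') ξ) * (c (½ • (y + y'), ξ) : ℂ) * f y'

lemma continuous_weylInner {c : Phase d → ℝ} (hc : SymbolBound 0 M c)
    (f : 𝓢(Space d, ℂ)) : Continuous fun p : Space d × Space d => weylInner c f p.1 p.2 := by
  have hfi : Integrable fun y => M * ‖f y‖ := (f.integrable (μ := volume)).norm.const_mul M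
  have hcc := hc.smooth.continuous
  have he := contDiff_expI.continuous
  simp only [weylInner]
  refine continuous_of_dominated (bound := fun y => M * ‖f y‖) (fun p => ?_) (fun p => ?_) hfi
    (.of_forall fun y' => ?_)
  · have h1 : Continuous fun y' => expI (inner ℝ (p.2 - y') p.1) *
        (c (½ • (p.2 + y'), p.1) : ℂ) * f y' := by
      have := f.continuous
      fun_prop
    exact h1.aestronglyMeasurable
  · refine .of_forall fun y' => ?_
    rw [norm_mul, norm_mul, norm_expI, one_mul, norm_real]
    exact mul_le_mul_of_nonneg_right (by simpa using hc.abs_le _) (norm_nonneg _)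
  · fun_prop

/-- Integration by parts in `y'` gives decay in `ξ`, so the outer quantization integral converges
absolutely although the symbol is only bounded. -/
lemma exists_norm_weylInner_le {c : Phase d → ℝ} (hc : SymbolBound 0 M c) (f : 𝓢(Space d, ℂ)) :
    ∃ K, ∀ ξ y, ‖weylInner c f ξ y‖ ≤ K * ((1 + ‖ξ‖) ^ (2 * (d + 1)))⁻¹ := by
  -- The symbol is evaluated at the midpoint `(y + y') / 2`; directions of length two compensate
  -- this factor, so that its derivatives become those along `phaseVec`.
  let b : Fin d → Space d := fun i => (2 : ℝ) • stdVec i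
  have hr : Integrable fun w : Space d => ((1 + ‖w‖) ^ (d + 1))⁻¹ := by
    have := integrable_one_add_norm (E := Space d) (μ := volume) (r := ((d + 1 : ℕ) : ℝ)) (by simp)
    refine this.congr (.of_forall fun w => ?_)
    simp only [rpow_neg (by positivity : (0 : ℝ) ≤ 1 + ‖w‖), rpow_natCast]
  have hG : ∃ G, 0 ≤ G ∧ ∀ l : List (Fin d), l.length ≤ 2 * (d + 1) → ∀ w,
      (1 + ‖w‖) ^ (d + 1) * ‖derivs (l.map b) f w‖ ≤ G := by
    have h1 : ∀ l : List (Fin d), ∃ G, 0 ≤ G ∧ ∀ w,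
        (1 + ‖w‖) ^ (d + 1) * ‖derivs (l.map b) f w‖ ≤ G := fun l => by
      obtain ⟨g, hg⟩ := SchwartzMap.exists_eq_derivs f (l.map b)
      obtain ⟨G, hG0, hG⟩ := SchwartzMap.exists_one_add_pow_mul_norm_le g (d + 1)
      exact ⟨G, hG0, fun w => by rw [← hg]; exact hG w⟩
    choose G hG0 hG using h1
    have hfin : {l : List (Fin d) | l.length ≤ 2 * (d + 1)}.Finite := finite_length_le _ _
    refine ⟨∑ l ∈ hfin.toFinset, G l, sum_nonneg fun l _ => hG0 l, fun l hl w => ?_⟩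
    exact (hG l w).trans (single_le_sum (fun l _ => hG0 l) (by simpa using hl))
  obtain ⟨G, hG0, hG⟩ := hG
  have hM := hc.nonneg
  refine ⟨2 ^ (d + 1) * ((1 + card (Fin d)) ^ (d + 1) *
    (2 ^ (2 * (d + 1)) * (M * G) * ∫ w : Space d, ((1 + ‖w‖) ^ (d + 1))⁻¹)), fun ξ y => ?_⟩
  set τ : Space d →L[ℝ] ℝ := -(innerSL ℝ ξ) with hτ
  let L : Space d →L[ℝ] Phase d :=
    (½ • ContinuousLinearMap.id ℝ (Space d)).prod (0 : Space d →L[ℝ] Space d)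
  have hL : ∀ y', (½ • (y + y'), ξ) = L y' + (½ • y, ξ) := fun y' => by simp [L, add_comm]
  set F : Space d → ℂ := fun y' => c (L y' + (½ • y, ξ)) • f y' with hF
  have hc1 : Smooth fun z => c (z + (½ • y, ξ)) := hc.smooth.comp (contDiff_id.add contDiff_const)
  have hc2 : Smooth fun y' => c (L y' + (½ • y, ξ)) := hc1.comp L.contDiff
  have hFs : Smooth F := hc2.smul (f.smooth ⊤)
  have h1 : weylInner c f ξ y = expI (inner ℝ y ξ) * oscInt F τ := by
    rw [weylInner, oscInt, ← integral_const_mul]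
    refine integral_congr_ae (.of_forall fun y' => ?_)
    simp only [hL, hF, hτ, real_smul, neg_apply, innerSL_apply_apply]
    rw [inner_sub_left, sub_eq_add_neg, expI_add, real_inner_comm y' ξ]
    ring
  have hb : ∀ l : List (Fin d), l.length ≤ 2 * (d + 1) → ∀ w, ‖derivs (l.map b) F w‖ ≤
      2 ^ (2 * (d + 1)) * (M * G) * ((1 + ‖w‖) ^ (d + 1))⁻¹ := by
    intro l hl w
    have h2 := norm_derivs_smul_le b w l hc2 (f.smooth ⊤) (A := M)
      (B := G * ((1 + ‖w‖) ^ (d + 1))⁻¹)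
      (fun l' hl' => by
        rw [derivs_comp_clm hc1 L, derivs_comp_add, List.map_map]
        have e : (L ∘ b) = fun i => phaseVec (inl i) := by
          funext i
          simp [L, b, phaseVec, smul_smul]
        rw [e]
        have h3 := hc.bound (l'.map inl) (by
          rw [List.length_map, symbolOrder]; omega) (L w + (½ • y, ξ))
        rw [List.map_map] at h3
        simpa using! h3)
      (fun l' hl' => by
        rw [← div_eq_mul_inv, le_div_iff₀ (by positivity), mul_comm]
        exact hG l' (hl'.trans hl) w)
    refine h2.trans ?_
    have h4 : (2 : ℝ) ^ l.length ≤ 2 ^ (2 * (d + 1)) := pow_le_pow_right₀ one_le_two hl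
    calc 2 ^ l.length * (M * (G * ((1 + ‖w‖) ^ (d + 1))⁻¹)) ≤
        2 ^ (2 * (d + 1)) * (M * (G * ((1 + ‖w‖) ^ (d + 1))⁻¹)) := by gcongr
      _ = _ := by ring
  have h5 := norm_oscInt_le_of_derivs b τ (d + 1) hFs (hr.const_mul _) hb
  rw [integral_const_mul] at h5
  have h6 : (1 + ‖ξ‖) ^ (2 * (d + 1)) ≤ 2 ^ (d + 1) * (1 + ∑ j, τ (b j) ^ 2) ^ (d + 1) := by
    rw [pow_mul, ← mul_pow]
    refine pow_le_pow_left₀ (by positivity) ?_ _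
    have h7 : ∑ j, τ (b j) ^ 2 = 4 * ‖ξ‖ ^ 2 := by
      rw [norm_sq_eq, mul_sum]
      refine sum_congr rfl fun i _ => ?_
      simp [hτ, b, stdVec, mul_pow, EuclideanSpace.inner_single_right]
      norm_num
    rw [h7]
    nlinarith [sq_nonneg (‖ξ‖ - 1), sq_nonneg ‖ξ‖]
  rw [h1, norm_mul, norm_expI, one_mul, ← div_eq_mul_inv, le_div_iff₀ (by positivity), mul_comm]
  refine (mul_le_mul_of_nonneg_right h6 (norm_nonneg _)).trans ?_
  rw [mul_assoc]
  exact mul_le_mul_of_nonneg_left h5 (by positivity)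

lemma coeFn_reflect (z : Phase d) (f : 𝓢(Space d, ℂ)) : stdSys.reflect z f♭ =ᵐ[volume] fun y =>
      expI (2 * inner ℝ (y - z.1) z.2) * f ((2 : ℝ) • z.1 - y) := by
  filter_upwards [coeFn_lShift_of_ae (z := (2 : ℝ) • z)
    (coeFn_lParity_of_ae (f.coeFn_toLp 2 volume))] with y h1
  refine h1.trans ?_
  have e : shiftPhase ((2 : ℝ) • z) y = 2 * inner ℝ (y - z.1) z.2 := by
    rw [real_inner_comm, inner_sub_right]
    simp only [shiftPhase, smul_fst, smul_snd, real_inner_smul_left, real_inner_smul_right]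
    ring
  rw [shiftFun, e, smul_fst, neg_sub]

/-- The substitution `y' = 2x - y`, whose Jacobian is the factor `2^{-d}`. -/
lemma integral_reflect (c : Phase d → ℝ) (f : 𝓢(Space d, ℂ)) (ξ y : Space d) :
    ∫ x : Space d, (c (x, ξ) : ℂ) * (expI (2 * inner ℝ (y - x) ξ) * f ((2 : ℝ) • x - y)) =
      𝕔((2 ^ d)⁻¹) * weylInner c f ξ y := by
  set g : Space d → ℂ := fun y' =>
    expI (inner ℝ (y - y') ξ) * (c (½ • (y + y'), ξ) : ℂ) * f y' with hg
  have h1 : ∀ x : Space d, (c (x, ξ) : ℂ) * (expI (2 * inner ℝ (y - x) ξ) * f ((2 : ℝ) • x - y)) =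
      g ((2 : ℝ) • x - y) := by
    intro x
    have e1 : y - ((2 : ℝ) • x - y) = (2 : ℝ) • (y - x) := by module
    have e2 : ½ • (y + ((2 : ℝ) • x - y)) = x := by module
    rw [hg]
    simp only [e1, e2, real_inner_smul_left]
    ring
  simp only [h1]
  rw [Measure.integral_comp_smul volume (fun u => g (u - y)), integral_sub_right_eq_self]
  simp only [finrank_euclideanSpace, Fintype.card_fin, real_smul]
  rw [abs_of_pos (by positivity), weylInner]

lemma weylQuantization_eq (c : Phase d → ℝ) (f : 𝓢(Space d, ℂ)) (y : Space d) :
    weylQuantization (fun x ξ => c (x, ξ)) f y = 𝕔(((2 * π) ^ d)⁻¹) * ∫ ξ, weylInner c f ξ y := by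
  simp only [weylQuantization, weylInner, expI]

lemma integrable_inv_one_add_norm_space :
    Integrable fun ξ : Space d => ((1 + ‖ξ‖) ^ (2 * (d + 1)))⁻¹ := by
  have := integrable_one_add_norm (E := Space d) (μ := volume) (r := ((2 * (d + 1) : ℕ) : ℝ))
    (by simp; linarith)
  refine this.congr (.of_forall fun w => ?_)
  simp only [rpow_neg (by positivity : (0 : ℝ) ≤ 1 + ‖w‖), rpow_natCast]

lemma continuous_weylQuantization {c : Phase d → ℝ} (hc : SymbolBound 0 M c)
    (f : 𝓢(Space d, ℂ)) : Continuous (weylQuantization (fun x ξ => c (x, ξ)) f) := by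
  obtain ⟨K, hK⟩ := exists_norm_weylInner_le hc f
  have hcont := continuous_weylInner hc f
  have h1 : Continuous fun y => ∫ ξ, weylInner c f ξ y := by
    refine continuous_of_dominated (bound := fun ξ => K * ((1 + ‖ξ‖) ^ (2 * (d + 1)))⁻¹)
      (fun y => ?_) (fun y => .of_forall fun ξ => hK ξ y)
      (integrable_inv_one_add_norm_space.const_mul K) (.of_forall fun ξ => ?_)
    · exact (hcont.comp (continuous_id.prodMk continuous_const)).aestronglyMeasurable
    · exact hcont.comp (continuous_const.prodMk continuous_id)
  have h2 : weylQuantization (fun x ξ => c (x, ξ)) f = fun y =>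
      𝕔(((2 * π) ^ d)⁻¹) * ∫ ξ, weylInner c f ξ y :=
    funext (weylQuantization_eq c f)
  rw [h2]
  exact continuous_const.mul h1

lemma integral_inner_reflect {c : Phase d → ℝ} (hc : SymbolBound 0 M c)
    (f v : 𝓢(Space d, ℂ)) (ξ : Space d) :
    ∫ x : Space d, (c (x, ξ) : ℂ) * ⟪v♭, stdSys.reflect (x, ξ) f♭⟫ =
      ∫ y, (starRingEnd ℂ) (v y) * (𝕔((2 ^ d)⁻¹) * weylInner c f ξ y) := by
  have hvi : Integrable fun y => ‖v y‖ := (v.integrable (μ := volume)).norm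
  have h1 : ∀ x : Space d, (c (x, ξ) : ℂ) * ⟪v♭, stdSys.reflect (x, ξ) f♭⟫ =
      ∫ y, (starRingEnd ℂ) (v y) * ((c (x, ξ) : ℂ) *
        (expI (2 * inner ℝ (y - x) ξ) * f ((2 : ℝ) • x - y))) := by
    intro x
    rw [inner_toLp_left v (coeFn_reflect (x, ξ) f), ← integral_const_mul]
    refine integral_congr_ae (.of_forall fun y => ?_)
    simp only
    ring
  simp only [h1]
  rw [integral_integral_swap]
  · simp only [integral_const_mul, integral_reflect]
  · have hcc := hc.smooth.continuous
    have he := contDiff_expI.continuous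
    have hfc := f.continuous
    have hG : Continuous (uncurry fun (x y : Space d) => (starRingEnd ℂ) (v y) *
        ((c (x, ξ) : ℂ) * (expI (2 * inner ℝ (y - x) ξ) * f ((2 : ℝ) • x - y)))) := by
      unfold uncurry
      fun_prop
    have hb : ∀ x y : Space d, ‖(starRingEnd ℂ) (v y) *
        ((c (x, ξ) : ℂ) * (expI (2 * inner ℝ (y - x) ξ) * f ((2 : ℝ) • x - y)))‖ ≤
        M * ‖v y‖ * ‖f ((2 : ℝ) • x - y)‖ := by
      intro x y
      rw [norm_mul, norm_mul, norm_mul, norm_expI, one_mul, RCLike.norm_conj, norm_real,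
        mul_comm M, mul_assoc]
      exact mul_le_mul_of_nonneg_left (mul_le_mul_of_nonneg_right
        (by simpa using hc.abs_le (x, ξ)) (norm_nonneg _)) (norm_nonneg _)
    have hfi : ∀ y, Integrable fun x : Space d => ‖f ((2 : ℝ) • x - y)‖ := fun y =>
      (((f.integrable (μ := volume)).norm.comp_sub_right y).comp_smul two_ne_zero)
    have hfe : ∀ y, ∫ x : Space d, ‖f ((2 : ℝ) • x - y)‖ = (2 ^ d)⁻¹ * ∫ x, ‖f x‖ := fun y => by
      rw [Measure.integral_comp_smul volume (fun u => ‖f (u - y)‖),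
        integral_sub_right_eq_self fun u => ‖f u‖]
      simp [abs_of_pos]
    rw [integrable_prod_iff' hG.aestronglyMeasurable]
    refine ⟨.of_forall fun y => ?_, ?_⟩
    · refine ((hfi y).const_mul (M * ‖v y‖)).mono' ?_ (.of_forall fun x => hb x y)
      exact (hG.comp (continuous_id.prodMk continuous_const)).aestronglyMeasurable
    · refine ((hvi.const_mul M).mul_const ((2 ^ d)⁻¹ * ∫ x, ‖f x‖)).mono'
        hG.norm.stronglyMeasurable.integral_prod_left'.aestronglyMeasurable
        (.of_forall fun y => ?_)
      rw [norm_of_nonneg (integral_nonneg fun x => norm_nonneg _), ← hfe y, ← integral_const_mul]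
      exact integral_mono_of_nonneg (.of_forall fun x => norm_nonneg _)
        ((hfi y).const_mul _) (.of_forall fun x => hb x y)

/-- The reflection formula is tested against Schwartz functions. Integrating first in position gives
the inner Weyl integral by `integral_reflect`, and `π^{-d} 2^{-d}` is the constant of the
quantization. -/
lemma op_toLp_ae_eq {c : Phase d → ℝ} (hc : SymbolBound 0 M c) (f : 𝓢(Space d, ℂ)) :
    stdSys.op c f♭ =ᵐ[volume] weylQuantization (fun x ξ => c (x, ξ)) f := by
  obtain ⟨K, hK⟩ := exists_norm_weylInner_le hc f
  have hcont := continuous_weylInner hc f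
  have hr := (integrable_inv_one_add_norm_space (d := d)).const_mul K
  have hwc := continuous_weylQuantization hc f
  refine ae_eq_of_inner_toLp hwc.locallyIntegrable fun v => ?_
  obtain ⟨hi, h⟩ := HeisenbergSystem.inner_op_eq_integral hc (smoothVec_toLTwo v) (smoothVec_toLTwo f)
  refine h.trans ?_
  have hvi : Integrable fun y => ‖v y‖ := (v.integrable (μ := volume)).norm
  have hvc : Continuous fun y => (starRingEnd ℂ) (v y) := continuous_conj.comp v.continuous
  have hslice := fun ξ => integral_inner_reflect hc f v ξ
  have hi' := hi
  rw [volume_eq_prod] at hi' ⊢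
  rw [integral_prod_symm _ hi']
  have h2 : ∀ ξ : Space d, ∫ x : Space d, (c (x, ξ) : ℂ) * ⟪toLTwo d v,
      stdSys.reflect (x, ξ) (toLTwo d f)⟫ = _ := hslice
  simp only [h2]
  rw [integral_integral_swap]
  · simp only [weylQuantization_eq, integral_const_mul]
    rw [← integral_const_mul]
    refine integral_congr_ae (.of_forall fun y => ?_)
    simp only
    rw [mul_pow, mul_inv]
    push_cast
    ring
  · have hG : Continuous (uncurry fun (ξ y : Space d) => (starRingEnd ℂ) (v y) *
        (𝕔((2 ^ d)⁻¹) * weylInner c f ξ y)) :=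
      (hvc.comp continuous_snd).mul (continuous_const.mul hcont)
    refine (hr.mul_prod hvi).mono' hG.aestronglyMeasurable (.of_forall fun p => ?_)
    rw [uncurry, norm_mul, norm_mul, RCLike.norm_conj, norm_real, mul_comm]
    refine mul_le_mul_of_nonneg_right ?_ (norm_nonneg _)
    refine (mul_le_of_le_one_left (norm_nonneg _) ?_).trans (hK _ _)
    rw [norm_of_nonneg (by positivity)]
    exact inv_le_one_of_one_le₀ (one_le_pow₀ one_le_two)

lemma isWeylOperator_op {c : Phase d → ℝ} (hc : SymbolBound 0 M c) :
    IsWeylOperator (fun x ξ => c (x, ξ)) (stdSys.op c) :=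
  fun f => op_toLp_ae_eq hc f

/-! ### Sobolev norms bound the coherent state transform -/

namespace HeisenbergSystem

variable (S) in
lemma sob_creation_le {u} (hu : S.SmoothVec u) (k : ℕ) (i : Fin d) :
    S.sob k (S.creation i u) ≤ 4 * S.sob (k + 1) u := by
  have h2 := sob_add_le (hu.gen (phaseVec (inr i))) ((hu.gen (phaseVec (inl i))).smul I) k
  rw [sob_smul (hu.gen _), norm_I] at h2
  have h3 := S.sob_gen_le k (inr i) u
  have h4 := S.sob_gen_le k (inl i) u
  unfold creation
  linarith

/-- One factor `1 + Σ |c_i|²` splits the integral into the one for `u` and those for its creation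
operators. -/
lemma exists_integral_cohWeight_le (S : HeisenbergSystem d H) (r : ℕ) :
    ∃ C, 0 ≤ C ∧ ∀ u, S.SmoothVec u → Integrable (fun q => cohWeight q ^ r * ‖⟪S.coh q, u⟫‖ ^ 2) ∧
      ∫ q, cohWeight q ^ r * ‖⟪S.coh q, u⟫‖ ^ 2 ≤ C * S.sob r u := by
  induction r with
  | zero =>
    refine ⟨(2 * π) ^ d, by positivity, fun u _ => ?_⟩
    simp only [pow_zero, one_mul]
    exact ⟨S.integrable_sq u, (S.integral_sq_inner_coh u).le⟩
  | succ r ih =>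
    obtain ⟨C, hC0, hC⟩ := ih
    refine ⟨C * (1 + d * 4), by positivity, fun u hu => ?_⟩
    have e : (fun q => cohWeight q ^ (r + 1) * ‖⟪S.coh q, u⟫‖ ^ 2) = fun q =>
        cohWeight q ^ r * ‖⟪S.coh q, u⟫‖ ^ 2 +
          ∑ i, cohWeight q ^ r * ‖⟪S.coh q, S.creation i u⟫‖ ^ 2 := by
      funext q
      have h1 : ∀ i : Fin d, ‖⟪S.coh q, S.creation i u⟫‖ ^ 2 =
          normSq (cohCoord i q) * ‖⟪S.coh q, u⟫‖ ^ 2 := fun i => by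
        rw [creation, ← mul_inner_coh hu, norm_mul, mul_pow, normSq_eq_norm_sq]
        rfl
      simp only [h1]
      rw [← mul_sum, ← sum_mul, ← mul_add, ← one_add_mul, ← cohWeight, pow_succ]
      ring
    have hi := hC u hu
    have hj := fun i => hC _ (hu.creation i)
    rw [e]
    refine ⟨hi.1.add (integrable_finsetSum _ fun i _ => (hj i).1), ?_⟩
    rw [integral_add hi.1 (integrable_finsetSum _ fun i _ => (hj i).1),
      integral_finsetSum _ fun i _ => (hj i).1]
    have h2 : ∀ i ∈ (univ : Finset (Fin d)),
        ∫ q, cohWeight q ^ r * ‖⟪S.coh q, S.creation i u⟫‖ ^ 2 ≤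
        C * (4 * S.sob (r + 1) u) := fun i _ =>
      (hj i).2.trans (mul_le_mul_of_nonneg_left (S.sob_creation_le hu r i) hC0)
    refine (add_le_add (hi.2.trans (mul_le_mul_of_nonneg_left (S.sob_le_succ r u) hC0))
      (sum_le_sum h2)).trans_eq ?_
    simp
    ring

lemma exists_integral_norm_inner_coh_le (S : HeisenbergSystem d H) :
    ∃ (k : ℕ) (C : ℝ), 0 ≤ C ∧ ∀ u, S.SmoothVec u → ∫ q, ‖⟪S.coh q, u⟫‖ ≤ C * (1 + S.sob k u) := by
  obtain ⟨C, hC0, hC⟩ := S.exists_integral_cohWeight_le (4 * d + 3)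
  set J := ∫ q : Phase d, ((1 + ‖q‖) ^ (4 * d + 3))⁻¹ with hJ
  have hJ0 : 0 ≤ J := integral_nonneg fun q => by positivity
  refine ⟨4 * d + 3, 2 ^ (4 * d + 3) * J + C, by positivity, fun u hu => ?_⟩
  obtain ⟨h1, h2⟩ := hC u hu
  have hpt : ∀ q, ‖⟪S.coh q, u⟫‖ ≤ 2 ^ (4 * d + 3) * ((1 + ‖q‖) ^ (4 * d + 3))⁻¹ +
      cohWeight q ^ (4 * d + 3) * ‖⟪S.coh q, u⟫‖ ^ 2 := by
    intro q
    have h3 : 1 + ‖q‖ ≤ 2 * cohWeight q := (le_self_pow₀ (by simp) two_ne_zero).trans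
      (sq_one_add_norm_le_cohWeight q)
    have h0 : 0 < 1 + ‖q‖ := by positivity
    have hw : 0 < cohWeight q := by linarith
    set X := cohWeight q ^ (4 * d + 3) with hX
    have hX0 : 0 < X := by positivity
    have h4 : X⁻¹ ≤ 2 ^ (4 * d + 3) * ((1 + ‖q‖) ^ (4 * d + 3))⁻¹ := by
      rw [← div_eq_mul_inv, le_div_iff₀ (by positivity), inv_mul_le_iff₀ hX0]
      have h5 := pow_le_pow_left₀ h0.le h3 (4 * d + 3)
      rw [mul_pow] at h5
      linarith
    have h5 : X⁻¹ * X = 1 := inv_mul_cancel₀ hX0.ne'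
    have h6 : 0 < X⁻¹ := inv_pos.2 hX0
    set a := ‖⟪S.coh q, u⟫‖
    have ha : 0 ≤ a := norm_nonneg _
    -- Completing the square replaces the Cauchy-Schwarz inequality: `X⁻¹` is integrable by the
    -- choice of exponent, and `X a²` is bounded by the Sobolev norm.
    have h7 : a ≤ X⁻¹ + X * a ^ 2 := by
      have : 0 ≤ X⁻¹ * (1 - X * a) ^ 2 := by positivity
      have e : X⁻¹ * (1 - X * a) ^ 2 = X⁻¹ - 2 * a + X * a ^ 2 := by
        linear_combination (-2 * a + X * a ^ 2) * h5
      linarith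
    linarith
  have hi := (integrable_inv_one_add_norm_pow (d := d)).const_mul (2 ^ (4 * d + 3))
  refine (integral_mono (integrable_inner_coh hu).norm (hi.add h1) hpt).trans ?_
  rw [integral_add' hi h1, integral_const_mul]
  have h8 := S.sob_nonneg (4 * d + 3) u
  have h9 : 0 ≤ 2 ^ (4 * d + 3) * J := by positivity
  nlinarith [mul_nonneg h9 h8]

end HeisenbergSystem

/-! ### Continuous superpositions of continuous functions -/

lemma continuous_integral_mul {m : Phase d → ℂ} (hm : Integrable m)
    {F : Phase d → Space d → ℂ} (hF : Continuous (uncurry F)) {C : ℝ}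
    (hC : ∀ p y, ‖F p y‖ ≤ C) : Continuous fun y => ∫ p, m p * F p y := by
  refine continuous_of_dominated (bound := fun p => ‖m p‖ * C) (fun y => ?_)
    (fun y => .of_forall fun p => ?_) (hm.norm.mul_const C) (.of_forall fun p => ?_)
  · exact hm.1.mul (hF.comp (continuous_id.prodMk continuous_const)).aestronglyMeasurable
  · rw [norm_mul]
    exact mul_le_mul_of_nonneg_left (hC p y) (norm_nonneg _)
  · exact continuous_const.mul (hF.comp (continuous_const.prodMk continuous_id))

/-- A weak superposition of `L²` vectors with bounded continuous representatives is represented by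
the pointwise integral, by Fubini's theorem against Schwartz functions. -/
lemma ae_eq_integral_mul {m : Phase d → ℂ} (hm : Integrable m)
    {F : Phase d → Space d → ℂ} (hF : Continuous (uncurry F)) {C : ℝ}
    (hC : ∀ p y, ‖F p y‖ ≤ C) {T : Phase d → LTwo d} (hT : ∀ p, T p =ᵐ[volume] F p)
    {w : LTwo d} (hw : ∀ v : 𝓢(Space d, ℂ), ⟪v♭, w⟫ = ∫ p, m p * ⟪v♭, T p⟫) :
    w =ᵐ[volume] fun y => ∫ p, m p * F p y := by
  refine ae_eq_of_inner_toLp (continuous_integral_mul hm hF hC).locallyIntegrable fun v => ?_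
  rw [hw v]
  have h1 : ∀ p, m p * ⟪v♭, T p⟫ = ∫ y, m p * ((starRingEnd ℂ) (v y) * F p y) := fun p => by
    rw [inner_toLp_left v (hT p), integral_const_mul]
  simp only [h1]
  rw [integral_integral_swap]
  · refine integral_congr_ae (.of_forall fun y => ?_)
    simp only
    rw [← integral_const_mul]
    refine integral_congr_ae (.of_forall fun p => ?_)
    simp only
    ring
  · have hvi : Integrable fun y => (starRingEnd ℂ) (v y) := (v.integrable (μ := volume)).norm.mono'
        (continuous_conj.comp v.continuous).aestronglyMeasurable
        (.of_forall fun y => (RCLike.norm_conj _).le)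
    have h2 := (hm.mul_prod hvi).mul_bdd (c := C) hF.aestronglyMeasurable
      (.of_forall fun p => hC p.1 p.2)
    refine h2.congr (.of_forall fun p => ?_)
    simp only [uncurry]
    ring

namespace HeisenbergSystem

variable {Q : Type} [NormedAddCommGroup Q] [NormedSpace ℝ Q]

/-- The derivative, in the frame translated by `X`, of a family of vectors. -/
def movingDeriv (S : HeisenbergSystem d H) (X : Q → Space d) (e : Q) (v : Space d) (V : Q → H) :
    Q → H :=
  fun q => I • S.gen (𝜕 e X q - v, 0) (V q) + 𝜕 e V q

/-- Shifts in position only have mutually vanishing symplectic products, so no scalar terms arise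
from the cocycle. -/
lemma IsSmoothFunctional.dirDeriv_moving {E : H → ℂ} (hE : S.IsSmoothFunctional E) {V : Q → H}
    (hV : S.SmoothFam V) {X : Q → Space d} (hX : Smooth X) (e : Q) (v : Space d) :
    𝜕 (e, v) (fun p : Q × Space d => E (S.shift ((X p.1 - p.2, 0) : Phase d) (V p.1))) = fun p =>
      E (S.shift ((X p.1 - p.2, 0) : Phase d) (S.movingDeriv X e v V p.1)) := by
  have hf : Smooth fun p : Q × Space d => ((X p.1 - p.2, 0) : Phase d) :=
    ((hX.comp contDiff_fst).sub contDiff_snd).prodMk contDiff_const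
  have hVf : S.SmoothFam fun p : Q × Space d => V p.1 := hV.comp contDiff_fst
  rw [hE.deriv (Q × Space d) _ (hVf.shift hf) (e, v)]
  funext p
  have h1 : 𝜕 (e, v) (fun p : Q × Space d => ((X p.1 - p.2, 0) : Phase d)) p =
      (𝜕 e X p.1 - v, 0) := by
    have h2 := (((hX.diff_infty p.1).hasFDerivAt.comp p
      (hasFDerivAt_fst (𝕜 := ℝ))).sub (hasFDerivAt_snd (𝕜 := ℝ))).prodMk
      (hasFDerivAt_const (0 : Space d) p)
    rw [show 𝜕 (e, v) (fun p : Q × Space d => ((X p.1 - p.2, 0) : Phase d)) p = _ from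
      congrFun (congrArg DFunLike.coe h2.fderiv) (e, v)]
    simp [_root_.dirDeriv]
  have h3 : 𝜕 (e, v) (fun p : Q × Space d => V p.1) p = 𝜕 e V p.1 := by
    have h4 := (hV.contDiff.diff_infty p.1).hasFDerivAt.comp p (hasFDerivAt_fst (𝕜 := ℝ))
    exact congrFun (congrArg DFunLike.coe h4.fderiv) (e, v)
  have hs : ∀ a b : Space d, symp ((a, 0) : Phase d) (b, 0) = 0 := fun a b => by simp [symp_apply]
  rw [dirDeriv_shift_family hVf hf, h1, h3, hs, gen_shift (hV.smoothVec _), hs, movingDeriv]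
  congr 1
  simp

lemma IsSmoothFunctional.hasDerivAt_shift_line {E : H → ℂ} (hE : S.IsSmoothFunctional E) {u}
    (hu : S.SmoothVec u) (v : Phase d) :
    HasDerivAt (fun s : ℝ => E (S.shift (s • v) u)) (E (I • S.gen v u)) 0 := by
  have hV : S.SmoothFam fun s : ℝ => S.shift (s • v) u :=
    hu.shift_fam.comp (contDiff_id.smul contDiff_const)
  have h1 := congrFun (hE.deriv ℝ _ hV 1) 0
  have h2 := ((hE.contDiff ℝ _ hV).diff_infty 0).hasDerivAt
  have h3 : 𝜕 (1 : ℝ) (fun s : ℝ => S.shift (s • v) u) 0 = I • S.gen v u := by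
    rw [dirDeriv_shift_family (hu.const (Q := ℝ)) (f := fun s : ℝ => s • v)
      (contDiff_id.smul contDiff_const)]
    have h4 : 𝜕 (1 : ℝ) (fun s : ℝ => s • v) 0 = v := by
      have := ((hasDerivAt_id (0 : ℝ)).smul_const v).hasFDerivAt.fderiv
      have h5 := congrFun (congrArg DFunLike.coe this) (1 : ℝ)
      simpa using! h5
    rw [h4, zero_smul, S.shift_zero, map_zero]
    simp [dirDeriv_const]
  beta_reduce at h1
  rw [h3] at h1
  exact h2.congr_deriv h1

end HeisenbergSystem

/-! ### Pointwise values of smooth vectors -/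

open HeisenbergSystem (integrable_inner_coh coh cohInt shift_shift contDiff_symp dirDeriv_half_symp
  isSmoothFunctional_cohInt movingDeriv)

section Values

lemma continuous_shiftFun_vac : Continuous (uncurry fun (q : Phase d) (y : Space d) =>
      shiftFun q vacSchwartz y) := by
  have h1 : Continuous fun p : Phase d × Space d => shiftPhase p.1 p.2 := by
    unfold shiftPhase; fun_prop
  have h2 : Continuous fun p : Phase d × Space d => p.2 - p.1.1 := by fun_prop
  exact (contDiff_expI.continuous.comp h1).mul (vacSchwartz.continuous.comp h2)

lemma norm_vacSchwartz_le (y : Space d) : ‖vacSchwartz y‖ ≤ 1 := by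
  rw [vacSchwartz_apply, norm_real, norm_of_nonneg (by positivity)]
  refine mul_le_one₀ (Real.rpow_le_one_of_one_le_of_nonpos ?_ ?_) (by positivity)
    (Real.exp_le_one_iff.2 ?_)
  · linarith [Real.pi_gt_three]
  · have : (0 : ℝ) ≤ d := Nat.cast_nonneg d
    linarith
  · have := sq_nonneg ‖y‖
    linarith

lemma norm_shiftFun_vac_le (q : Phase d) (y : Space d) : ‖shiftFun q vacSchwartz y‖ ≤ 1 := by
  rw [norm_shiftFun]
  exact norm_vacSchwartz_le _

lemma shiftFun_shiftFun (z w : Phase d) (f : Space d → ℂ) (y : Space d) :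
    shiftFun z (shiftFun w f) y = expI (symp z w / 2) * shiftFun (z + w) f y := by
  rw [shiftFun, shiftFun, shiftFun, ← mul_assoc, ← mul_assoc, ← expI_add, ← expI_add,
    shiftPhase_add, fst_add, sub_sub]

/-- The symbol of the evaluation at `y`. -/
def valSymbol (y : Space d) (q : Phase d) : ℂ := 𝕔(((2 * π) ^ d)⁻¹) * shiftFun q vacSchwartz y

lemma continuous_valSymbol (y : Space d) : Continuous (valSymbol y) :=
  continuous_const.mul (continuous_shiftFun_vac.comp (continuous_id.prodMk continuous_const))

lemma norm_valSymbol_le (y : Space d) (q : Phase d) : ‖valSymbol y q‖ ≤ ((2 * π) ^ d)⁻¹ := by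
  rw [valSymbol, norm_mul, norm_real, norm_of_nonneg (by positivity)]
  exact mul_le_of_le_one_right (by positivity) (norm_shiftFun_vac_le q y)

/-- The value at `y` of a smooth vector. -/
def valAt (u : LTwo d) (y : Space d) : ℂ := stdSys.cohInt (valSymbol y) u

lemma isSmoothFunctional_valAt (y : Space d) : stdSys.IsSmoothFunctional fun u => valAt u y :=
  isSmoothFunctional_cohInt (continuous_valSymbol y) (norm_valSymbol_le y)

lemma integrable_valAt {u : LTwo d} (hu : stdSys.SmoothVec u) (y : Space d) :
    Integrable fun q => valSymbol y q * ⟪stdSys.coh q, u⟫ :=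
  (integrable_inner_coh hu).bdd_mul
    (continuous_valSymbol y).aestronglyMeasurable (.of_forall (norm_valSymbol_le y))

lemma valAt_smul (c : ℂ) (u : LTwo d) (y : Space d) : valAt (c • u) y = c * valAt u y := by
  simp only [valAt, cohInt, inner_smul_right]
  rw [← integral_const_mul]
  refine integral_congr_ae (.of_forall fun q => ?_)
  simp only
  ring

lemma exists_norm_valAt_le (d : ℕ) : ∃ (k : ℕ) (C : ℝ), 0 ≤ C ∧ ∀ u : LTwo d,
    stdSys.SmoothVec u → ∀ y, ‖valAt u y‖ ≤ C * (1 + stdSys.sob k u) := by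
  obtain ⟨k, C, hC0, hC⟩ := stdSys.exists_integral_norm_inner_coh_le
  refine ⟨k, ((2 * π) ^ d)⁻¹ * C, by positivity, fun u hu y => ?_⟩
  rw [mul_assoc]
  refine le_trans ?_ (mul_le_mul_of_nonneg_left (hC u hu) (by positivity))
  rw [← integral_const_mul]
  refine (norm_integral_le_integral_norm _).trans (integral_mono (integrable_valAt hu y).norm
    ((integrable_inner_coh hu).norm.const_mul _) fun q => ?_)
  simp only [norm_mul (valSymbol y q)]
  exact mul_le_mul_of_nonneg_right (norm_valSymbol_le y q) (norm_nonneg _)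

lemma coeFn_coh (q : Phase d) : stdSys.coh q =ᵐ[volume] shiftFun q vacSchwartz :=
  coeFn_lShift_of_ae (vacSchwartz.coeFn_toLp 2 volume)

/-- The value is defined by evaluating the resolution of the identity pointwise; the integral
converges for smooth vectors and represents `u`. -/
lemma ae_eq_valAt {u : LTwo d} (hu : stdSys.SmoothVec u) : u =ᵐ[volume] valAt u := by
  have h := ae_eq_integral_mul (m := fun q => 𝕔(((2 * π) ^ d)⁻¹) * ⟪stdSys.coh q, u⟫)
    ((integrable_inner_coh hu).const_mul _) continuous_shiftFun_vac
    norm_shiftFun_vac_le coeFn_coh (w := u) fun v => ?_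
  · refine h.trans (.of_forall fun y => integral_congr_ae (.of_forall fun q => ?_))
    simp only [valSymbol]
    ring
  · have h1 := stdSys.resolution v♭ u
    have h2 : ∀ q, 𝕔(((2 * π) ^ d)⁻¹) * ⟪stdSys.coh q, u⟫ * ⟪v♭, stdSys.coh q⟫ =
        𝕔(((2 * π) ^ d)⁻¹) * (⟪v♭, stdSys.shift q stdSys.vac⟫ *
          ⟪stdSys.shift q stdSys.vac, u⟫) := fun q => by
      rw [coh]; ring
    simp only [h2]
    rw [integral_const_mul, h1, ← mul_assoc, ← ofReal_mul,
      inv_mul_cancel₀ (by positivity), Complex.ofReal_one, one_mul]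

lemma valAt_shift (z : Phase d) (u : LTwo d) (y : Space d) :
    valAt (stdSys.shift z u) y = shiftFun z (valAt u) y := by
  have h1 : ∀ q, ⟪stdSys.coh (q + z), stdSys.shift z u⟫ =
      expI (symp z q / 2) * ⟪stdSys.coh q, u⟫ := by
    intro q
    have h2 : stdSys.coh (q + z) = expI (-(symp z q / 2)) • stdSys.shift z (stdSys.coh q) := by
      rw [coh, coh, shift_shift, smul_smul,
        expI_neg_mul, one_smul, add_comm]
    rw [h2, inner_smul_left, conj_expI, neg_neg]
    congr 1
    rw [HeisenbergSystem.inner_shift_left, shift_shift, neg_add_cancel]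
    simp [HeisenbergSystem.shift_zero]
  have h3 : ∀ q, valSymbol y (q + z) * ⟪stdSys.coh (q + z), stdSys.shift z u⟫ =
      expI (shiftPhase z y) * (valSymbol (y - z.1) q * ⟪stdSys.coh q, u⟫) := by
    intro q
    rw [h1, valSymbol, valSymbol]
    have h4 : expI (symp z q / 2) * shiftFun (q + z) vacSchwartz y =
        expI (shiftPhase z y) * shiftFun q vacSchwartz (y - z.1) := by
      rw [add_comm q z, ← shiftFun_shiftFun]
      rfl
    linear_combination 𝕔(((2 * π) ^ d)⁻¹) * ⟪stdSys.coh q, u⟫ * h4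
  rw [shiftFun, valAt, valAt, cohInt, cohInt,
    ← integral_add_right_eq_self _ z]
  simp only [h3]
  rw [integral_const_mul]

/-- Evaluation at any point becomes one fixed functional of a translated vector, so the dependence
on `y` is differentiated through the shifts. -/
lemma valAt_eq_shift (u : LTwo d) (y : Space d) : valAt u y = valAt (stdSys.shift (-y, 0) u) 0 := by
  rw [valAt_shift]
  simp [shiftFun, shiftPhase]

variable {Q : Type} [NormedAddCommGroup Q] [NormedSpace ℝ Q]

lemma contDiff_valAt_sub {V : Q → LTwo d} (hV : stdSys.SmoothFam V)
    {X : Q → Space d} (hX : Smooth X) :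
    Smooth fun p : Q × Space d => valAt (V p.1) (p.2 - X p.1) := by
  have hf : Smooth fun p : Q × Space d => ((X p.1 - p.2, 0) : Phase d) :=
    ((hX.comp contDiff_fst).sub contDiff_snd).prodMk contDiff_const
  have h := (isSmoothFunctional_valAt (0 : Space d)).contDiff (Q × Space d) _
    ((hV.comp contDiff_fst).shift hf)
  refine (congrArg (ContDiff ℝ ∞) (funext fun p => ?_)).mp h
  rw [valAt_eq_shift _ (p.2 - X p.1), neg_sub]

lemma dirDeriv_valAt_sub {V : Q → LTwo d} (hV : stdSys.SmoothFam V)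
    {X : Q → Space d} (hX : Smooth X) (e : Q) (v : Space d) :
    𝜕 (e, v) (fun p : Q × Space d => valAt (V p.1) (p.2 - X p.1)) = fun p =>
      valAt (stdSys.movingDeriv X e v V p.1) (p.2 - X p.1) := by
  have h0 : ∀ W : Q → LTwo d, (fun p : Q × Space d => valAt (W p.1) (p.2 - X p.1)) = fun p =>
      valAt (stdSys.shift ((X p.1 - p.2, 0) : Phase d) (W p.1)) 0 := by
    intro W
    funext p
    rw [valAt_eq_shift, neg_sub]
  rw [h0, h0]
  exact (isSmoothFunctional_valAt (0 : Space d)).dirDeriv_moving hV hX e v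

/-- A momentum shift multiplies the function by `expI (s * y j)`; its derivative is multiplication
by the coordinate. Polynomial weights thus stay within uniform families of smooth vectors. -/
lemma valAt_gen_position {u : LTwo d} (hu : stdSys.SmoothVec u) (j : Fin d)
    (y : Space d) : valAt (stdSys.gen (phaseVec (inr j)) u) y = (y j : ℂ) * valAt u y := by
  have h1 : ∀ s : ℝ, valAt (stdSys.shift (s • phaseVec (inr j)) u) y =
      expI (s * y j) * valAt u y := by
    intro s
    rw [valAt_shift]
    have e : inner ℝ (s • stdVec j) y = s * y j := by
      rw [real_inner_smul_left]
      simp [stdVec, inner_single_left]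
    simp [shiftFun, shiftPhase, phaseVec, e]
  have h2 := (isSmoothFunctional_valAt y).hasDerivAt_shift_line hu (phaseVec (inr j))
  simp only [h1] at h2
  have h3 : HasDerivAt (fun s : ℝ => expI (s * y j) * valAt u y) (I * y j * valAt u y) 0 := by
    have h4 := ((((hasDerivAt_id (0 : ℝ)).mul_const (y j)).ofReal_comp.const_mul
      I).cexp).mul_const (valAt u y)
    unfold expI
    refine h4.congr_deriv ?_
    simp
  have h5 := h2.unique h3
  rw [valAt_smul] at h5
  refine mul_left_cancel₀ Complex.I_ne_zero ?_
  rw [h5, mul_assoc]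

end Values

/-! ### Derivatives and weighted norms of moving values -/

/-- Indices for the directions in `Ext d × Space d`. -/
abbrev MovIndex (d : ℕ) : Type := ExtIndex d ⊕ Fin d

/-- The coordinate directions in `Ext d × Space d`. -/
def movVec : MovIndex d → Ext d × Space d
  | inl i => (extVec i, 0)
  | inr j => (0, stdVec j)

namespace HeisenbergSystem

lemma UnifVec.smoothVec {V : Ω → Ext d → H} (hV : S.UnifVec T n V) (κ : Ω)
    (q : Ext d) : S.SmoothVec (V κ q) := (hV.smoothFam κ).smoothVec q

lemma UnifVec.movingDeriv {V : Ω → Ext d → H} (hV : ∀ n, S.UnifVec T n V)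
    {X : Ω → Ext d → Space d} (hX : ∀ n i, UnifFun T n fun κ => 𝜕 (extVec i) (X κ))
    (j : MovIndex d) (n : ℕ) :
    S.UnifVec T n fun κ => S.movingDeriv (X κ) (movVec j).1 (movVec j).2 (V κ) := by
  let L : Space d →L[ℝ] Phase d := (ContinuousLinearMap.id ℝ _).prod 0
  rcases j with i | j
  · have h1 : UnifFun T n fun κ q => ((𝜕 (extVec i) (X κ) q - 0, 0) : Phase d) := by
      have := (hX n i).clm L
      simpa [L] using! this
    exact (((hV n).gen_along h1).const_smul I).add ((hV (n + 1)).2 i)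
  · have h1 : UnifFun T n fun (_ : Ω) (_ : Ext d) => ((0 - stdVec j, 0) : Phase d) :=
      unifFun_const n ⟨_, fun _ => le_rfl⟩
    have h2 : (fun κ => S.movingDeriv (X κ) 0 (stdVec j) (V κ)) = fun κ q =>
        I • S.gen ((0 - stdVec j, 0) : Phase d) (V κ q) := by
      funext κ q
      simp [HeisenbergSystem.movingDeriv, dirDeriv]
    change S.UnifVec T n fun κ => S.movingDeriv (X κ) 0 (stdVec j) (V κ)
    rw [h2]
    exact ((hV n).gen_along h1).const_smul I

end HeisenbergSystem

/-- Differentiation replaces the family by its moving derivative, again a uniform family, so one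
`L²` bound covers every word of derivatives. -/
lemma exists_derivs_moving {V : Ω → Ext d → LTwo d}
    (hV : ∀ n, stdSys.UnifVec T n V) {X : Ω → Ext d → Space d}
    (hXs : ∀ κ, Smooth (X κ)) (hX : ∀ n i, UnifFun T n fun κ => 𝜕 (extVec i) (X κ))
    (l : List (MovIndex d)) : ∃ W : Ω → Ext d → LTwo d, (∀ n, stdSys.UnifVec T n W) ∧ ∀ κ,
        derivs (l.map movVec) (fun p : Ext d × Space d =>
          valAt (V κ p.1) (p.2 - X κ p.1)) = fun p => valAt (W κ p.1) (p.2 - X κ p.1) := by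
  induction l with
  | nil => exact ⟨V, hV, fun κ => rfl⟩
  | cons j l ih =>
    obtain ⟨W, hW, h⟩ := ih
    refine ⟨_, HeisenbergSystem.UnifVec.movingDeriv hW hX j, fun κ => ?_⟩
    rw [map_cons, derivs_cons, h κ]
    exact dirDeriv_valAt_sub ((hW 0).smoothFam κ) (hXs κ) _ _

lemma exists_monomial_valAt {V : Ω → Ext d → LTwo d}
    (hV : ∀ n, stdSys.UnifVec T n V) (γ : Fin d → ℕ) :
    ∃ W : Ω → Ext d → LTwo d, (∀ n, stdSys.UnifVec T n W) ∧
      ∀ κ q y, (monomialWeight γ y : ℂ) * valAt (V κ q) y = valAt (W κ q) y := by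
  have h1 : ∀ (i : Fin d) (k : ℕ) (V : Ω → Ext d → LTwo d),
      (∀ n, stdSys.UnifVec T n V) → ∃ W : Ω → Ext d → LTwo d,
      (∀ n, stdSys.UnifVec T n W) ∧
      ∀ κ q y, ((y i : ℂ)) ^ k * valAt (V κ q) y = valAt (W κ q) y := by
    intro i k
    induction k with
    | zero => exact fun V hV => ⟨V, hV, fun κ q y => by simp⟩
    | succ k ih =>
      intro V hV
      obtain ⟨W, hW, h⟩ := ih V hV
      refine ⟨_, fun n => (hW n).gen (inr i), fun κ q y => ?_⟩
      rw [valAt_gen_position ((hW 0).smoothVec κ q), ← h, pow_succ]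
      ring
  have h2 : ∀ s : Finset (Fin d), ∃ W : Ω → Ext d → LTwo d, (∀ n, stdSys.UnifVec T n W) ∧
      ∀ κ q y, (∏ i ∈ s, ((y i : ℂ)) ^ γ i) * valAt (V κ q) y = valAt (W κ q) y := by
    intro s
    induction s using Finset.induction_on with
    | empty => exact ⟨V, hV, fun κ q y => by simp⟩
    | insert i s hi ih =>
      obtain ⟨W, hW, h⟩ := ih
      obtain ⟨W', hW', h'⟩ := h1 i (γ i) W hW
      refine ⟨W', hW', fun κ q y => ?_⟩
      rw [Finset.prod_insert hi, mul_assoc, h, h']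
  obtain ⟨W, hW, h⟩ := h2 univ
  refine ⟨W, hW, fun κ q y => ?_⟩
  rw [← h, monomialWeight]
  push_cast
  rfl

lemma eLpNorm_valAt_sub {u : LTwo d} (hu : stdSys.SmoothVec u) (x : Space d) :
    eLpNorm (fun y => valAt u (y - x)) 2 volume = ofReal ‖u‖ := by
  have h1 : AEStronglyMeasurable (valAt u) volume :=
    (Lp.aestronglyMeasurable u).congr (ae_eq_valAt hu)
  have h2 := eLpNorm_comp_measurePreserving (p := 2) h1 (measurePreserving_sub_right volume x)
  rw [Function.comp_def] at h2
  rw [h2, ← eLpNorm_congr_ae (ae_eq_valAt hu), Lp.norm_def, ENNReal.ofReal_toReal (Lp.eLpNorm_ne_top u)]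

lemma abs_monomialWeight_neg (γ : Fin d → ℕ) (v : Space d) :
    |monomialWeight γ (-v)| = |monomialWeight γ v| := by
  simp [monomialWeight, Finset.abs_prod, abs_pow]

lemma exists_eLpNorm_derivs_moving_le {V : Ω → Ext d → LTwo d}
    (hV : ∀ n, stdSys.UnifVec T n V) {X : Ω → Ext d → Space d}
    (hXs : ∀ κ, Smooth (X κ)) (hX : ∀ n i, UnifFun T n fun κ => 𝜕 (extVec i) (X κ))
    (γ : Fin d → ℕ) (l : List (MovIndex d)) : ∃ C : ℝ, ∀ κ q, q.1 ∈ T κ →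
      eLpNorm (fun y : Space d => (monomialWeight γ (X κ q - y) : ℂ) *
        derivs (l.map movVec) (fun p : Ext d × Space d =>
          valAt (V κ p.1) (p.2 - X κ p.1)) (q, y)) 2 volume ≤ ofReal C := by
  obtain ⟨W, hW, h⟩ := exists_derivs_moving hV hXs hX l
  obtain ⟨W', hW', h'⟩ := exists_monomial_valAt hW γ
  obtain ⟨C, hC⟩ := (hW' 0).2 0
  refine ⟨√C, fun κ q hq => ?_⟩
  have h1 := eLpNorm_valAt_sub ((hW' 0).smoothVec κ q) (X κ q)
  have h2 : eLpNorm (fun y : Space d => (monomialWeight γ (X κ q - y) : ℂ) *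
      derivs (l.map movVec) (fun p : Ext d × Space d =>
        valAt (V κ p.1) (p.2 - X κ p.1)) (q, y)) 2 volume =
      eLpNorm (fun y => valAt (W' κ q) (y - X κ q)) 2 volume := by
    refine eLpNorm_congr_norm_ae (.of_forall fun y => ?_)
    rw [← h', h κ, norm_mul, norm_mul, norm_real, norm_real, norm_eq_abs,
      norm_eq_abs, ← abs_monomialWeight_neg γ (y - X κ q), neg_sub]
  rw [h2, h1]
  refine ENNReal.ofReal_le_ofReal (Real.le_sqrt_of_sq_le ?_)
  exact hC κ q hq

/-! ### Words of derivatives and multi-indices -/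

lemma iterate_dirDeriv_eq_derivs (v : V) (n : ℕ) (f : V → F) :
    (𝜕 v)^[n] f = derivs (replicate n v) f := by
  induction n with
  | zero => rfl
  | succ n ih => rw [Function.iterate_succ_apply', ih, List.replicate_succ, derivs_cons]

/-- The word which spells out the multi-index `α`. -/
def multiWord (e : Fin d → ι) (α : Fin d → ℕ) : List ι :=
  (List.finRange d).flatMap fun i => replicate (α i) (e i)

lemma multiDeriv_eq_derivs (b : ι → V) (e : Fin d → ι) (α : Fin d → ℕ) (f : V → F) :
    multiDeriv (fun i => b (e i)) α f = derivs ((multiWord e α).map b) f := by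
  unfold multiDeriv multiWord
  induction List.finRange d with
  | nil => rfl
  | cons i l ih =>
    rw [List.foldr_cons, ih, iterate_dirDeriv_eq_derivs, List.flatMap_cons, map_append,
      derivs_append, map_replicate]

lemma derivs_map_smul {f : V → F} (hf : Smooth f) (c : ι → ℝ) (v : ι → V)
    (l : List ι) : derivs (l.map fun j => c j • v j) f =
      fun x => (l.map c).prod • derivs (l.map v) f x := by
  induction l with
  | nil => simp
  | cons j l ih =>
    rw [map_cons, derivs_cons, ih, dirDeriv_const_smul (hf.derivs _), map_cons,
      map_cons, List.prod_cons, derivs_cons]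
    funext x
    rw [dirDeriv_smul_vec, smul_smul, mul_comm]

lemma count_multiWord [DecidableEq ι] {e : Fin d → ι}
    (he : Function.Injective e) (α : Fin d → ℕ) (i : Fin d) :
    (multiWord e α).count (e i) = α i := by
  rw [multiWord, List.count_flatMap, ← Fin.sum_univ_def]
  simp only [Function.comp_apply, count_replicate, beq_iff_eq, he.eq_iff]
  simp

lemma count_multiWord_of_ne [DecidableEq ι] {e : Fin d → ι} (α : Fin d → ℕ)
    {j : ι} (hj : ∀ i, e i ≠ j) : (multiWord e α).count j = 0 := by
  rw [multiWord, List.count_flatMap, ← Fin.sum_univ_def]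
  simp [count_replicate, hj]

lemma exists_perm_multiWord [DecidableEq ι] (e e' : Fin d → ι) (o : ι)
    (he : Function.Injective e) (he' : Function.Injective e') (h1 : ∀ i j, e i ≠ e' j)
    (h2 : ∀ i, e i ≠ o) (h3 : ∀ i, e' i ≠ o)
    (hc : ∀ j, j = o ∨ (∃ i, e i = j) ∨ ∃ i, e' i = j) (l : List ι) :
    ∃ α k β, l.Perm (multiWord e α ++ (replicate k o ++ multiWord e' β)) := by
  refine ⟨fun i => l.count (e i), l.count o, fun i => l.count (e' i),
    List.perm_iff_count.2 fun j => ?_⟩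
  rw [List.count_append, List.count_append]
  rcases hc j with rfl | ⟨i, rfl⟩ | ⟨i, rfl⟩
  · rw [count_multiWord_of_ne _ h2, count_multiWord_of_ne _ h3]
    simp
  · rw [count_multiWord he, count_multiWord_of_ne _ fun j => (h1 i j).symm]
    simp [count_replicate, (h2 i).symm]
  · rw [count_multiWord he', count_multiWord_of_ne _ fun j => h1 j i]
    simp [count_replicate, (h3 i).symm]

lemma prod_map_multiWord {e : Fin d → ι} (α : Fin d → ℕ) {c : ι → ℝ} (hc : ∀ i, c (e i) = r) : ((multiWord e α).map c).prod = r ^ multiLen α := by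
  rw [multiWord, multiLen, Fin.sum_univ_def]
  induction List.finRange d with
  | nil => simp
  | cons i l ih =>
    rw [List.flatMap_cons, map_append, prod_append, ih, map_cons, List.sum_cons,
      pow_add, map_replicate, List.prod_replicate, hc]

lemma length_multiWord (e : Fin d → ι) (α : Fin d → ℕ) : (multiWord e α).length = multiLen α := by
  rw [multiWord, multiLen, Fin.sum_univ_def]
  induction List.finRange d with
  | nil => simp
  | cons i l ih => rw [List.flatMap_cons, length_append, ih, List.length_replicate]; simp

/-! ### Rescaled Hamiltonians -/

/-- The coordinate directions in `(x, t, ξ)` space. -/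
def symVec : ExtIndex d → Space d × ℝ × Space d
  | none => (0, 1, 0)
  | some (inl i) => (stdVec i, 0, 0)
  | some (inr i) => (0, 0, stdVec i)

/-- The sorted word of `∂_x^α ∂_t^k ∂_ξ^β`. -/
def symWord (α : Fin d → ℕ) (k : ℕ) (β : Fin d → ℕ) : List (ExtIndex d) :=
  multiWord (fun i => some (inl i)) α ++ (replicate k none ++ multiWord (fun i => some (inr i)) β)

lemma symbolDeriv_eq_derivs (α : Fin d → ℕ) (k : ℕ) (β : Fin d → ℕ)
    (a : Space d × ℝ × Space d → ℝ) :
    symbolDeriv α k β a = derivs ((symWord α k β).map symVec) a := by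
  have h1 := multiDeriv_eq_derivs (symVec (d := d)) (fun i => some (inr i)) β a
  have h2 := fun f : Space d × ℝ × Space d → ℝ =>
    multiDeriv_eq_derivs (symVec (d := d)) (fun i => some (inl i)) α f
  rw [symWord, map_append, map_append, derivs_append, derivs_append, ← h1, ← h2,
    map_replicate, ← iterate_dirDeriv_eq_derivs]
  rfl

lemma exists_perm_symWord (l : List (ExtIndex d)) : ∃ α k β, l.Perm (symWord α k β) := by
  classical
  refine exists_perm_multiWord (fun i => some (inl i)) (fun i => some (inr i)) none
    (fun i j h => Sum.inl_injective (Option.some_injective _ h))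
    (fun i j h => Sum.inr_injective (Option.some_injective _ h)) (by simp) (by simp) (by simp) ?_ l
  rintro (_ | i | i)
  · exact Or.inl rfl
  · exact Or.inr (Or.inl ⟨i, rfl⟩)
  · exact Or.inr (Or.inr ⟨i, rfl⟩)

/-- The change of variables `(t, (x, ξ)) ↦ (λ x, λ t, ξ / λ)`. -/
def rescale (r : ℝ) : Ext d →L[ℝ] Space d × ℝ × Space d := (r • (fst ℝ _ _).comp (snd ℝ _ _)).prod
    ((r • fst ℝ _ _).prod (r⁻¹ • (snd ℝ _ _).comp (snd ℝ _ _)))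

@[simp] lemma rescale_apply (r : ℝ) (z : Ext d) :
    rescale r z = (r • z.2.1, r * z.1, r⁻¹ • z.2.2) := rfl

/-- The scaling factor of the coordinate directions. -/
def scaleFactor (r : ℝ) : ExtIndex d → ℝ
  | none => r
  | some (inl _) => r
  | some (inr _) => r⁻¹

lemma rescale_extVec (r : ℝ) (j : ExtIndex d) :
    rescale r (extVec j) = scaleFactor r j • symVec j := by
  rcases j with _ | i | i <;> simp [extVec, scaleFactor, symVec, phaseVec]

/-- The rescaled Hamiltonian `λ a(λ x, λ t, ξ / λ)`. -/
def scaledHam (r : ℝ) (a : Space d × ℝ × Space d → ℝ) (z : Ext d) : ℝ := r • a (rescale r z)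

lemma derivs_scaledHam {a : Space d × ℝ × Space d → ℝ} (ha : Smooth a) (r : ℝ)
    (l : List (ExtIndex d)) (z : Ext d) :
    derivs (l.map extVec) (scaledHam r a) z =
      r * ((l.map (scaleFactor r)).prod * derivs (l.map symVec) a (rescale r z)) := by
  have h1 : Smooth fun z : Ext d => a (rescale r z) := ha.comp (rescale r).contDiff
  unfold scaledHam
  rw [derivs_const_smul h1, derivs_comp_clm ha, List.map_map]
  have h2 : (rescale r ∘ extVec : ExtIndex d → _) = fun j => scaleFactor r j • symVec j :=
    funext (rescale_extVec r)
  rw [h2, derivs_map_smul ha]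
  simp only [smul_eq_mul]

lemma prod_scaleFactor_symWord (r : ℝ) (α : Fin d → ℕ) (k : ℕ) (β : Fin d → ℕ) :
    ((symWord α k β).map (scaleFactor r)).prod = r ^ (multiLen α + k) * (r⁻¹) ^ multiLen β := by
  rw [symWord, map_append, map_append, prod_append, prod_append,
    prod_map_multiWord α (c := scaleFactor r) (r := r) (fun _ => rfl),
    prod_map_multiWord β (c := scaleFactor r) (r := r⁻¹) (fun _ => rfl),
    map_replicate, List.prod_replicate, pow_add, mul_assoc]
  rfl

/-- The arithmetic of the scaling. A derivative in space or time gains `r`, one in momentum gains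
`r⁻¹`, and the weight at `R = r ^ 2` is `r ^ (-2m)` or `r ^ (-m - 2)`. Together with the prefactor
`r` of `scaledHam`, first derivatives are O(1) and all higher ones O(r⁻¹). -/
lemma symbolWeight_sq_le (hr : 1 ≤ r) (m b : ℕ) :
    r ^ m * (r⁻¹) ^ b * symbolWeight (r ^ 2) m ≤ (r⁻¹) ^ min (m + b) 2 := by
  have h0 : 0 < r := by linarith
  have hx : r⁻¹ ≤ 1 := inv_le_one_of_one_le₀ hr
  have hx0 : 0 < r⁻¹ := inv_pos.2 h0
  have hmul : r ^ m * (r⁻¹) ^ m = 1 := by rw [← mul_pow, mul_inv_cancel₀ h0.ne', one_pow]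
  unfold symbolWeight
  split_ifs with hm
  · have e : (r ^ 2) ^ (-(m : ℝ)) = (r⁻¹) ^ m * (r⁻¹) ^ m := by
      rw [← rpow_natCast r 2, ← rpow_mul h0.le, ← pow_add, inv_pow, ← rpow_natCast r,
        ← rpow_neg h0.le]
      congr 1
      push_cast
      ring
    rw [e, show r ^ m * r⁻¹ ^ b * (r⁻¹ ^ m * r⁻¹ ^ m) = (r ^ m * r⁻¹ ^ m) * (r⁻¹ ^ m * r⁻¹ ^ b) by ring,
      hmul, one_mul, ← pow_add]
    exact pow_le_pow_of_le_one hx0.le hx (min_le_left _ _)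
  · have e : (r ^ 2) ^ (-(((m : ℝ) - 2) / 2) - 2) = (r⁻¹) ^ m * (r⁻¹) ^ 2 := by
      rw [← rpow_natCast r 2, ← rpow_mul h0.le, ← pow_add, inv_pow, ← rpow_natCast r,
        ← rpow_neg h0.le]
      congr 1
      push_cast
      ring
    rw [e, show r ^ m * r⁻¹ ^ b * (r⁻¹ ^ m * r⁻¹ ^ 2) = (r ^ m * r⁻¹ ^ m) * (r⁻¹ ^ (2 + b)) by
      rw [pow_add]; ring, hmul, one_mul]
    exact pow_le_pow_of_le_one hx0.le hx ((min_le_right _ _).trans (by omega))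

lemma exists_abs_derivs_scaledHam_le (C : (Fin d → ℕ) → ℕ → (Fin d → ℕ) → ℝ)
    (l : List (ExtIndex d)) : ∃ K, 0 ≤ K ∧ ∀ r : ℝ, 1 ≤ r → ∀ a, IsRoughHamiltonian (r ^ 2) C a →
      ∀ z, |derivs (l.map extVec) (scaledHam r a) z| ≤ K * r * (r⁻¹) ^ min l.length 2 := by
  obtain ⟨α, k, β, h⟩ := exists_perm_symWord l
  refine ⟨|C α k β|, abs_nonneg _, fun r hr a ha z => ?_⟩
  have h0 : 0 < r := by linarith
  have hlen : l.length = multiLen α + k + multiLen β := by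
    rw [h.length_eq, symWord, length_append, length_append, length_multiWord,
      length_multiWord, List.length_replicate, add_assoc]
  have hp : ((l.map (scaleFactor r)).prod : ℝ) = _ :=
    (h.map (scaleFactor r)).prod_eq.trans (prod_scaleFactor_symWord r α k β)
  rw [derivs_scaledHam ha.smooth, hp, derivs_perm ha.smooth (h.map symVec),
    ← symbolDeriv_eq_derivs, hlen, abs_mul, abs_mul, abs_of_pos h0,
    abs_of_pos (by positivity : 0 < r ^ (multiLen α + k) * r⁻¹ ^ multiLen β)]
  have hw0 : 0 ≤ symbolWeight (r ^ 2) (multiLen α + k) := by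
    unfold symbolWeight; split_ifs <;> positivity
  have h1 := ha.bound α k β (rescale r z)
  have h2 := symbolWeight_sq_le hr (multiLen α + k) (multiLen β)
  calc _ ≤ r * (r ^ (multiLen α + k) * r⁻¹ ^ multiLen β *
        (|C α k β| * symbolWeight (r ^ 2) (multiLen α + k))) := by
        gcongr
        exact h1.trans (mul_le_mul_of_nonneg_right (le_abs_self _) hw0)
    _ = |C α k β| * r * (r ^ (multiLen α + k) * r⁻¹ ^ multiLen β *
        symbolWeight (r ^ 2) (multiLen α + k)) := by ring
    _ ≤ _ := by gcongr

lemma contDiff_scaledHam {a : Space d × ℝ × Space d → ℝ} (ha : Smooth a) (r : ℝ) :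
    Smooth (scaledHam r a) := (ha.comp (rescale r).contDiff).const_smul r

lemma bddSymbol_scaledHam {C : (Fin d → ℕ) → ℕ → (Fin d → ℕ) → ℝ} (hr : 1 ≤ r)
    {a : Space d × ℝ × Space d → ℝ} (ha : IsRoughHamiltonian (r ^ 2) C a) :
    BddSymbol (scaledHam r a) where
  smooth := contDiff_scaledHam ha.smooth r
  bound l := by
    obtain ⟨K, -, hK⟩ := exists_abs_derivs_scaledHam_le C l
    exact ⟨_, hK r hr a ha⟩

lemma unifSym_dirDeriv_scaledHam {C : (Fin d → ℕ) → ℕ → (Fin d → ℕ) → ℝ}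
    {r : Ω → ℝ} (hr : ∀ κ, 1 ≤ r κ) {a : Ω → Space d × ℝ × Space d → ℝ}
    (ha : ∀ κ, IsRoughHamiltonian (r κ ^ 2) C (a κ)) (j : ExtIndex d) :
    UnifSym fun κ => 𝜕 (extVec j) (scaledHam (r κ) (a κ)) where
  smooth κ := (contDiff_scaledHam (ha κ).smooth _).dirDeriv _
  bound l := by
    obtain ⟨K, hK0, hK⟩ := exists_abs_derivs_scaledHam_le C (l ++ [j])
    refine ⟨K, fun κ z => ?_⟩
    have h1 := hK (r κ) (hr κ) (a κ) (ha κ) z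
    rw [map_append, derivs_append] at h1
    refine h1.trans ?_
    have h0 : 0 < r κ := by linarith [hr κ]
    have hx : (r κ)⁻¹ ≤ 1 := inv_le_one_of_one_le₀ (hr κ)
    have h2 : (r κ)⁻¹ ^ min (l ++ [j]).length 2 ≤ (r κ)⁻¹ ^ 1 :=
      pow_le_pow_of_le_one (inv_pos.2 h0).le hx (by simp)
    calc K * r κ * (r κ)⁻¹ ^ min (l ++ [j]).length 2 ≤ K * r κ * (r κ)⁻¹ ^ 1 := by gcongr
      _ = K := by field_simp

lemma unifSym_dirDeriv_dirDeriv_scaledHam {C : (Fin d → ℕ) → ℕ → (Fin d → ℕ) → ℝ} {r : Ω → ℝ} (hr : ∀ κ, 1 ≤ r κ)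
    {a : Ω → Space d × ℝ × Space d → ℝ} (ha : ∀ κ, IsRoughHamiltonian (r κ ^ 2) C (a κ))
    (i j : ExtIndex d) :
    UnifSym fun κ x => ((r κ)⁻¹)⁻¹ * 𝜕 (extVec i) (𝜕 (extVec j) (scaledHam (r κ) (a κ))) x where
  smooth κ := contDiff_const.mul (((contDiff_scaledHam (ha κ).smooth _).dirDeriv _).dirDeriv _)
  bound l := by
    obtain ⟨K, hK0, hK⟩ := exists_abs_derivs_scaledHam_le C (l ++ [i, j])
    refine ⟨K, fun κ z => ?_⟩
    have h1 := hK (r κ) (hr κ) (a κ) (ha κ) z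
    rw [map_append, derivs_append] at h1
    have h0 : 0 < r κ := by linarith [hr κ]
    have e : derivs (l.map extVec) (fun x => ((r κ)⁻¹)⁻¹ *
        𝜕 (extVec i) (𝜕 (extVec j) (scaledHam (r κ) (a κ))) x) = fun x =>
        ((r κ)⁻¹)⁻¹ * derivs (l.map extVec)
          (𝜕 (extVec i) (𝜕 (extVec j) (scaledHam (r κ) (a κ)))) x :=
      derivs_const_smul (((contDiff_scaledHam (ha κ).smooth _).dirDeriv _).dirDeriv _) ((r κ)⁻¹)⁻¹ _
    rw [e, norm_mul, inv_inv, norm_of_nonneg h0.le]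
    refine (mul_le_mul_of_nonneg_left h1 h0.le).trans_eq ?_
    have h2 : min (l ++ [i, j]).length 2 = 2 := by simp
    rw [h2]
    field_simp

/-! ### Global flows of bounded Hamiltonians -/

lemma BddSymbol.exists_abs_sub_le {g : Ext d → ℝ} (hg : BddSymbol g) :
    ∃ K : ℝ, 0 ≤ K ∧ ∀ x y, |g x - g y| ≤ K * ‖x - y‖ := by
  choose C hC using fun j : ExtIndex d => hg.bound [j]
  have hC0 j : 0 ≤ C j := (abs_nonneg _).trans (hC j 0)
  refine ⟨∑ j, ‖extCoord (d := d) j‖ * C j,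
    sum_nonneg fun j _ => mul_nonneg (norm_nonneg _) (hC0 j), fun x y => ?_⟩
  refine Convex.norm_image_sub_le_of_norm_fderiv_le (𝕜 := ℝ) (s := Set.univ) (f := g)
    (fun x _ => hg.smooth.diff_infty x) (fun x _ => ?_) convex_univ trivial trivial
  refine opNorm_le_bound _ (sum_nonneg fun j _ => mul_nonneg (norm_nonneg _) (hC0 j)) fun v => ?_
  rw [fderiv_eq_sum_extCoord, sum_mul]
  refine norm_sum_le_of_le _ fun j _ => ?_
  rw [norm_smul, mul_right_comm]
  exact mul_le_mul ((extCoord j).le_opNorm v) (hC j x) (norm_nonneg _) (by positivity)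

lemma BddSymbol.exists_hamVec_bounds {h : Ext d → ℝ} (hh : BddSymbol h) :
    ∃ K L : NNReal, (∀ t, LipschitzWith K fun p => hamVec h (t, p)) ∧ ∀ x, ‖hamVec h x‖ ≤ L := by
  choose K hK0 hK using fun j : PhaseIndex d => (hh.dirDeriv (some j)).exists_abs_sub_le
  choose C hC using fun j : PhaseIndex d => hh.bound [some j]
  have hC0 j : 0 ≤ C j := (abs_nonneg _).trans (hC j 0)
  refine ⟨⟨∑ j, K j * ‖dualVec (d := d) j‖, sum_nonneg fun j _ =>
    mul_nonneg (hK0 j) (norm_nonneg _)⟩, ⟨∑ j, C j * ‖dualVec (d := d) j‖,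
    sum_nonneg fun j _ => mul_nonneg (hC0 j) (norm_nonneg _)⟩, fun t => ?_, fun x => ?_⟩
  · refine LipschitzWith.of_dist_le_mul fun p q => ?_
    rw [dist_eq_norm, dist_eq_norm, hamVec, hamVec, ← sum_sub_distrib]
    change _ ≤ (∑ j, K j * ‖dualVec (d := d) j‖) * _
    rw [sum_mul]
    refine norm_sum_le_of_le _ fun j _ => ?_
    rw [← sub_smul, norm_smul, mul_right_comm]
    refine mul_le_mul_of_nonneg_right ?_ (norm_nonneg _)
    simpa using! hK j (t, p) (t, q)
  · exact norm_sum_le_of_le _ fun j _ => by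
      rw [norm_smul]
      exact mul_le_mul_of_nonneg_right (hC j x) (norm_nonneg _)

lemma hasDerivAt_slice_left {f : Ext d → F} (hf : Smooth f) (t : ℝ) (p : Phase d) :
    HasDerivAt (fun τ => f (τ, p)) (𝜕 (extVec none) f (t, p)) t :=
  (hf.diff_infty (t, p)).hasFDerivAt.comp_hasDerivAt t
    ((hasDerivAt_id t).prodMk (hasDerivAt_const t p))

lemma dirDeriv_none_of_hasDerivAt {f : Ext d → F} (hf : Smooth f) {x : Ext d} {f' : F}
    (h : HasDerivAt (fun τ => f (τ, x.2)) f' x.1) : 𝜕 (extVec none) f x = f' :=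
  (hasDerivAt_slice_left hf x.1 x.2).unique h

/-- `φ` is the Hamiltonian flow of `h`. -/
structure IsFlow (h : Ext d → ℝ) (φ : Ext d → Phase d) : Prop where
  smooth : Smooth φ
  zero : ∀ p, φ (0, p) = p
  deriv : ∀ t p, HasDerivAt (fun τ => φ (τ, p)) (hamVec h (t, φ (t, p))) t

lemma exists_isFlow {h : Ext d → ℝ} (hh : BddSymbol h) : ∃ φ, IsFlow h φ := by
  obtain ⟨K, L, hK, hL⟩ := hh.exists_hamVec_bounds
  have hX := contDiff_hamVec hh.smooth
  choose y hy0 hy using exists_global_solution hK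
    (fun p => hX.continuous.comp (.prodMk_left p)) (fun t p => hL (t, p)) 0
  exact ⟨fun x => y x.2 x.1, contDiff_flow (Φ := fun t p => y p t) hX hK hy0 hy, hy0,
    fun t p => hy p t⟩

namespace IsFlow

variable {h : Ext d → ℝ} {φ : Ext d → Phase d}

lemma eq_of_hasDerivAt (hφ : IsFlow h φ) (hh : BddSymbol h) {y : ℝ → Phase d}
    (hy : ∀ t, HasDerivAt y (hamVec h (t, y t)) t) {s : ℝ} {p : Phase d} (hs : y s = φ (s, p))
    (t : ℝ) : y t = φ (t, p) := by
  obtain ⟨K, -, hK, -⟩ := hh.exists_hamVec_bounds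
  exact congrFun (eq_of_hasDerivAt_lipschitz hK hy (hφ.deriv · p) hs) t

lemma bijective (hφ : IsFlow h φ) (hh : BddSymbol h) (s : ℝ) :
    Function.Bijective fun p => φ (s, p) := by
  refine ⟨fun p q hpq => ?_, fun q => ?_⟩
  · have := hφ.eq_of_hasDerivAt hh (hφ.deriv · p) hpq 0
    rwa [hφ.zero, hφ.zero] at this
  · obtain ⟨K, L, hK, hL⟩ := hh.exists_hamVec_bounds
    obtain ⟨y, hy0, hy⟩ := exists_global_solution hK
      (fun p => (contDiff_hamVec hh.smooth).continuous.comp (.prodMk_left p))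
      (fun t p => hL (t, p)) s q
    exact ⟨y 0, (hφ.eq_of_hasDerivAt hh hy (hφ.zero _).symm s).symm.trans hy0⟩

lemma dirDeriv_none (hφ : IsFlow h φ) (x : Ext d) : 𝜕 (extVec none) φ x = hamVec h (traj φ x) :=
  dirDeriv_none_of_hasDerivAt hφ.smooth (hφ.deriv x.1 x.2)

end IsFlow

/-- Rescaling to a fixed interval turns the variable end point into a parameter, and
`contDiff_curry` applies. -/
lemma contDiff_integral_zero {g : Ext d → ℝ} (hg : Smooth g) :
    Smooth fun x : Ext d => ∫ τ in (0 : ℝ)..x.1, g (τ, x.2) := by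
  have h1 : Smooth fun x : ℝ × (Ext d) => x.2.1 * g (x.2.1 * x.1, x.2.2) := by fun_prop
  convert (evalTime unitEnd).contDiff.comp (primitive.contDiff.comp (contDiff_curry _ h1)) using 1
  funext x
  simp only [Function.comp_apply, evalTime_apply, primitive_apply]
  have h2 := intervalIntegral.mul_integral_comp_mul_left (a := 0) (b := 1) (c := x.1)
    (f := fun τ => g (τ, x.2))
  rw [mul_zero, mul_one] at h2
  rw [← h2, ← intervalIntegral.integral_const_mul]
  refine integral_congr fun τ hτ => ?_
  have hτ' : τ ∈ Icc (-1 : ℝ) 1 := by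
    rw [Set.uIcc_of_le zero_le_one] at hτ
    exact ⟨by linarith [hτ.1], hτ.2⟩
  rw [extendTime_of_mem _ hτ']
  rfl

/-- The Lagrangian along the flow. -/
def lagrangian (h : Ext d → ℝ) (φ : Ext d → Phase d) (x : Ext d) : ℝ :=
  -h (traj φ x) + inner ℝ (φ x).2 (hamVec h (traj φ x)).1

/-- The action along the flow, normalized to vanish at time `s`. -/
def action (h : Ext d → ℝ) (φ : Ext d → Phase d) (s : ℝ) (x : Ext d) : ℝ :=
  (∫ τ in (0 : ℝ)..x.1, lagrangian h φ (τ, x.2)) - (∫ τ in (0 : ℝ)..s, lagrangian h φ (τ, x.2)) -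
    (inner ℝ (φ x).2 (φ x).1 / 2 - inner ℝ (φ (s, x.2)).2 (φ (s, x.2)).1 / 2)

/-- The Lagrangian contains `ξ · ẋ`, while the packets need the symmetric form `symp φ φ̇ / 2`. The
two differ by the time derivative of `ξ · x / 2`, which is the boundary term in `action`. -/
lemma IsFlow.isPropagation {h : Ext d → ℝ} {φ : Ext d → Phase d}
    (hφ : IsFlow h φ) (hh : BddSymbol h) {s : ℝ} {U : ℝ → H →L[ℂ] H} (hU : S.IsEvolution h s U) :
    S.IsPropagation h φ (action h φ s) s U := by
  have hφs := hφ.smooth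
  have hL : Smooth (lagrangian h φ) := ((hh.smooth.comp (contDiff_traj hφs)).neg).add
      (hφs.snd.inner ℝ ((contDiff_hamVec hh.smooth).comp (contDiff_traj hφs)).fst)
  have hI := contDiff_integral_zero hL
  have hs : Smooth fun x : Ext d => (s, x.2) := contDiff_const.prodMk contDiff_snd
  have hA : Smooth (action h φ s) :=
    (hI.sub (hI.comp hs)).sub (((hφs.snd.inner ℝ hφs.fst).div_const 2).sub
      (((hφs.comp hs).snd.inner ℝ (hφs.comp hs).fst).div_const 2))
  refine ⟨hh, hU, hφs, hφ.dirDeriv_none, hA, fun p => by simp [action],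
    fun ⟨t, p⟩ => dirDeriv_none_of_hasDerivAt hA ?_⟩
  have h1 : HasDerivAt (fun t => ∫ τ in (0 : ℝ)..t, lagrangian h φ (τ, p)) (lagrangian h φ (t, p)) t :=
    integral_hasDerivAt_right
      ((hL.continuous.comp (.prodMk_left p)).intervalIntegrable _ _)
      ((hL.continuous.comp (.prodMk_left p)).stronglyMeasurableAtFilter _ _)
      (hL.continuous.comp (.prodMk_left p)).continuousAt
  have hd := hφ.deriv t p
  have h2 := ((hd.hasFDerivAt.snd.hasDerivAt).inner ℝ (hd.hasFDerivAt.fst.hasDerivAt)).div_const 2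
  have h3 := (h1.sub_const (∫ τ in (0 : ℝ)..s, lagrangian h φ (τ, p))).sub
    (h2.sub_const (inner ℝ (φ (s, p)).2 (φ (s, p)).1 / 2))
  refine HasDerivAt.congr_deriv (f := fun τ => action h φ s (τ, p)) h3 ?_
  simp only [lagrangian, traj, symp_apply, comp_apply,
    ContinuousLinearMap.coe_fst', ContinuousLinearMap.coe_snd',
    ContinuousLinearMap.toSpanSingleton_apply, one_smul]
  rw [real_inner_comm (φ (t, p)).1]
  ring

/-! ### Canonical transformations -/

/-- The Gram matrix `J` of the symplectic form satisfies `Aᵀ J A = J` with `J` invertible, so `det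
A` has square one; its sign is irrelevant for volume. -/
lemma abs_det_eq_one_of_symp {A : Phase d →L[ℝ] Phase d}
    (hA : ∀ v w, symp (A v) (A w) = symp v w) : |A.det| = 1 := by
  let B : LinearMap.BilinForm ℝ (Phase d) :=
    LinearMap.mk₂ ℝ (fun v w => symp v w) (by simp) (by simp) (by simp) (by simp)
  have h0 : ∀ z : Phase d, symp z (z.2, -z.1) = 0 → z = 0 := fun z hz => by
    simp only [symp_apply, inner_neg_right, real_inner_self_eq_norm_sq] at hz
    have h1 : ‖z.1‖ = 0 := by nlinarith [sq_nonneg ‖z.1‖, sq_nonneg ‖z.2‖]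
    have h2 : ‖z.2‖ = 0 := by nlinarith [sq_nonneg ‖z.1‖, sq_nonneg ‖z.2‖]
    exact Prod.ext (norm_eq_zero.1 h1) (norm_eq_zero.1 h2)
  have hB : B.Nondegenerate := ⟨fun z hz => h0 z (hz _), fun z hz => h0 z (by
    rw [symp_swap, neg_eq_zero]; exact hz _)⟩
  let b := Module.finBasis ℝ (Phase d)
  have h1 : B.comp A.toLinearMap A.toLinearMap = B := LinearMap.ext₂ hA
  have h2 := congrArg Matrix.det
    (LinearMap.BilinForm.toMatrix_comp b b B A.toLinearMap A.toLinearMap)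
  rw [h1, Matrix.det_mul, Matrix.det_mul, Matrix.det_transpose, LinearMap.det_toMatrix] at h2
  have h3 := (LinearMap.BilinForm.nondegenerate_iff_det_ne_zero b).1 hB
  have h4 : A.det * A.det = 1 := mul_right_cancel₀ h3 (by
    rw [one_mul]; exact (mul_right_comm _ _ _).trans h2.symm)
  rcases mul_self_eq_one_iff.1 h4 with h | h <;> rw [h] <;> norm_num

/-- Bijective canonical transformations preserve the volume. -/
lemma integral_comp_of_symp {g : Phase d → Phase d} (hg : Differentiable ℝ g)
    (hb : Function.Bijective g) (hs : ∀ p v w, symp (fderiv ℝ g p v) (fderiv ℝ g p w) = symp v w)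
    (F : Phase d → ℂ) : ∫ p, F (g p) = ∫ p, F p ∧ (Integrable F → Integrable fun p => F (g p)) := by
  have hd : ∀ p ∈ Set.univ, HasFDerivWithinAt g (fderiv ℝ g p) Set.univ p := fun p _ =>
    (hg p).hasFDerivAt.hasFDerivWithinAt
  have h1 := integral_image_eq_integral_abs_det_fderiv_smul volume MeasurableSet.univ hd
    hb.1.injOn F
  have h2 := integrableOn_image_iff_integrableOn_abs_det_fderiv_smul volume MeasurableSet.univ hd
    hb.1.injOn F
  simp only [abs_det_eq_one_of_symp (hs _), one_smul, Set.image_univ, hb.2.range_eq,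
    integrableOn_univ, setIntegral_univ] at h1 h2
  exact ⟨h1.symm, h2.1⟩

/-- By `dirDeriv_action` the second derivatives of the action contain `symp (dφ w) (dφ v) - symp w
v` and otherwise symmetric terms. Second derivatives are symmetric, whereas this difference is
antisymmetric, so it vanishes. -/
lemma IsFlow.symp_fderiv {h : Ext d → ℝ} {φ : Ext d → Phase d} (hφ : IsFlow h φ)
    (hh : BddSymbol h) (t : ℝ) (p v w : Phase d) :
    symp (𝜕 (0, v) φ (t, p)) (𝜕 (0, w) φ (t, p)) = symp v w := by
  -- The evolution serves only to supply the structure in which the derivative of the action was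
  -- computed.
  obtain ⟨U, hU⟩ := stdSys.exists_isEvolution hh 0
  have hP := hφ.isPropagation hh hU
  have h0 : ∀ p v, 𝜕 (0, v) φ (0, p) = v := fun p v => by
    have h1 := congrFun (dirDeriv_slice_right hφ.smooth 0 v) p
    simp only [hφ.zero] at h1
    exact h1.symm.trans (by simp [dirDeriv])
  have h2 : ∀ v w, 𝜕 (0, w) (𝜕 (0, v) (action h φ 0)) (t, p) =
      symp (𝜕 (0, w) φ (t, p)) (𝜕 (0, v) φ (t, p)) / 2 +
        symp (φ (t, p)) (𝜕 (0, w) (𝜕 (0, v) φ) (t, p)) / 2 - symp w v / 2 := by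
    intro v w
    have e : 𝜕 (0, v) (action h φ 0) = fun x => symp (φ x) (𝜕 (0, v) φ x) / 2 - symp x.2 v / 2 := by
      funext x
      rw [hP.dirDeriv_action, h0, hφ.zero]
    have hc : Smooth fun _ : Ext d => v := contDiff_const
    rw [e, dirDeriv_sub (contDiff_symp hφ.smooth (hφ.smooth.dirDeriv _) |>.div_const 2)
      ((contDiff_symp contDiff_snd hc).div_const 2)]
    beta_reduce
    rw [dirDeriv_half_symp hφ.smooth (hφ.smooth.dirDeriv _),
      dirDeriv_half_symp contDiff_snd hc, dirDeriv_const]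
    have h3 : 𝜕 ((0 : ℝ), w) (fun x : Ext d => x.2) (t, p) = w :=
      dirDeriv_eq (f := fun x : Ext d => x.2) hasFDerivAt_snd _
    rw [h3, map_zero, zero_div, add_zero]
  have h3 := h2 v w
  have h4 := h2 w v
  rw [dirDeriv_comm hP.action_smooth, dirDeriv_comm hφ.smooth] at h3
  have h5 := symp_swap (𝜕 (0, v) φ (t, p)) (𝜕 (0, w) φ (t, p))
  have h6 := symp_swap v w
  linarith

/-! ### Rescaled flows -/

/-- The canonical dilation `(x, ξ) ↦ (r x, ξ / r)`. -/
def dil (r : ℝ) : Phase d →L[ℝ] Phase d := (r • fst ℝ _ _).prod (r⁻¹ • snd ℝ _ _)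

lemma dil_apply (r : ℝ) (p : Phase d) : dil r p = (r • p.1, r⁻¹ • p.2) := rfl

lemma dil_dil_inv (hr : r ≠ 0) (p : Phase d) : dil r (dil r⁻¹ p) = p := by
  simp [dil_apply, smul_smul, hr]

lemma dil_inv_dil (hr : r ≠ 0) (p : Phase d) : dil r⁻¹ (dil r p) = p := by
  simp [dil_apply, smul_smul, hr]

lemma symp_dil (hr : r ≠ 0) (v w : Phase d) : symp (dil r v) (dil r w) = symp v w := by
  simp [symp_apply, dil_apply, inner_smul_left, inner_smul_right, hr]

lemma inner_gradXi {a : Space d × ℝ × Space d → ℝ} (ha : Smooth a) (x : Space d) (t : ℝ)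
    (ξ e : Space d) : inner ℝ e (gradXi a x t ξ) = fderiv ℝ a (x, t, ξ) (0, 0, e) := by
  have h1 : HasFDerivAt (fun η => a (x, t, η)) _ ξ := (ha.diff_infty (x, t, ξ)).hasFDerivAt.comp ξ
      ((hasFDerivAt_const x ξ).prodMk ((hasFDerivAt_const t ξ).prodMk (hasFDerivAt_id ξ)))
  rw [gradXi, gradient, real_inner_comm, InnerProductSpace.toDual_symm_apply, h1.fderiv]
  rfl

lemma inner_gradX {a : Space d × ℝ × Space d → ℝ} (ha : Smooth a) (x : Space d) (t : ℝ)
    (ξ e : Space d) : inner ℝ e (gradX a x t ξ) = fderiv ℝ a (x, t, ξ) (e, 0, 0) := by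
  have h1 : HasFDerivAt (fun z => a (z, t, ξ)) _ x :=
    (ha.diff_infty (x, t, ξ)).hasFDerivAt.comp (f := fun z => (z, t, ξ)) x
      ((hasFDerivAt_id x).prodMk ((hasFDerivAt_const t x).prodMk (hasFDerivAt_const ξ x)))
  rw [gradX, gradient, real_inner_comm, InnerProductSpace.toDual_symm_apply, h1.fderiv]
  rfl

/-- The dilation preserves `symp`, so Hamiltonian vector fields correspond; the factor `r` is the
change of the time unit. The two components are compared by pairing with arbitrary vectors. -/
lemma dil_hamVec_scaledHam {a : Space d × ℝ × Space d → ℝ} (ha : Smooth a) (hr : r ≠ 0) (t : ℝ) (p : Phase d) : dil r (hamVec (scaledHam r a) (r⁻¹ * t, dil r⁻¹ p)) =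
      r • (gradXi a p.1 t p.2, -gradX a p.1 t p.2) := by
  have hz : rescale r (r⁻¹ * t, dil r⁻¹ p) = (p.1, t, p.2) := by simp [dil_apply, smul_smul, hr]
  have h1 : ∀ v, symp v (hamVec (scaledHam r a) (r⁻¹ * t, dil r⁻¹ p)) =
      r * fderiv ℝ a (p.1, t, p.2) (rescale r (0, v)) := by
    intro v
    have h2 : HasFDerivAt (scaledHam r a) _ (r⁻¹ * t, dil r⁻¹ p) :=
      ((ha.diff_infty _).hasFDerivAt.comp _ (rescale r).hasFDerivAt).const_smul r
    rw [symp_hamVec, h2.fderiv, hz]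
    rfl
  refine Prod.ext (ext_inner_left ℝ fun e => ?_) (ext_inner_left ℝ fun e => ?_)
  · have h2 := h1 (0, e)
    have e1 : rescale r ((0 : ℝ), ((0, e) : Phase d)) = r⁻¹ • (0, 0, e) := by simp
    rw [symp_apply, inner_zero_left, sub_zero, e1, map_smul, ← inner_gradXi ha, smul_eq_mul,
      mul_inv_cancel_left₀ hr] at h2
    simp [dil_apply, inner_smul_right, ← h2]
  · have h2 := h1 (e, 0)
    have e1 : rescale r ((0 : ℝ), ((e, 0) : Phase d)) = r • (e, 0, 0) := by simp
    rw [symp_apply, inner_zero_left, zero_sub, e1, map_smul, ← inner_gradX ha, smul_eq_mul,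
      neg_eq_iff_eq_neg] at h2
    change inner ℝ e (r⁻¹ • (hamVec (scaledHam r a) (r⁻¹ * t, dil r⁻¹ p)).2) = inner ℝ e (r • -_)
    rw [inner_smul_right, inner_smul_right, h2, inner_neg_right, mul_neg, inv_mul_cancel_left₀ hr,
      mul_neg]

/-- An explicit formula as a characterization yields existence and uniqueness at the original scale
at once. -/
lemma isHamiltonianFlow_iff {a : Space d × ℝ × Space d → ℝ} (ha : Smooth a) (hr : r ≠ 0) (hh : BddSymbol (scaledHam r a)) {φ : Ext d → Phase d}
    (hφ : IsFlow (scaledHam r a) φ) {Φ : ℝ → Space d × Space d → Space d × Space d} :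
    IsHamiltonianFlow a Φ ↔ ∀ t p, Φ t p = dil r (φ (r⁻¹ * t, dil r⁻¹ p)) := by
  refine ⟨fun h t p => ?_, fun h => ?_⟩
  · rw [← hφ.eq_of_hasDerivAt hh (y := fun τ => dil r⁻¹ (Φ (r * τ) p)) (s := 0) (fun τ => ?_)
      (by simp [h.init, hφ.zero]), mul_inv_cancel_left₀ hr, dil_dil_inv hr]
    have h1 := (dil r⁻¹).hasFDerivAt.comp_hasDerivAt τ
      ((h.position p (r * τ)).prodMk (h.momentum p (r * τ)) |>.scomp τ
        ((hasDerivAt_id τ).const_mul r))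
    refine h1.congr_deriv ?_
    rw [mul_one, ← dil_hamVec_scaledHam ha hr, dil_inv_dil hr, inv_mul_cancel_left₀ hr]
  · have hd : ∀ p t, HasDerivAt (fun t => Φ t p)
        (gradXi a (Φ t p).1 t (Φ t p).2, -gradX a (Φ t p).1 t (Φ t p).2) t := by
      intro p t
      have h1 := (dil r).hasFDerivAt.comp_hasDerivAt t
        ((hφ.deriv (r⁻¹ * t) (dil r⁻¹ p)).scomp t ((hasDerivAt_id t).const_mul r⁻¹))
      refine (h1.congr_deriv ?_).congr_of_eventuallyEq (.of_forall fun t => h t p)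
      have h2 := dil_hamVec_scaledHam ha hr t (Φ t p)
      rw [h t p, dil_inv_dil hr, ← h t p] at h2
      rw [map_smul, h2, mul_one, smul_smul, inv_mul_cancel₀ hr, one_smul]
    refine ⟨fun p => ?_, fun p t => ?_, fun p t => ?_⟩
    · rw [h, mul_zero, hφ.zero, dil_dil_inv hr]
    · simpa using! (hd p t).hasFDerivAt.fst.hasDerivAt
    · simpa using! (hd p t).hasFDerivAt.snd.hasDerivAt

/-- The factor `r` in `scaledHam` compensates the change of the time unit, and the dilation
preserves `ξ · dx`; the action integral is therefore invariant. -/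
lemma phaseShift_eq {a : Space d × ℝ × Space d → ℝ} (ha : Smooth a) (hr : r ≠ 0) {φ : Ext d → Phase d} {Φ : ℝ → Space d × Space d → Space d × Space d}
    (hΦ : ∀ t p, Φ t p = dil r (φ (r⁻¹ * t, dil r⁻¹ p))) (t : ℝ) (p : Phase d) :
    phaseShift a Φ t p =
      ∫ τ in (0 : ℝ)..(r⁻¹ * t), lagrangian (scaledHam r a) φ (τ, dil r⁻¹ p) := by
  have h1 := intervalIntegral.mul_integral_comp_mul_left (a := 0) (b := r⁻¹ * t) (c := r)
    (f := fun τ => -a ((Φ τ p).1, τ, (Φ τ p).2) +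
      inner ℝ (Φ τ p).2 (gradXi a (Φ τ p).1 τ (Φ τ p).2))
  rw [mul_zero, mul_inv_cancel_left₀ hr] at h1
  rw [phaseShift, ← h1, ← intervalIntegral.integral_const_mul]
  refine integral_congr fun τ _ => ?_
  have h2 := congrArg Prod.fst (dil_hamVec_scaledHam ha hr (r * τ) (Φ (r * τ) p))
  rw [hΦ, inv_mul_cancel_left₀ hr, dil_inv_dil hr] at h2
  simp only [hΦ, inv_mul_cancel_left₀ hr, lagrangian, traj]
  have h3 : (hamVec (scaledHam r a) (τ, φ (τ, dil r⁻¹ p))).1 = _ := smul_right_injective _ hr h2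
  rw [h3]
  simp [dil_apply, scaledHam, inner_smul_left, mul_add, hr]

/-- The scaled flow preserves the volume. -/
lemma IsFlow.integral_comp {h : Ext d → ℝ} {φ : Ext d → Phase d} (hφ : IsFlow h φ)
    (hh : BddSymbol h) (hr : r ≠ 0) (s : ℝ) (F : Phase d → ℂ) :
    ∫ p, F (φ (s, dil r⁻¹ p)) = ∫ p, F p ∧
      (Integrable F → Integrable fun p => F (φ (s, dil r⁻¹ p))) := by
  have hd : ∀ p, HasFDerivAt (fun p => φ (s, dil r⁻¹ p)) _ p := fun p =>
    (hφ.smooth.diff_infty (s, dil r⁻¹ p)).hasFDerivAt.comp p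
      ((hasFDerivAt_const s p).prodMk (dil r⁻¹).hasFDerivAt)
  refine integral_comp_of_symp (fun p => (hd p).differentiableAt)
    ((hφ.bijective hh s).comp (Function.bijective_iff_has_inverse.2
      ⟨dil r, dil_dil_inv hr, dil_inv_dil hr⟩)) (fun p v w => ?_) F
  rw [(hd p).fderiv]
  refine (hφ.symp_fderiv hh s (dil r⁻¹ p) (dil r⁻¹ v) (dil r⁻¹ w)).trans ?_
  exact symp_dil (inv_ne_zero hr) v w

/-! ### Dilations of `L²` -/

/-- The norm of the dilation `f ↦ f (· / r)` of `L²`. -/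
def dilNorm (d : ℕ) (r : ℝ) : ℝ := r ^ ((d : ℝ) / 2)

lemma dilNorm_mul_inv (d : ℕ) (hr : 0 < r) : dilNorm d r * dilNorm d r⁻¹ = 1 := by
  rw [dilNorm, dilNorm, ← Real.mul_rpow hr.le (inv_pos.2 hr).le, mul_inv_cancel₀ hr.ne',
    Real.one_rpow]

lemma quasiMeasurePreserving_smul (hr : 0 < r) :
    Measure.QuasiMeasurePreserving (fun y : Space d => r⁻¹ • y) volume volume := by
  refine ⟨measurable_const_smul _, ?_⟩
  rw [Measure.map_addHaar_smul _ (inv_ne_zero hr.ne')]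
  exact Measure.smul_absolutelyContinuous

lemma eLpNorm_comp_inv_smul (hr : 0 < r) (f : Space d → ℂ) :
    eLpNorm (fun y => f (r⁻¹ • y)) 2 volume = ofReal (dilNorm d r) * eLpNorm f 2 volume := by
  have h1 := (Homeomorph.smulOfNeZero r⁻¹ (inv_ne_zero hr.ne')).measurableEmbedding.eLpNorm_map_measure
    (μ := (volume : Measure (Space d))) (p := 2) (g := f)
  have h2 : Measure.map (Homeomorph.smulOfNeZero (α := Space d) r⁻¹ (inv_ne_zero hr.ne')) volume = _ :=
    Measure.map_addHaar_smul volume (inv_ne_zero hr.ne')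
  rw [h2, eLpNorm_smul_measure_of_ne_top (by simp)] at h1
  refine Eq.trans h1.symm ?_
  rw [smul_eq_mul]
  congr 1
  change ofReal |(r⁻¹ ^ Module.finrank ℝ (Space d))⁻¹| ^ (1 / 2 : ENNReal).toReal = _
  rw [inv_pow, inv_inv, finrank_euclideanSpace_fin, abs_of_pos (by positivity), dilNorm,
    ENNReal.ofReal_rpow_of_pos (by positivity), ← rpow_natCast, ← rpow_mul hr.le]
  congr 2
  norm_num
  ring

lemma eLpNorm_dilate (hr : 0 < r) (f : Space d → ℂ) :
    eLpNorm (fun y => ((dilNorm d r)⁻¹ : ℂ) * f (r⁻¹ • y)) 2 volume = eLpNorm f 2 volume := by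
  have h0 : 0 < dilNorm d r := Real.rpow_pos_of_pos hr _
  have h1 := eLpNorm_const_smul ((dilNorm d r : ℂ)⁻¹) (fun y : Space d => f (r⁻¹ • y)) 2 volume
  refine Eq.trans h1 ?_
  rw [eLpNorm_comp_inv_smul hr, ← mul_assoc, ← ofReal_norm, ← ENNReal.ofReal_mul
    (norm_nonneg _), norm_inv, norm_real, norm_of_nonneg h0.le,
    inv_mul_cancel₀ h0.ne', ENNReal.ofReal_one, one_mul]

/-- The unitary dilation of `L²`. -/
def lDil (r : ℝ) (hr : 0 < r) : LTwo d →L[ℂ] LTwo d :=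
  (weightedComp (c := fun _ => ((dilNorm d r)⁻¹ : ℂ)) continuous_const
    (quasiMeasurePreserving_smul hr) fun f _ => eLpNorm_dilate hr f).toContinuousLinearMap

lemma coeFn_lDil (hr : 0 < r) {f : LTwo d} {g : Space d → ℂ} (h : f =ᵐ[volume] g) :
    lDil r hr f =ᵐ[volume] fun y => ((dilNorm d r)⁻¹ : ℂ) * g (r⁻¹ • y) := by
  filter_upwards [coeFn_weightedComp (c := fun _ => ((dilNorm d r)⁻¹ : ℂ)) continuous_const
    (quasiMeasurePreserving_smul hr) (fun f _ => eLpNorm_dilate hr f) f,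
    (quasiMeasurePreserving_smul hr).ae h] with y h1 h2
  exact h1.trans (by rw [h2])

lemma lDil_lDil_inv (hr : 0 < r) (f : LTwo d) : lDil r hr (lDil r⁻¹ (inv_pos.2 hr) f) = f := by
  have h1 := coeFn_lDil hr (coeFn_lDil (inv_pos.2 hr) (ae_eq_refl f))
  refine Lp.ext (h1.trans (.of_forall fun y => ?_))
  have h2 := dilNorm_mul_inv d hr
  simp only [smul_smul, inv_inv, mul_inv_cancel₀ hr.ne', one_smul, ← mul_assoc, ← mul_inv,
    ← ofReal_mul, h2]
  simp

lemma lDil_inv_lDil (hr : 0 < r) (f : LTwo d) : lDil r⁻¹ (inv_pos.2 hr) (lDil r hr f) = f := by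
  simpa only [inv_inv] using lDil_lDil_inv (inv_pos.2 hr) f

/-- The dilation of a Schwartz function. -/
def dilSchwartz {r : ℝ} (hr : r ≠ 0) : 𝓢(Space d, ℂ) →L[ℂ] 𝓢(Space d, ℂ) :=
  SchwartzMap.compCLMOfContinuousLinearEquiv ℂ (ContinuousLinearEquiv.smulLeft (Units.mk0 r hr))

lemma dilSchwartz_apply (hr : r ≠ 0) (f : 𝓢(Space d, ℂ)) (y : Space d) :
    dilSchwartz hr f y = f (r • y) := rfl

lemma lDil_inv_toLp (hr : 0 < r) (f : 𝓢(Space d, ℂ)) : lDil r⁻¹ (inv_pos.2 hr) f♭ =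
      (dilNorm d r : ℂ) • (dilSchwartz hr.ne' f)♭ := by
  refine Lp.ext ((coeFn_lDil (inv_pos.2 hr) (f.coeFn_toLp 2 volume)).trans ?_)
  filter_upwards [(dilSchwartz hr.ne' f).coeFn_toLp 2 volume,
    Lp.coeFn_smul (dilNorm d r : ℂ) (dilSchwartz hr.ne' f)♭] with y h1 h2
  rw [h2, Pi.smul_apply, h1, dilSchwartz_apply, inv_inv, smul_eq_mul, ← ofReal_inv,
    inv_eq_of_mul_eq_one_left (dilNorm_mul_inv d hr)]

/-- The Jacobians of the substitutions in `y` and `ξ` are inverse to each other, as the dilation is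
canonical. -/
lemma weylQuantization_dil (hr : 0 < r) (b : Space d → Space d → ℝ) (f : 𝓢(Space d, ℂ))
    (x : Space d) : weylQuantization (fun x ξ => r * b (r • x) (r⁻¹ • ξ)) (dilSchwartz hr.ne' f)
      (r⁻¹ • x) = r * weylQuantization b f x := by
  have h1 : ∀ ξ, ∫ y, Complex.exp (I * (inner ℝ (r⁻¹ • x - y) ξ : ℝ)) *
      𝕔(r * b (r • ½ • (r⁻¹ • x + y)) (r⁻¹ • ξ)) * dilSchwartz hr.ne' f y =
      ((r ^ d)⁻¹ : ℝ) • (r * ∫ y, Complex.exp (I * (inner ℝ (x - y) (r⁻¹ • ξ) : ℝ)) *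
        (b (½ • (x + y)) (r⁻¹ • ξ) : ℂ) * f y) := by
    intro ξ
    rw [← integral_const_mul]
    have h2 := Measure.integral_comp_smul_of_nonneg (volume : Measure (Space d))
      (fun y => (r : ℂ) * (Complex.exp (I * (inner ℝ (x - y) (r⁻¹ • ξ) : ℝ)) *
        (b (½ • (x + y)) (r⁻¹ • ξ) : ℂ) * f y)) r (hR := hr.le)
    rw [finrank_euclideanSpace_fin] at h2
    rw [← h2]
    refine integral_congr_ae (.of_forall fun y => ?_)
    have e1 : inner ℝ (x - r • y) (r⁻¹ • ξ) = inner ℝ (r⁻¹ • x - y) ξ := by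
      rw [show x - r • y = r • (r⁻¹ • x - y) by rw [smul_sub, smul_inv_smul₀ hr.ne'],
        inner_smul_left, inner_smul_right]
      simp [hr.ne']
    have e2 : r • ½ • (r⁻¹ • x + y) = ½ • (x + r • y) := by
      rw [smul_comm, smul_add, smul_inv_smul₀ hr.ne']
    simp only [e1, e2, dilSchwartz_apply]
    push_cast
    ring
  have h3 := Measure.integral_comp_inv_smul_of_nonneg (volume : Measure (Space d))
    (fun ξ => ((r ^ d)⁻¹ : ℝ) • ((r : ℂ) * ∫ y, Complex.exp (I * (inner ℝ (x - y) ξ : ℝ)) *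
        (b (½ • (x + y)) ξ : ℂ) * f y)) hr.le
  rw [finrank_euclideanSpace_fin, integral_smul (r ^ d)⁻¹ (f := fun ξ => (r : ℂ) *
    ∫ y, Complex.exp (I * (inner ℝ (x - y) ξ : ℝ)) *
      (b (½ • (x + y)) ξ : ℂ) * f y), smul_smul, mul_inv_cancel₀ (by positivity),
    one_smul, integral_const_mul] at h3
  simp only [weylQuantization, h1, h3]
  ring

lemma isWeylOperator_dil (hr : 0 < r) {b : Space d → Space d → ℝ}
    {B : LTwo d →L[ℂ] LTwo d} (hB : IsWeylOperator (fun x ξ => r * b (r • x) (r⁻¹ • ξ)) B) :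
    IsWeylOperator b ((r⁻¹ : ℂ) • (lDil r hr).comp (B.comp (lDil r⁻¹ (inv_pos.2 hr)))) := by
  intro f
  change ((r⁻¹ : ℂ) • lDil r hr (B (lDil r⁻¹ (inv_pos.2 hr) f♭)) : LTwo d) =ᵐ[volume] _
  rw [lDil_inv_toLp hr, map_smul, map_smul]
  filter_upwards [Lp.coeFn_smul (r⁻¹ : ℂ) ((dilNorm d r : ℂ) •
    lDil r hr (B (dilSchwartz hr.ne' f)♭)),
    Lp.coeFn_smul (dilNorm d r : ℂ) (lDil r hr (B (dilSchwartz hr.ne' f)♭)),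
    coeFn_lDil hr (hB (dilSchwartz hr.ne' f))] with y h1 h2 h3
  have h0 : (dilNorm d r : ℂ) ≠ 0 := by exact_mod_cast (Real.rpow_pos_of_pos hr _).ne'
  have hr' : (r : ℂ) ≠ 0 := by exact_mod_cast hr.ne'
  rw [h1, Pi.smul_apply, h2, Pi.smul_apply, h3, weylQuantization_dil hr]
  simp only [smul_eq_mul]
  field_simp

lemma IsWeylOperator.unique {b : Space d → Space d → ℝ} {A B : LTwo d →L[ℂ] LTwo d}
    (hA : IsWeylOperator b A) (hB : IsWeylOperator b B) : A = B := by
  refine DFunLike.coe_injective (Continuous.ext_on dense_range_toLTwo A.continuous B.continuous ?_)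
  rintro _ ⟨f, rfl⟩
  exact Lp.ext ((hA f).trans (hB f).symm)

/-! ### The evolution operators -/

lemma hasDerivAt_complex_iff {y : ℝ → H} {v : H} {t : ℝ} : HasDerivAt y v t ↔
      (fun τ => y τ - y t - 𝕔(τ - t) • v) =o[nhds t] fun τ => τ - t :=
  hasDerivAt_iff_isLittleO

/-- Derivatives of curves in `LTwo d` refer to the real structure of `Lp`, those of the abstract
theory to the restriction of the complex one. This lemma and the preceding one bring both to the
same asymptotic statement. -/
lemma hasDerivAt_lTwo_iff {y : ℝ → LTwo d} {v : LTwo d} {t : ℝ} : HasDerivAt y v t ↔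
    (fun τ => y τ - y t - 𝕔(τ - t) • v) =o[nhds t] fun τ => τ - t := by
  have h (c : ℝ) : c • v = (c : ℂ) • v := (algebraMap_smul ℂ c v).symm
  simp only [hasDerivAt_iff_isLittleO, h]

lemma hasDerivAt_rescale (T : H →L[ℂ] H) (r : ℝ) {y : ℝ → H} {v : H} {t : ℝ} (hy : HasDerivAt y v (r * t)) :
    HasDerivAt (fun τ => T (y (r * τ))) ((r : ℂ) • T v) t := by
  have h1 := (T.restrictScalars ℝ).hasFDerivAt.comp_hasDerivAt t
    (hy.scomp t ((hasDerivAt_id t).const_mul r))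
  refine h1.congr_deriv ?_
  simp

lemma isFundamentalSolution_iff {a : Space d × ℝ × Space d → ℝ} (hr : 0 < r)
    (hh : BddSymbol (scaledHam r a)) {U : ℝ → ℝ → LTwo d →L[ℂ] LTwo d}
    (hU : ∀ s, stdSys.IsEvolution (scaledHam r a) s (U s))
    {S : ℝ → ℝ → LTwo d →L[ℂ] LTwo d} : IsFundamentalSolution a S ↔
      ∀ t s u, S t s u = lDil r hr (U (r⁻¹ * s) (r⁻¹ * t) (lDil r⁻¹ (inv_pos.2 hr) u)) := by
  have hr' : (r : ℂ) ≠ 0 := by exact_mod_cast hr.ne'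
  set A : ℝ → LTwo d →L[ℂ] LTwo d := fun t => (r⁻¹ : ℂ) • (lDil r hr).comp
    ((stdSys.opAt (scaledHam r a) (r⁻¹ * t, 0)).comp (lDil r⁻¹ (inv_pos.2 hr)))
  have hA : ∀ t, IsWeylOperator (fun x ξ => a (x, t, ξ)) (A t) := by
    intro t
    obtain ⟨M, hM⟩ := hh.exists_symbolBound
    have h1 := isWeylOperator_op (hM (r⁻¹ * t, 0))
    refine isWeylOperator_dil hr ?_
    convert h1 using 3 with x ξ
    · simp [slice, scaledHam, hr.ne']
    · rfl
  refine ⟨fun ⟨A', hA', hS, hd⟩ t s u => ?_, fun h => ⟨A, hA, fun s => ?_, fun s t u => ?_⟩⟩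
  · have h1 := (hU (r⁻¹ * s)).eq_of_hasDerivAt hh
      (y := fun τ => lDil r⁻¹ (inv_pos.2 hr) (S (r * τ) s u)) (fun τ => ?_) (r⁻¹ * t)
    · simp only [mul_inv_cancel_left₀ hr.ne', hS] at h1
      rw [id_apply] at h1
      rw [← h1, lDil_lDil_inv]
    · have h2 := hasDerivAt_rescale (lDil r⁻¹ (inv_pos.2 hr)) r
        (hasDerivAt_complex_iff.2 (hasDerivAt_lTwo_iff.1 (hd s (r * τ) u)))
      convert h2 using 1
      rw [(hA' _).unique (hA _)]
      change _ = (r : ℂ) • lDil r⁻¹ (inv_pos.2 hr) (-(I • ((r⁻¹ : ℂ) • lDil r hr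
        (stdSys.opAt (scaledHam r a) (r⁻¹ * (r * τ), 0) _))))
      rw [inv_mul_cancel_left₀ hr.ne', smul_comm I, map_neg, map_smul, smul_neg, smul_smul,
        mul_inv_cancel₀ hr', one_smul, map_smul, lDil_inv_lDil]
      rfl
  · ext1 u
    rw [h, (hU _).init, lDil_lDil_inv]; rfl
  · have h2 := hasDerivAt_rescale (lDil r hr) r⁻¹ ((hU (r⁻¹ * s)).deriv (r⁻¹ * t)
      (lDil r⁻¹ (inv_pos.2 hr) u))
    have e : -(I • A t (S t s u)) = 𝕔(r⁻¹) • lDil r hr (-(I •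
        stdSys.opAt (scaledHam r a) (r⁻¹ * t, 0) (U (r⁻¹ * s) (r⁻¹ * t)
          (lDil r⁻¹ (inv_pos.2 hr) u)))) := by
      change -(I • ((r⁻¹ : ℂ) • lDil r hr (stdSys.opAt (scaledHam r a)
        (r⁻¹ * t, 0) (lDil r⁻¹ (inv_pos.2 hr) (S t s u))))) = _
      rw [h t s u, lDil_inv_lDil, smul_comm I, map_neg, map_smul, smul_neg, ofReal_inv]
    rw [hasDerivAt_complex_iff] at h2
    rw [e, hasDerivAt_lTwo_iff]
    simp only [h]
    exact h2

/-! ### The phase space representation of the evolution -/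

section Kernel

variable {h : Ext d → ℝ} {φ : Ext d → Phase d} {θ : Ext d → ℝ} {s : ℝ}
  {U : ℝ → LTwo d →L[ℂ] LTwo d}

lemma valAt_evolution (x : Ext d) (y : Space d) :
    valAt (U x.1 (stdSys.coh (φ (s, x.2)))) y = expI (θ x) * (expI (shiftPhase (φ x) y) *
      valAt (stdSys.packet φ θ s U stdSys.vac x) (y - (φ x).1)) := by
  have h1 : U x.1 (stdSys.coh (φ (s, x.2))) = expI (θ x) • stdSys.shift (φ x)
      (stdSys.packet φ θ s U stdSys.vac x) := by
    rw [HeisenbergSystem.packet, map_smul, HeisenbergSystem.shift_shift_neg, smul_smul, mul_comm,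
      expI_neg_mul, one_smul]
    rfl
  rw [h1, valAt_smul, valAt_shift]
  rfl

/-- The resolution of the identity is transported through the scaled flow at time `s`, which
preserves volume, and then evolved. Convergence is absolute at every `y`: the transform of a
Schwartz function is integrable, and the evolved states have uniformly bounded values by the Sobolev
bounds on the packets. -/
lemma evolution_ae_eq_integral (hφ : IsFlow h φ) (hP : stdSys.IsPropagation h φ θ s U) {t : ℝ}
    (hV : ∀ k, ∃ C, ∀ q, stdSys.sob k (stdSys.packet φ θ s U stdSys.vac (t, q)) ≤ C)
    (hr : r ≠ 0) (f : 𝓢(Space d, ℂ)) :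
    (∀ y, Integrable fun p : Phase d => 𝕔(((2 * π) ^ d)⁻¹) * ⟪stdSys.coh (φ (s, dil r⁻¹ p)), f♭⟫ *
        valAt (U t (stdSys.coh (φ (s, dil r⁻¹ p)))) y) ∧
    U t f♭ =ᵐ[volume] fun y => ∫ p : Phase d, 𝕔(((2 * π) ^ d)⁻¹) *
      ⟪stdSys.coh (φ (s, dil r⁻¹ p)), f♭⟫ * valAt (U t (stdSys.coh (φ (s, dil r⁻¹ p)))) y := by
  have hvac := (stdSys (d := d)).smooth_vac
  have hQ : Smooth fun p : Phase d => (t, dil r⁻¹ p) := contDiff_const.prodMk (dil r⁻¹).contDiff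
  have hT : stdSys.SmoothFam fun p : Phase d => U t (stdSys.coh (φ (s, dil r⁻¹ p))) :=
    (hP.smoothFam_inner hvac).comp hQ
  have hm := (((hφ.integral_comp hP.bdd hr s _).2 (integrable_inner_coh
    (smoothVec_toLTwo f))).const_mul 𝕔(((2 * π) ^ d)⁻¹))
  have hF : Continuous (uncurry fun (p : Phase d) y =>
      valAt (U t (stdSys.coh (φ (s, dil r⁻¹ p)))) y) := by
    have h1 := (contDiff_valAt_sub hT (X := fun _ => 0) contDiff_const).continuous
    simpa only [sub_zero] using! h1
  obtain ⟨k, C, hC0, hC⟩ := exists_norm_valAt_le d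
  obtain ⟨C', hC'⟩ := hV k
  have hb : ∀ p y, ‖valAt (U t (stdSys.coh (φ (s, dil r⁻¹ p)))) y‖ ≤ C * (1 + C') := by
    intro p y
    rw [valAt_evolution (θ := θ) (t, dil r⁻¹ p), norm_mul, norm_mul, norm_expI, norm_expI, one_mul,
      one_mul]
    refine (hC _ ((hP.smoothFam_packet hvac).smoothVec _) _).trans ?_
    gcongr
    exact hC' _
  refine ⟨fun y => hm.mul_bdd (c := C * (1 + C')) ?_ ?_, ?_⟩
  · exact (hF.comp (.prodMk_left y)).aestronglyMeasurable
  · exact .of_forall fun p => hb p y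
  · refine ae_eq_integral_mul hm hF hb (fun p => ae_eq_valAt (hT.smoothVec p)) fun v => ?_
    have h1 := stdSys.resolution (ContinuousLinearMap.adjoint (U t) v♭) f♭
    simp only [adjoint_inner_left] at h1
    have h2 := (hφ.integral_comp hP.bdd hr s fun q => ⟪v♭,
      U t (stdSys.coh q)⟫ * ⟪stdSys.coh q, f♭⟫).1
    have h3 : ⟪v♭, U t f♭⟫ = 𝕔(((2 * π) ^ d)⁻¹) * (((2 * π) ^ d : ℝ) * ⟪v♭, U t f♭⟫) := by
      rw [← mul_assoc, ← ofReal_mul, inv_mul_cancel₀ (by positivity), Complex.ofReal_one, one_mul]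
    rw [h3, ← h1]
    refine (congrArg _ h2.symm).trans ?_
    rw [← integral_const_mul]
    refine integral_congr_ae (.of_forall fun p => ?_)
    rw [toLTwo_apply]
    ring

/-- The normalization of the amplitude. -/
def amplitudeConst (d : ℕ) (r : ℝ) : ℝ := ((2 * π) ^ d)⁻¹ * π ^ (-((d : ℝ) / 4)) * (r ^ d)⁻¹

/-- The hypothesis on `ψ` is the relation between phase shift and symmetrized action; its half
boundary terms `ξ · x / 2` are the ones needed to pass from the phases of the kernel to those of the
shifts. The Gaussian is the vacuum up to `π ^ (d / 4)`, which `amplitudeConst` compensates. -/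
lemma integral_kernelIntegrand (hr : 0 < r)
    {Φ : ℝ → Space d × Space d → Space d × Space d} {ψ : ℝ → Space d × Space d → ℝ}
    {G : ℝ → ℝ → Space d → Space d → Space d → ℂ} {t s θ : ℝ} {y : Space d} {p zs zt : Phase d}
    {W : ℂ} (hs : Φ s p = dil r zs) (ht : Φ t p = dil r zt)
    (hψ : ψ t p - ψ s p = θ + inner ℝ zt.2 zt.1 / 2 - inner ℝ zs.2 zs.1 / 2)
    (hG : G t s p.1 p.2 y = amplitudeConst d r * W) (f : 𝓢(Space d, ℂ)) :
    ∫ y', kernelIntegrand (r ^ 2) Φ ψ G t y s y' p * f y' = 𝕔(((2 * π) ^ d)⁻¹) *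
      ⟪stdSys.coh zs, (dilSchwartz hr.ne' f)♭⟫ *
        (expI θ * (expI (shiftPhase zt (r⁻¹ • y)) * W)) := by
  obtain ⟨g, hg⟩ : ∃ g : Space d → ℂ, g = fun y' => 𝕔(π ^ ((d : ℝ) / 4) * amplitudeConst d r) *
        (expI (inner ℝ zs.2 zs.1 / 2) * (expI θ * (expI (shiftPhase zt (r⁻¹ • y)) * W))) *
        (expI (-(inner ℝ zs.2 y')) * (vacSchwartz (y' - zs.1) * dilSchwartz hr.ne' f y')) :=
    ⟨_, rfl⟩
  have h1 : ∀ y', kernelIntegrand (r ^ 2) Φ ψ G t y s y' p * f y' = g (r⁻¹ • y') := by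
    intro y'
    have e1 : ∀ y : Space d, y - r • zs.1 = r • (r⁻¹ • y - zs.1) := fun y => by
      rw [smul_sub, smul_inv_smul₀ hr.ne']
    have e2 : ∀ y : Space d, y - r • zt.1 = r • (r⁻¹ • y - zt.1) := fun y => by
      rw [smul_sub, smul_inv_smul₀ hr.ne']
    have e3 : exp (-(‖r • (r⁻¹ • y' - zs.1)‖ ^ 2 / (2 * r ^ 2))) =
        π ^ ((d : ℝ) / 4) * (π ^ (-((d : ℝ) / 4)) * exp (-(‖r⁻¹ • y' - zs.1‖ ^ 2 / 2))) := by
      rw [← mul_assoc, ← rpow_add pi_pos, add_neg_cancel, Real.rpow_zero, one_mul,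
        norm_smul, norm_of_nonneg hr.le]
      congr 2
      field_simp
    have e4 : ∀ x : ℝ, Complex.exp (I * x) = expI x := fun x => by rw [expI]
    have e5 : ∀ x : ℝ, Complex.exp (-(I * x)) = expI (-x) := fun x => by
      rw [← e4, Complex.ofReal_neg, mul_neg]
    simp only [hg, kernelIntegrand, hs, ht, hψ, hG, dil_apply, e1, e2, e3, e4, e5, dilSchwartz_apply,
      smul_inv_smul₀ hr.ne', vacSchwartz_apply, inner_smul_left, inner_smul_right]
    have e6 : ∀ x : ℝ, r * ((starRingEnd ℝ) r⁻¹ * x) = x := fun x => mul_inv_cancel_left₀ hr.ne' x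
    have e7 : expI (-inner ℝ zs.2 (r⁻¹ • y' - zs.1)) *
        expI (θ + inner ℝ zt.2 zt.1 / 2 - inner ℝ zs.2 zs.1 / 2) *
        expI (inner ℝ zt.2 (r⁻¹ • y - zt.1)) = expI (inner ℝ zs.2 zs.1 / 2) * expI θ *
        expI (shiftPhase zt (r⁻¹ • y)) * expI (-(r⁻¹ * inner ℝ zs.2 y')) := by
      simp only [← expI_add, shiftPhase, inner_sub_right, inner_smul_right]
      congr 1
      ring
    simp only [e6]
    push_cast
    linear_combination 𝕔(π ^ ((d : ℝ) / 4)) * 𝕔(π ^ (-((d : ℝ) / 4))) *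
      Complex.exp (-(‖r⁻¹ • y' - zs.1‖ ^ 2 / 2)) * amplitudeConst d r * W * f y' * e7
  have h2 : ⟪stdSys.coh zs, (dilSchwartz hr.ne' f)♭⟫ = _ :=
    inner_lShift_vac zs (dilSchwartz hr.ne' f)
  have h3 : r ^ d * (π ^ ((d : ℝ) / 4) * amplitudeConst d r) = ((2 * π) ^ d)⁻¹ := by
    have e : π ^ ((d : ℝ) / 4) * π ^ (-((d : ℝ) / 4)) = 1 := by
      rw [← rpow_add pi_pos, add_neg_cancel, Real.rpow_zero]
    calc _ = ((2 * π) ^ d)⁻¹ * (π ^ ((d : ℝ) / 4) * π ^ (-((d : ℝ) / 4))) *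
          (r ^ d * (r ^ d)⁻¹) := by rw [amplitudeConst]; ring
      _ = _ := by rw [e, mul_inv_cancel₀ (by positivity), mul_one, mul_one]
  refine (integral_congr_ae (.of_forall h1)).trans
    ((Measure.integral_comp_inv_smul_of_nonneg volume g hr.le).trans ?_)
  rw [hg, integral_const_mul, finrank_euclideanSpace_fin, h2, real_smul, ← h3]
  push_cast
  ring

end Kernel

/-! ### Uniform estimates for the amplitude -/

section Amplitude

variable {C : (Fin d → ℕ) → ℕ → (Fin d → ℕ) → ℝ} {M : ℝ}

/-- Rescaled flows and evolutions of Hamiltonians obeying the estimates with constants `C`. -/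
structure ScaledEvolution (d : ℕ) (C : (Fin d → ℕ) → ℕ → (Fin d → ℕ) → ℝ) (M : ℝ) : Type where
  r : ℝ
  a : Space d × ℝ × Space d → ℝ
  φ : Ext d → Phase d
  s : ℝ
  U : ℝ → LTwo d →L[ℂ] LTwo d
  one_le : 1 ≤ r
  rough : IsRoughHamiltonian (r ^ 2) C a
  flow : IsFlow (scaledHam r a) φ
  evol : stdSys.IsEvolution (scaledHam r a) s U
  time : r⁻¹ * |s| ≤ M

namespace ScaledEvolution

lemma isPropagation (κ : ScaledEvolution d C M) : stdSys.IsPropagation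
    (scaledHam κ.r κ.a) κ.φ (action (scaledHam κ.r κ.a) κ.φ κ.s) κ.s κ.U :=
  κ.flow.isPropagation (bddSymbol_scaledHam κ.one_le κ.rough) κ.evol

/-- The wave packets of the rescaled evolution. -/
def packet (κ : ScaledEvolution d C M) : Ext d → LTwo d :=
  stdSys.packet κ.φ (action (scaledHam κ.r κ.a) κ.φ κ.s) κ.s κ.U stdSys.vac

lemma hamFamily : HamFamily (fun κ : ScaledEvolution d C M => κ.r⁻¹)
    (fun κ => scaledHam κ.r κ.a) (fun κ => κ.φ) where
  pos κ := inv_pos.2 (one_pos.trans_le κ.one_le)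
  le_one κ := inv_le_one_of_one_le₀ κ.one_le
  bdd κ := bddSymbol_scaledHam κ.one_le κ.rough
  first := unifSym_dirDeriv_scaledHam one_le rough
  second := unifSym_dirDeriv_dirDeriv_scaledHam one_le rough
  flow_smooth κ := κ.flow.smooth
  flow_zero κ := κ.flow.zero
  flow_deriv κ := κ.flow.dirDeriv_none

lemma unifVec_packet (n : ℕ) : stdSys.UnifVec
    (timeRange M fun κ : ScaledEvolution d C M => κ.r⁻¹) n packet :=
  HeisenbergSystem.unifVec_packet hamFamily isPropagation time n stdSys.smooth_vac

/-- The amplitude in rescaled coordinates, up to normalization. -/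
def profile (κ : ScaledEvolution d C M) (p : Ext d × Space d) : ℂ :=
  valAt (κ.packet p.1) (p.2 - (κ.φ p.1).1)

lemma contDiff_profile (κ : ScaledEvolution d C M) : Smooth κ.profile :=
  contDiff_valAt_sub (V := κ.packet) (X := fun q => (κ.φ q).1)
    (κ.isPropagation.smoothFam_packet stdSys.smooth_vac) κ.flow.smooth.fst

lemma exists_eLpNorm_derivs_profile_le (γ : Fin d → ℕ) (l : List (MovIndex d)) : ∃ K : ℝ, 0 ≤ K ∧
    ∀ (κ : ScaledEvolution d C M) q, κ.r⁻¹ * |q.1| ≤ M → eLpNorm (fun y : Space d =>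
      (monomialWeight γ ((κ.φ q).1 - y) : ℂ) * derivs (l.map movVec) κ.profile (q, y)) 2 volume ≤
        ofReal K := by
  have hX : ∀ n i, UnifFun (timeRange M fun κ : ScaledEvolution d C M => κ.r⁻¹) n
      fun κ => 𝜕 (extVec i) fun q => (κ.φ q).1 := fun n i => by
    have h1 := ((hamFamily (C := C) (M := M)).unifFun_dirDeriv_flow (M := M) n i).clm
      (fst ℝ (Space d) (Space d))
    have h2 : ∀ κ : ScaledEvolution d C M, 𝜕 (extVec i) (fun q => (κ.φ q).1) = fun x =>
        fst ℝ (Space d) (Space d) (𝜕 (extVec i) κ.φ x) := fun κ =>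
      dirDeriv_clm_comp κ.flow.smooth (fst ℝ (Space d) (Space d)) _
    simpa only [h2] using h1
  obtain ⟨K, hK⟩ := exists_eLpNorm_derivs_moving_le unifVec_packet
    (X := fun κ q => (κ.φ q).1) (fun κ => κ.flow.smooth.fst) hX γ l
  exact ⟨|K|, abs_nonneg _, fun κ q hq => (hK κ q hq).trans
    (ENNReal.ofReal_le_ofReal (le_abs_self K))⟩

end ScaledEvolution

/-- The coordinate directions in `(t, x, ξ, y)` space. -/
def ampVec : MovIndex d → ℝ × Space d × Space d × Space d
  | inl none => (1, 0, 0, 0)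
  | inl (some (inl i)) => (0, stdVec i, 0, 0)
  | inl (some (inr i)) => (0, 0, stdVec i, 0)
  | inr i => (0, 0, 0, stdVec i)

/-- The scaling factors of the coordinate directions in `(t, x, ξ, y)` space. -/
def ampFactor (r : ℝ) : MovIndex d → ℝ
  | inl (some (inr _)) => r
  | _ => r⁻¹

/-- The change of variables `(t, x, ξ, y) ↦ ((t / r, (x / r, r ξ)), y / r)`. -/
def unscale (r : ℝ) : (ℝ × Space d × Space d × Space d) →L[ℝ] Ext d × Space d :=
  LinearMap.toContinuousLinearMap
    { toFun := fun q => ((r⁻¹ * q.1, dil r⁻¹ (q.2.1, q.2.2.1)), r⁻¹ • q.2.2.2)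
      map_add' := fun p q => by simp [dil_apply, mul_add]
      map_smul' := fun c q => by simp [dil_apply, mul_left_comm, smul_comm c] }

lemma unscale_ampVec (r : ℝ) (j : MovIndex d) :
    unscale r (ampVec j) = ampFactor r j • movVec j := by
  rcases j with (_ | i | i) | i <;>
    simp [unscale, ampVec, ampFactor, movVec, extVec, phaseVec, dil_apply]

/-- The word of `∂_t^σ ∂_x^α ∂_ξ^β ∂_y^ν`. -/
def ampWord (σ : ℕ) (α β ν : Fin d → ℕ) : List (MovIndex d) :=
  replicate σ (inl none) ++ (multiWord (fun i => inl (some (inl i))) α ++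
    (multiWord (fun i => inl (some (inr i))) β ++ multiWord inr ν))

lemma amplitudeDeriv_eq_derivs (σ : ℕ) (α β ν : Fin d → ℕ)
    (g : ℝ × Space d × Space d × Space d → ℂ) :
    amplitudeDeriv σ α β ν g = derivs ((ampWord σ α β ν).map ampVec) g := by
  simp only [ampWord, map_append, derivs_append, ← multiDeriv_eq_derivs, map_replicate,
    ← iterate_dirDeriv_eq_derivs]
  rfl

lemma prod_ampFactor (r : ℝ) (σ : ℕ) (α β ν : Fin d → ℕ) :
    ((ampWord σ α β ν).map (ampFactor r)).prod =
      r⁻¹ ^ σ * (r⁻¹ ^ multiLen α * (r ^ multiLen β * r⁻¹ ^ multiLen ν)) := by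
  simp only [ampWord, map_append, prod_append, map_replicate, List.prod_replicate]
  rw [prod_map_multiWord α (c := ampFactor r) (r := r⁻¹) fun _ => rfl,
    prod_map_multiWord β (c := ampFactor r) (r := r) fun _ => rfl,
    prod_map_multiWord ν (c := ampFactor r) (r := r⁻¹) fun _ => rfl]
  rfl

lemma eLpNorm_coherentState (hr : 0 < r) (x ξ : Space d) :
    eLpNorm (coherentState (r ^ 2) x ξ) 2 volume = ofReal (π ^ ((d : ℝ) / 4) * dilNorm d r) := by
  have h2 : eLpNorm (fun y => vacSchwartz (y - r⁻¹ • x)) 2 volume = 1 := by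
    have h1 := eLpNorm_congr_ae (p := 2) (coeFn_coh (r⁻¹ • x, (0 : Space d)))
    rw [← Lp.enorm_def, ← ofReal_norm, HeisenbergSystem.norm_coh, ENNReal.ofReal_one] at h1
    refine Eq.trans (eLpNorm_congr_norm_ae (.of_forall fun y => ?_)) h1.symm
    exact (norm_shiftFun (r⁻¹ • x, 0) vacSchwartz y).symm
  have h3 : ∀ y, ‖coherentState (r ^ 2) x ξ y‖ =
      ‖𝕔(π ^ ((d : ℝ) / 4)) * vacSchwartz (r⁻¹ • y - r⁻¹ • x)‖ := by
    intro y
    have e : ‖r⁻¹ • y - r⁻¹ • x‖ ^ 2 / 2 = ‖x - y‖ ^ 2 / (2 * r ^ 2) := by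
      rw [← smul_sub, norm_smul, norm_sub_rev y x, norm_of_nonneg (inv_pos.2 hr).le]
      field_simp
    rw [coherentState, norm_mul, mul_comm I, Complex.norm_exp_ofReal_mul_I, one_mul,
      vacSchwartz_apply, ← ofReal_mul, ← mul_assoc, ← rpow_add pi_pos,
      add_neg_cancel, Real.rpow_zero, one_mul, e]
  rw [eLpNorm_congr_norm_ae (.of_forall h3)]
  refine (eLpNorm_const_smul 𝕔(π ^ ((d : ℝ) / 4))
    (fun y => vacSchwartz (r⁻¹ • y - r⁻¹ • x)) 2 volume).trans ?_
  rw [eLpNorm_comp_inv_smul hr (fun y => vacSchwartz (y - r⁻¹ • x)), h2, mul_one, ← ofReal_norm,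
    norm_real, norm_of_nonneg (by positivity), ENNReal.ofReal_mul (by positivity)]

/-- Matching of normalizations: the factor `2 ^ d / (2π) ^ d` is the quotient of `amplitudeConst` by
`fbiConst ^ 2` and the Gaussian norm. The dilation factor is absent, as it occurs on both sides of
the final estimate. -/
lemma amplitudeConst_mul_eq (hr : 0 < r) (K : ℝ) (σ : ℕ) (α β ν : Fin d → ℕ) :
    amplitudeConst d r * ((ampWord σ α β ν).map (ampFactor r)).prod * K =
      K * (2 ^ d * ((2 * π) ^ d)⁻¹) *
        (r ^ 2) ^ (-(((multiLen α : ℝ) - multiLen β + multiLen ν + σ) / 2)) *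
        fbiConst d (r ^ 2) ^ 2 * π ^ ((d : ℝ) / 4) := by
  have e : ∀ x : ℝ, (r ^ 2) ^ x = r ^ (2 * x) := fun x => by
    rw [← rpow_natCast r 2, ← rpow_mul hr.le]; rfl
  have h1 : (r ^ 2) ^ (-(((multiLen α : ℝ) - multiLen β + multiLen ν + σ) / 2)) =
      r⁻¹ ^ σ * (r⁻¹ ^ multiLen α * (r ^ multiLen β * r⁻¹ ^ multiLen ν)) := by
    rw [e]
    simp only [inv_pow, ← rpow_natCast r, ← rpow_neg hr.le, ← rpow_add hr]
    congr 1
    ring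
  have h2 : fbiConst d (r ^ 2) ^ 2 * π ^ ((d : ℝ) / 4) =
      (r ^ d)⁻¹ * (2 ^ d)⁻¹ * π ^ (-((d : ℝ) / 4)) := by
    rw [fbiConst, e]
    simp only [mul_pow, ← rpow_natCast, ← rpow_mul hr.le, ← rpow_mul pi_pos.le,
      ← rpow_mul zero_le_two, ← rpow_neg hr.le, ← rpow_neg zero_le_two, mul_assoc,
      ← rpow_add pi_pos]
    push_cast
    ring_nf
  rw [prod_ampFactor, h1, mul_assoc _ (fbiConst d (r ^ 2) ^ 2), h2, amplitudeConst]
  field_simp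

/-- The amplitude with initial time `κ.s`, as a function of `(t, x, ξ, y)`. -/
def ScaledEvolution.amplitude {M : ℝ} (κ : ScaledEvolution d C M)
    (q : ℝ × Space d × Space d × Space d) : ℂ :=
  amplitudeConst d κ.r • κ.profile (unscale κ.r q)

lemma ScaledEvolution.derivs_amplitude (κ : ScaledEvolution d C M)
    (l : List (MovIndex d)) (q : ℝ × Space d × Space d × Space d) :
    derivs (l.map ampVec) κ.amplitude q = (amplitudeConst d κ.r * (l.map (ampFactor κ.r)).prod) •
      derivs (l.map movVec) κ.profile (unscale κ.r q) := by
  have h1 : (unscale κ.r ∘ ampVec : MovIndex d → _) = fun j => ampFactor κ.r j • movVec j :=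
    funext (unscale_ampVec κ.r)
  have h2 : Smooth fun q => κ.profile (unscale κ.r q) :=
    κ.contDiff_profile.comp (unscale κ.r).contDiff
  have h3 : κ.amplitude = fun q => amplitudeConst d κ.r • κ.profile (unscale κ.r q) := rfl
  rw [h3, derivs_const_smul h2, derivs_comp_clm κ.contDiff_profile, List.map_map, h1,
    derivs_map_smul κ.contDiff_profile]
  simp only [smul_smul]

lemma ScaledEvolution.eLpNorm_derivs_amplitude_le (κ : ScaledEvolution d C M)
    {γ : Fin d → ℕ} {K : ℝ} {σ : ℕ} {α β ν : Fin d → ℕ} (hK0 : 0 ≤ K) {t : ℝ} {x ξ : Space d}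
    (hK : eLpNorm (fun y : Space d => (monomialWeight γ
      ((κ.φ (κ.r⁻¹ * t, dil κ.r⁻¹ (x, ξ))).1 - y) : ℂ) *
        derivs ((ampWord σ α β ν).map movVec) κ.profile ((κ.r⁻¹ * t, dil κ.r⁻¹ (x, ξ)), y)) 2 volume ≤
        ofReal K) :
    eLpNorm (fun y : Space d => (monomialWeight γ ((κ.r ^ 2) ^ (-½) •
      ((dil κ.r (κ.φ (κ.r⁻¹ * t, dil κ.r⁻¹ (x, ξ)))).1 - y)) : ℂ) *
        amplitudeDeriv σ α β ν κ.amplitude (t, x, ξ, y)) 2 volume ≤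
      ofReal (K * (2 ^ d * ((2 * π) ^ d)⁻¹) *
        (κ.r ^ 2) ^ (-(((multiLen α : ℝ) - multiLen β + multiLen ν + σ) / 2)) *
        fbiConst d (κ.r ^ 2) ^ 2) * eLpNorm (coherentState (κ.r ^ 2) x ξ) 2 volume := by
  have hr : 0 < κ.r := one_pos.trans_le κ.one_le
  have hP : 0 ≤ amplitudeConst d κ.r * ((ampWord σ α β ν).map (ampFactor κ.r)).prod := by
    rw [prod_ampFactor, amplitudeConst]; positivity
  have e1 : (κ.r ^ 2) ^ (-½) = κ.r⁻¹ := by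
    rw [rpow_neg (by positivity), ← Real.sqrt_eq_rpow, Real.sqrt_sq hr.le]
  obtain ⟨g, hg⟩ : ∃ g : Space d → ℂ, g = fun y : Space d => (monomialWeight γ
      ((κ.φ (κ.r⁻¹ * t, dil κ.r⁻¹ (x, ξ))).1 - y) : ℂ) *
        derivs ((ampWord σ α β ν).map movVec) κ.profile ((κ.r⁻¹ * t, dil κ.r⁻¹ (x, ξ)), y) :=
    ⟨_, rfl⟩
  rw [← hg] at hK
  have h1 : (fun y : Space d => (monomialWeight γ ((κ.r ^ 2) ^ (-½) •
      ((dil κ.r (κ.φ (κ.r⁻¹ * t, dil κ.r⁻¹ (x, ξ)))).1 - y)) : ℂ) *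
        amplitudeDeriv σ α β ν κ.amplitude (t, x, ξ, y)) =
      𝕔(amplitudeConst d κ.r * ((ampWord σ α β ν).map (ampFactor κ.r)).prod) •
        fun y => g (κ.r⁻¹ • y) := by
    funext y
    rw [amplitudeDeriv_eq_derivs, κ.derivs_amplitude, e1, dil_apply, smul_sub,
      inv_smul_smul₀ hr.ne', real_smul, mul_left_comm, hg]
    rfl
  rw [h1, eLpNorm_const_smul, eLpNorm_comp_inv_smul hr, eLpNorm_coherentState hr, ← ofReal_norm,
    norm_real, norm_of_nonneg hP]
  have h0 : 0 ≤ dilNorm d κ.r := Real.rpow_nonneg hr.le _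
  have h2 : 0 ≤ K * (2 ^ d * ((2 * π) ^ d)⁻¹) *
      (κ.r ^ 2) ^ (-(((multiLen α : ℝ) - multiLen β + multiLen ν + σ) / 2)) *
        fbiConst d (κ.r ^ 2) ^ 2 := by positivity
  refine (mul_le_mul_right (mul_le_mul_right hK _) _).trans_eq ?_
  rw [← ENNReal.ofReal_mul h0, ← ENNReal.ofReal_mul hP, ← ENNReal.ofReal_mul h2]
  congr 1
  have h3 := amplitudeConst_mul_eq (d := d) hr K σ α β ν
  linear_combination dilNorm d κ.r * h3

end Amplitude

/-! ### The theorem at the original scale -/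

theorem mainTheorem4 (d : ℕ) (C : (Fin d → ℕ) → ℕ → (Fin d → ℕ) → ℝ) :
    ∃ c : ℝ → (Fin d → ℕ) → ℕ → (Fin d → ℕ) → (Fin d → ℕ) → (Fin d → ℕ) → ℝ,
      ∀ (R : ℝ), 1 ≤ R →
      ∀ a : Space d × ℝ × Space d → ℝ, IsRoughHamiltonian R C a →
        (∃! Φ : ℝ → Space d × Space d → Space d × Space d, IsHamiltonianFlow a Φ) ∧
        (∃! S : ℝ → ℝ → LTwo d →L[ℂ] LTwo d, IsFundamentalSolution a S) ∧
        ∀ (Φ : ℝ → Space d × Space d → Space d × Space d)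
          (S : ℝ → ℝ → LTwo d →L[ℂ] LTwo d),
          IsHamiltonianFlow a Φ → IsFundamentalSolution a S →
          ∃ G : ℝ → ℝ → Space d → Space d → Space d → ℂ,
            (∀ s, ContDiff ℝ ∞ (amplitudeAt G s)) ∧
            (∀ t s : ℝ, IsPhaseSpaceKernel
              (fun y y' p => kernelIntegrand R Φ (phaseShift a Φ) G t y s y' p) (S t s)) ∧
            ∀ (M : ℝ) (γ : Fin d → ℕ) (σ : ℕ) (α β ν : Fin d → ℕ) (t s : ℝ) (x ξ : Space d),
              |t - s| ≤ M * R → |s| ≤ M * R →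
              eLpNorm (fun y : Space d =>
                  (monomialWeight γ (R ^ (-(1 / 2 : ℝ)) • ((Φ t (x, ξ)).1 - y)) : ℂ) *
                    amplitudeDeriv σ α β ν (amplitudeAt G s) (t, x, ξ, y)) 2 volume ≤
                ENNReal.ofReal
                  (c M γ σ α β ν *
                    R ^ (-(((multiLen α : ℝ) - multiLen β + multiLen ν + σ) / 2)) *
                    fbiConst d R ^ 2) *
                  eLpNorm (coherentState R x ξ) 2 volume := by
  -- The constants are fixed before `R` and `a`, by uniformity over all of `ScaledEvolution d C (2 *
  -- M)`. The factor two arises because `|t - s|` and `|s|` are bounded by `M R`, hence `|t|` only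
  -- by `2 M R`.
  choose K hK0 hK using fun (M : ℝ) (γ : Fin d → ℕ) (σ : ℕ) (α β ν : Fin d → ℕ) =>
    ScaledEvolution.exists_eLpNorm_derivs_profile_le (C := C) (M := 2 * M) γ (ampWord σ α β ν)
  refine ⟨fun M γ σ α β ν => K M γ σ α β ν * (2 ^ d * ((2 * Real.pi) ^ d)⁻¹), fun R hR a ha => ?_⟩
  obtain ⟨r, hr1, rfl⟩ : ∃ r : ℝ, 1 ≤ r ∧ R = r ^ 2 :=
    ⟨√R, Real.one_le_sqrt.2 hR, (Real.sq_sqrt (by linarith)).symm⟩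
  have hr : 0 < r := one_pos.trans_le hr1
  have hh := bddSymbol_scaledHam hr1 ha
  obtain ⟨φ, hφ⟩ := exists_isFlow hh
  choose U hU using stdSys.exists_isEvolution hh
  have hflow := fun Φ => isHamiltonianFlow_iff (Φ := Φ) ha.smooth hr.ne' hh hφ
  have hsol := fun S => isFundamentalSolution_iff (S := S) hr hh hU
  refine ⟨⟨_, (hflow _).2 fun _ _ => rfl, fun Φ h => funext fun t => funext ((hflow Φ).1 h t)⟩,
    ⟨fun t s => (lDil r hr).comp ((U (r⁻¹ * s) (r⁻¹ * t)).comp (lDil r⁻¹ (inv_pos.2 hr))),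
      (hsol _).2 fun _ _ _ => rfl, fun S h => funext fun t => funext fun s =>
        ContinuousLinearMap.ext ((hsol S).1 h t s)⟩, fun Φ S hΦ hS => ?_⟩
  rw [hflow] at hΦ
  rw [hsol] at hS
  let κ (M s : ℝ) (hs : r⁻¹ * |r⁻¹ * s| ≤ M) : ScaledEvolution d C M :=
    ⟨r, a, φ, r⁻¹ * s, U (r⁻¹ * s), hr1, ha, hφ, hU _, hs⟩
  -- The amplitude must not depend on `M`, so it is built with the smallest admissible time bound.
  -- The bound enters a `ScaledEvolution` only through a proof, so every larger one gives the same
  -- amplitude.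
  let κ₀ (s : ℝ) := κ _ s le_rfl
  refine ⟨fun t s x ξ y => (κ₀ s).amplitude (t, x, ξ, y), fun s => ?_, fun t s f => ?_, ?_⟩
  · exact ((κ₀ s).contDiff_profile.comp (unscale r).contDiff).const_smul (amplitudeConst d r)
  · have hV : ∀ k, ∃ B, ∀ q, stdSys.sob k ((κ₀ s).packet (r⁻¹ * t, q)) ≤ B := fun k => by
      obtain ⟨B, hB⟩ := (ScaledEvolution.unifVec_packet (C := C)
        (M := max (r⁻¹ * |r⁻¹ * s|) (r⁻¹ * |r⁻¹ * t|)) 0).2 k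
      exact ⟨B, fun q => hB (κ _ s (le_max_left _ _)) (r⁻¹ * t, q)
        (le_max_right (r⁻¹ * |r⁻¹ * s|) (r⁻¹ * |r⁻¹ * t|))⟩
    obtain ⟨hi, he⟩ := evolution_ae_eq_integral hφ (κ₀ s).isPropagation hV hr.ne'
      (dilSchwartz hr.ne' f)
    have hk : ∀ y p, ∫ y', kernelIntegrand (r ^ 2) Φ (phaseShift a Φ)
        (fun t s x ξ y => (κ₀ s).amplitude (t, x, ξ, y)) t y s y' p * f y' =
        ((((2 * Real.pi) ^ d)⁻¹ : ℝ) : ℂ) * inner ℂ (stdSys.coh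
          (φ (r⁻¹ * s, dil r⁻¹ p))) ((dilSchwartz hr.ne' f).toLp 2 volume) *
        valAt (U (r⁻¹ * s) (r⁻¹ * t) (stdSys.coh (φ (r⁻¹ * s, dil r⁻¹ p))))
          (r⁻¹ • y) := fun y p => by
      rw [integral_kernelIntegrand hr (hΦ s p) (hΦ t p)
        (θ := action (scaledHam r a) φ (r⁻¹ * s) (r⁻¹ * t, dil r⁻¹ p)) (by
          rw [phaseShift_eq ha.smooth hr.ne' hΦ, phaseShift_eq ha.smooth hr.ne' hΦ, action]
          ring) rfl f]
      exact congrArg _ (valAt_evolution (U := U (r⁻¹ * s)) (r⁻¹ * t, dil r⁻¹ p) (r⁻¹ • y)).symm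
    simp only [hk]
    refine ⟨fun y => hi (r⁻¹ • y), ?_⟩
    rw [hS, lDil_inv_toLp hr, map_smul, map_smul]
    have h0 : (dilNorm d r : ℂ) ≠ 0 := by exact_mod_cast (Real.rpow_pos_of_pos hr _).ne'
    filter_upwards [coeFn_lDil hr he, Lp.coeFn_smul (dilNorm d r : ℂ)
      (lDil r hr (U (r⁻¹ * s) (r⁻¹ * t) ((dilSchwartz hr.ne' f).toLp 2 volume)))] with y h1 h2
    rw [h2, Pi.smul_apply, h1, smul_eq_mul, mul_inv_cancel_left₀ h0]
  · intro M γ σ α β ν t s x ξ hts hs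
    have hM : 0 ≤ M := nonneg_of_mul_nonneg_left ((abs_nonneg s).trans hs) (by positivity)
    have e : ∀ u, |u| ≤ 2 * M * r ^ 2 → r⁻¹ * |r⁻¹ * u| ≤ 2 * M := fun u hu => by
      rw [abs_mul, abs_of_pos (inv_pos.2 hr), ← mul_assoc]
      calc _ ≤ r⁻¹ * r⁻¹ * (2 * M * r ^ 2) := by gcongr
        _ = _ := by field_simp
    have hs2 : |s| ≤ 2 * M * r ^ 2 := by nlinarith [abs_nonneg s]
    have ht2 : |t| ≤ 2 * M * r ^ 2 := by
      have := abs_add_le (t - s) s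
      rw [sub_add_cancel] at this
      linarith
    simp only [hΦ]
    exact (κ _ s (e s hs2)).eLpNorm_derivs_amplitude_le (hK0 M γ σ α β ν)
      (hK M γ σ α β ν (κ _ s (e s hs2)) _ (e t ht2))

end
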